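/- Let $k$ be a field of characteristic zero, $G$ a group, and $\mathcal H=kG$ with its Hopf algebra structure $\Delta(g)=g\otimes g$. Let $\widetilde C_n(kG)=(kG)^{\otimes (n+1)}\,\Box_{kG}\,k$ be the cyclic module of $kG$ with trivial coefficients: the space of coinvariants of the codiagonal coaction on $(kG)^{\otimes(n+1)}$, with faces $\delta_i(h_0\otimes\cdots\otimes h_n)=h_0\otimes\cdots\otimes h_ih_{i+1}\otimes\cdots\otimes h_n$ ($0\le i<n$), $\delta_n(h_0\otimes\cdots\otimes h_n)=h_nh_0\otimes h_1\otimes\cdots\otimes h_{n-1}$, degeneracies $\sigma_i$ inserting $1$ after $h_i$, and $\tau_n(h_0\otimes\cdots\otimes h_n)=h_n\otimes h_0\otimes\cdots\otimes h_{n-1}$. Let $\widetilde{HH}_*(kG)$ be the homology of $(\widetilde C_*(kG),b)$ and $\widetilde{HC}_*(kG)$ the homology of the total complex $k[u]\otimes\overline{C}_*$, $|u|=2$, with differential $b+u^{-1}B$, of the normalized mixed complex $(\overline C_*,b,B)$ of $\widetilde C_*(kG)$. Let $\Omega\Delta^{\otimes (n+1)}(h_0\otimes\cdots\otimes h_n)=(h_0^{(1)}\otimes\cdots\otimes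 h_n^{(1)})\otimes(h_0^{(2)}\otimes\cdots\otimes h_n^{(2)})$, let $AW=\sum_{i+j=n}\delta_{i+1}\cdots\delta_n\otimes\delta_0^{\,i}$ be the Alexander–Whitney map, and let $\widetilde{AW}=\sum_{r\ge 0}u^{-r}\,(-1)^r AW(B\varphi)^r$ be its extension to $(b,B)$-total complexes, where $B$ is Connes' operator of the diagonal cyclic module and $$\varphi_n=\sum_{q=0}^{n-1}\sum_{p=0}^{n-q-1}\sum_{(\alpha,\beta)}(-1)^{n-p-q+\sum_i(\alpha_i-i+1)}\,\bigl(s_{\beta_q+n-p-q}\cdots s_{\beta_1+n-p-q}\,s_{n-p-q-1}\,\delta_{n-q+1}\cdots\delta_n\bigr)\otimes\bigl(s_{\alpha_{p+1}+n-p-q}\cdots s_{\alpha_1+n-p-q}\,\delta_{n-p-q}\cdots\delta_{n-q-1}\bigr),$$ where $s_i$ denotes the degeneracy $\sigma_i$ and $(\alpha,\beta)$ runs over the $(p+1,q)$-shuffles of $\{0,\dots,p+q\}$. Let $\mathcal I$ be the Künneth map $v^s(c\otimes c')\mapsto\sum_{a+b=s}u^ac\otimes u^bc'$. (1) $AW\,\Omega\Delta^{\otimes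 (n+1)}$ and $\mathcal I\,\widetilde{AW}\,\Omega\Delta^{\otimes (n+1)}$ induce, through the Künneth map $[\alpha]\otimes[\beta]\mapsto[\alpha\otimes\beta]$, uniquely determined coproducts $\sqcup:\widetilde{HH}_n(kG)\to\bigoplus_{p+q=n}\widetilde{HH}_p(kG)\otimes\widetilde{HH}_q(kG)$ and $\sqcup:\widetilde{HC}_n(kG)\to\bigoplus_{p+q=n}\widetilde{HC}_p(kG)\otimes\widetilde{HC}_q(kG)$; likewise $(g_1,\dots,g_n)\mapsto\sum_{i=0}^n(g_1,\dots,g_i)\otimes(g_{i+1},\dots,g_n)$ on bar chains induces a uniquely determined coproduct $\sqcup_{Gr}$ on $H_*(G,k)$. (2) Under the identification $(g_1,\dots,g_n)\mapsto (g_1\cdots g_n)^{-1}\otimes g_1\otimes\cdots\otimes g_n$ of the bar complex $C_*(G,k)$ with $(\widetilde C_*(kG),b)$, the map $AW\,\Omega\Delta^{\otimes (n+1)}$ equals the chain map $(g_1,\dots,g_n)\mapsto\sum_i(g_1,\dots,g_i)\otimes(g_{i+1},\dots,g_n)$, and the induced isomorphism $\widetilde{HH}_n(kG)\cong H_n(G,k)$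 carries $\sqcup$ to $\sqcup_{Gr}$. (3) Let $E_n=k[G^{n+1}]$ be the homogeneous bar resolution of $k$, regarded as a cyclic module (faces delete an entry, degeneracies repeat an entry, and $\tau_n$ moves the last entry to the front), so that $\widetilde C_*(kG)$ is its quotient by $G$. There is a $G$-equivariant $S$-map $\sum_r u^{-r}f_r$ from $k[u]\otimes E$ with differential $b$ to $k[u]\otimes\overline E$ with differential $b+u^{-1}B$, with $f_0=\mathrm{id}$; after passing to the quotients by $G$, every such $S$-map induces one and the same isomorphism in homology, and its inverse is the canonical isomorphism $$\theta:\widetilde{HC}_n(kG)\;\cong\;\bigoplus_{i\ge 0}H_{n-2i}(G,k).$$ Under $\theta$ the coproduct $\sqcup$ of $\widetilde{HC}_*(kG)$ coincides with the coproduct of group homology, extended to $\bigoplus_{i\ge0}H_{n-2i}(G,k)=(k[u]\otimes H_*(G,k))_n$ by $u^i\mapsto\sum_{a+b=i}u^a\otimes u^b$: that is, $(\theta\otimes\theta)\circ\sqcup=\sqcup_{Gr}\circ\theta$. -/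

import Mathlib

open scoped TensorProduct DirectSum

universe u

noncomputable section

namespace HopfCyclic

/-! ## Operators built from the structure maps of a cyclic module

For a sequence of modules `X n` with faces `δ n i : X (n+1) → X n` (`i = 0, …, n+1`),
degeneracies `σ n i : X n → X (n+1)` (`i = 0, …, n`) and cyclic maps `τ n : X n → X n`,
all operators are regarded as endomorphisms of the graded space `⨁ n, X n`. -/

section Graded

variable {k : Type*} [CommRing k] {X : ℕ → Type*} [∀ n, AddCommGroup (X n)] [∀ n, Module k (X n)]

/-- The `i`-th face on `⨁ n, X n` (zero where `δ_i` is not defined). -/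
def gFace (δ : ∀ n, Fin (n + 2) → X (n + 1) →ₗ[k] X n) (i : ℕ) : Module.End k (⨁ n, X n) :=
  DirectSum.toModule k ℕ _ fun n => match n with
    | 0 => 0
    | m + 1 => if h : i < m + 2 then DirectSum.lof k ℕ X m ∘ₗ δ m ⟨i, h⟩ else 0

/-- The `i`-th degeneracy on `⨁ n, X n` (zero where `σ_i` is not defined). -/
def gDegen (σ : ∀ n, Fin (n + 1) → X n →ₗ[k] X (n + 1)) (i : ℕ) : Module.End k (⨁ n, X n) :=
  DirectSum.toModule k ℕ _ fun n =>
    if h : i < n + 1 then DirectSum.lof k ℕ X (n + 1) ∘ₗ σ n ⟨i, h⟩ else 0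

/-- The cyclic operator on `⨁ n, X n`. -/
def gRot (τ : ∀ n, X n →ₗ[k] X n) : Module.End k (⨁ n, X n) :=
  DirectSum.toModule k ℕ _ fun n => DirectSum.lof k ℕ X n ∘ₗ τ n

variable (k X) in
/-- The operator `(-1)^n` in degree `n`. -/
def gSign : Module.End k (⨁ n, X n) :=
  DirectSum.toModule k ℕ _ fun n => (-1 : k) ^ n • DirectSum.lof k ℕ X n

/-- The Hochschild differential `b = ∑_{i=0}^n (-1)^i δ_i` in degree `n` (zero in degree `0`). -/
def hochschildDiff (face : ℕ → Module.End k (⨁ n, X n)) : Module.End k (⨁ n, X n) :=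
  DirectSum.toModule k ℕ _ fun n =>
    (∑ i ∈ Finset.range (n + 1), (-1 : k) ^ i • face i) ∘ₗ DirectSum.lof k ℕ X n

/-- Connes' differential (as it acts on normalized chains): in degree `n` it is
`B = s_{-1} N`, where `s_{-1} = τ σ_n` is the extra degeneracy and `N = ∑_{i=0}^n (-1)^{ni} τ^i`. -/
def connesDiff (degen : ℕ → Module.End k (⨁ n, X n)) (rot : Module.End k (⨁ n, X n)) :
    Module.End k (⨁ n, X n) :=
  DirectSum.toModule k ℕ _ fun n =>
    (∑ i ∈ Finset.range (n + 1), (-1 : k) ^ (n * i) • (rot * degen n * rot ^ i)) ∘ₗ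
      DirectSum.lof k ℕ X n

end Graded

/-! ## The Alexander–Whitney map and its cyclic extension

`P` is the graded space of a cyclic module.  The degree `n` part `X n ⊗ X n` of the diagonal
cyclic module `C × C` and the space `⨁_{p+q=n} X p ⊗ X q` of the tensor product complex `C ⊗ C`
both live in `P ⊗ P`.  The operators indexed by `n` below are only applied to `X n ⊗ X n`. -/

section EilenbergZilber

variable {k : Type*} [CommRing k] {P : Type*} [AddCommGroup P] [Module k P]
  (face degen : ℕ → Module.End k P) (rot : Module.End k P)

/-- The Alexander–Whitney map in degree `n`:
`∑_{i+j=n} (δ_{i+1} δ_{i+2} ⋯ δ_n) ⊗ δ_0^i`. -/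
def alexanderWhitney (n : ℕ) : Module.End k (P ⊗[k] P) :=
  ∑ ij ∈ Finset.HasAntidiagonal.antidiagonal n,
    TensorProduct.map (((List.range' (ij.1 + 1) ij.2).map face).prod) (face 0 ^ ij.1)

/-- Connes' operator of the diagonal cyclic module `C × C` in degree `n`. -/
def diagConnes (n : ℕ) : Module.End k (P ⊗[k] P) :=
  ∑ i ∈ Finset.range (n + 1), (-1 : k) ^ (n * i) •
    TensorProduct.map (rot * degen n * rot ^ i) (rot * degen n * rot ^ i)

/-- The explicit Eilenberg–Mac Lane homotopy `φ_n` of degree `1` on `C × C`, i.e. the sum over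
`0 ≤ q ≤ n-1`, `0 ≤ p ≤ n-q-1` and all `(p+1,q)`-shuffles `(α, β)` (disjoint
`α_1 < ⋯ < α_{p+1}` and `β_1 < ⋯ < β_q` with union `{0, …, p+q}`) of
`(-1)^{n-p-q+∑(α_i-i+1)}` times
`(s_{β_q+n-p-q} ⋯ s_{β_1+n-p-q} s_{n-p-q-1} δ_{n-q+1} ⋯ δ_n) ⊗`
`(s_{α_{p+1}+n-p-q} ⋯ s_{α_1+n-p-q} δ_{n-p-q} ⋯ δ_{n-q-1})`. -/
def shihHomotopy (n : ℕ) : Module.End k (P ⊗[k] P) :=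
  ∑ q ∈ Finset.range n, ∑ p ∈ Finset.range (n - q),
    ∑ α ∈ Finset.powersetCard (p + 1) (Finset.range (p + q + 1)),
      (-1 : k) ^ ((n - p - q) + ((∑ a ∈ α, a) - ∑ i ∈ Finset.range (p + 1), i)) •
        TensorProduct.map
          ((((Finset.range (p + q + 1) \ α).sort (· ≥ ·)).map fun b => degen (b + (n - p - q))).prod
            * degen (n - p - q - 1) * ((List.range' (n - q + 1) q).map face).prod)
          (((α.sort (· ≥ ·)).map fun a => degen (a + (n - p - q))).prod
            * ((List.range' (n - p - q) p).map face).prod)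

/-- The `r`-th entry `AW^{(r)} = (-1)^r AW ∘ (B φ)^r`, raising degrees by `2r`, of the `S`-map
`\widetilde{AW}`, on the part of degree `n` of `C × C`.  In particular `AW^{(0)} = AW`. -/
def cyclicAW : ℕ → ℕ → Module.End k (P ⊗[k] P)
  | 0, n => alexanderWhitney face n
  | r + 1, n => -(cyclicAW r (n + 2) * diagConnes degen rot (n + 1) * shihHomotopy face degen n)

end EilenbergZilber

/-! ## Total complexes of `(b,B)`-bicomplexes

The total space of the `(b,B)`-bicomplex of a mixed complex `P` is `k[u] ⊗ P = ℕ →₀ P`, with `u`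
of degree `2`. -/

section Total

variable {k : Type*} [CommRing k] {P : Type*} [AddCommGroup P] [Module k P]

/-- The total differential `b + u⁻¹ B` of `k[u] ⊗ P`. -/
def totalDiff (b B : Module.End k P) : Module.End k (ℕ →₀ P) :=
  Finsupp.lsum k fun i => Finsupp.lsingle i ∘ₗ b +
    match i with
    | 0 => 0
    | j + 1 => Finsupp.lsingle j ∘ₗ B

/-- The Künneth map `v^s ⊗ (c ⊗ c') ↦ ∑_{a+b=s} (u^a ⊗ c) ⊗ (u^b ⊗ c')`, from the total complex of
`C ⊗ C` to the tensor product of the total complexes. -/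
def kunnethTotal (s : ℕ) : P ⊗[k] P →ₗ[k] (ℕ →₀ P) ⊗[k] (ℕ →₀ P) :=
  ∑ ab ∈ Finset.HasAntidiagonal.antidiagonal s,
    TensorProduct.map (Finsupp.lsingle ab.1) (Finsupp.lsingle ab.2)

end Total

/-! ## Homology of subquotient complexes, and coproducts in homology -/

/-- Presentation of a chain complex as a subquotient of a vector space `V`: the part of degree `n`
is `chains n ⧸ (chains n ⊓ degen)` and the differential is induced by `d`.  The operator `sgn`
is `(-1)^n` on chains of degree `n`. -/
structure SubquotientComplex (k : Type*) [CommRing k] (V : Type*) [AddCommGroup V]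
    [Module k V] where
  /-- the differential -/
  d : V →ₗ[k] V
  /-- the sign operator -/
  sgn : V →ₗ[k] V
  /-- the chains of each degree -/
  chains : ℕ → Submodule k V
  /-- the elements regarded as zero -/
  degen : Submodule k V

namespace SubquotientComplex

variable {k : Type*} [CommRing k] {V : Type*} [AddCommGroup V] [Module k V]
  (C : SubquotientComplex k V)

/-- Cycles of degree `n`: chains with boundary in `degen`. -/
def cycles (n : ℕ) : Submodule k V := C.chains n ⊓ C.degen.comap C.d

/-- Boundaries of degree `n`, together with the elements regarded as zero. -/
def boundaries (n : ℕ) : Submodule k V := (C.chains (n + 1)).map C.d ⊔ C.degen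

/-- The `n`-th homology. -/
def Homology (n : ℕ) : Type _ :=
  C.cycles n ⧸ (C.boundaries n).comap (C.cycles n).subtype

instance (n : ℕ) : AddCommGroup (C.Homology n) :=
  inferInstanceAs (AddCommGroup (C.cycles n ⧸ (C.boundaries n).comap (C.cycles n).subtype))

instance (n : ℕ) : Module k (C.Homology n) :=
  inferInstanceAs (Module k (C.cycles n ⧸ (C.boundaries n).comap (C.cycles n).subtype))

/-- The class of a cycle. -/
def classOf (n : ℕ) : C.cycles n →ₗ[k] C.Homology n :=
  Submodule.mkQ ((C.boundaries n).comap (C.cycles n).subtype)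

/-- The image of `A ⊗ B` in `V ⊗ V`. -/
def tensorSub (A B : Submodule k V) : Submodule k (V ⊗[k] V) :=
  LinearMap.range (TensorProduct.mapIncl A B)

/-- The boundaries of the tensor product of the complex with itself (differential
`d ⊗ 1 + (-1)^p 1 ⊗ d` on degree `(p,q)`), together with the elements that are zero in it. -/
def tensorBoundaries : Submodule k (V ⊗[k] V) :=
  (tensorSub (⨆ n, C.chains n) (⨆ n, C.chains n)).map
      (TensorProduct.map C.d LinearMap.id + TensorProduct.map C.sgn C.d)
    ⊔ tensorSub C.degen (⨆ n, C.chains n) ⊔ tensorSub (⨆ n, C.chains n) C.degen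

end SubquotientComplex

/-- Families of linear maps `H n → ⨁_{p+q=n} H p ⊗ H q`, the candidates for a coproduct. -/
abbrev Coproduct (k : Type*) [CommRing k] (H : ℕ → Type*) [∀ n, AddCommGroup (H n)]
    [∀ n, Module k (H n)] : Type _ :=
  ∀ n, H n →ₗ[k] ((pq : Finset.HasAntidiagonal.antidiagonal n) → H pq.1.1 ⊗[k] H pq.1.2)

/-- The sum `⨁_{i ≥ 0} H (n-2i)`, i.e. the degree `n` part of `k[u] ⊗ H` with `u` of degree
`2`. -/
abbrev EvenSum (H : ℕ → Type*) (n : ℕ) : Type _ := (i : Fin (n / 2 + 1)) → H (n - 2 * i)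

/-- The extension of a coproduct `D` on `H` to `k[u] ⊗ H` by `u^i ↦ ∑_{a+b=i} u^a ⊗ u^b`.  The
component of bidegree `(p, q)` of the image of `c = ∑ u^i c_i`, `c_i ∈ H (n-2i)`, is
`∑_{a,b} (u^a ⊗ u^b) D(c_{a+b})_{p-2a,q-2b}`. -/
def extendCoproduct {k : Type*} [CommRing k] {H : ℕ → Type*} [∀ n, AddCommGroup (H n)]
    [∀ n, Module k (H n)] (D : Coproduct k H) : Coproduct k (EvenSum H) := fun n =>
  LinearMap.pi fun pq => ∑ a : Fin (pq.1.1 / 2 + 1), ∑ b : Fin (pq.1.2 / 2 + 1),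
    TensorProduct.map
        (LinearMap.single k (fun i : Fin (pq.1.1 / 2 + 1) => H (pq.1.1 - 2 * i)) a)
        (LinearMap.single k (fun i : Fin (pq.1.2 / 2 + 1) => H (pq.1.2 - 2 * i)) b) ∘ₗ
      LinearMap.proj (R := k)
        (φ := fun rs : Finset.HasAntidiagonal.antidiagonal (n - 2 * (a + b)) =>
          H rs.1.1 ⊗[k] H rs.1.2)
        ⟨(pq.1.1 - 2 * a, pq.1.2 - 2 * b), by
          have := Finset.HasAntidiagonal.mem_antidiagonal.1 pq.2
          rw [Finset.HasAntidiagonal.mem_antidiagonal]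
          dsimp only
          omega⟩ ∘ₗ
      D (n - 2 * (a + b)) ∘ₗ
      LinearMap.proj (R := k) (φ := fun i : Fin (n / 2 + 1) => H (n - 2 * i))
        ⟨a + b, by have := Finset.HasAntidiagonal.mem_antidiagonal.1 pq.2; omega⟩

/-- The isomorphisms `θ n : H n ≃ H' n` carry `D` to `D'`: `(θ ⊗ θ) ∘ D = D' ∘ θ`. -/
def CarriesCoproduct {k : Type*} [CommRing k] {H H' : ℕ → Type*} [∀ n, AddCommGroup (H n)]
    [∀ n, Module k (H n)] [∀ n, AddCommGroup (H' n)] [∀ n, Module k (H' n)]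
    (θ : ∀ n, H n ≃ₗ[k] H' n) (D : Coproduct k H) (D' : Coproduct k H') : Prop :=
  ∀ (n : ℕ) (x : H n) (pq : Finset.HasAntidiagonal.antidiagonal n),
    TensorProduct.map (θ pq.1.1).toLinearMap (θ pq.1.2).toLinearMap (D n x pq) = D' n (θ n x) pq

/-- Let a complex be given by its cycles `ι n : Z n → V` and its homology `π n : Z n → H n`, let
`bd` be the space of boundaries of the tensor square of the complex, inside `V ⊗ V`, and let
`c : V → V ⊗ V`.  The family `D n : H n → ⨁_{p+q=n} H p ⊗ H q` is the coproduct induced by `c`: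
for each cycle `x` of degree `n`, the homology class of `c x` is the image of `D n [x]` under the
Künneth map `[α] ⊗ [β] ↦ [α ⊗ β]`. -/
def IsInducedCoproduct {k : Type*} [CommRing k] {V : Type*} [AddCommGroup V] [Module k V]
    {Z H : ℕ → Type*} [∀ n, AddCommGroup (Z n)] [∀ n, Module k (Z n)]
    [∀ n, AddCommGroup (H n)] [∀ n, Module k (H n)]
    (ι : ∀ n, Z n →ₗ[k] V) (π : ∀ n, Z n →ₗ[k] H n) (bd : Submodule k (V ⊗[k] V))
    (c : V →ₗ[k] V ⊗[k] V)
    (D : Coproduct k H) : Prop :=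
  ∀ (n : ℕ) (x : Z n), ∃ t : (pq : Finset.HasAntidiagonal.antidiagonal n) → Z pq.1.1 ⊗[k] Z pq.1.2,
    (∀ pq, D n (π n x) pq = TensorProduct.map (π _) (π _) (t pq)) ∧
      c (ι n x) - ∑ pq, TensorProduct.map (ι _) (ι _) (t pq) ∈ bd

/-! ## The cyclic module of a Hopf algebra with trivial coefficients -/

section TensorPowers

variable (k : Type*) [CommRing k] (H K : Type*)

section Modules

variable [AddCommGroup H] [Module k H] [AddCommGroup K] [Module k K]

/-- `h ⊗ (h_1 ⊗ ⋯ ⊗ h_n) ↦ h ⊗ h_1 ⊗ ⋯ ⊗ h_n`. -/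
def consTensor (n : ℕ) : H →ₗ[k] (⨂[k] _ : Fin n, H) →ₗ[k] ⨂[k] _ : Fin (n + 1), H :=
  PiTensorProduct.lift.toLinearMap ∘ₗ
    (PiTensorProduct.tprod k : MultilinearMap k (fun _ : Fin (n + 1) => H) _).curryLeft

/-- The multilinear map underlying `unshuffle`. -/
def unshuffleMultilinear : ∀ n : ℕ, MultilinearMap k (fun _ : Fin n => H ⊗[k] K)
    ((⨂[k] _ : Fin n, H) ⊗[k] (⨂[k] _ : Fin n, K))
  | 0 => MultilinearMap.constOfIsEmpty k _
      (PiTensorProduct.tprod k Fin.elim0 ⊗ₜ PiTensorProduct.tprod k Fin.elim0)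
  | n + 1 => LinearMap.uncurryLeft
      { toFun := fun z => (TensorProduct.homTensorHomMap (RingHom.id k) _ _ _ _
            (TensorProduct.map (consTensor k H n) (consTensor k K n) z)).compMultilinearMap
              (unshuffleMultilinear n)
        map_add' := fun x y => by ext; simp
        map_smul' := fun a x => by ext; simp }

/-- `(h_1 ⊗ k_1) ⊗ ⋯ ⊗ (h_n ⊗ k_n) ↦ (h_1 ⊗ ⋯ ⊗ h_n) ⊗ (k_1 ⊗ ⋯ ⊗ k_n)`. -/
def unshuffle (n : ℕ) : (⨂[k] _ : Fin n, H ⊗[k] K) →ₗ[k]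
    (⨂[k] _ : Fin n, H) ⊗[k] (⨂[k] _ : Fin n, K) :=
  PiTensorProduct.lift (unshuffleMultilinear k H K n)

theorem unshuffle_tprod (n : ℕ) (h : Fin n → H) (l : Fin n → K) :
    unshuffle k H K n (PiTensorProduct.tprod k fun i => h i ⊗ₜ l i) =
      PiTensorProduct.tprod k h ⊗ₜ PiTensorProduct.tprod k l := by
  induction n with
  | zero =>
    rw [Subsingleton.elim h Fin.elim0, Subsingleton.elim l Fin.elim0]
    simp [unshuffle, unshuffleMultilinear]
  | succ n ih =>
    have := ih (Fin.tail h) (Fin.tail l)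
    simp only [unshuffle, PiTensorProduct.lift.tprod] at this ⊢
    simp only [unshuffleMultilinear, LinearMap.uncurryLeft_apply]
    change (TensorProduct.homTensorHomMap (RingHom.id k) _ _ _ _
            (TensorProduct.map (consTensor k H n) (consTensor k K n) (h 0 ⊗ₜ l 0)))
              (unshuffleMultilinear k H K n fun i => Fin.tail h i ⊗ₜ[k] Fin.tail l i) = _
    rw [this]
    simp [consTensor]

end Modules

variable [Ring H] [HopfAlgebra k H]

/-- The tensor power `H^{⊗(n+1)}`. -/
abbrev TPow (n : ℕ) : Type _ := ⨂[k] _ : Fin (n + 1), H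

variable {k H} in
theorem contractNth_update {n : ℕ} [DecidableEq (Fin (n + 2))] (i : Fin (n + 1))
    (h : Fin (n + 2) → H) (l : Fin (n + 2)) (x : H) :
    Fin.contractNth i.castSucc (· * ·) (Function.update h l x) =
      Function.update (Fin.contractNth i.castSucc (· * ·) h) (i.predAbove l)
        (if l = i.castSucc then x * h i.succ else if l = i.succ then h i.castSucc * x else x) := by
  have hm : ((i.predAbove l : Fin (n + 1)) : ℕ) = if (i : ℕ) < l then (l : ℕ) - 1 else l := by
    simp only [Fin.predAbove, Fin.lt_def, Fin.val_castSucc]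
    split_ifs <;> simp
  ext j
  simp only [Fin.contractNth, Function.update_apply, Fin.ext_iff, hm, Fin.val_castSucc,
    Fin.val_succ]
  have hj := j.isLt
  have hl := l.isLt
  have hi := i.isLt
  by_cases hji : (j : ℕ) = i
  · obtain rfl : j = i := Fin.ext hji
    split_ifs <;> first | rfl | (exfalso; omega)
  · split_ifs <;> first | rfl | (exfalso; omega)

/-- `h_0 ⊗ ⋯ ⊗ h_{n+1} ↦ h_0 ⊗ ⋯ ⊗ h_i h_{i+1} ⊗ ⋯ ⊗ h_{n+1}` for `0 ≤ i ≤ n`. -/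
def mulAdjacent (n : ℕ) (i : Fin (n + 1)) : TPow k H (n + 1) →ₗ[k] TPow k H n :=
  PiTensorProduct.lift
    { toFun := fun h => PiTensorProduct.tprod k (Fin.contractNth i.castSucc (· * ·) h)
      map_update_add' := fun h l x y => by
        simp only [contractNth_update]
        split_ifs <;> simp [add_mul, mul_add, MultilinearMap.map_update_add]
      map_update_smul' := fun h l c x => by
        simp only [contractNth_update]
        split_ifs <;> simp [MultilinearMap.map_update_smul] }

/-- The cyclic map `h_0 ⊗ ⋯ ⊗ h_n ↦ h_n ⊗ h_0 ⊗ ⋯ ⊗ h_{n-1}`.  With trivial coefficients `k`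
(action by the counit, coaction `1 ↦ 1 ⊗ 1`) the general formula
`h_n^{(1)} ⊗ h_0 ⊗ ⋯ ⊗ h_{n-1} ⊗ h_n^{(2)} · 1` reduces to this one. -/
def rotate (n : ℕ) : TPow k H n →ₗ[k] TPow k H n :=
  (PiTensorProduct.reindex k (fun _ : Fin (n + 1) => H) (finRotate (n + 1))).toLinearMap

/-- The faces: `δ_i` multiplies `h_i` and `h_{i+1}` for `i ≤ n`, and the last face is
`h_0 ⊗ ⋯ ⊗ h_{n+1} ↦ h_{n+1} h_0 ⊗ h_1 ⊗ ⋯ ⊗ h_n`, that is, `δ_0` after the cyclic map. -/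
def hopfFace (n : ℕ) (i : Fin (n + 2)) : TPow k H (n + 1) →ₗ[k] TPow k H n :=
  if h : (i : ℕ) < n + 1 then mulAdjacent k H n ⟨i, h⟩
  else mulAdjacent k H n 0 ∘ₗ rotate k H (n + 1)

/-- The degeneracies: `σ_i` inserts `1` after `h_i`. -/
def hopfDegen (n : ℕ) (i : Fin (n + 1)) : TPow k H n →ₗ[k] TPow k H (n + 1) :=
  PiTensorProduct.lift
    ((PiTensorProduct.tprod k : MultilinearMap k (fun _ : Fin (n + 2) => H) _).curryMid i.succ 1)

/-- `Ω_n ∘ Δ^{⊗(n+1)} : H^{⊗(n+1)} → (H ⊗ H)^{⊗(n+1)} → H^{⊗(n+1)} ⊗ H^{⊗(n+1)}`,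
`h_0 ⊗ ⋯ ⊗ h_n ↦ (h_0^{(1)} ⊗ ⋯ ⊗ h_n^{(1)}) ⊗ (h_0^{(2)} ⊗ ⋯ ⊗ h_n^{(2)})`. -/
def omegaDelta (n : ℕ) : TPow k H n →ₗ[k] TPow k H n ⊗[k] TPow k H n :=
  unshuffle k H H (n + 1) ∘ₗ PiTensorProduct.map fun _ => (CoalgebraStruct.comul : H →ₗ[k] H ⊗[k] H)

/-- The codiagonal right coaction
`h_0 ⊗ ⋯ ⊗ h_n ↦ (h_0^{(1)} ⊗ ⋯ ⊗ h_n^{(1)}) ⊗ h_0^{(2)} ⋯ h_n^{(2)}`. -/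
def codiagonalCoaction (n : ℕ) : TPow k H n →ₗ[k] TPow k H n ⊗[k] H :=
  LinearMap.lTensor _ (PiTensorProduct.lift (MultilinearMap.mkPiAlgebraFin k (n + 1) H)) ∘ₗ
    omegaDelta k H n

/-- The space `\widetilde C_n(H) = H^{⊗(n+1)} □_H k` of the cyclic module of `H` with trivial
coefficients: the cotensor product with `k` is the space of coinvariants of the coaction. -/
def hopfChains (n : ℕ) : Submodule k (TPow k H n) :=
  LinearMap.eqLocus (codiagonalCoaction k H n) ((TensorProduct.mk k (TPow k H n) H).flip 1)

/-- The span of the degenerate elements in each degree. -/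
def hopfDegenerate : ∀ n : ℕ, Submodule k (TPow k H n)
  | 0 => ⊥
  | n + 1 => ⨆ i : Fin (n + 1), (hopfChains k H n).map (hopfDegen k H n i)

/-- The graded space `⨁ n, H^{⊗(n+1)}`. -/
abbrev GPow : Type _ := ⨁ n, TPow k H n

/-- The inclusion of degree `n`. -/
abbrev gι (n : ℕ) : TPow k H n →ₗ[k] GPow k H := DirectSum.lof k ℕ (TPow k H) n

/-- `Ω ∘ Δ^{⊗(n+1)}` in all degrees. -/
def gOmegaDelta : GPow k H →ₗ[k] GPow k H ⊗[k] GPow k H :=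
  DirectSum.toModule k ℕ _ fun n =>
    TensorProduct.map (gι k H n) (gι k H n) ∘ₗ omegaDelta k H n

/-- The faces on the graded space. -/
abbrev hFace : ℕ → Module.End k (GPow k H) := gFace (hopfFace k H)

/-- The degeneracies on the graded space. -/
abbrev hDegen : ℕ → Module.End k (GPow k H) := gDegen (hopfDegen k H)

/-- The cyclic operator on the graded space. -/
abbrev hRot : Module.End k (GPow k H) := gRot (rotate k H)

/-! ### Hopf Hochschild homology -/

/-- The Hochschild complex `(\widetilde C_*(H), b)`. -/
def hochschildComplex : SubquotientComplex k (GPow k H) where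
  d := hochschildDiff (hFace k H)
  sgn := gSign k (TPow k H)
  chains n := (hopfChains k H n).map (gι k H n)
  degen := ⊥

/-- Hopf Hochschild homology `\widetilde{HH}_n(H)` with trivial coefficients. -/
abbrev HopfHH (n : ℕ) : Type _ := (hochschildComplex k H).Homology n

/-- The chain map `AW ∘ Ω ∘ Δ^{⊗(n+1)}`. -/
def hochschildCup : GPow k H →ₗ[k] GPow k H ⊗[k] GPow k H :=
  DirectSum.toModule k ℕ _ fun n =>
    alexanderWhitney (hFace k H) n ∘ₗ gOmegaDelta k H ∘ₗ gι k H n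

/-! ### Hopf cyclic homology -/

/-- The total complex of the normalized `(b,B)`-bicomplex of `\widetilde C_*(H)`. -/
def cyclicComplex : SubquotientComplex k (ℕ →₀ GPow k H) where
  d := totalDiff (hochschildDiff (hFace k H)) (connesDiff (hDegen k H) (hRot k H))
  sgn := Finsupp.mapRange.linearMap (gSign k (TPow k H))
  chains n := ⨆ i : Fin (n / 2 + 1),
    (hopfChains k H (n - 2 * i)).map (Finsupp.lsingle (i : ℕ) ∘ₗ gι k H (n - 2 * i))
  degen := ⨆ (i : ℕ) (m : ℕ), (hopfDegenerate k H m).map (Finsupp.lsingle i ∘ₗ gι k H m)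

/-- Hopf cyclic homology `\widetilde{HC}_n(H)` with trivial coefficients. -/
abbrev HopfHC (n : ℕ) : Type _ := (cyclicComplex k H).Homology n

/-- The map `I ∘ \widetilde{AW} ∘ Ω ∘ Δ^{⊗(n+1)}`: on `u^j ⊗ x` with `x` of degree `n` it is
`∑_{s+r=j} I (v^s ⊗ AW^{(r)} (Ω Δ^{⊗(n+1)} x))`, where `I` is the Künneth map. -/
def cyclicCup : (ℕ →₀ GPow k H) →ₗ[k] (ℕ →₀ GPow k H) ⊗[k] (ℕ →₀ GPow k H) :=
  Finsupp.lsum k fun j => DirectSum.toModule k ℕ _ fun n =>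
    ∑ sr ∈ Finset.HasAntidiagonal.antidiagonal j,
      kunnethTotal sr.1 ∘ₗ cyclicAW (hFace k H) (hDegen k H) (hRot k H) sr.2 n ∘ₗ
        gOmegaDelta k H ∘ₗ gι k H n

/-- `\sqcup` is the coproduct of Hopf Hochschild homology, induced by `AW Ω Δ^{⊗(n+1)}`. -/
def IsHochschildCoproduct (D : Coproduct k (HopfHH k H)) : Prop :=
  IsInducedCoproduct (fun n => ((hochschildComplex k H).cycles n).subtype)
    (fun n => (hochschildComplex k H).classOf n) (hochschildComplex k H).tensorBoundaries
    (hochschildCup k H) D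

/-- `\sqcup` is the coproduct of Hopf cyclic homology, induced by
`I \widetilde{AW} Ω Δ^{⊗(n+1)}`. -/
def IsCyclicCoproduct (D : Coproduct k (HopfHC k H)) : Prop :=
  IsInducedCoproduct (fun n => ((cyclicComplex k H).cycles n).subtype)
    (fun n => (cyclicComplex k H).classOf n) (cyclicComplex k H).tensorBoundaries
    (cyclicCup k H) D

end TensorPowers

/-! ## Group homology and its coproduct -/

section GroupHomology

variable (k G : Type u) [CommRing k] [Group G]

/-- Group homology `H_n(G, k)` with trivial coefficients. -/
abbrev GH (n : ℕ) : Type u := groupHomology (Rep.trivial k G k) n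

/-- Cycles in the bar complex `C_*(G, k)` of inhomogeneous chains. -/
abbrev GCycles (n : ℕ) : Type u := groupHomology.cycles (Rep.trivial k G k) n

/-- The bar chains `C_n(G, k) = k[G^n]`. -/
abbrev GChains (n : ℕ) : Type u := (Fin n → G) →₀ k

/-- The inclusion of cycles into chains. -/
def gCyclesι (n : ℕ) : GCycles k G n →ₗ[k] GChains k G n :=
  (groupHomology.iCycles (Rep.trivial k G k) n).hom

/-- The homology class of a cycle. -/
def gClass (n : ℕ) : GCycles k G n →ₗ[k] GH k G n :=
  (groupHomology.π (Rep.trivial k G k) n).hom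

/-- The differential of the bar complex, in all degrees. -/
def gBarDiff : Module.End k (⨁ n, GChains k G n) :=
  DirectSum.toModule k ℕ _ fun n => match n with
    | 0 => 0
    | m + 1 => DirectSum.lof k ℕ (GChains k G) m ∘ₗ
        (groupHomology.inhomogeneousChains.d (Rep.trivial k G k) m).hom

/-- `(g_1, …, g_n) ↦ ∑_{i=0}^n (g_1, …, g_i) ⊗ (g_{i+1}, …, g_n)`. -/
def groupCup : (⨁ n, GChains k G n) →ₗ[k] (⨁ n, GChains k G n) ⊗[k] (⨁ n, GChains k G n) :=
  DirectSum.toModule k ℕ _ fun n => Finsupp.lift _ k _ fun g : Fin n → G =>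
    ∑ i : Fin (n + 1),
      DirectSum.lof k ℕ (GChains k G) i
          (Finsupp.single (fun t : Fin i => g ⟨t, by omega⟩) 1) ⊗ₜ[k]
        DirectSum.lof k ℕ (GChains k G) (n - i)
          (Finsupp.single (fun t : Fin (n - i) => g ⟨i + t, by omega⟩) 1)

/-- `\sqcup` is the coproduct of group homology, induced by `groupCup`. -/
def IsGroupCoproduct (D : Coproduct k (GH k G)) : Prop :=
  IsInducedCoproduct (V := ⨁ n, GChains k G n)
    (fun n => DirectSum.lof k ℕ (GChains k G) n ∘ₗ gCyclesι k G n)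
    (gClass k G)
    (LinearMap.range (TensorProduct.map (gBarDiff k G) LinearMap.id +
      TensorProduct.map (gSign k (GChains k G)) (gBarDiff k G)))
    (groupCup k G) D

/-- The graded space `⨁_{i ≥ 0} H_{n-2i}(G, k)`, in each degree `n`. -/
abbrev GHSum (n : ℕ) : Type u := EvenSum (GH k G) n

end GroupHomology

/-! ## The comparison of the homology of `kG` with group homology -/

section Comparison

variable (k G : Type u) [CommRing k] [Group G]

/-- `E_n = k[G^{n+1}]`: the homogeneous bar resolution of `k`, as a cyclic module. -/
abbrev EG (n : ℕ) : Type u := (Fin (n + 1) → G) →₀ k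

/-- The graded space `⨁ n, E_n`. -/
abbrev GEG : Type u := ⨁ n, EG k G n

/-- `δ_i` deletes `x_i`. -/
def eFace (n : ℕ) (i : Fin (n + 2)) : EG k G (n + 1) →ₗ[k] EG k G n :=
  Finsupp.lmapDomain k k fun x => i.removeNth x

/-- `σ_i` repeats `x_i`. -/
def eDegen (n : ℕ) (i : Fin (n + 1)) : EG k G n →ₗ[k] EG k G (n + 1) :=
  Finsupp.lmapDomain k k fun x => x ∘ i.predAbove

/-- `(x_0, …, x_n) ↦ (x_n, x_0, …, x_{n-1})`. -/
def eRot (n : ℕ) : EG k G n →ₗ[k] EG k G n :=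
  Finsupp.lmapDomain k k fun x => x ∘ (finRotate (n + 1)).symm

/-- The diagonal action of `s ∈ G` by left multiplication. -/
def eAct (s : G) : Module.End k (GEG k G) :=
  DirectSum.toModule k ℕ _ fun n =>
    DirectSum.lof k ℕ (EG k G) n ∘ₗ Finsupp.lmapDomain k k fun x i => s * x i

/-- The differential `b` of `E`. -/
abbrev eB : Module.End k (GEG k G) := hochschildDiff (gFace (eFace k G))

/-- Connes' differential of `E`. -/
abbrev eConnes : Module.End k (GEG k G) :=
  connesDiff (gDegen (eDegen k G)) (gRot (eRot k G))

/-- The degenerate elements of `E`. -/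
def eDegenerate : Submodule k (GEG k G) :=
  ⨆ i : ℕ, LinearMap.range (gDegen (eDegen k G) i)

/-- `f_0 = id, f_1, f_2, …` are the entries of a `G`-equivariant `S`-map
`∑_r u^{-r} f_r : k[u] ⊗ E → k[u] ⊗ \overline E` lifting the identity of `k[u]`, from the total
complex of the mixed complex `(E, b, 0)` to that of the normalized mixed complex
`(\overline E, b, B)`.  Both are resolutions of `k[u]` by `kG`-modules, the first one free. -/
structure IsComparison (f : ℕ → Module.End k (GEG k G)) : Prop where
  zero : f 0 = LinearMap.id
  degree : ∀ r n, ∀ x : EG k G n, ∃ y : EG k G (n + 2 * r),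
    f r (DirectSum.lof k ℕ (EG k G) n x) = DirectSum.lof k ℕ (EG k G) (n + 2 * r) y
  equivariant : ∀ r s x, f r (eAct k G s x) = eAct k G s (f r x)
  comm : ∀ r x, eB k G (f (r + 1) x) + eConnes k G (f r x) - f (r + 1) (eB k G x)
    ∈ eDegenerate k G

/-- The quotient map `E → \widetilde C_*(kG)` by the action of `G`:
`(x_0, …, x_n) ↦ x_n⁻¹ x_0 ⊗ x_0⁻¹ x_1 ⊗ ⋯ ⊗ x_{n-1}⁻¹ x_n`. -/
def eToHopf : GEG k G →ₗ[k] GPow k (MonoidAlgebra k G) :=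
  DirectSum.toModule k ℕ _ fun n => gι k (MonoidAlgebra k G) n ∘ₗ
    Finsupp.lift _ k _ fun x : Fin (n + 1) → G =>
      PiTensorProduct.tprod k fun i =>
        MonoidAlgebra.of k G ((x ((finRotate (n + 1)).symm i))⁻¹ * x i)

/-- `(g_1, …, g_n) ↦ (1, g_1, g_1 g_2, …, g_1 ⋯ g_n)`, a section of `E_n → C_n(G, k)`. -/
def barToE (n : ℕ) : GChains k G n →ₗ[k] GEG k G :=
  DirectSum.lof k ℕ (EG k G) n ∘ₗ Finsupp.lmapDomain k k Fin.partialProd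

/-- The identification `C_n(G, k) = kG^{⊗n} ≅ \widetilde C_n(kG)`,
`(g_1, …, g_n) ↦ (g_1 ⋯ g_n)⁻¹ ⊗ g_1 ⊗ ⋯ ⊗ g_n`. -/
def barToHopf (n : ℕ) : GChains k G n →ₗ[k] GPow k (MonoidAlgebra k G) :=
  eToHopf k G ∘ₗ barToE k G n

/-- The same identification in all degrees. -/
def gBarToHopf : (⨁ n, GChains k G n) →ₗ[k] GPow k (MonoidAlgebra k G) :=
  DirectSum.toModule k ℕ _ (barToHopf k G)

variable {k G} in
/-- The map `C_m(G, k) → k[u] ⊗ \widetilde C_*(kG)` induced, after passing to the quotients by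
`G`, by the `S`-map with entries `f` on `u^i ⊗ E_m`: `z ↦ ∑_{r ≤ i} u^{i-r} ⊗ f_r(z)`. -/
def comparisonChain (f : ℕ → Module.End k (GEG k G)) (i m : ℕ) :
    GChains k G m →ₗ[k] (ℕ →₀ GPow k (MonoidAlgebra k G)) :=
  ∑ r ∈ Finset.range (i + 1),
    Finsupp.lsingle (i - r) ∘ₗ eToHopf k G ∘ₗ f r ∘ₗ barToE k G m

/-- The isomorphism `\widetilde{HH}_n(kG) ≅ H_n(G, k)` given by the identification of complexes
`\widetilde C_*(kG) = C_*(G, k)`. -/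
def IsHochschildComparison
    (θ : ∀ n, HopfHH k (MonoidAlgebra k G) n ≃ₗ[k] GH k G n) : Prop :=
  ∀ (n : ℕ) (z : GCycles k G n), ∃ w : (hochschildComplex k (MonoidAlgebra k G)).cycles n,
    (w : GPow k (MonoidAlgebra k G)) = barToHopf k G n (gCyclesι k G n z) ∧
      θ n ((hochschildComplex k (MonoidAlgebra k G)).classOf n w) = gClass k G n z

/-- The canonical isomorphism `\widetilde{HC}_n(kG) ≅ ⨁_{i ≥ 0} H_{n-2i}(G, k)`: it is inverse to
the map induced by any equivariant `S`-map `k[u] ⊗ E → k[u] ⊗ \overline E` lifting the identity. -/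
def IsCyclicComparison
    (θ : ∀ n, HopfHC k (MonoidAlgebra k G) n ≃ₗ[k] GHSum k G n) : Prop :=
  ∀ f, IsComparison k G f → ∀ (n : ℕ) (i : Fin (n / 2 + 1)) (z : GCycles k G (n - 2 * i)),
    ∃ w : (cyclicComplex k (MonoidAlgebra k G)).cycles n,
      (w : ℕ →₀ GPow k (MonoidAlgebra k G)) =
          comparisonChain f i (n - 2 * i) (gCyclesι k G (n - 2 * i) z) ∧
        θ n ((cyclicComplex k (MonoidAlgebra k G)).classOf n w) =
          Pi.single i (gClass k G (n - 2 * i) z)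

end Comparison

end HopfCyclic

end

/-! The statement is lifted from the quotient complexes to the homogeneous resolution. A generator
$(x_0,\dots,x_n)$ of $E_n$ is read as a word of length $n+1$ in the alphabet $G$, so that the
augmented resolution becomes the free algebra `Words k G`, with the empty word in degree $-1$. There
$b$ is the antiderivation sending each letter to $1$, left multiplication by a letter is a
contraction, $AW$ cuts a word at a shared letter, the shuffle map $\nabla$ sums over lattice paths,
and a word is degenerate when two adjacent letters agree. Both $\widetilde C_*(kG)$ and the bar
complex are coinvariants of this algebra under translation of letters (the empty word going to $0$),
so identities between equivariant operators on words descend. Group elements are group-like, hence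
$\Omega\Delta^{\otimes(n+1)}$ only duplicates a word, and the Hochschild statement is an equality of
chain maps: the front and back faces of $(x_0,\dots,x_n)$ have successive quotients
$(g_1,\dots,g_i)$ and $(g_{i+1},\dots,g_n)$.

The cyclic statement rests on three facts.

The map $\widetilde{AW}$ is an $S$-map (`tensorBoundary_wordCyclicAW`). Besides $b\varphi+\varphi
b=1-\nabla AW$, this needs two identities modulo degenerate elements:
$AW\,B\,\nabla=B\otimes1\pm1\otimes B$ (`wordAW_wordConnes_listShuffle`) and $B\varphi B\nabla=0$
(`wordConnes_wordHomotopy_wordConnes_listShuffle`). Both come from the geometry of lattice paths;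
the higher entries then follow formally by induction. The explicit shuffle formula for $\varphi$
agrees with the recursive one modulo degenerate words (`listShih_sub_wordHomotopy`).

The resolution is contractible by a contraction that depends only on the first letter of a word, so
the recursion `coneMap` produces equivariant maps with prescribed boundary. It yields a comparison
$f:(E,b,0)\to(\overline E,b,B)$, a retraction in the other direction that kills degenerate words,
homotopies showing that they are mutually inverse, and a homotopy between $\widetilde{AW}\Delta\circ
f$ and $(f\otimes f)\circ AW\Delta$ (`IsWordComparison.cupHomotopy_boundary`). The last one is the
compatibility of $\theta$ with the coproducts. Since $\theta$ is defined by the retraction, it is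
inverse to the map induced by every comparison at once.

Over a field the bar complex contracts onto its homology (`exists_isSplitHomology`), and the
contraction of the tensor square makes the Künneth theorem explicit: a cycle $y$ is homologous to
$(e\otimes e)y$. This gives existence and uniqueness of the coproduct on group homology and,
coefficientwise in $u$, on $k[u]\otimes H_*(G,k)$. `IsHomologyModel.exists_coproduct` transports it
to Hopf Hochschild and Hopf cyclic homology. -/

noncomputable section

namespace HopfCyclic

/-! ## The free algebra on words -/

section Words

variable (k : Type*) [CommRing k] (S : Type*)

/-- The free algebra on `S`: linear combinations of words. -/
abbrev Words : Type _ := MonoidAlgebra k (FreeMonoid S)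

variable {k S} {M N : Type*} [AddCommGroup M] [Module k M] [AddCommGroup N] [Module k N]

variable (k) in
/-- The basis element given by a word. -/
def word (l : List S) : Words k S := MonoidAlgebra.of k _ (FreeMonoid.ofList l)

theorem word_append (l m : List S) : word k (l ++ m) = word k l * word k m := by
  simp [word]

@[simp] theorem word_nil : word k ([] : List S) = 1 := by
  simp [word, MonoidAlgebra.one_def]

theorem word_cons (c : S) (l : List S) : word k (c :: l) = word k [c] * word k l :=
  word_append [c] l

/-- Linear extension of a function on words. -/
def wordLift (f : List S → M) : Words k S →ₗ[k] M :=
  Finsupp.lsum k (fun l : FreeMonoid S => (LinearMap.toSpanSingleton k M (f l.toList))) ∘ₗ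
    (MonoidAlgebra.coeffLinearEquiv k).toLinearMap

@[simp] theorem wordLift_word (f : List S → M) (l : List S) : wordLift f (word k l) = f l := by
  simp [wordLift, word]

theorem words_hom_ext {f g : Words k S →ₗ[k] M} (h : ∀ l, f (word k l) = g (word k l)) : f = g := by
  apply MonoidAlgebra.lhom_ext'
  intro x
  ext
  simpa [word] using h x.toList

variable (k) in
/-- The span of the words with property `p`. -/
def wordSpan (p : List S → Prop) : Submodule k (Words k S) := Submodule.span k (word k '' {l | p l})

theorem word_mem {p : List S → Prop} {l : List S} (h : p l) : word k l ∈ wordSpan k p :=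
  Submodule.subset_span ⟨l, h, rfl⟩

theorem wordSpan_le {p : List S → Prop} {W : Submodule k (Words k S)} :
    wordSpan k p ≤ W ↔ ∀ l, p l → word k l ∈ W := by
  simp [wordSpan, Submodule.span_le, Set.subset_def]

theorem wordSpan_mono {p q : List S → Prop} (h : ∀ l, p l → q l) :
    wordSpan k p ≤ wordSpan k q :=
  (wordSpan_le (k := k)).2 fun l hl => word_mem (h l hl)

theorem wordSpan_true : wordSpan k (fun _ : List S => True) = ⊤ := by
  rw [eq_top_iff]
  have : (wordSpan k fun _ : List S => True).mkQ = 0 := words_hom_ext fun l => by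
    simpa using word_mem (k := k) (p := fun _ : List S => True) trivial
  rw [← Submodule.ker_mkQ (wordSpan k fun _ : List S => True), this, LinearMap.ker_zero]

theorem words_induction {p : Words k S → Prop} (x : Words k S) (h : ∀ l, p (word k l))
    (ha : ∀ x y, p x → p y → p (x + y)) (hs : ∀ (a : k) x, p x → p (a • x)) : p x := by
  have hx : x ∈ wordSpan k (fun _ : List S => True) := wordSpan_true (k := k) ▸ Submodule.mem_top
  induction hx using Submodule.span_induction with
  | mem x hx => obtain ⟨l, -, rfl⟩ := hx; exact h l
  | zero => simpa using hs 0 _ (h [])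
  | add x y _ _ hx hy => exact ha x y hx hy
  | smul a x _ hx => exact hs a x hx

theorem wordSpan_induction {q : List S → Prop} {p : Words k S → Prop} {x : Words k S}
    (hx : x ∈ wordSpan k q) (h : ∀ l, q l → p (word k l)) (h0 : p 0)
    (ha : ∀ x y, p x → p y → p (x + y)) (hs : ∀ (a : k) x, p x → p (a • x)) : p x := by
  induction hx using Submodule.span_induction with
  | mem x hx => obtain ⟨l, hl, rfl⟩ := hx; exact h l hl
  | zero => exact h0
  | add x y _ _ hx hy => exact ha x y hx hy
  | smul a x _ hx => exact hs a x hx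

theorem wordSpan_map_le {p : List S → Prop} {f : Words k S →ₗ[k] M} {W : Submodule k M}
    (h : ∀ l, p l → f (word k l) ∈ W) {x : Words k S} (hx : x ∈ wordSpan k p) : f x ∈ W :=
  (wordSpan_le (W := W.comap f)).2 h hx

theorem wordSpan_eqOn {p : List S → Prop} {f g : Words k S →ₗ[k] M}
    (h : ∀ l, p l → f (word k l) = g (word k l)) {x : Words k S} (hx : x ∈ wordSpan k p) :
    f x = g x :=
  (wordSpan_le (W := LinearMap.eqLocus f g)).2 h hx

theorem mul_mem_wordSpan {p q r : List S → Prop} (h : ∀ l m, p l → q m → r (l ++ m))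
    {x y : Words k S} (hx : x ∈ wordSpan k p) (hy : y ∈ wordSpan k q) : x * y ∈ wordSpan k r := by
  refine wordSpan_map_le (f := LinearMap.mulRight k y) (fun l hl => ?_) hx
  refine wordSpan_map_le (f := LinearMap.mulLeft k (word k l)) (fun m hm => ?_) hy
  simpa [← word_append] using word_mem (h l m hl hm)

/-! ### Degenerate words -/

/-- Words with two equal adjacent letters. -/
def Degenerate (l : List S) : Prop := ¬ l.IsChain (· ≠ ·)

theorem degenerate_append_left {l : List S} (h : Degenerate l) (m : List S) :
    Degenerate (m ++ l) := fun hc => h (List.isChain_append.1 hc).2.1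

theorem degenerate_append_right {l : List S} (h : Degenerate l) (m : List S) :
    Degenerate (l ++ m) := fun hc => h (List.isChain_append.1 hc).1

theorem degenerate_cons_cons {a b : S} {l : List S} :
    Degenerate (a :: b :: l) ↔ a = b ∨ Degenerate (b :: l) := by
  simp only [Degenerate, List.isChain_cons_cons]
  tauto

theorem Degenerate.exists_eq {l : List S} (h : Degenerate l) :
    ∃ (u : List S) (c : S) (v : List S), l = u ++ c :: c :: v := by
  induction l with
  | nil => simp [Degenerate] at h
  | cons a l ih =>
    cases l with
    | nil => simp [Degenerate] at h
    | cons b l =>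
      rcases degenerate_cons_cons.1 h with rfl | h
      · exact ⟨[], a, l, rfl⟩
      · obtain ⟨u, c, v, e⟩ := ih h
        exact ⟨a :: u, c, v, by rw [e]; rfl⟩

theorem degenerate_of_eq (u : List S) (c : S) (v : List S) : Degenerate (u ++ c :: c :: v) :=
  degenerate_append_left (degenerate_cons_cons.2 (Or.inl rfl)) u

theorem Degenerate.map {S' : Type*} (f : S → S') {l : List S} (h : Degenerate l) :
    Degenerate (l.map f) := by
  obtain ⟨u, c, v, rfl⟩ := h.exists_eq
  simpa using degenerate_of_eq (u.map f) (f c) (v.map f)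

variable (k S) in
/-- The span of the degenerate words. -/
def degenWords : Submodule k (Words k S) := wordSpan k Degenerate

theorem mul_mem_degenWords_left (x : Words k S) {y : Words k S} (hy : y ∈ degenWords k S) :
    x * y ∈ degenWords k S :=
  mul_mem_wordSpan (p := fun _ => True) (fun l _ _ h => degenerate_append_left h l)
    (wordSpan_true (k := k) ▸ Submodule.mem_top) hy

theorem mul_mem_degenWords_right {x : Words k S} (hx : x ∈ degenWords k S) (y : Words k S) :
    x * y ∈ degenWords k S :=
  mul_mem_wordSpan (q := fun _ => True) (fun _ m h _ => degenerate_append_right h m) hx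
    (wordSpan_true (k := k) ▸ Submodule.mem_top)

theorem square_mem_degenWords (c : S) : word k [c] * word k [c] ∈ degenWords k S := by
  rw [← word_append]
  exact word_mem (degenerate_of_eq [] c [])

theorem square_mul_mem_degenWords (c : S) (x : Words k S) :
    word k [c] * (word k [c] * x) ∈ degenWords k S := by
  rw [← mul_assoc]
  exact mul_mem_degenWords_right (square_mem_degenWords c) x

/-- Closed up cyclically, the word has two equal adjacent letters. -/
def CyclicDegenerate (l : List S) : Prop := ¬ (l : Cycle S).Chain (· ≠ ·)

theorem cyclicDegenerate_cons {c : S} {l : List S} :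
    CyclicDegenerate (c :: l) ↔ Degenerate (c :: (l ++ [c])) := by
  simp [CyclicDegenerate, Degenerate, Cycle.chain_coe_cons]

theorem cyclicDegenerate_rotate {l m : List S} :
    CyclicDegenerate (l ++ m) ↔ CyclicDegenerate (m ++ l) := by
  have : ((l ++ m : List S) : Cycle S) = (m ++ l : List S) :=
    Quotient.sound (List.isRotated_append)
  simp [CyclicDegenerate, this]

theorem Degenerate.cyclicDegenerate {l : List S} (h : Degenerate l) : CyclicDegenerate l := by
  cases l with
  | nil => simp [Degenerate] at h
  | cons c l => exact cyclicDegenerate_cons.2 (degenerate_append_right h [c])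

theorem cyclicDegenerate_of_ends (c : S) (l : List S) : CyclicDegenerate (c :: (l ++ [c])) :=
  cyclicDegenerate_cons.2 <| by simpa using degenerate_of_eq (c :: l) c []

/-! ### Homogeneous elements and signs -/

variable (k S) in
/-- The span of the words of length `n`. -/
def wordsOfLength (n : ℕ) : Submodule k (Words k S) := wordSpan k fun l => l.length = n

theorem word_mem_length (l : List S) : word k l ∈ wordsOfLength k S l.length := word_mem rfl

theorem mul_mem_length {m n : ℕ} {x y : Words k S} (hx : x ∈ wordsOfLength k S m)
    (hy : y ∈ wordsOfLength k S n) : x * y ∈ wordsOfLength k S (m + n) :=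
  mul_mem_wordSpan (fun l l' h h' => by rw [List.length_append, h, h']) hx hy

theorem letter_mul_mem_length {n : ℕ} (c : S) {x : Words k S} (hx : x ∈ wordsOfLength k S n) :
    word k [c] * x ∈ wordsOfLength k S (n + 1) :=
  add_comm 1 n ▸ mul_mem_length (word_mem_length [c]) hx

theorem neg_one_pow_mul_self' (n : ℕ) : ((-1 : k) ^ n) * (-1) ^ n = 1 := by
  rw [← mul_pow]; simp

/-! ### The boundary -/

/-- The boundary of a word. -/
def listBoundary : List S → Words k S
  | [] => 0
  | c :: l => word k l - word k [c] * listBoundary l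

variable (k S) in
/-- The alternating sum of the deletions of a letter. -/
def wordBoundary : Words k S →ₗ[k] Words k S := wordLift listBoundary

@[simp] theorem wordBoundary_one : wordBoundary k S 1 = 0 := by
  rw [← word_nil, wordBoundary, wordLift_word, listBoundary]

theorem wordBoundary_letter_mul (c : S) (x : Words k S) :
    wordBoundary k S (word k [c] * x) = x - word k [c] * wordBoundary k S x := by
  have : wordBoundary k S ∘ₗ LinearMap.mulLeft k (word k [c]) =
      LinearMap.id - LinearMap.mulLeft k (word k [c]) ∘ₗ wordBoundary k S := by
    refine words_hom_ext fun l => ?_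
    simp [← word_append, wordBoundary, listBoundary]
  exact LinearMap.congr_fun this x

@[simp] theorem wordBoundary_letter (c : S) : wordBoundary k S (word k [c]) = 1 := by
  simpa using wordBoundary_letter_mul c (1 : Words k S)

/-- The graded Leibniz rule, with letters in degree one. -/
theorem wordBoundary_word_mul (l : List S) (x : Words k S) :
    wordBoundary k S (word k l * x) =
      wordBoundary k S (word k l) * x + (-1 : k) ^ l.length • (word k l * wordBoundary k S x) := by
  induction l with
  | nil => simp
  | cons c l ih =>
    rw [word_cons, mul_assoc, wordBoundary_letter_mul, wordBoundary_letter_mul, ih,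
      List.length_cons, pow_succ]
    simp only [mul_add, sub_mul, mul_assoc, mul_smul_comm]
    module

@[simp] theorem wordBoundary_wordBoundary (x : Words k S) :
    wordBoundary k S (wordBoundary k S x) = 0 := by
  have : wordBoundary k S ∘ₗ wordBoundary k S = 0 := by
    refine words_hom_ext fun l => ?_
    induction l with
    | nil => simp
    | cons c l ih =>
      simp only [LinearMap.comp_apply, LinearMap.zero_apply] at ih ⊢
      rw [word_cons, wordBoundary_letter_mul, map_sub, wordBoundary_letter_mul, ih]
      simp
  exact LinearMap.congr_fun this x

theorem wordBoundary_word_mem (l : List S) :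
    wordBoundary k S (word k l) ∈ wordsOfLength k S (l.length - 1) := by
  induction l with
  | nil => simp
  | cons c l ih =>
    rw [word_cons, wordBoundary_letter_mul]
    refine sub_mem (word_mem_length l) ?_
    cases l with
    | nil => simp
    | cons d l => exact letter_mul_mem_length c ih

/-- In the boundary of $u\,c\,c\,v$ the two deletions inside the pair $cc$ cancel; all other
deletions leave the pair in place. -/
theorem wordBoundary_mem_degenWords {x : Words k S} (hx : x ∈ degenWords k S) :
    wordBoundary k S x ∈ degenWords k S := by
  refine wordSpan_map_le (fun l hl => ?_) hx
  obtain ⟨u, c, v, rfl⟩ := hl.exists_eq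
  have e : wordBoundary k S (word k (c :: c :: v)) =
      word k [c] * (word k [c] * wordBoundary k S (word k v)) := by
    rw [word_cons, word_cons c v, wordBoundary_letter_mul, wordBoundary_letter_mul, mul_sub]
    abel
  rw [word_append, wordBoundary_word_mul, e]
  refine add_mem (mul_mem_degenWords_left _ (word_mem (degenerate_of_eq [] c v)))
    (Submodule.smul_mem _ _ (mul_mem_degenWords_left _ (square_mul_mem_degenWords c _)))

/-! ### Connes' operator -/

/-- The sum of the words `c v x u c` over all decompositions `w = x c v`, with
coefficients the powers of `ζ`. -/
def listTurns (ζ : k) : List S → List S → Words k S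
  | _, [] => 0
  | u, c :: w => word k (c :: w ++ u ++ [c]) + ζ • listTurns ζ (u ++ [c]) w

variable (S) in
/-- The bilinear extension of `listTurns`. -/
def turns (ζ : k) : Words k S →ₗ[k] Words k S →ₗ[k] Words k S :=
  wordLift fun u => wordLift fun w => listTurns ζ u w

@[simp] theorem turns_one (ζ : k) (x : Words k S) : turns S ζ x 1 = 0 := by
  have : (turns S ζ).flip 1 = 0 := words_hom_ext fun l => by
    rw [← word_nil]
    simp [turns, listTurns, -word_nil]
  exact LinearMap.congr_fun this x

theorem turns_letter_mul (ζ : k) (x : Words k S) (c : S) (y : Words k S) :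
    turns S ζ x (word k [c] * y) =
      word k [c] * y * x * word k [c] + ζ • turns S ζ (x * word k [c]) y := by
  have h1 : ∀ l m, turns S ζ (word k l) (word k [c] * word k m) =
      word k [c] * word k m * word k l * word k [c] +
        ζ • turns S ζ (word k l * word k [c]) (word k m) := fun l m => by
    simp [← word_append, turns, listTurns]
  induction x using words_induction with
  | h l =>
    induction y using words_induction with
    | h m => exact h1 l m
    | ha x y hx hy => simp only [mul_add, add_mul, map_add, hx, hy]; module
    | hs a x hx => simp only [mul_smul_comm, smul_mul_assoc, map_smul, hx]; module
  | ha x y hx hy => simp only [mul_add, add_mul, map_add, hx, hy, LinearMap.add_apply]; module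
  | hs a x hx => simp only [mul_smul_comm, smul_mul_assoc, map_smul, hx, LinearMap.smul_apply]; module

variable (k S) in
/-- Connes' operator on words. -/
def wordConnes : Words k S →ₗ[k] Words k S :=
  wordLift fun l => (-1 : k) ^ (l.length + 1) • listTurns ((-1) ^ (l.length + 1)) [] l

theorem wordConnes_of_mem {n : ℕ} {x : Words k S} (hx : x ∈ wordsOfLength k S n) :
    wordConnes k S x = (-1 : k) ^ (n + 1) • turns S ((-1) ^ (n + 1)) 1 x := by
  refine wordSpan_eqOn (g := (-1 : k) ^ (n + 1) • turns S ((-1) ^ (n + 1)) 1) (fun l hl => ?_) hx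
  subst hl
  rw [← word_nil]
  simp [wordConnes, turns, -word_nil]

theorem wordConnes_word (l : List S) : wordConnes k S (word k l) =
    (-1 : k) ^ (l.length + 1) • turns S ((-1) ^ (l.length + 1)) 1 (word k l) :=
  wordConnes_of_mem (word_mem_length l)

@[simp] theorem wordConnes_one : wordConnes k S 1 = 0 := by
  rw [← word_nil, wordConnes_word]; simp

/-- Interior deletions in the turns give turns of the shorter words, with $\zeta$ replaced by
$-\zeta$ because the length drops by one. Deleting the first letter of one turn and the last letter
of the next gives the same word with opposite coefficients, so these terms telescope; only $uw$ and
$wu$ survive. The prefix $u$ is kept general for the induction on $w$; Connes' operator is the case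
where $u$ is empty. -/
theorem wordBoundary_turns (n : ℕ) (u w : List S) (h : u.length + w.length = n + 1) :
    wordBoundary k S (turns S ((-1) ^ n) (word k u) (word k w)) =
      turns S (-(-1) ^ n) (word k u) (wordBoundary k S (word k w)) +
      (-1 : k) ^ w.length • turns S (-(-1) ^ n) (wordBoundary k S (word k u)) (word k w) +
      ((-1 : k) ^ n) ^ (w.length + 1) • (word k u * word k w) -
      (-1 : k) ^ n • (word k w * word k u) := by
  induction w generalizing u with
  | nil => simp
  | cons c w ih =>
    have ih' := ih (u ++ [c]) (by simp at h ⊢; omega)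
    have hn : (-1 : k) ^ n = (-1) ^ u.length * (-1) ^ w.length := by
      rw [← pow_add]; congr 1; simp at h; omega
    have e1 := neg_one_pow_mul_self' (k := k) u.length
    have e2 := neg_one_pow_mul_self' (k := k) w.length
    rw [word_append] at ih'
    rw [word_cons, turns_letter_mul, map_add, map_smul, ih', wordBoundary_letter_mul, map_sub,
      turns_letter_mul, turns_letter_mul, List.length_cons]
    have e3 : wordBoundary k S (word k [c] * word k w * word k u * word k [c]) =
        word k w * word k u * word k [c]
        - word k [c] * wordBoundary k S (word k w) * word k u * word k [c]
        - (-1 : k) ^ w.length • (word k [c] * word k w * wordBoundary k S (word k u) * word k [c])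
        - (-1 : k) ^ n • (word k [c] * word k w * word k u) := by
      simp only [mul_assoc]
      rw [wordBoundary_letter_mul, wordBoundary_word_mul w, wordBoundary_word_mul u,
        wordBoundary_letter, hn]
      simp only [mul_add, mul_smul_comm, mul_one]
      module
    rw [e3, wordBoundary_word_mul u, wordBoundary_letter]
    have e4 : (-1 : k) ^ n * (-1) ^ n = 1 := neg_one_pow_mul_self' n
    have e5 : (-1 : k) ^ w.length * (-1) ^ n * (-1) ^ u.length = 1 := by
      rw [hn]; linear_combination (-1 : k) ^ u.length * (-1) ^ u.length * e2 + e1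
    simp only [mul_one, map_add, map_smul, LinearMap.add_apply, LinearMap.smul_apply, pow_succ,
      mul_assoc] at *
    generalize (-1 : k) ^ n = ζ at *
    generalize (-1 : k) ^ w.length = ε at *
    generalize (-1 : k) ^ u.length = δ at *
    linear_combination (norm := module) e5 • turns S (-ζ) (word k u) (word k w) -
      e4 • (word k w * (word k u * word k [c]))

theorem wordBoundary_wordConnes (x : Words k S) :
    wordBoundary k S (wordConnes k S x) = -wordConnes k S (wordBoundary k S x) := by
  have : wordBoundary k S ∘ₗ wordConnes k S = -(wordConnes k S ∘ₗ wordBoundary k S) := by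
    refine words_hom_ext fun l => ?_
    cases l with
    | nil => simp
    | cons c l =>
      have h := wordBoundary_turns (k := k) l.length [] (c :: l) (by simp)
      have h1 := wordConnes_of_mem (wordBoundary_word_mem (k := k) (c :: l))
      -- For an empty prefix the two surviving words coincide; they cancel because $n(n+1)$ is even.
      have e : ((-1 : k) ^ l.length) ^ ((c :: l).length + 1) = (-1) ^ l.length := by
        rw [← pow_mul, List.length_cons, show l.length * (l.length + 1 + 1) =
          l.length * (l.length + 1) + l.length by ring, pow_add,
          (Nat.even_mul_succ_self _).neg_one_pow, one_mul]
      rw [e] at h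
      have e' : (-1 : k) ^ (l.length + 1 + 1) = (-1) ^ l.length := by ring
      have e'' : (-1 : k) ^ (l.length + 1) = -(-1) ^ l.length := by ring
      simp only [LinearMap.comp_apply, LinearMap.neg_apply, h1, wordConnes_word, map_smul]
      simp only [List.length_cons, Nat.add_sub_cancel, e', e'', word_nil] at h ⊢
      rw [h]
      simp
  exact LinearMap.congr_fun this x

theorem listTurns_mem_length (ζ : k) (u w : List S) :
    listTurns ζ u w ∈ wordsOfLength k S (u.length + w.length + 1) := by
  induction w generalizing u with
  | nil => simp [listTurns]
  | cons c w ih =>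
    rw [listTurns]
    refine add_mem (word_mem (by simp; omega)) (Submodule.smul_mem _ _ ?_)
    have := ih (u ++ [c])
    rwa [show (u ++ [c]).length + w.length + 1 = u.length + (c :: w).length + 1 by
      simp; omega] at this

theorem wordConnes_mem_length {n : ℕ} {x : Words k S} (hx : x ∈ wordsOfLength k S n) :
    wordConnes k S x ∈ wordsOfLength k S (n + 1) := by
  refine wordSpan_map_le (fun l hl => ?_) hx
  subst hl
  rw [wordConnes, wordLift_word]
  exact Submodule.smul_mem _ _ (by simpa using listTurns_mem_length (k := k) _ [] l)

/-- A turn runs once around the closed-up word and repeats its starting letter at the end, so every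
cyclic adjacency of the word reappears as an ordinary adjacency. -/
theorem listTurns_mem_degenWords (ζ : k) (u w : List S) (h : CyclicDegenerate (u ++ w)) :
    listTurns ζ u w ∈ degenWords k S := by
  induction w generalizing u with
  | nil => simp [listTurns]
  | cons c w ih =>
    refine add_mem (word_mem ?_) (Submodule.smul_mem _ _ (ih _ (by simpa using h)))
    simpa using cyclicDegenerate_cons.1 (cyclicDegenerate_rotate.1 h)

theorem wordConnes_word_mem_degenWords {l : List S} (h : CyclicDegenerate l) :
    wordConnes k S (word k l) ∈ degenWords k S := by
  rw [wordConnes, wordLift_word]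
  exact Submodule.smul_mem _ _ (listTurns_mem_degenWords _ [] l h)

theorem wordConnes_mem_degenWords {x : Words k S} (hx : x ∈ wordSpan k CyclicDegenerate) :
    wordConnes k S x ∈ degenWords k S :=
  wordSpan_map_le (fun _ hl => wordConnes_word_mem_degenWords hl) hx

theorem degenWords_le_cyclic : degenWords k S ≤ wordSpan k CyclicDegenerate :=
  wordSpan_mono fun _ h => h.cyclicDegenerate

theorem wordConnes_degenWords {x : Words k S} (hx : x ∈ degenWords k S) :
    wordConnes k S x ∈ degenWords k S :=
  wordConnes_mem_degenWords (degenWords_le_cyclic hx)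

theorem listTurns_mem_ends (ζ : k) (u w : List S) :
    listTurns ζ u w ∈ wordSpan k fun l => ∃ c v, l = c :: (v ++ [c]) := by
  induction w generalizing u with
  | nil => simp [listTurns]
  | cons c w ih => exact add_mem (word_mem ⟨c, w ++ u, rfl⟩) (Submodule.smul_mem _ _ (ih _))

/-- A turn begins and ends with the same letter, hence is cyclically degenerate. The relation
$B^2=0$ holds only modulo degenerate words because `wordConnes` is the normalized formula, without
the factor $1-t$. -/
theorem wordConnes_wordConnes (x : Words k S) :
    wordConnes k S (wordConnes k S x) ∈ degenWords k S := by
  refine wordConnes_mem_degenWords ?_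
  have hx : x ∈ wordSpan k (fun _ : List S => True) :=
    wordSpan_true (k := k) ▸ Submodule.mem_top
  refine wordSpan_map_le (fun l _ => ?_) hx
  rw [wordConnes, wordLift_word]
  refine Submodule.smul_mem _ _ (wordSpan_mono ?_ (listTurns_mem_ends _ [] l))
  rintro _ ⟨c, v, rfl⟩
  exact cyclicDegenerate_of_ends c v

/-! ### Naturality -/

variable {S' : Type*}

variable (k) in
/-- The algebra map induced by a map of alphabets. -/
def wordMap (f : S → S') : Words k S →ₐ[k] Words k S' :=
  MonoidAlgebra.mapDomainAlgHom k k (FreeMonoid.map f)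

@[simp] theorem wordMap_word (f : S → S') (l : List S) :
    wordMap k f (word k l) = word k (l.map f) := by
  simp [wordMap, word, ← FreeMonoid.ofList_map]

theorem wordMap_wordMap {S'' : Type*} (f : S → S') (g : S' → S'') (x : Words k S) :
    wordMap k g (wordMap k f x) = wordMap k (g ∘ f) x :=
  LinearMap.congr_fun (f := (wordMap k g).toLinearMap ∘ₗ (wordMap k f).toLinearMap)
    (g := (wordMap k (g ∘ f)).toLinearMap) (words_hom_ext fun l => by simp) x

theorem wordMap_id (x : Words k S) : wordMap k id x = x :=
  LinearMap.congr_fun (f := (wordMap k id).toLinearMap) (g := LinearMap.id)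
    (words_hom_ext fun l => by simp) x

theorem wordMap_mem_degenWords (f : S → S') {x : Words k S} (hx : x ∈ degenWords k S) :
    wordMap k f x ∈ degenWords k S' :=
  wordSpan_map_le (f := (wordMap k f).toLinearMap)
    (fun l hl => by
      rw [AlgHom.toLinearMap_apply, wordMap_word]
      exact word_mem (hl.map f)) hx

theorem wordMap_mem_length (f : S → S') {n : ℕ} {x : Words k S} (hx : x ∈ wordsOfLength k S n) :
    wordMap k f x ∈ wordsOfLength k S' n :=
  wordSpan_map_le (f := (wordMap k f).toLinearMap)
    (fun l hl => by
      rw [AlgHom.toLinearMap_apply, wordMap_word]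
      exact word_mem (by simpa using hl)) hx

theorem wordBoundary_wordMap (f : S → S') (x : Words k S) :
    wordBoundary k S' (wordMap k f x) = wordMap k f (wordBoundary k S x) := by
  refine LinearMap.congr_fun (f := wordBoundary k S' ∘ₗ (wordMap k f).toLinearMap)
    (g := (wordMap k f).toLinearMap ∘ₗ wordBoundary k S) (words_hom_ext fun l => ?_) x
  induction l with
  | nil => simp
  | cons c l ih =>
    simp only [LinearMap.comp_apply, AlgHom.toLinearMap_apply] at ih ⊢
    rw [word_cons, map_mul (wordMap k f), wordBoundary_letter_mul, map_sub,
      map_mul (wordMap k f), ← ih, wordMap_word,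
      List.map_singleton, wordBoundary_letter_mul]

theorem listTurns_map (ζ : k) (f : S → S') (u w : List S) :
    listTurns ζ (u.map f) (w.map f) = wordMap k f (listTurns ζ u w) := by
  induction w generalizing u with
  | nil => simp [listTurns]
  | cons c w ih =>
    have := ih (u ++ [c])
    simp only [List.map_append, List.map_cons, List.map_nil] at this
    simp [listTurns, this]

theorem wordConnes_wordMap (f : S → S') (x : Words k S) :
    wordConnes k S' (wordMap k f x) = wordMap k f (wordConnes k S x) := by
  refine LinearMap.congr_fun (f := wordConnes k S' ∘ₗ (wordMap k f).toLinearMap)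
    (g := (wordMap k f).toLinearMap ∘ₗ wordConnes k S) (words_hom_ext fun l => ?_) x
  simp [wordConnes, ← listTurns_map]

end Words

end HopfCyclic

end

noncomputable section

namespace HopfCyclic

/-! ## The Eilenberg–Zilber theory of words -/

section WordShuffles

variable {k : Type*} [CommRing k] {S S' : Type*}

/-! ### Signs, augmentation, tensor products -/

variable (k S) in
/-- The sign `(-1)^n` on words of length `n + 1`. -/
def wordSign : Words k S →ₗ[k] Words k S := wordLift fun l => (-1 : k) ^ (l.length + 1) • word k l

@[simp] theorem wordSign_word (l : List S) :
    wordSign k S (word k l) = (-1 : k) ^ (l.length + 1) • word k l := wordLift_word _ _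

@[simp] theorem wordSign_one : wordSign k S 1 = -1 := by
  rw [← word_nil, wordSign_word]; simp

theorem wordSign_letter_mul (c : S) (x : Words k S) :
    wordSign k S (word k [c] * x) = -(word k [c] * wordSign k S x) := by
  refine LinearMap.congr_fun (f := wordSign k S ∘ₗ LinearMap.mulLeft k (word k [c]))
    (g := -(LinearMap.mulLeft k (word k [c]) ∘ₗ wordSign k S)) (words_hom_ext fun l => ?_) x
  simp [← word_append, pow_succ]

theorem wordSign_of_mem {n : ℕ} {x : Words k S} (hx : x ∈ wordsOfLength k S n) :
    wordSign k S x = (-1 : k) ^ (n + 1) • x :=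
  wordSpan_eqOn (g := (-1 : k) ^ (n + 1) • LinearMap.id)
    (fun l hl => by subst hl; simp) hx

theorem wordBoundary_wordSign (x : Words k S) :
    wordBoundary k S (wordSign k S x) = -wordSign k S (wordBoundary k S x) := by
  refine LinearMap.congr_fun (f := wordBoundary k S ∘ₗ wordSign k S)
    (g := -(wordSign k S ∘ₗ wordBoundary k S)) (words_hom_ext fun l => ?_) x
  cases l with
  | nil => simp
  | cons c l =>
    have h1 := wordSign_of_mem (wordBoundary_word_mem (k := k) (c :: l))
    simp only [LinearMap.comp_apply, LinearMap.neg_apply, wordSign_word, map_smul, h1]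
    simp [pow_succ]

theorem wordConnes_wordSign (x : Words k S) :
    wordConnes k S (wordSign k S x) = -wordSign k S (wordConnes k S x) := by
  refine LinearMap.congr_fun (f := wordConnes k S ∘ₗ wordSign k S)
    (g := -(wordSign k S ∘ₗ wordConnes k S)) (words_hom_ext fun l => ?_) x
  have h1 := wordSign_of_mem (wordConnes_mem_length (word_mem_length (k := k) l))
  simp only [LinearMap.comp_apply, LinearMap.neg_apply, wordSign_word, map_smul, h1]
  simp [pow_succ]

variable (k S) in
/-- The coefficient of the empty word. -/
def emptyCoeff : Words k S →ₗ[k] k := wordLift fun l => if l.length = 0 then 1 else 0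

theorem emptyCoeff_word (l : List S) :
    emptyCoeff k S (word k l) = if l.length = 0 then 1 else 0 := wordLift_word _ _

@[simp] theorem emptyCoeff_one : emptyCoeff k S 1 = 1 := by
  rw [← word_nil, emptyCoeff_word]; simp

@[simp] theorem emptyCoeff_letter_mul (c : S) (x : Words k S) :
    emptyCoeff k S (word k [c] * x) = 0 :=
  LinearMap.congr_fun (f := emptyCoeff k S ∘ₗ LinearMap.mulLeft k (word k [c]))
    (g := 0) (words_hom_ext fun l => by simp [← word_append, emptyCoeff_word]) x

@[simp] theorem emptyCoeff_wordMap (f : S → S') (x : Words k S) :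
    emptyCoeff k S' (wordMap k f x) = emptyCoeff k S x :=
  LinearMap.congr_fun (f := emptyCoeff k S' ∘ₗ (wordMap k f).toLinearMap)
    (g := emptyCoeff k S) (words_hom_ext fun l => by simp [emptyCoeff_word]) x

variable (k S S') in
/-- Tensor products of words. -/
abbrev WordTensor : Type _ := Words k S ⊗[k] Words k S'

theorem wordTensor_hom_ext {M : Type*} [AddCommGroup M] [Module k M]
    {f g : WordTensor k S S' →ₗ[k] M}
    (h : ∀ l m, f (word k l ⊗ₜ word k m) = g (word k l ⊗ₜ word k m)) : f = g :=
  TensorProduct.ext <| words_hom_ext fun l => words_hom_ext fun m => h l m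

variable (k S S') in
/-- The boundary of the tensor product. -/
def tensorBoundary : Module.End k (WordTensor k S S') :=
  TensorProduct.map (wordBoundary k S) LinearMap.id +
    TensorProduct.map (wordSign k S) (wordBoundary k S')

variable (k S S') in
/-- Connes' operator of the tensor product. -/
def tensorConnes : Module.End k (WordTensor k S S') :=
  TensorProduct.map (wordConnes k S) LinearMap.id +
    TensorProduct.map (wordSign k S) (wordConnes k S')

theorem tensorBoundary_tmul (x : Words k S) (y : Words k S') :
    tensorBoundary k S S' (x ⊗ₜ y) =
      wordBoundary k S x ⊗ₜ y + wordSign k S x ⊗ₜ wordBoundary k S' y := by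
  simp [tensorBoundary]

theorem tensorConnes_tmul (x : Words k S) (y : Words k S') :
    tensorConnes k S S' (x ⊗ₜ y) =
      wordConnes k S x ⊗ₜ y + wordSign k S x ⊗ₜ wordConnes k S' y := by
  simp [tensorConnes]

theorem tensorBoundary_letter_mul (c : S) (z : WordTensor k S S') :
    tensorBoundary k S S' ((word k [c] ⊗ₜ 1) * z) =
      z - (word k [c] ⊗ₜ 1) * tensorBoundary k S S' z := by
  refine LinearMap.congr_fun
    (f := tensorBoundary k S S' ∘ₗ LinearMap.mulLeft k (word k [c] ⊗ₜ 1))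
    (g := LinearMap.id - LinearMap.mulLeft k (word k [c] ⊗ₜ 1) ∘ₗ tensorBoundary k S S')
    (TensorProduct.ext' fun x y => ?_) z
  simp [tensorBoundary_tmul, wordBoundary_letter_mul, wordSign_letter_mul, TensorProduct.sub_tmul,
    TensorProduct.neg_tmul, mul_add]
  abel

/-- `U ⊗ A + A ⊗ U'`. -/
def tensorIdeal (U : Submodule k (Words k S)) (U' : Submodule k (Words k S')) :
    Submodule k (WordTensor k S S') :=
  Submodule.map₂ (TensorProduct.mk k _ _) U ⊤ ⊔ Submodule.map₂ (TensorProduct.mk k _ _) ⊤ U'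

section tensorIdeal

variable {U : Submodule k (Words k S)} {U' : Submodule k (Words k S')}

theorem tmul_mem_tensorIdeal_left {x : Words k S} (hx : x ∈ U) (y : Words k S') :
    x ⊗ₜ y ∈ tensorIdeal U U' :=
  Submodule.mem_sup_left (Submodule.apply_mem_map₂ (TensorProduct.mk k _ _) hx trivial)

theorem tmul_mem_tensorIdeal_right (x : Words k S) {y : Words k S'} (hy : y ∈ U') :
    x ⊗ₜ y ∈ tensorIdeal U U' :=
  Submodule.mem_sup_right (Submodule.apply_mem_map₂ (TensorProduct.mk k _ _) trivial hy)

theorem tensorIdeal_le {W : Submodule k (WordTensor k S S')} (h : ∀ x ∈ U, ∀ y, x ⊗ₜ y ∈ W)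
    (h' : ∀ x, ∀ y ∈ U', x ⊗ₜ y ∈ W) : tensorIdeal U U' ≤ W :=
  sup_le (Submodule.map₂_le.2 fun x hx y _ => h x hx y)
    (Submodule.map₂_le.2 fun x _ y hy => h' x y hy)

theorem tensorIdeal_mono {V : Submodule k (Words k S)} {V' : Submodule k (Words k S')}
    (h : U ≤ V) (h' : U' ≤ V') : tensorIdeal U U' ≤ tensorIdeal V V' :=
  tensorIdeal_le (fun _ hx y => tmul_mem_tensorIdeal_left (h hx) y)
    (fun x _ hy => tmul_mem_tensorIdeal_right x (h' hy))

theorem tensorIdeal_map {M : Type*} [AddCommGroup M] [Module k M] {f : WordTensor k S S' →ₗ[k] M}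
    {W : Submodule k M} (h : ∀ x ∈ U, ∀ y, f (x ⊗ₜ y) ∈ W)
    (h' : ∀ x, ∀ y ∈ U', f (x ⊗ₜ y) ∈ W) {z : WordTensor k S S'} (hz : z ∈ tensorIdeal U U') :
    f z ∈ W :=
  tensorIdeal_le (W := W.comap f) h h' hz

end tensorIdeal

variable (k S S') in
/-- The tensors with a degenerate factor. -/
abbrev degenTensors : Submodule k (WordTensor k S S') :=
  tensorIdeal (degenWords k S) (degenWords k S')

theorem mul_mem_degenTensors_left (w : WordTensor k S S') {z : WordTensor k S S'}
    (hz : z ∈ degenTensors k S S') : w * z ∈ degenTensors k S S' := by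
  induction w using TensorProduct.induction_on with
  | zero => simp
  | add w w' h h' => rw [add_mul]; exact add_mem h h'
  | tmul a a' =>
    refine tensorIdeal_map (f := LinearMap.mulLeft k (a ⊗ₜ[k] a')) (fun x hx y => ?_)
      (fun x y hy => ?_) hz
    · simpa using tmul_mem_tensorIdeal_left (mul_mem_degenWords_left a hx) _
    · simpa using tmul_mem_tensorIdeal_right _ (mul_mem_degenWords_left a' hy)

theorem mul_mem_degenTensors_right {z : WordTensor k S S'} (hz : z ∈ degenTensors k S S')
    (w : WordTensor k S S') : z * w ∈ degenTensors k S S' := by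
  induction w using TensorProduct.induction_on with
  | zero => simp
  | add w w' h h' => rw [mul_add]; exact add_mem h h'
  | tmul a a' =>
    refine tensorIdeal_map (f := LinearMap.mulRight k (a ⊗ₜ[k] a')) (fun x hx y => ?_)
      (fun x y hy => ?_) hz
    · simpa using tmul_mem_tensorIdeal_left (mul_mem_degenWords_right hx a) _
    · simpa using tmul_mem_tensorIdeal_right _ (mul_mem_degenWords_right hy a')

/-! ### The Alexander–Whitney map -/

/-- The Alexander–Whitney map on a word in pairs. -/
def listAW : List (S × S') → WordTensor k S S'
  | [] => 0
  | c :: w => word k [c.1] ⊗ₜ word k ((c :: w).map Prod.snd) + (word k [c.1] ⊗ₜ 1) * listAW w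

variable (k S S') in
/-- The Alexander–Whitney map. -/
def wordAW : Words k (S × S') →ₗ[k] WordTensor k S S' := wordLift listAW

@[simp] theorem wordAW_one : wordAW k S S' 1 = 0 := by
  rw [← word_nil, wordAW, wordLift_word, listAW]

theorem wordAW_letter_mul (c : S × S') (x : Words k (S × S')) :
    wordAW k S S' (word k [c] * x) =
      word k [c.1] ⊗ₜ (word k [c.2] * wordMap k Prod.snd x) +
        (word k [c.1] ⊗ₜ 1) * wordAW k S S' x := by
  refine LinearMap.congr_fun (f := wordAW k S S' ∘ₗ LinearMap.mulLeft k (word k [c]))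
    (g := TensorProduct.mk k _ _ (word k [c.1]) ∘ₗ LinearMap.mulLeft k (word k [c.2]) ∘ₗ
      (wordMap k Prod.snd).toLinearMap + LinearMap.mulLeft k (word k [c.1] ⊗ₜ 1) ∘ₗ wordAW k S S')
    (words_hom_ext fun l => ?_) x
  simp [← word_append, wordAW, listAW]

/-- The shared letter of a splitting of a product lies either in the left or in the right factor. -/
theorem wordAW_mul (x y : Words k (S × S')) :
    wordAW k S S' (x * y) = wordAW k S S' x * (1 ⊗ₜ wordMap k Prod.snd y) +
      (wordMap k Prod.fst x ⊗ₜ 1) * wordAW k S S' y := by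
  induction x using words_induction with
  | h l =>
    induction l with
    | nil => simp [← Algebra.TensorProduct.one_def]
    | cons c l ih =>
      rw [word_cons, mul_assoc, wordAW_letter_mul, wordAW_letter_mul, ih]
      simp [add_mul, mul_add, mul_assoc, wordMap_word]
      simp [← mul_assoc]
      abel
  | ha x x' h h' =>
    simp only [add_mul, map_add, h, h', TensorProduct.add_tmul]; abel
  | hs a x h =>
    simp only [smul_mul_assoc, map_smul, h, ← TensorProduct.smul_tmul', smul_add]

/-- The two extra terms are the deletions of the shared letter at the extreme splittings. They have
an empty factor and exist only because the complexes are augmented; they vanish in every quotient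
that kills the empty word. -/
theorem tensorBoundary_wordAW (x : Words k (S × S')) :
    tensorBoundary k S S' (wordAW k S S' x) = wordAW k S S' (wordBoundary k (S × S') x) +
      1 ⊗ₜ wordMap k Prod.snd x + wordSign k S (wordMap k Prod.fst x) ⊗ₜ 1 := by
  induction x using words_induction with
  | h l =>
    induction l with
    | nil => simp [TensorProduct.neg_tmul]
    | cons c l ih =>
      rw [word_cons, wordAW_letter_mul, map_add, tensorBoundary_letter_mul, ih,
        wordBoundary_letter_mul, map_sub, wordAW_letter_mul, tensorBoundary_tmul,
        wordBoundary_letter_mul, wordBoundary_wordMap, map_mul, map_mul, wordMap_word, wordMap_word]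
      simp [mul_add, wordSign_letter_mul, TensorProduct.tmul_sub, TensorProduct.neg_tmul]
      abel
  | ha x y h h' =>
    simp only [map_add, h, h', TensorProduct.add_tmul, TensorProduct.tmul_add]; abel
  | hs a x h =>
    simp only [map_smul, h, TensorProduct.tmul_smul, TensorProduct.smul_tmul', smul_add]

/-- A splitting of $u\,c\,c\,v$ at the first of the two equal letters, or before it, leaves the pair
in the second factor; a splitting at the second of them, or after it, leaves it in the first. -/
theorem wordAW_degenWords {x : Words k (S × S')} (hx : x ∈ degenWords k (S × S')) :
    wordAW k S S' x ∈ degenTensors k S S' := by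
  refine wordSpan_map_le (fun l hl => ?_) hx
  obtain ⟨u, c, v, rfl⟩ := hl.exists_eq
  rw [word_append, wordAW_mul]
  refine add_mem (mul_mem_degenTensors_left _ (tmul_mem_tensorIdeal_right _ ?_))
    (mul_mem_degenTensors_left _ ?_)
  · exact wordMap_mem_degenWords _ (word_mem (degenerate_of_eq [] c v))
  · rw [word_cons, word_cons c v, wordAW_letter_mul, wordAW_letter_mul, mul_add, ← mul_assoc]
    simp only [map_mul, wordMap_word, List.map_cons, List.map_nil,
      Algebra.TensorProduct.tmul_mul_tmul, one_mul]
    refine add_mem (tmul_mem_tensorIdeal_right _ (square_mul_mem_degenWords _ _))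
      (add_mem (tmul_mem_tensorIdeal_left (square_mem_degenWords _) _)
        (mul_mem_degenTensors_right (tmul_mem_tensorIdeal_left (square_mem_degenWords _) _) _))

/-- The Alexander–Whitney map of a word is a combination of its splittings. -/
theorem wordAW_word_mem (w : List (S × S')) (W : Submodule k (WordTensor k S S'))
    (h : ∀ v e v', w = v ++ e :: v' →
      word k ((v ++ [e]).map Prod.fst) ⊗ₜ word k ((e :: v').map Prod.snd) ∈ W) :
    wordAW k S S' (word k w) ∈ W := by
  induction w generalizing W with
  | nil => simp
  | cons c w ih =>
    rw [word_cons, wordAW_letter_mul]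
    refine add_mem ?_ ?_
    · simpa [← word_append] using h [] c w rfl
    · refine ih (W.comap (LinearMap.mulLeft k (word k [c.1] ⊗ₜ 1))) fun v e v' hw => ?_
      subst hw
      simpa [← word_append] using h (c :: v) e v' rfl

end WordShuffles

end HopfCyclic

end

noncomputable section

namespace HopfCyclic

section WordShuffles

variable {k : Type*} [CommRing k] {S S' : Type*}

/-! ### The shuffle map -/

variable (k) in
/-- The signed sum of the lattice paths from `(a_0, b_0)` to `(a_p, b_q)`. -/
def listShuffle : List S → List S' → Words k (S × S')
  | a :: l, b :: m => word k [(a, b)] * ((if l.length + m.length = 0 then 1 else 0) +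
      listShuffle l (b :: m) + (-1 : k) ^ l.length • listShuffle (a :: l) m)
  | [], _ => 0
  | _ :: _, [] => 0
termination_by l m => l.length + m.length

@[simp] theorem listShuffle_nil_left (m : List S') : listShuffle k ([] : List S) m = 0 := by
  rw [listShuffle]

@[simp] theorem listShuffle_nil_right (l : List S) : listShuffle k l ([] : List S') = 0 := by
  cases l <;> rw [listShuffle]

theorem listShuffle_cons_cons (a : S) (l : List S) (b : S') (m : List S') :
    listShuffle k (a :: l) (b :: m) =
      word k [(a, b)] * ((if l.length + m.length = 0 then 1 else 0) +
        listShuffle k l (b :: m) + (-1 : k) ^ l.length • listShuffle k (a :: l) m) := by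
  rw [listShuffle]

/-- Induction on the recursion of lattice paths. -/
theorem shuffle_induction {p : List S → List S' → Prop} (h₁ : ∀ m, p [] m) (h₂ : ∀ l, p l [])
    (h : ∀ a l b m, p l (b :: m) → p (a :: l) m → p (a :: l) (b :: m)) (l : List S)
    (m : List S') : p l m := by
  induction l generalizing m with
  | nil => exact h₁ m
  | cons a l ih =>
    induction m with
    | nil => exact h₂ _
    | cons b m ih' => exact h a l b m (ih _) ih'

variable (k S S') in
/-- The shuffle map. -/
def wordShuffle : WordTensor k S S' →ₗ[k] Words k (S × S') :=
  TensorProduct.lift (wordLift fun l => wordLift fun m => listShuffle k l m)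

@[simp] theorem wordShuffle_word (l : List S) (m : List S') :
    wordShuffle k S S' (word k l ⊗ₜ word k m) = listShuffle k l m := by
  simp [wordShuffle]

@[simp] theorem wordShuffle_one_tmul (y : Words k S') : wordShuffle k S S' (1 ⊗ₜ y) = 0 :=
  LinearMap.congr_fun (f := wordShuffle k S S' ∘ₗ TensorProduct.mk k _ _ 1) (g := 0)
    (words_hom_ext fun m => by rw [← word_nil]; simp [-word_nil]) y

@[simp] theorem wordShuffle_tmul_one (x : Words k S) : wordShuffle k S S' (x ⊗ₜ 1) = 0 :=
  LinearMap.congr_fun (f := wordShuffle k S S' ∘ₗ (TensorProduct.mk k _ _).flip 1) (g := 0)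
    (words_hom_ext fun m => by rw [← word_nil]; simp [-word_nil]) x

/-- The recursion on the first step of a lattice path in bilinear form. The product of the two
`emptyCoeff` detects the path consisting of a single point, and the sign of a step in the second
direction is absorbed in `wordSign`. -/
theorem wordShuffle_letter_mul (a : S) (b : S') (x : Words k S) (y : Words k S') :
    wordShuffle k S S' ((word k [a] * x) ⊗ₜ (word k [b] * y)) =
      word k [(a, b)] * ((emptyCoeff k S x * emptyCoeff k S' y) • 1 +
        wordShuffle k S S' (x ⊗ₜ (word k [b] * y)) -
        wordShuffle k S S' ((word k [a] * wordSign k S x) ⊗ₜ y)) := by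
  have : ∀ l m, wordShuffle k S S' ((word k [a] * word k l) ⊗ₜ (word k [b] * word k m)) =
      word k [(a, b)] * ((emptyCoeff k S (word k l) * emptyCoeff k S' (word k m)) • 1 +
        wordShuffle k S S' (word k l ⊗ₜ (word k [b] * word k m)) -
        wordShuffle k S S' ((word k [a] * wordSign k S (word k l)) ⊗ₜ word k m)) := fun l m => by
    rw [← word_append, ← word_append, wordSign_word, mul_smul_comm, ← word_append,
      ← TensorProduct.smul_tmul', map_smul, emptyCoeff_word, emptyCoeff_word]
    simp only [wordShuffle_word, List.cons_append, List.nil_append, listShuffle_cons_cons, pow_succ]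
    congr 1
    have : (if l.length + m.length = 0 then (1 : Words k (S × S')) else 0) =
        ((if l.length = 0 then (1 : k) else 0) * if m.length = 0 then 1 else 0) • 1 := by
      rcases l with - | ⟨_, l⟩ <;> rcases m with - | ⟨_, m⟩ <;> simp
    rw [this]
    module
  induction x using words_induction with
  | h l =>
    induction y using words_induction with
    | h m => exact this l m
    | ha x y hx hy =>
      simp only [mul_add, map_add, TensorProduct.tmul_add, hx, hy, mul_sub, add_smul]; abel
    | hs a x hx =>
      simp only [mul_smul_comm, map_smul, TensorProduct.tmul_smul, hx, mul_sub, mul_add, smul_eq_mul,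
        smul_add, smul_sub, mul_left_comm, mul_smul]
  | ha x y hx hy =>
    simp only [mul_add, map_add, TensorProduct.add_tmul, hx, hy, mul_sub, add_smul, add_mul]; abel
  | hs a x hx =>
    simp only [mul_smul_comm, map_smul, ← TensorProduct.smul_tmul', hx, mul_sub, mul_add,
      smul_eq_mul, smul_add, smul_sub, mul_assoc, mul_smul]

variable (k S S') in
/-- The coefficient of the tensors of two letters. -/
def letterCoeff : WordTensor k S S' →ₗ[k] k :=
  LinearMap.mul' k k ∘ₗ TensorProduct.map (emptyCoeff k S ∘ₗ wordBoundary k S)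
    (emptyCoeff k S' ∘ₗ wordBoundary k S')

theorem letterCoeff_tmul (x : Words k S) (y : Words k S') : letterCoeff k S S' (x ⊗ₜ y) =
    emptyCoeff k S (wordBoundary k S x) * emptyCoeff k S' (wordBoundary k S' y) := by
  simp [letterCoeff]

theorem emptyCoeff_word_eq (l : List S) :
    emptyCoeff k S (wordBoundary k S (word k l)) = if l.length = 1 then 1 else 0 := by
  rcases l with - | ⟨a, l⟩
  · simp
  · rw [word_cons, wordBoundary_letter_mul]
    simp [emptyCoeff_word]

/-- The usual cancellation of the two ways around a corner of a path. The term with `letterCoeff` is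
due to the augmentation: the one-point path has the empty word as boundary, whereas the shuffle of
anything with the empty word is $0$. -/
theorem wordBoundary_wordShuffle (z : WordTensor k S S') :
    wordBoundary k (S × S') (wordShuffle k S S' z) =
      wordShuffle k S S' (tensorBoundary k S S' z) + letterCoeff k S S' z • 1 := by
  refine LinearMap.congr_fun (f := wordBoundary k (S × S') ∘ₗ wordShuffle k S S')
    (g := wordShuffle k S S' ∘ₗ tensorBoundary k S S' +
      (letterCoeff k S S').smulRight (1 : Words k (S × S'))) (wordTensor_hom_ext fun l m => ?_) z
  simp only [LinearMap.comp_apply, LinearMap.add_apply, LinearMap.smulRight_apply]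
  induction l, m using shuffle_induction with
  | h₁ m => simp [tensorBoundary_tmul, TensorProduct.neg_tmul, letterCoeff_tmul]
  | h₂ l => simp [tensorBoundary_tmul, letterCoeff_tmul]
  | h a l b m ih₁ ih₂ =>
    have e1 := neg_one_pow_mul_self' (k := k) l.length
    have hb := wordSign_of_mem (wordBoundary_word_mem (k := k) l)
    have hb' : wordSign k S (wordBoundary k S (word k l)) =
        (-1 : k) ^ l.length • wordBoundary k S (word k l) := by
      rcases l with - | ⟨c, l⟩
      · simp
      · simpa using hb
    rw [word_cons a l, word_cons b m, wordShuffle_letter_mul, ← word_cons b m,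
      ← word_cons a l, wordSign_word, mul_smul_comm, ← TensorProduct.smul_tmul', map_smul,
      ← word_cons a l, wordBoundary_letter_mul, map_sub, map_add, map_smul, map_smul, ih₁, ih₂]
    simp only [tensorBoundary_tmul, wordBoundary_one, letterCoeff_tmul, wordSign_word, map_add,
      map_smul, ← TensorProduct.smul_tmul']
    rw [word_cons a l, word_cons b m, wordBoundary_letter_mul, wordBoundary_letter_mul]
    simp only [TensorProduct.sub_tmul, TensorProduct.tmul_sub, map_sub, wordShuffle_letter_mul,
      emptyCoeff_letter_mul, hb', wordSign_word, mul_smul_comm, ← TensorProduct.smul_tmul', map_smul,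
      List.length_cons, pow_succ]
    simp only [mul_add, mul_sub, mul_smul_comm, smul_add, smul_sub, mul_one, mul_zero, smul_zero]
    generalize (-1 : k) ^ l.length = ε at *
    module

/-- If a word starts with a repeated letter, the corresponding first step of the path does not move,
and the path starts with two equal points. Otherwise the repetition is still present in the
recursive calls. -/
theorem listShuffle_mem_degenWords (l : List S) (m : List S') (h : Degenerate l ∨ Degenerate m) :
    listShuffle k l m ∈ degenWords k (S × S') := by
  induction l, m using shuffle_induction with
  | h₁ m => simp
  | h₂ l => simp
  | h a l b m ih₁ ih₂ =>
    have hδ : (if l.length + m.length = 0 then (1 : Words k (S × S')) else 0) = 0 := by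
      rw [if_neg]
      intro h0
      rcases l with - | ⟨_, l⟩ <;> rcases m with - | ⟨_, m⟩ <;> simp [Degenerate] at h h0
    rw [listShuffle_cons_cons, hδ, zero_add, mul_add, mul_smul_comm]
    refine add_mem ?_ (Submodule.smul_mem _ _ ?_)
    · rcases l with - | ⟨a', l⟩
      · simp
      · by_cases h' : Degenerate (a' :: l) ∨ Degenerate (b :: m)
        · exact mul_mem_degenWords_left _ (ih₁ h')
        · rw [degenerate_cons_cons] at h
          obtain rfl : a = a' := by tauto
          rw [listShuffle_cons_cons]
          exact square_mul_mem_degenWords _ _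
    · rcases m with - | ⟨b', m⟩
      · simp
      · by_cases h' : Degenerate (a :: l) ∨ Degenerate (b' :: m)
        · exact mul_mem_degenWords_left _ (ih₂ h')
        · rw [degenerate_cons_cons (a := b)] at h
          obtain rfl : b = b' := by tauto
          rw [listShuffle_cons_cons]
          exact square_mul_mem_degenWords _ _

theorem wordShuffle_mem_degenWords {z : WordTensor k S S'} (hz : z ∈ degenTensors k S S') :
    wordShuffle k S S' z ∈ degenWords k (S × S') := by
  refine tensorIdeal_map (fun x hx y => ?_) (fun x y hy => ?_) hz
  · induction y using words_induction with
    | h m =>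
      exact wordSpan_map_le (f := wordShuffle k S S' ∘ₗ (TensorProduct.mk k _ _).flip (word k m))
        (fun l hl => by simpa using listShuffle_mem_degenWords l m (Or.inl hl)) hx
    | ha y y' h h' => rw [TensorProduct.tmul_add, map_add]; exact add_mem h h'
    | hs a y h => rw [TensorProduct.tmul_smul, map_smul]; exact Submodule.smul_mem _ _ h
  · induction x using words_induction with
    | h l =>
      exact wordSpan_map_le (f := wordShuffle k S S' ∘ₗ TensorProduct.mk k _ _ (word k l))
        (fun m hm => by simpa using listShuffle_mem_degenWords l m (Or.inr hm)) hy
    | ha y y' h h' => rw [TensorProduct.add_tmul, map_add]; exact add_mem h h'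
    | hs a y h => rw [← TensorProduct.smul_tmul', map_smul]; exact Submodule.smul_mem _ _ h

/-! ### The Eilenberg–Mac Lane homotopy -/

variable (k S S') in
/-- The composite of the Alexander–Whitney map and the shuffle map. -/
def shuffleAW : Module.End k (Words k (S × S')) := wordShuffle k S S' ∘ₗ wordAW k S S'

theorem shuffleAW_mem_degenWords {x : Words k (S × S')} (hx : x ∈ degenWords k (S × S')) :
    shuffleAW k S S' x ∈ degenWords k (S × S') :=
  wordShuffle_mem_degenWords (wordAW_degenWords hx)

@[simp] theorem shuffleAW_one : shuffleAW k S S' 1 = 0 := by simp [shuffleAW]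

theorem emptyCoeff_wordAW (y : Words k S' →ₗ[k] k) (x : Words k (S × S')) :
    TensorProduct.map (emptyCoeff k S) y (wordAW k S S' x) = 0 := by
  refine LinearMap.congr_fun (f := TensorProduct.map (emptyCoeff k S) y ∘ₗ wordAW k S S')
    (g := 0) (words_hom_ext fun l => ?_) x
  cases l with
  | nil => simp
  | cons c l =>
    have (z : WordTensor k S S') :
        TensorProduct.map (emptyCoeff k S) y ((word k [c.1] ⊗ₜ 1) * z) = 0 :=
      LinearMap.congr_fun (f := TensorProduct.map (emptyCoeff k S) y ∘ₗ
        LinearMap.mulLeft k (word k [c.1] ⊗ₜ 1)) (g := 0)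
        (TensorProduct.ext' fun a b => by simp) z
    simp only [LinearMap.comp_apply, LinearMap.zero_apply]
    rw [word_cons, wordAW_letter_mul, map_add, this]
    have h0 : emptyCoeff k S (word k [c.1]) = 0 := by
      simpa using emptyCoeff_letter_mul (k := k) c.1 1
    simp [h0]

/-- Alexander–Whitney preserves the augmentation of degree zero; this makes the augmentation terms
in $b\,\nabla AW$ match. -/
theorem letterCoeff_wordAW (x : Words k (S × S')) :
    letterCoeff k S S' (wordAW k S S' x) =
      emptyCoeff k (S × S') (wordBoundary k (S × S') x) := by
  refine LinearMap.congr_fun (f := letterCoeff k S S' ∘ₗ wordAW k S S')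
    (g := emptyCoeff k (S × S') ∘ₗ wordBoundary k (S × S')) (words_hom_ext fun l => ?_) x
  cases l with
  | nil => simp
  | cons c l =>
    have (z : WordTensor k S S') : letterCoeff k S S' ((word k [c.1] ⊗ₜ 1) * z) =
        LinearMap.mul' k k (TensorProduct.map (emptyCoeff k S)
          (emptyCoeff k S' ∘ₗ wordBoundary k S') z) :=
      LinearMap.congr_fun (f := letterCoeff k S S' ∘ₗ LinearMap.mulLeft k (word k [c.1] ⊗ₜ 1))
        (g := LinearMap.mul' k k ∘ₗ TensorProduct.map (emptyCoeff k S)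
          (emptyCoeff k S' ∘ₗ wordBoundary k S'))
        (TensorProduct.ext' fun a b => by simp [letterCoeff_tmul, wordBoundary_letter_mul]) z
    simp only [LinearMap.comp_apply]
    rw [word_cons, wordAW_letter_mul, map_add, this, emptyCoeff_wordAW, letterCoeff_tmul,
      wordBoundary_letter_mul, wordBoundary_letter_mul]
    simp [emptyCoeff_word]

theorem wordBoundary_shuffleAW (x : Words k (S × S')) :
    wordBoundary k (S × S') (shuffleAW k S S' x) = shuffleAW k S S' (wordBoundary k (S × S') x) +
      emptyCoeff k (S × S') (wordBoundary k (S × S') x) • 1 := by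
  simp [shuffleAW, wordBoundary_wordShuffle, tensorBoundary_wordAW, letterCoeff_wordAW]

variable (k) in
/-- The Eilenberg–Mac Lane homotopy on a word. -/
def listHomotopy : List (S × S') → Words k (S × S')
  | [] => 0
  | c :: l => -(word k [c] * (listHomotopy l + shuffleAW k S S' (word k (c :: l))))

variable (k S S') in
/-- The Eilenberg–Mac Lane homotopy. -/
def wordHomotopy : Module.End k (Words k (S × S')) := wordLift (listHomotopy k)

@[simp] theorem wordHomotopy_one : wordHomotopy k S S' 1 = 0 := by
  rw [← word_nil, wordHomotopy, wordLift_word, listHomotopy]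

theorem wordHomotopy_letter_mul (c : S × S') (x : Words k (S × S')) :
    wordHomotopy k S S' (word k [c] * x) =
      -(word k [c] * (wordHomotopy k S S' x + shuffleAW k S S' (word k [c] * x))) := by
  refine LinearMap.congr_fun (f := wordHomotopy k S S' ∘ₗ LinearMap.mulLeft k (word k [c]))
    (g := -(LinearMap.mulLeft k (word k [c]) ∘ₗ (wordHomotopy k S S' + shuffleAW k S S' ∘ₗ
      LinearMap.mulLeft k (word k [c])))) (words_hom_ext fun l => ?_) x
  simp [← word_append, wordHomotopy, listHomotopy]

/-- The recursion defining $\varphi$ is chosen so that this holds. Writing $\varphi(cx)=-c\,y$ with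
$y=\varphi x+\nabla AW(cx)$, the contraction identity gives $b\varphi(cx)=-y+c\,b\,y$. The induction
hypothesis and the chain map property of $\nabla AW$ evaluate $b\,y$; the two occurrences of $\nabla
AW\,x$ cancel, and so do the augmentation terms. -/
theorem wordBoundary_wordHomotopy (x : Words k (S × S')) :
    wordBoundary k (S × S') (wordHomotopy k S S' x) =
      x - shuffleAW k S S' x - emptyCoeff k (S × S') x • 1 -
        wordHomotopy k S S' (wordBoundary k (S × S') x) := by
  refine LinearMap.congr_fun (f := wordBoundary k (S × S') ∘ₗ wordHomotopy k S S')
    (g := LinearMap.id - shuffleAW k S S' - (emptyCoeff k (S × S')).smulRight 1 -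
      wordHomotopy k S S' ∘ₗ wordBoundary k (S × S')) (words_hom_ext fun l => ?_) x
  induction l with
  | nil => simp
  | cons c l ih =>
    simp only [LinearMap.comp_apply, LinearMap.sub_apply, LinearMap.id_apply,
      LinearMap.smulRight_apply] at ih ⊢
    rw [word_cons, wordHomotopy_letter_mul, map_neg, wordBoundary_letter_mul, map_add, ih,
      wordBoundary_shuffleAW, wordBoundary_letter_mul, map_sub (wordHomotopy k S S'),
      wordHomotopy_letter_mul]
    simp [mul_sub, mul_add]
    abel

theorem wordHomotopy_degenWords {x : Words k (S × S')} (hx : x ∈ degenWords k (S × S')) :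
    wordHomotopy k S S' x ∈ degenWords k (S × S') := by
  refine wordSpan_map_le (fun l hl => ?_) hx
  induction l with
  | nil => simp [Degenerate] at hl
  | cons c l ih =>
    rw [word_cons, wordHomotopy_letter_mul, mul_add, ← word_cons]
    refine neg_mem (add_mem ?_ (mul_mem_degenWords_left _ (shuffleAW_mem_degenWords (word_mem hl))))
    cases l with
    | nil => simp
    | cons d l =>
      rcases degenerate_cons_cons.1 hl with rfl | h
      · rw [word_cons c l, wordHomotopy_letter_mul, mul_neg]
        exact neg_mem (square_mul_mem_degenWords _ _)
      · exact mul_mem_degenWords_left _ (ih h)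

end WordShuffles

end HopfCyclic

end

noncomputable section

namespace HopfCyclic

section WordShuffles

variable {k : Type*} [CommRing k] {S S' : Type*}

/-! ### The composite `AW ∘ B ∘ ∇` -/

theorem wordMap_snd_shuffle_singleton (a : S) (m : List S') :
    wordMap k Prod.snd (listShuffle k [a] m) = word k m - emptyCoeff k S' (word k m) • 1 := by
  induction m with
  | nil => simp
  | cons b m ih =>
    rw [listShuffle_cons_cons, map_mul, map_add, map_add, map_smul, ih]
    simp [emptyCoeff_word]
    rcases m with - | ⟨_, m⟩ <;> simp [← word_append]

theorem wordMap_fst_shuffle_singleton (l : List S) (b : S') :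
    wordMap k Prod.fst (listShuffle k l [b]) = word k l - emptyCoeff k S (word k l) • 1 := by
  induction l with
  | nil => simp
  | cons a l ih =>
    rw [listShuffle_cons_cons, map_mul, map_add, map_add, map_smul, ih]
    simp [emptyCoeff_word]
    rcases l with - | ⟨_, l⟩ <;> simp [← word_append]

/-- A path that moves at least once in the first direction repeats a second coordinate there. -/
theorem wordMap_snd_shuffle_mem (a a' : S) (l : List S) (m : List S') :
    wordMap k Prod.snd (listShuffle k (a :: a' :: l) m) ∈ degenWords k S' := by
  induction m with
  | nil => simp
  | cons b m ih =>
    rw [listShuffle_cons_cons, map_mul, map_add, map_add, map_smul, mul_add, mul_add]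
    refine add_mem (add_mem (by simp) ?_)
      (mul_mem_degenWords_left _ (Submodule.smul_mem _ _ ih))
    rw [listShuffle_cons_cons, map_mul, wordMap_word, wordMap_word]
    exact square_mul_mem_degenWords _ _

theorem wordMap_fst_shuffle_mem (l : List S) (b b' : S') (m : List S') :
    wordMap k Prod.fst (listShuffle k l (b :: b' :: m)) ∈ degenWords k S := by
  induction l with
  | nil => simp
  | cons a l ih =>
    rw [listShuffle_cons_cons, map_mul, map_add, map_add, map_smul, mul_add, mul_add, mul_smul_comm]
    refine add_mem (add_mem (by simp) (mul_mem_degenWords_left _ ih)) (Submodule.smul_mem _ _ ?_)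
    rw [listShuffle_cons_cons, map_mul, wordMap_word, wordMap_word]
    exact square_mul_mem_degenWords _ _

/-- A splitting of a lattice path has two nondegenerate factors only if the path moves just in the
first direction before the cut and just in the second after it. There is exactly one such path, cut
at its corner, and its sign is $+1$. -/
theorem wordAW_listShuffle (l : List S) (m : List S') (hl : l ≠ []) (hm : m ≠ []) :
    wordAW k S S' (listShuffle k l m) - word k l ⊗ₜ word k m ∈ degenTensors k S S' := by
  induction l, m using shuffle_induction with
  | h₁ m => exact absurd rfl hl
  | h₂ l => exact absurd rfl hm
  | h a l b m ih₁ ih₂ =>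
    rw [listShuffle_cons_cons, wordAW_letter_mul, map_add (wordAW k S S'),
      map_add (wordAW k S S'), map_smul (wordAW k S S'), mul_add, mul_add]
    have h2 : (word k [a] ⊗ₜ[k] (1 : Words k S')) *
        ((-1 : k) ^ l.length • wordAW k S S' (listShuffle k (a :: l) m)) ∈
          degenTensors k S S' := by
      rcases m with - | ⟨b', m⟩
      · simp
      · have e := mul_mem_degenTensors_left (word k [a] ⊗ₜ[k] (1 : Words k S')) (ih₂ hl (by simp))
        have e' := tmul_mem_tensorIdeal_left (U' := degenWords k S')
          (square_mul_mem_degenWords a (word k l)) (word k (b' :: m))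
        rw [mul_sub, Algebra.TensorProduct.tmul_mul_tmul, one_mul, word_cons a l] at e
        rw [mul_smul_comm]
        exact Submodule.smul_mem _ _ (by simpa using add_mem e e')
    have h0 : wordAW k S S' (if l.length + m.length = 0 then 1 else 0) = 0 := by split_ifs <;> simp
    rw [h0]
    rcases l with - | ⟨a', l⟩
    · have h1 : word k [b] * wordMap k Prod.snd (((if ([] : List S).length + m.length = 0 then 1 else 0) +
          listShuffle k [] (b :: m) + (-1 : k) ^ ([] : List S).length • listShuffle k [a] m)) =
          word k (b :: m) := by
        simp only [map_add, listShuffle_nil_left, List.length_nil, pow_zero, one_smul,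
          wordMap_snd_shuffle_singleton, emptyCoeff_word]
        rcases m with - | ⟨_, m⟩ <;> simp [← word_append]
      rw [h1]
      simpa using h2
    · have h1 : word k [b] * wordMap k Prod.snd (((if (a' :: l).length + m.length = 0 then 1 else 0) +
          listShuffle k (a' :: l) (b :: m) +
            (-1 : k) ^ (a' :: l).length • listShuffle k (a :: a' :: l) m)) ∈ degenWords k S' := by
        have := wordMap_snd_shuffle_mem (k := k) a a' l (b :: m)
        rwa [listShuffle_cons_cons, map_mul, wordMap_word] at this
      have h3 := mul_mem_degenTensors_left (word k [a] ⊗ₜ[k] (1 : Words k S'))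
        (ih₁ (by simp) (by simp))
      rw [mul_sub, Algebra.TensorProduct.tmul_mul_tmul, one_mul, ← word_append] at h3
      have h4 := add_mem (add_mem (tmul_mem_tensorIdeal_right (U := degenWords k S)
        (word k [a]) h1) h3) h2
      convert h4 using 1
      simp only [List.cons_append, List.nil_append, mul_zero]
      abel

/-- The part of `AW ∘ B` in which the turn takes place in the second factor. -/
def listTurnsSnd (ζ : k) : Words k S' → List (S × S') → WordTensor k S S'
  | _, [] => 0
  | y, c :: w => wordAW k S S' (word k (c :: w)) * (1 ⊗ₜ (y * word k [c.2])) +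
      ζ • listTurnsSnd ζ (y * word k [c.2]) w

variable (S) in
/-- Linear extension of `listTurnsSnd`. -/
def turnsSnd (ζ : k) (y : Words k S') : Words k (S × S') →ₗ[k] WordTensor k S S' :=
  wordLift (listTurnsSnd ζ y)

@[simp] theorem turnsSnd_one (ζ : k) (y : Words k S') : turnsSnd S ζ y 1 = 0 := by
  rw [← word_nil, turnsSnd, wordLift_word, listTurnsSnd]

theorem turnsSnd_letter_mul (ζ : k) (y : Words k S') (c : S × S') (x : Words k (S × S')) :
    turnsSnd S ζ y (word k [c] * x) =
      wordAW k S S' (word k [c] * x) * (1 ⊗ₜ (y * word k [c.2])) +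
        ζ • turnsSnd S ζ (y * word k [c.2]) x := by
  refine LinearMap.congr_fun (f := turnsSnd S ζ y ∘ₗ LinearMap.mulLeft k (word k [c]))
    (g := LinearMap.mulRight k (1 ⊗ₜ (y * word k [c.2])) ∘ₗ wordAW k S S' ∘ₗ
      LinearMap.mulLeft k (word k [c]) + ζ • turnsSnd S ζ (y * word k [c.2]))
    (words_hom_ext fun l => ?_) x
  simp [← word_append, turnsSnd, listTurnsSnd]

theorem turnsSnd_mem_of_mem (ζ : k) {y : Words k S'} (hy : y ∈ degenWords k S')
    (x : Words k (S × S')) : turnsSnd S ζ y x ∈ degenTensors k S S' := by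
  have hx : x ∈ wordSpan k (fun _ : List (S × S') => True) :=
    wordSpan_true (k := k) ▸ Submodule.mem_top
  refine wordSpan_map_le (fun l _ => ?_) hx
  induction l generalizing y with
  | nil => simp
  | cons c l ih =>
    rw [word_cons, turnsSnd_letter_mul]
    have := mul_mem_degenWords_right hy (word k [c.2])
    exact add_mem (mul_mem_degenTensors_left _ (tmul_mem_tensorIdeal_right _ this))
      (Submodule.smul_mem _ _ (ih this))

/-- The part of the path before the turn contributes its second coordinates to the second factor, so
a step in the first direction there produces a repetition. Only paths that begin with steps in the
second direction survive, each such step carrying the shuffle sign $(-1)^{|l|}$. The remaining path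
is handled by $AW\nabla=1$. -/
theorem turnsSnd_listShuffle (ζ : k) (y : Words k S') (a : S) (l : List S) (m : List S') :
    turnsSnd S ζ y (listShuffle k (a :: l) m) -
      word k (a :: l) ⊗ₜ turns S' (ζ * (-1) ^ l.length) y (word k m) ∈ degenTensors k S S' := by
  induction m generalizing y with
  | nil => simp
  | cons b m ih =>
    have h1 := mul_mem_degenTensors_right (wordAW_listShuffle (k := k) (a :: l) (b :: m)
      (by simp) (by simp)) (1 ⊗ₜ (y * word k [b]))
    have h2 : turnsSnd S ζ (y * word k [b]) (listShuffle k l (b :: m)) ∈ degenTensors k S S' := by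
      rcases l with - | ⟨a', l⟩
      · simp
      · rw [listShuffle_cons_cons, turnsSnd_letter_mul, mul_assoc]
        have h := mul_mem_degenWords_left y (square_mem_degenWords (k := k) b)
        refine add_mem (mul_mem_degenTensors_left _ (tmul_mem_tensorIdeal_right _ h))
          (Submodule.smul_mem _ _ (turnsSnd_mem_of_mem _ ?_ _))
        exact h
    have h3 := ih (y * word k [b])
    rw [word_cons b m, turns_letter_mul]
    rw [listShuffle_cons_cons] at h1 ⊢
    rw [turnsSnd_letter_mul, map_add (turnsSnd S ζ _), map_add (turnsSnd S ζ _),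
      map_smul (turnsSnd S ζ _)]
    have h0 : turnsSnd S ζ (y * word k [b]) (if l.length + m.length = 0 then 1 else 0) = 0 := by
      split_ifs <;> simp
    rw [h0, zero_add]
    have h4 := add_mem (add_mem h1 (Submodule.smul_mem _ ζ h2))
      (Submodule.smul_mem _ (ζ * (-1) ^ l.length) h3)
    convert h4 using 1
    rw [sub_mul, Algebra.TensorProduct.tmul_mul_tmul, mul_one, word_cons b m]
    simp only [TensorProduct.tmul_add, TensorProduct.tmul_smul, mul_assoc]
    module

/-- The part of `AW ∘ B` in which the turn takes place in the first factor. -/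
def listTurnsFst (ζ : k) : List (S × S') → WordTensor k S (S × S')
  | [] => 0
  | c :: w => word k ((c :: w).map Prod.fst) ⊗ₜ word k [c] + ζ • ((1 ⊗ₜ word k [c]) * listTurnsFst ζ w)

variable (S S') in
/-- Linear extension of `listTurnsFst`. -/
def turnsFst (ζ : k) : Words k (S × S') →ₗ[k] WordTensor k S (S × S') := wordLift (listTurnsFst ζ)

@[simp] theorem turnsFst_one (ζ : k) : turnsFst S S' ζ 1 = 0 := by
  rw [← word_nil, turnsFst, wordLift_word, listTurnsFst]

theorem turnsFst_letter_mul (ζ : k) (c : S × S') (x : Words k (S × S')) :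
    turnsFst S S' ζ (word k [c] * x) = wordMap k Prod.fst (word k [c] * x) ⊗ₜ word k [c] +
        ζ • ((1 ⊗ₜ word k [c]) * turnsFst S S' ζ x) := by
  refine LinearMap.congr_fun (f := turnsFst S S' ζ ∘ₗ LinearMap.mulLeft k (word k [c]))
    (g := (TensorProduct.mk k _ _).flip (word k [c]) ∘ₗ (wordMap k Prod.fst).toLinearMap ∘ₗ
      LinearMap.mulLeft k (word k [c]) +
        ζ • LinearMap.mulLeft k (1 ⊗ₜ word k [c]) ∘ₗ turnsFst S S' ζ)
    (words_hom_ext fun l => ?_) x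
  simp [← word_append, turnsFst, listTurnsFst]

variable (k S S') in
/-- `x ⊗ u ↦ (x ⊗ 1) AW(u)`. -/
def mulAW : WordTensor k S (S × S') →ₗ[k] WordTensor k S S' :=
  TensorProduct.lift ((LinearMap.mul k (WordTensor k S S')).compl₁₂
    ((TensorProduct.mk k _ _).flip 1) (wordAW k S S'))

@[simp] theorem mulAW_tmul (x : Words k S) (u : Words k (S × S')) :
    mulAW k S S' (x ⊗ₜ u) = (x ⊗ₜ 1) * wordAW k S S' u := by simp [mulAW]

/-- Decomposition of `AW ∘ B` according to the factor of the turn. -/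
theorem wordAW_turns (ζ : k) (x y : Words k (S × S')) :
    wordAW k S S' (turns (S × S') ζ x y) = turnsSnd S ζ (wordMap k Prod.snd x) y +
      mulAW k S S' ((1 ⊗ₜ x) * turnsFst S S' ζ y) := by
  induction y using words_induction with
  | h l =>
    induction l generalizing x with
    | nil => simp
    | cons c l ih =>
      rw [word_cons, turns_letter_mul, map_add, map_smul, ih, mul_assoc (_ * _), wordAW_mul,
        turnsSnd_letter_mul, turnsFst_letter_mul]
      simp only [map_mul, wordMap_word, List.map_cons, List.map_nil, mul_add, map_add,
        Algebra.TensorProduct.tmul_mul_tmul, one_mul, mulAW_tmul, mul_smul_comm, map_smul,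
        ← mul_assoc]
      module
  | ha y y' h h' => simp only [map_add, h, h', mul_add]; abel
  | hs a y h => simp only [map_smul, h, mul_smul_comm, smul_add]

/-- The sum of `e v ⊗ ∇(x u e, m)` over all decompositions `l = u e v`, with coefficients the
powers of `ζ`. -/
def listSplits (ζ : k) (m : List S') : List S → List S → WordTensor k S (S × S')
  | _, [] => 0
  | x, e :: l => word k (e :: l) ⊗ₜ listShuffle k (x ++ [e]) m + ζ • listSplits ζ m (x ++ [e]) l

@[simp] theorem listSplits_nil (ζ : k) (x l : List S) : listSplits ζ ([] : List S') x l = 0 := by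
  induction l generalizing x with
  | nil => rfl
  | cons e l ih => simp [listSplits, ih]

/-- Every shuffle in the sum starts at the same point $(a,b)$, which can be factored out. A step in
the second direction carries a sign for the letters of $x\,e$ still to come, and this changes with
$e$; hence $-\zeta$ in the second sum. -/
theorem listSplits_cons (ζ : k) (a : S) (x l : List S) (b : S') (m : List S') :
    listSplits ζ (b :: m) (a :: x) l = (1 ⊗ₜ word k [(a, b)]) *
      (listSplits ζ (b :: m) x l + (-1 : k) ^ (x.length + 1) • listSplits (-ζ) m (a :: x) l) := by
  induction l generalizing x with
  | nil => simp [listSplits]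
  | cons e l ih =>
    simp only [listSplits, List.cons_append, ih, listShuffle_cons_cons, List.length_append,
      List.length_cons, List.length_nil, zero_add, Nat.add_eq_zero_iff, one_ne_zero, and_false,
      false_and, if_false, pow_succ, mul_add, TensorProduct.tmul_add, TensorProduct.tmul_smul,
      mul_smul_comm, Algebra.TensorProduct.tmul_mul_tmul, one_mul]
    module

theorem mul_mem_tensorIdeal_bot {z : WordTensor k S S'}
    (hz : z ∈ (tensorIdeal (degenWords k S) ⊥ : Submodule k (WordTensor k S S'))) (u : Words k S') :
    (1 ⊗ₜ u) * z ∈ (tensorIdeal (degenWords k S) ⊥ : Submodule k (WordTensor k S S')) := by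
  refine tensorIdeal_map (f := LinearMap.mulLeft k (1 ⊗ₜ[k] u)) (fun x hx y => ?_)
    (fun x y hy => ?_) hz
  · simpa using tmul_mem_tensorIdeal_left hx _
  · rw [(Submodule.mem_bot k).1 hy]; simp

/-- Here the first factor receives the first coordinates of the path from the turn on, so modulo
degenerate words all steps in the second direction precede the turn. The path is then a shuffle of a
prefix of $l$ with all of $b\,m$, followed by steps in the first direction. The $|m|$ additional
letters before the turn give $\zeta^{|m|}$; each of the $|m|$ steps also has one extra sign for
every letter of $l$ after the turn, compared with the shuffle of the prefix. -/
theorem turnsFst_listShuffle (ζ : k) (l : List S) (b : S') (m : List S') :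
    turnsFst S S' ζ (listShuffle k l (b :: m)) -
      (ζ ^ m.length * (-1) ^ (m.length * (l.length + 1))) •
        listSplits (ζ * (-1) ^ m.length) (b :: m) [] l ∈
      (tensorIdeal (degenWords k S) ⊥ : Submodule k (WordTensor k S (S × S'))) := by
  -- The second list is kept arbitrary so that `shuffle_induction` applies; being nonempty becomes a
  -- hypothesis.
  suffices ∀ m' : List S', ∀ b m, m' = b :: m → turnsFst S S' ζ (listShuffle k l (b :: m)) -
      (ζ ^ m.length * (-1) ^ (m.length * (l.length + 1))) •
        listSplits (ζ * (-1) ^ m.length) (b :: m) [] l ∈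
      (tensorIdeal (degenWords k S) ⊥ : Submodule k (WordTensor k S (S × S'))) from
    this _ b m rfl
  intro m'
  induction l, m' using shuffle_induction with
  | h₁ m' => intro b m _; simp [listSplits]
  | h₂ l => intro b m h; cases h
  | h a l b m ih₁ ih₂ =>
    rintro _ _ ⟨rfl, rfl⟩
    have h1 := mul_mem_tensorIdeal_bot (ih₁ b m rfl) (word k [(a, b)])
    have e1 := listSplits_cons (ζ * (-1) ^ m.length) a [] l b m
    have h0 : turnsFst S S' ζ (if l.length + m.length = 0 then 1 else 0) = 0 := by
      split_ifs <;> simp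
    rcases m with - | ⟨b', m⟩
    · have hX := wordMap_fst_shuffle_singleton (k := k) (a :: l) b
      rw [listShuffle_cons_cons] at hX ⊢
      rw [turnsFst_letter_mul, hX]
      simp only [listShuffle_nil_right, smul_zero, add_zero, map_add] at h0 h1 e1 hX ⊢
      rw [h0]
      simp only [List.length_nil, pow_zero, mul_one, zero_mul, one_smul, listSplits_nil,
        smul_zero, add_zero, zero_add, listSplits, List.nil_append, emptyCoeff_word,
        List.length_cons] at h1 e1 ⊢
      rw [e1]
      have h2 := Submodule.smul_mem _ ζ h1
      convert h2 using 1
      have : listShuffle k [a] [b] = word k [(a, b)] := by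
        rw [listShuffle_cons_cons]; simp
      rw [this, mul_sub, smul_sub, if_neg (by omega)]
      simp
    · have hX := wordMap_fst_shuffle_mem (k := k) (a :: l) b b' m
      have h2 := mul_mem_tensorIdeal_bot (ih₂ b' m rfl) (word k [(a, b)])
      have e2 : listShuffle k [a] (b :: b' :: m) = word k [(a, b)] * listShuffle k [a] (b' :: m) := by
        rw [listShuffle_cons_cons]; simp
      rw [listShuffle_cons_cons] at hX ⊢
      rw [turnsFst_letter_mul, map_add (turnsFst S S' ζ), map_add (turnsFst S S' ζ),
        map_smul (turnsFst S S' ζ), h0, zero_add]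
      simp only [listSplits, List.nil_append] at h1 h2 e1 ⊢
      rw [e1, e2]
      have h3 := add_mem (tmul_mem_tensorIdeal_left (U' := ⊥) hX (word k [(a, b)]))
        (Submodule.smul_mem _ ζ (add_mem h1 (Submodule.smul_mem _ ((-1 : k) ^ l.length) h2)))
      convert h3 using 1
      have e3 : (-1 : k) ^ l.length * (-1) ^ l.length = 1 := neg_one_pow_mul_self' _
      have e4 : (-1 : k) ^ m.length * (-1) ^ m.length = 1 := neg_one_pow_mul_self' _
      have e5 : (1 : WordTensor k S (S × S')) = 1 ⊗ₜ 1 := Algebra.TensorProduct.one_def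
      have e6 : word k (a :: l) ⊗ₜ[k] (word k [(a, b)] * listShuffle k [a] (b' :: m)) =
          (1 ⊗ₜ word k [(a, b)]) * (word k (a :: l) ⊗ₜ listShuffle k [a] (b' :: m)) := by simp
      rw [e6]
      have e7 : ζ * (-1 : k) ^ (b' :: m).length = -(ζ * (-1) ^ m.length) := by
        rw [List.length_cons, pow_succ]; ring
      have e8 : (-1 : k) ^ ((b' :: m).length * ((a :: l).length + 1)) =
        (-1) ^ (m.length * l.length) * (-1) ^ l.length := by
        simp only [List.length_cons]
        rw [show (m.length + 1) * (l.length + 1 + 1) = m.length * l.length + l.length +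
          2 * (m.length + 1) by ring, pow_add _ _ (2 * _), pow_mul _ 2]
        simp [pow_add]
      have e9 : (-1 : k) ^ ((b' :: m).length * (l.length + 1)) =
        -((-1) ^ (m.length * l.length) * (-1) ^ l.length * (-1) ^ m.length) := by
        simp only [List.length_cons]
        rw [show (m.length + 1) * (l.length + 1) = m.length * l.length + l.length +
          m.length + 1 by ring]
        simp [pow_add]
      have e10 : (-1 : k) ^ (m.length * ((a :: l).length + 1)) = (-1) ^ (m.length * l.length) := by
        simp only [List.length_cons]
        rw [show m.length * (l.length + 1 + 1) = m.length * l.length + 2 * m.length by ring,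
          pow_add _ _ (2 * _), pow_mul _ 2]
        simp
      rw [e7, e8, e9, e10]
      simp only [neg_neg, List.length_nil, zero_add, List.length_cons, pow_succ, mul_add,
        mul_sub, mul_smul_comm, smul_add, smul_sub]
      generalize (-1 : k) ^ l.length = ε at *
      generalize (-1 : k) ^ m.length = δ at *
      generalize (-1 : k) ^ (m.length * l.length) = η at *
      module

theorem mulAW_listSplits (ζ : k) (x l : List S) (m : List S') (hm : m ≠ []) :
    mulAW k S S' (listSplits ζ m x l) - turns S ζ (word k x) (word k l) ⊗ₜ word k m ∈
      degenTensors k S S' := by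
  induction l generalizing x with
  | nil => simp [listSplits]
  | cons e l ih =>
    have h1 := mul_mem_degenTensors_left (word k (e :: l) ⊗ₜ[k] (1 : Words k S'))
      (wordAW_listShuffle (k := k) (x ++ [e]) m (by simp) hm)
    have h2 := add_mem h1 (Submodule.smul_mem _ ζ (ih (x ++ [e])))
    convert h2 using 1
    rw [word_cons e l, turns_letter_mul, ← word_cons e l]
    simp only [listSplits, map_add, map_smul, mulAW_tmul, mul_sub,
      Algebra.TensorProduct.tmul_mul_tmul, one_mul, word_append, TensorProduct.add_tmul, smul_sub,
      ← TensorProduct.smul_tmul', mul_assoc]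
    abel

theorem mulAW_mem {z : WordTensor k S (S × S')}
    (hz : z ∈ (tensorIdeal (degenWords k S) ⊥ : Submodule k (WordTensor k S (S × S')))) :
    mulAW k S S' z ∈ degenTensors k S S' := by
  refine tensorIdeal_map (fun x hx y => ?_) (fun x y hy => ?_) hz
  · rw [mulAW_tmul]
    exact mul_mem_degenTensors_right (tmul_mem_tensorIdeal_left hx _) _
  · rw [(Submodule.mem_bot k).1 hy]; simp

theorem listShuffle_mem_length (l : List S) (m : List S') :
    listShuffle k l m ∈ wordsOfLength k (S × S') (l.length + m.length - 1) := by
  induction l, m using shuffle_induction with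
  | h₁ m => simp
  | h₂ l => simp
  | h a l b m ih₁ ih₂ =>
    rw [listShuffle_cons_cons, show (a :: l).length + (b :: m).length - 1 = l.length + m.length + 1
      by simp +arith]
    refine letter_mul_mem_length _ (add_mem (add_mem ?_ ?_) (Submodule.smul_mem _ _ ?_))
    · split_ifs with h
      · rw [h, ← word_nil]; exact word_mem_length []
      · simp
    · exact ih₁
    · rwa [show (a :: l).length + m.length - 1 = l.length + m.length by simp +arith] at ih₂

/-- The first of the two facts behind the cyclic extension of $AW$. A cut of a turned path lies
either before or after the point where the path closes up. The two kinds of cuts give the two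
summands of Connes' operator on the tensor product. -/
theorem wordAW_wordConnes_listShuffle (l : List S) (m : List S') (hl : l ≠ []) (hm : m ≠ []) :
    wordAW k S S' (wordConnes k (S × S') (listShuffle k l m)) -
      tensorConnes k S S' (word k l ⊗ₜ word k m) ∈ degenTensors k S S' := by
  obtain ⟨a, l, rfl⟩ := List.exists_cons_of_ne_nil hl
  obtain ⟨b, m, rfl⟩ := List.exists_cons_of_ne_nil hm
  have hlen : (a :: l).length + (b :: m).length - 1 = l.length + m.length + 1 := by simp; omega
  have h0 := listShuffle_mem_length (k := k) (a :: l) (b :: m)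
  rw [hlen] at h0
  have e1 : (-1 : k) ^ l.length * (-1) ^ l.length = 1 := neg_one_pow_mul_self' _
  have e2 : (-1 : k) ^ m.length * (-1) ^ m.length = 1 := neg_one_pow_mul_self' _
  have hζ : (-1 : k) ^ (l.length + m.length + 1 + 1) = (-1) ^ l.length * (-1) ^ m.length := by
    rw [pow_succ, pow_succ, pow_add]; ring
  rw [wordConnes_of_mem h0, hζ, map_smul, wordAW_turns, map_one]
  obtain ⟨ζ, hζd⟩ : ∃ ζ : k, ζ = (-1) ^ l.length * (-1) ^ m.length := ⟨_, rfl⟩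
  rw [← hζd]
  have h1 := turnsSnd_listShuffle (k := k) ζ 1 a l (b :: m)
  have h2 := mulAW_mem (turnsFst_listShuffle ζ (a :: l) b m)
  rw [map_sub, map_smul] at h2
  have h3 := mulAW_listSplits (k := k) (ζ * (-1) ^ m.length) [] (a :: l) (b :: m) (by simp)
  -- The total sign $\zeta=(-1)^{|l|+|m|}$, with $l$, $m$ now the tails, combines with the shuffle
  -- signs to give exactly the signs of Connes' operators of the two factors.
  have z1 : ζ * (-1) ^ l.length = (-1) ^ m.length := by
    rw [hζd]; linear_combination (-1 : k) ^ m.length * e1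
  have z2 : ζ * (-1) ^ m.length = (-1) ^ l.length := by
    rw [hζd]; linear_combination (-1 : k) ^ l.length * e2
  have z3 : ζ ^ m.length * (-1) ^ (m.length * ((a :: l).length + 1)) = (-1) ^ m.length := by
    rw [hζd, mul_pow, ← pow_mul, ← pow_mul, List.length_cons,
      show m.length * (l.length + 1 + 1) = l.length * m.length + 2 * m.length by ring,
      pow_add _ _ (2 * _), pow_mul _ 2]
    have e3 : (-1 : k) ^ (l.length * m.length) * (-1) ^ (l.length * m.length) = 1 :=
      neg_one_pow_mul_self' _
    have e4 : (-1 : k) ^ (m.length * m.length) = (-1) ^ m.length := by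
      rcases Nat.even_or_odd m.length with h | h
      · rw [(h.mul_left _).neg_one_pow, h.neg_one_pow]
      · rw [(h.mul h).neg_one_pow, h.neg_one_pow]
    simp only [even_two, Even.neg_pow, one_pow, mul_one]
    linear_combination (-1 : k) ^ (m.length * m.length) * e3 + e4
  rw [z1] at h1
  rw [z3, z2] at h2
  rw [z2] at h3
  have h4 := Submodule.smul_mem _ ζ (add_mem (add_mem h1 h2)
    (Submodule.smul_mem _ ((-1 : k) ^ m.length) h3))
  convert h4 using 1
  rw [tensorConnes_tmul, wordConnes_word, wordConnes_word, wordSign_word, word_nil]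
  simp only [List.length_cons, pow_succ, mul_neg, mul_one, neg_neg, one_mul,
    TensorProduct.tmul_smul, ← TensorProduct.smul_tmul', ← Algebra.TensorProduct.one_def]
  linear_combination (norm := module)
    z2 • (turns S ((-1) ^ l.length) 1 (word k (a :: l)) ⊗ₜ[k] word k (b :: m)) +
      hζd • (word k (a :: l) ⊗ₜ[k] turns S' ((-1) ^ m.length) 1 (word k (b :: m)))

end WordShuffles

end HopfCyclic

end

noncomputable section

namespace HopfCyclic

section WordShuffles

variable {k : Type*} [CommRing k] {S S' : Type*}

/-! ### Vanishing of `B ∘ φ ∘ B ∘ ∇` -/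

/-- Steps of lattice paths. -/
def LatticeStep (s t : S × S') : Prop := s.1 = t.1 ∨ s.2 = t.2

theorem listShuffle_mem_lattice (a : S) (l : List S) (b : S') (m : List S') :
    listShuffle k (a :: l) (b :: m) ∈ wordSpan k fun w =>
      w.IsChain LatticeStep ∧ w.head? = some (a, b) ∧
        w.getLast? = some ((a :: l).getLast (by simp), (b :: m).getLast (by simp)) := by
  suffices ∀ l' : List S, ∀ m' : List S', ∀ a l b m, l' = a :: l → m' = b :: m →
      listShuffle k (a :: l) (b :: m) ∈ wordSpan k fun w =>
        w.IsChain LatticeStep ∧ w.head? = some (a, b) ∧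
          w.getLast? = some ((a :: l).getLast (by simp), (b :: m).getLast (by simp)) from
    this _ _ a l b m rfl rfl
  intro l' m'
  induction l', m' using shuffle_induction with
  | h₁ m => intro a l b m h; cases h
  | h₂ l => intro a l b m _ h; cases h
  | h a l b m ih₁ ih₂ =>
    rintro _ _ _ _ ⟨rfl, rfl⟩ ⟨rfl, rfl⟩
    rw [listShuffle_cons_cons, mul_add, mul_add]
    refine add_mem (add_mem ?_ ?_) ?_
    · split_ifs with h
      · obtain rfl : l = [] := List.length_eq_zero_iff.1 (by omega)
        obtain rfl : m = [] := List.length_eq_zero_iff.1 (by omega)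
        rw [mul_one]
        exact word_mem (by simp)
      · simp
    · rcases l with - | ⟨a', l⟩
      · simp
      · refine wordSpan_map_le (f := LinearMap.mulLeft k (word k [(a, b)])) (fun w hw => ?_)
          (ih₁ _ _ _ _ rfl rfl)
        obtain ⟨h1, h2, h3⟩ := hw
        rcases w with - | ⟨c, w⟩
        · simp at h2
        · simp only [List.head?_cons, Option.some.injEq] at h2
          subst h2
          rw [LinearMap.mulLeft_apply, ← word_append]
          exact word_mem ⟨by simp [List.isChain_cons_cons, h1, LatticeStep], by simp,
            by simpa [List.getLast?_cons_cons] using h3⟩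
    · rw [mul_smul_comm]
      refine Submodule.smul_mem _ _ ?_
      rcases m with - | ⟨b', m⟩
      · simp
      · refine wordSpan_map_le (f := LinearMap.mulLeft k (word k [(a, b)])) (fun w hw => ?_)
          (ih₂ _ _ _ _ rfl rfl)
        obtain ⟨h1, h2, h3⟩ := hw
        rcases w with - | ⟨c, w⟩
        · simp at h2
        · simp only [List.head?_cons, Option.some.injEq] at h2
          subst h2
          rw [LinearMap.mulLeft_apply, ← word_append]
          exact word_mem ⟨by simp [List.isChain_cons_cons, h1, LatticeStep], by simp,
            by simpa [List.getLast?_cons_cons] using h3⟩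

/-- Words obtained by joining two lattice paths. -/
def IsBrokenPath (w : List (S × S')) : Prop :=
  ∃ p q, w = p ++ q ∧ p.IsChain LatticeStep ∧ q.IsChain LatticeStep

theorem IsBrokenPath.tail {c : S × S'} {w : List (S × S')} (h : IsBrokenPath (c :: w)) :
    IsBrokenPath w := by
  obtain ⟨p, q, e, hp, hq⟩ := h
  rcases p with - | ⟨d, p⟩
  · subst e
    exact ⟨[], w, rfl, by simp, hq.tail⟩
  · simp only [List.cons_append, List.cons.injEq] at e
    exact ⟨p, q, e.2, hp.tail, hq⟩

theorem listTurns_mem_closed (ζ : k) (u w : List (S × S')) (h : (u ++ w).IsChain LatticeStep) :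
    listTurns ζ u w ∈ wordSpan k fun W =>
      IsBrokenPath W ∧ ∃ c t, W = c :: (t ++ [c]) := by
  induction w generalizing u with
  | nil => simp [listTurns]
  | cons c w ih =>
    refine add_mem (word_mem ⟨⟨c :: w, u ++ [c], by simp, ?_, ?_⟩, c, w ++ u, by simp⟩)
      (Submodule.smul_mem _ _ (ih _ (by simpa using h)))
    · exact (List.isChain_append.1 h).2.1
    · rw [List.append_cons] at h
      exact (List.isChain_append.1 h).1

theorem wordConnes_listShuffle_mem (l : List S) (m : List S') :
    wordConnes k (S × S') (listShuffle k l m) ∈ wordSpan k fun W =>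
      IsBrokenPath W ∧ ∃ c t, W = c :: (t ++ [c]) := by
  rcases l with - | ⟨a, l⟩
  · simp
  rcases m with - | ⟨b, m⟩
  · simp
  refine wordSpan_map_le (fun w hw => ?_) (listShuffle_mem_lattice a l b m)
  rw [wordConnes, wordLift_word]
  exact Submodule.smul_mem _ _ (listTurns_mem_closed _ [] w (by simpa using hw.1))

/-- Each step keeps one coordinate. If the first coordinate never stays, the second stays at every
step. -/
theorem snd_eq_of_lattice {c d : S × S'} {w : List (S × S')}
    (h : (c :: (w ++ [d])).IsChain LatticeStep)
    (h' : ¬ Degenerate ((c :: (w ++ [d])).map Prod.fst)) : c.2 = d.2 := by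
  rw [Degenerate, not_not, List.isChain_map] at h'
  induction w generalizing c with
  | nil =>
    simp only [List.nil_append, List.isChain_cons_cons, List.isChain_singleton, and_true] at h h'
    exact h.resolve_left h'
  | cons e w ih =>
    simp only [List.cons_append, List.isChain_cons_cons] at h h'
    exact (h.1.resolve_left h'.1).trans (ih h.2 h'.2)

theorem fst_eq_of_lattice {c d : S × S'} {w : List (S × S')}
    (h : (c :: (w ++ [d])).IsChain LatticeStep)
    (h' : ¬ Degenerate ((c :: (w ++ [d])).map Prod.snd)) : c.1 = d.1 := by
  rw [Degenerate, not_not, List.isChain_map] at h'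
  induction w generalizing c with
  | nil =>
    simp only [List.nil_append, List.isChain_cons_cons, List.isChain_singleton, and_true] at h h'
    exact h.resolve_right h'
  | cons e w ih =>
    simp only [List.cons_append, List.isChain_cons_cons] at h h'
    exact (h.1.resolve_right h'.1).trans (ih h.2 h'.2)

theorem cyclicDegenerate_of_head_last {f : S} {l : List S} (hl : 2 ≤ l.length)
    (h : l.head? = some f) (h' : l.getLast? = some f) : CyclicDegenerate l := by
  rcases l with - | ⟨a, l⟩
  · simp at h
  obtain rfl : a = f := by simpa using h
  rcases List.eq_nil_or_concat l with rfl | ⟨t, d, rfl⟩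
  · simp at hl
  · simp only [List.concat_eq_append] at h' ⊢
    obtain rfl : d = a := by simpa [List.getLast?_cons, List.getLast?_append] using h'
    exact cyclicDegenerate_of_ends d t

/-- The combinatorial heart of $B\varphi B\nabla=0$. The shuffle runs from $(c_1,e_2)$ to
$(e_1,f_2)$. The closed path has only one break, so one of the parts $v\,e$ and $e\,v'$ is an
unbroken lattice path. Unless a factor is degenerate, this forces $c_2=e_2$ in the first case and
$e_1=f_1$ in the second. Then the shuffle either starts at $c$, repeating the last letter before it,
or ends at $f$, the first letter of the whole word. -/
theorem mul_shuffle_mem_cyclic (f c : S × S') (U v : List (S × S')) (e : S × S')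
    (v' t : List (S × S')) (hV : c :: t = v ++ e :: v') (hf : (U ++ [c]).head? = some f)
    (hl : (c :: t).getLast? = some f) (hb : IsBrokenPath (c :: t)) :
    word k (U ++ [c]) * listShuffle k ((v ++ [e]).map Prod.fst) ((e :: v').map Prod.snd) ∈
      wordSpan k CyclicDegenerate := by
  by_cases hX : Degenerate ((v ++ [e]).map Prod.fst)
  · exact degenWords_le_cyclic
      (mul_mem_degenWords_left _ (listShuffle_mem_degenWords _ _ (Or.inl hX)))
  by_cases hY : Degenerate ((e :: v').map Prod.snd)
  · exact degenWords_le_cyclic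
      (mul_mem_degenWords_left _ (listShuffle_mem_degenWords _ _ (Or.inr hY)))
  obtain ⟨w, hw⟩ : ∃ w, v ++ [e] = c :: w := by
    rcases v with - | ⟨d, v⟩
    · simp only [List.nil_append, List.cons.injEq] at hV
      exact ⟨[], by simp [hV.1]⟩
    · simp only [List.cons_append, List.cons.injEq] at hV
      exact ⟨v ++ [e], by simp [hV.1]⟩
  have hlast : (e :: v').getLast (by simp) = f := by
    rw [hV, List.getLast?_append_of_ne_nil _ (by simp), List.getLast?_eq_some_getLast (by simp)] at hl
    simpa using hl
  have hlast' : ((e :: v').map Prod.snd).getLast (by simp) = f.2 := by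
    rw [List.getLast_map, hlast]
  have hlastX : ((v ++ [e]).map Prod.fst).getLast (by simp) = e.1 := by
    rw [List.getLast_map]; simp
  have key : c.2 = e.2 ∨ e.1 = f.1 := by
    obtain ⟨p, q, e', hp, hq⟩ := hb
    rw [hV] at e'
    rcases List.append_eq_append_iff.1 e' with ⟨r, h1, h2⟩ | ⟨r, h1, h2⟩
    · -- the end of the first path lies in `e :: v'`
      rcases r with - | ⟨d, r⟩
      · right
        simp only [List.nil_append] at h2
        rw [← h2] at hq
        rcases List.eq_nil_or_concat v' with rfl | ⟨s, d, rfl⟩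
        · rw [← hlast]; simp
        · rw [List.concat_eq_append] at hq hY hlast
          have := fst_eq_of_lattice hq hY
          rw [this, ← hlast]; simp
      · left
        simp only [List.cons_append, List.cons.injEq] at h2
        obtain ⟨rfl, -⟩ := h2
        rw [h1, List.append_cons] at hp
        have hp' := (List.isChain_append.1 hp).1
        rcases v with - | ⟨d, v⟩
        · simp only [List.nil_append, List.cons.injEq] at hV
          rw [hV.1]
        · simp only [List.cons_append, List.cons.injEq] at hV
          obtain ⟨rfl, -⟩ := hV
          exact snd_eq_of_lattice hp' hX
    · right
      rw [h2] at hq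
      have hq' := (List.isChain_append.1 hq).2.1
      rcases List.eq_nil_or_concat v' with rfl | ⟨s, d, rfl⟩
      · rw [← hlast]; simp
      · rw [List.concat_eq_append] at hq' hY hlast
        have := fst_eq_of_lattice hq' hY
        rw [this, ← hlast]; simp
  simp only [hw, List.map_cons] at hlastX hlast' ⊢
  refine wordSpan_map_le (f := LinearMap.mulLeft k (word k (U ++ [c]))) (fun Z hZ => ?_)
    (listShuffle_mem_lattice c.1 (w.map Prod.fst) e.2 (v'.map Prod.snd))
  obtain ⟨-, h2, h3⟩ := hZ
  rw [hlastX, hlast'] at h3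
  rcases Z with - | ⟨z, Z⟩
  · simp at h2
  obtain rfl : z = (c.1, e.2) := by simpa using h2
  rw [LinearMap.mulLeft_apply, ← word_append]
  refine word_mem ?_
  rcases key with h | h
  · refine Degenerate.cyclicDegenerate ?_
    rw [← h]
    simpa using degenerate_of_eq U c Z
  · rw [h] at h3
    refine cyclicDegenerate_of_head_last (f := f) (by simp +arith) ?_ ?_
    · rw [List.head?_append, hf]; rfl
    · rw [List.getLast?_append, h3]; rfl

/-- Unrolling the recursion of $\varphi$ turns each term into a prefix ending in $c$, followed by
$\nabla AW$ of the suffix starting with the same $c$. The prefix $U$ accumulates the letters already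
passed. -/
theorem wordHomotopy_broken (f : S × S') (U V : List (S × S')) (hf : (U ++ V).head? = some f)
    (hl : V.getLast? = some f) (hb : IsBrokenPath V) :
    word k U * wordHomotopy k S S' (word k V) ∈ wordSpan k CyclicDegenerate := by
  induction V generalizing U with
  | nil => simp
  | cons c V ih =>
    have hf' : (U ++ [c]).head? = some f := by
      rw [List.append_cons, List.head?_append] at hf
      rcases U with - | ⟨u, U⟩ <;> simpa using hf
    rw [word_cons, wordHomotopy_letter_mul, mul_neg, ← mul_assoc, mul_add, ← word_append]
    refine neg_mem (add_mem ?_ ?_)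
    · rcases V with - | ⟨d, V⟩
      · simp
      · refine ih (U ++ [c]) (by simpa using hf) ?_ hb.tail
        simpa [List.getLast?_cons_cons] using hl
    · rw [← word_cons]
      refine wordAW_word_mem (c :: V) ((wordSpan k CyclicDegenerate).comap
        (LinearMap.mulLeft k (word k (U ++ [c])) ∘ₗ wordShuffle k S S')) fun v e v' hV => ?_
      have := mul_shuffle_mem_cyclic (k := k) f c U v e v' V hV hf' hl hb
      simpa using this

/-- The second fact behind the cyclic extension: $\varphi$ sends the closed paths occurring in
$B\nabla$ to cyclically degenerate words, which $B$ makes degenerate. -/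
theorem wordConnes_wordHomotopy_wordConnes_listShuffle (l : List S) (m : List S') :
    wordConnes k (S × S') (wordHomotopy k S S' (wordConnes k (S × S') (listShuffle k l m))) ∈
      degenWords k (S × S') := by
  refine wordConnes_mem_degenWords ?_
  refine wordSpan_map_le (fun W hW => ?_) (wordConnes_listShuffle_mem l m)
  obtain ⟨hb, c, t, rfl⟩ := hW
  have := wordHomotopy_broken (k := k) c [] (c :: (t ++ [c])) (by simp)
    (by simp [List.getLast?_cons]) hb
  simpa using this

/-! ### The cyclic Alexander–Whitney map -/

variable (k S S') in
/-- The entries of the `S`-map extending the Alexander–Whitney map. -/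
def wordCyclicAW : ℕ → Words k (S × S') →ₗ[k] WordTensor k S S'
  | 0 => wordAW k S S'
  | r + 1 => -(wordCyclicAW r ∘ₗ wordConnes k (S × S') ∘ₗ wordHomotopy k S S')

theorem wordCyclicAW_succ (r : ℕ) (x : Words k (S × S')) : wordCyclicAW k S S' (r + 1) x =
    -wordCyclicAW k S S' r (wordConnes k (S × S') (wordHomotopy k S S' x)) := rfl

@[simp] theorem wordCyclicAW_one (r : ℕ) : wordCyclicAW k S S' r 1 = 0 := by
  cases r with
  | zero => exact wordAW_one
  | succ r => simp [wordCyclicAW_succ]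

theorem wordCyclicAW_degenWords (r : ℕ) {x : Words k (S × S')} (hx : x ∈ degenWords k (S × S')) :
    wordCyclicAW k S S' r x ∈ degenTensors k S S' := by
  induction r generalizing x with
  | zero => exact wordAW_degenWords hx
  | succ r ih => exact neg_mem (ih (wordConnes_degenWords (wordHomotopy_degenWords hx)))

variable (k S) in
/-- The degenerate words together with the empty word. -/
def degenWordsOne : Submodule k (Words k S) := degenWords k S ⊔ Submodule.span k {1}

theorem degenWords_le_one : degenWords k S ≤ degenWordsOne k S := le_sup_left

theorem one_mem_degenWordsOne : (1 : Words k S) ∈ degenWordsOne k S :=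
  Submodule.mem_sup_right (Submodule.mem_span_singleton_self 1)

theorem degenWordsOne_map {M : Type*} [AddCommGroup M] [Module k M] {f : Words k S →ₗ[k] M}
    {W : Submodule k M} (h : ∀ x ∈ degenWords k S, f x ∈ W) (h1 : f 1 ∈ W) {x : Words k S}
    (hx : x ∈ degenWordsOne k S) : f x ∈ W := by
  have : degenWordsOne k S ≤ W.comap f :=
    sup_le h ((Submodule.span_singleton_le_iff_mem _ _).2 h1)
  exact this hx

theorem wordConnes_degenWordsOne {x : Words k S} (hx : x ∈ degenWordsOne k S) :
    wordConnes k S x ∈ degenWordsOne k S :=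
  degenWordsOne_map (fun _ h => degenWords_le_one (wordConnes_degenWords h)) (by simp) hx

theorem wordSign_degenWords {x : Words k S} (hx : x ∈ degenWords k S) :
    wordSign k S x ∈ degenWords k S :=
  wordSpan_map_le (fun l hl => by
    rw [wordSign_word]; exact Submodule.smul_mem _ _ (word_mem hl)) hx

theorem wordSign_degenWordsOne {x : Words k S} (hx : x ∈ degenWordsOne k S) :
    wordSign k S x ∈ degenWordsOne k S :=
  degenWordsOne_map (fun _ h => degenWords_le_one (wordSign_degenWords h))
    (by rw [wordSign_one]; exact neg_mem one_mem_degenWordsOne) hx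

variable (k S S') in
/-- The tensors with a factor that is degenerate or empty. -/
abbrev degenTensorsOne : Submodule k (WordTensor k S S') :=
  tensorIdeal (degenWordsOne k S) (degenWordsOne k S')

theorem degenTensors_le_one : degenTensors k S S' ≤ degenTensorsOne k S S' :=
  tensorIdeal_mono degenWords_le_one degenWords_le_one

theorem tensorConnes_degenTensorsOne {z : WordTensor k S S'} (hz : z ∈ degenTensorsOne k S S') :
    tensorConnes k S S' z ∈ degenTensorsOne k S S' := by
  refine tensorIdeal_map (fun x hx y => ?_) (fun x y hy => ?_) hz <;> rw [tensorConnes_tmul]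
  · exact add_mem (tmul_mem_tensorIdeal_left (wordConnes_degenWordsOne hx) _)
      (tmul_mem_tensorIdeal_left (wordSign_degenWordsOne hx) _)
  · exact add_mem (tmul_mem_tensorIdeal_right _ hy)
      (tmul_mem_tensorIdeal_right _ (wordConnes_degenWordsOne hy))

theorem tensorBoundary_wordAW_mem (x : Words k (S × S')) :
    tensorBoundary k S S' (wordAW k S S' x) - wordAW k S S' (wordBoundary k (S × S') x) ∈
      degenTensorsOne k S S' := by
  rw [tensorBoundary_wordAW]
  have := add_mem (tmul_mem_tensorIdeal_left (U' := degenWordsOne k S') one_mem_degenWordsOne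
      (wordMap k Prod.snd x))
    (tmul_mem_tensorIdeal_right (U := degenWordsOne k S) (wordSign k S (wordMap k Prod.fst x))
      one_mem_degenWordsOne)
  convert this using 1
  abel

theorem wordAW_wordConnes_shuffleAW (x : Words k (S × S')) :
    wordAW k S S' (wordConnes k (S × S') (shuffleAW k S S' x)) -
      tensorConnes k S S' (wordAW k S S' x) ∈ degenTensors k S S' := by
  have hx : x ∈ wordSpan k (fun _ : List (S × S') => True) :=
    wordSpan_true (k := k) ▸ Submodule.mem_top
  refine wordSpan_map_le (f := wordAW k S S' ∘ₗ wordConnes k (S × S') ∘ₗ shuffleAW k S S' -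
    tensorConnes k S S' ∘ₗ wordAW k S S') (fun l _ => ?_) hx
  refine wordAW_word_mem l ((degenTensors k S S').comap (wordAW k S S' ∘ₗ wordConnes k (S × S') ∘ₗ
    wordShuffle k S S' - tensorConnes k S S')) fun v e v' _ => ?_
  simpa using wordAW_wordConnes_listShuffle (k := k) ((v ++ [e]).map Prod.fst)
    ((e :: v').map Prod.snd) (by simp) (by simp)

theorem wordConnes_wordHomotopy_wordConnes_shuffleAW (x : Words k (S × S')) :
    wordConnes k (S × S') (wordHomotopy k S S' (wordConnes k (S × S') (shuffleAW k S S' x))) ∈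
      degenWords k (S × S') := by
  have hx : x ∈ wordSpan k (fun _ : List (S × S') => True) :=
    wordSpan_true (k := k) ▸ Submodule.mem_top
  refine wordSpan_map_le (f := wordConnes k (S × S') ∘ₗ wordHomotopy k S S' ∘ₗ
    wordConnes k (S × S') ∘ₗ shuffleAW k S S') (fun l _ => ?_) hx
  refine wordAW_word_mem l ((degenWords k (S × S')).comap (wordConnes k (S × S') ∘ₗ
    wordHomotopy k S S' ∘ₗ wordConnes k (S × S') ∘ₗ wordShuffle k S S')) fun v e v' _ => ?_
  simpa using wordConnes_wordHomotopy_wordConnes_listShuffle (k := k) ((v ++ [e]).map Prod.fst)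
    ((e :: v').map Prod.snd)

/-- The entries of the cyclic Alexander–Whitney map form an `S`-map. -/
theorem tensorBoundary_wordCyclicAW (r : ℕ) (x : Words k (S × S')) :
    tensorBoundary k S S' (wordCyclicAW k S S' (r + 1) x) +
        tensorConnes k S S' (wordCyclicAW k S S' r x) -
        wordCyclicAW k S S' (r + 1) (wordBoundary k (S × S') x) -
        wordCyclicAW k S S' r (wordConnes k (S × S') x) ∈ degenTensorsOne k S S' := by
  induction r generalizing x with
  | zero =>
    have h1 := tensorBoundary_wordAW_mem (k := k)
      (wordConnes k (S × S') (wordHomotopy k S S' x))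
    have h2 := degenTensors_le_one (wordAW_wordConnes_shuffleAW (k := k) x)
    rw [wordBoundary_wordConnes, wordBoundary_wordHomotopy] at h1
    have h3 := sub_mem (neg_mem h1) h2
    convert h3 using 1
    have e0 : wordCyclicAW k S S' 0 = wordAW k S S' := rfl
    simp only [wordCyclicAW_succ, e0, map_neg, map_sub, map_smul, wordConnes_one, map_zero,
      smul_zero]
    abel
  | succ r ih =>
    -- The induction hypothesis is applied to $B\varphi x$. Expanding $bB\varphi=-Bb\varphi$ by the
    -- homotopy formula leaves the wanted terms together with $B^2\varphi x$ and $B\varphi B\nabla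
    -- AW\,x$, both degenerate.
    have h1 := ih (wordConnes k (S × S') (wordHomotopy k S S' x))
    have h2 := degenTensors_le_one (wordCyclicAW_degenWords r
      (wordConnes_wordConnes (k := k) (wordHomotopy k S S' x)))
    have h3 := degenTensors_le_one (wordCyclicAW_degenWords r
      (wordConnes_wordHomotopy_wordConnes_shuffleAW (k := k) x))
    rw [wordBoundary_wordConnes, wordBoundary_wordHomotopy] at h1
    have h4 := add_mem (sub_mem (neg_mem h1) h2) h3
    convert h4 using 1
    rw [wordCyclicAW_succ (r + 1), wordCyclicAW_succ (r + 1)]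
    simp only [map_neg, map_sub, map_smul, wordConnes_one, map_zero, smul_zero]
    rw [wordCyclicAW_succ r x, wordCyclicAW_succ r (wordConnes k (S × S') (shuffleAW k S S' x))]
    simp only [map_neg]
    abel

end WordShuffles

end HopfCyclic

end

noncomputable section

namespace HopfCyclic

/-! ### Naturality of the word operators in the alphabets -/

section Naturality

variable {k : Type*} [CommRing k] {S S' R R' : Type*} (f : S → R) (g : S' → R')

/-- The map of tensors induced by maps of alphabets. -/
def tensorWordMap : WordTensor k S S' →ₗ[k] WordTensor k R R' :=
  TensorProduct.map (wordMap k f).toLinearMap (wordMap k g).toLinearMap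

@[simp] theorem tensorWordMap_tmul (x : Words k S) (y : Words k S') :
    tensorWordMap f g (x ⊗ₜ y) = wordMap k f x ⊗ₜ wordMap k g y := by simp [tensorWordMap]

theorem tensorWordMap_letter_mul (c : S) (z : WordTensor k S S') :
    tensorWordMap f g ((word k [c] ⊗ₜ 1) * z) = (word k [f c] ⊗ₜ 1) * tensorWordMap f g z :=
  LinearMap.congr_fun (f := tensorWordMap f g ∘ₗ LinearMap.mulLeft k (word k [c] ⊗ₜ 1))
    (g := LinearMap.mulLeft k (word k [f c] ⊗ₜ 1) ∘ₗ tensorWordMap f g)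
    (TensorProduct.ext' fun x y => by simp) z

theorem wordAW_wordMap (x : Words k (S × S')) :
    wordAW k R R' (wordMap k (Prod.map f g) x) = tensorWordMap f g (wordAW k S S' x) := by
  refine LinearMap.congr_fun (f := wordAW k R R' ∘ₗ (wordMap k (Prod.map f g)).toLinearMap)
    (g := tensorWordMap f g ∘ₗ wordAW k S S') (words_hom_ext fun l => ?_) x
  induction l with
  | nil => simp
  | cons c l ih =>
    simp only [LinearMap.comp_apply, AlgHom.toLinearMap_apply] at ih ⊢
    rw [word_cons, map_mul, wordMap_word, List.map_singleton, wordAW_letter_mul, ih,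
      wordAW_letter_mul, map_add, tensorWordMap_letter_mul]
    simp [Function.comp_def]

theorem listShuffle_map (l : List S) (m : List S') :
    listShuffle k (l.map f) (m.map g) = wordMap k (Prod.map f g) (listShuffle k l m) := by
  induction l, m using shuffle_induction with
  | h₁ m => simp
  | h₂ l => simp
  | h a l b m ih₁ ih₂ =>
    simp only [List.map_cons] at ih₁ ih₂
    rw [List.map_cons, List.map_cons, listShuffle_cons_cons, listShuffle_cons_cons, ih₁, ih₂]
    split_ifs <;> simp_all

theorem wordShuffle_wordMap (z : WordTensor k S S') :
    wordShuffle k R R' (tensorWordMap f g z) = wordMap k (Prod.map f g) (wordShuffle k S S' z) :=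
  LinearMap.congr_fun (f := wordShuffle k R R' ∘ₗ tensorWordMap f g)
    (g := (wordMap k (Prod.map f g)).toLinearMap ∘ₗ wordShuffle k S S')
    (wordTensor_hom_ext fun l m => by simp [listShuffle_map]) z

theorem shuffleAW_wordMap (x : Words k (S × S')) :
    shuffleAW k R R' (wordMap k (Prod.map f g) x) =
      wordMap k (Prod.map f g) (shuffleAW k S S' x) := by
  simp [shuffleAW, wordAW_wordMap, wordShuffle_wordMap]

theorem wordHomotopy_wordMap (x : Words k (S × S')) :
    wordHomotopy k R R' (wordMap k (Prod.map f g) x) =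
      wordMap k (Prod.map f g) (wordHomotopy k S S' x) := by
  refine LinearMap.congr_fun (f := wordHomotopy k R R' ∘ₗ (wordMap k (Prod.map f g)).toLinearMap)
    (g := (wordMap k (Prod.map f g)).toLinearMap ∘ₗ wordHomotopy k S S')
    (words_hom_ext fun l => ?_) x
  induction l with
  | nil => simp
  | cons c l ih =>
    simp only [LinearMap.comp_apply, AlgHom.toLinearMap_apply] at ih ⊢
    rw [word_cons, wordHomotopy_letter_mul, map_neg, map_mul (wordMap k _) _ (_ + _),
      map_add (wordMap k _), ← shuffleAW_wordMap, ← ih, map_mul (wordMap k _) _ (word k l),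
      wordMap_word, List.map_singleton, wordHomotopy_letter_mul]

theorem wordCyclicAW_wordMap (r : ℕ) (x : Words k (S × S')) :
    wordCyclicAW k R R' r (wordMap k (Prod.map f g) x) =
      tensorWordMap f g (wordCyclicAW k S S' r x) := by
  induction r generalizing x with
  | zero => exact wordAW_wordMap f g x
  | succ r ih =>
    rw [wordCyclicAW_succ, wordCyclicAW_succ, wordHomotopy_wordMap, wordConnes_wordMap, ih, map_neg]

theorem wordSign_wordMap (x : Words k S) :
    wordSign k R (wordMap k f x) = wordMap k f (wordSign k S x) :=
  LinearMap.congr_fun (f := wordSign k R ∘ₗ (wordMap k f).toLinearMap)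
    (g := (wordMap k f).toLinearMap ∘ₗ wordSign k S) (words_hom_ext fun l => by simp) x

theorem tensorConnes_wordMap (z : WordTensor k S S') :
    tensorConnes k R R' (tensorWordMap f g z) = tensorWordMap f g (tensorConnes k S S' z) :=
  LinearMap.congr_fun (f := tensorConnes k R R' ∘ₗ tensorWordMap f g)
    (g := tensorWordMap f g ∘ₗ tensorConnes k S S')
    (TensorProduct.ext' fun x y => by
      simp [tensorConnes_tmul, wordConnes_wordMap, wordSign_wordMap]) z

end Naturality

/-! ## Maps out of words constructed with a contraction -/

section Cone

variable {k : Type*} [CommRing k] {S : Type*} {M : Type*} [AddCommGroup M] [Module k M]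

/-- Auxiliary recursion for `coneMap`. -/
def coneAux (h : S → Module.End k M) (κ : k) (ω : Words k S →ₗ[k] M) (m₀ : M) :
    ℕ → Words k S →ₗ[k] M
  | 0 => wordLift fun _ => m₀
  | n + 1 => wordLift fun l => match l with
    | [] => m₀
    | c :: l => h c (κ • coneAux h κ ω m₀ n (wordBoundary k S (word k (c :: l))) +
        ω (word k (c :: l)))

/-- The map `F` with `F [] = m₀` and `F x = h_c (κ F (b x) + ω x)` for words `x` beginning
with `c`. -/
def coneMap (h : S → Module.End k M) (κ : k) (ω : Words k S →ₗ[k] M) (m₀ : M) :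
    Words k S →ₗ[k] M :=
  wordLift fun l => coneAux h κ ω m₀ l.length (word k l)

variable {h : S → Module.End k M} {κ : k} {ω : Words k S →ₗ[k] M} {m₀ : M}

@[simp] theorem coneMap_one : coneMap h κ ω m₀ 1 = m₀ := by
  rw [← word_nil, coneMap, wordLift_word, List.length_nil, coneAux, wordLift_word]

/-- The boundary of a word is a combination of words, so the recursion is not structural; `coneAux`
recurses on the length and this equation is what remains of it. -/
theorem coneMap_cons (c : S) (l : List S) :
    coneMap h κ ω m₀ (word k (c :: l)) =
      h c (κ • coneMap h κ ω m₀ (wordBoundary k S (word k (c :: l))) + ω (word k (c :: l))) := by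
  have e : ∀ n, ∀ x ∈ wordsOfLength k S n, coneMap h κ ω m₀ x = coneAux h κ ω m₀ n x :=
    fun n x hx => wordSpan_eqOn (fun l hl => by subst hl; simp [coneMap]) hx
  rw [e _ _ (wordBoundary_word_mem _), coneMap, wordLift_word, List.length_cons, coneAux,
    wordLift_word, Nat.add_sub_cancel]

theorem coneMap_mem {M' : Submodule k M} (hM : ∀ c y, h c y ∈ M') (h0 : m₀ ∈ M')
    (x : Words k S) : coneMap h κ ω m₀ x ∈ M' := by
  have hx : x ∈ wordSpan k (fun _ : List S => True) :=
    wordSpan_true (k := k) ▸ Submodule.mem_top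
  refine wordSpan_map_le (fun l _ => ?_) hx
  cases l with
  | nil => simpa
  | cons c l => rw [coneMap_cons]; exact hM _ _

/-- The comparison theorem of homological algebra in one formula: $\kappa=1$ constructs chain maps
and their perturbations, $\kappa=-1$ homotopies. For $x$ starting with $c$, the element $y=\kappa
F(bx)+\omega x$ is a cycle modulo $D$ by induction on the length and the condition on $\omega$, so
$h_c$ provides a preimage. The contraction identity is required only on $M'$, since the tensor
square is contractible only on the kernel of its augmentation. -/
theorem coneMap_boundary {b : Module.End k M} {D M' : Submodule k M}
    (hb : ∀ c, ∀ y ∈ M', b (h c y) + h c (b y) - y ∈ D) (hD : ∀ c, ∀ y ∈ D, h c y ∈ D)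
    (hM : ∀ c y, h c y ∈ M') (h0 : m₀ ∈ M') (hω' : ∀ x, ω x ∈ M')
    (hω : ∀ x, b (ω x) + κ • ω (wordBoundary k S x) ∈ D) (h1 : b m₀ - ω 1 ∈ D) (x : Words k S) :
    b (coneMap h κ ω m₀ x) - κ • coneMap h κ ω m₀ (wordBoundary k S x) - ω x ∈ D := by
  have key : ∀ n, ∀ x ∈ wordsOfLength k S n,
      b (coneMap h κ ω m₀ x) - κ • coneMap h κ ω m₀ (wordBoundary k S x) - ω x ∈ D := by
    intro n
    induction n with
    | zero =>
      intro x hx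
      refine wordSpan_map_le (f := b ∘ₗ coneMap h κ ω m₀ -
        κ • coneMap h κ ω m₀ ∘ₗ wordBoundary k S - ω) (fun l hl => ?_) hx
      obtain rfl := List.length_eq_zero_iff.1 hl
      simpa using h1
    | succ n ih =>
      intro x hx
      refine wordSpan_map_le (f := b ∘ₗ coneMap h κ ω m₀ -
        κ • coneMap h κ ω m₀ ∘ₗ wordBoundary k S - ω) (fun l hl => ?_) hx
      cases l with
      | nil => simp at hl
      | cons c l =>
        have hx' := wordBoundary_word_mem (k := k) (c :: l)
        rw [hl, Nat.add_sub_cancel] at hx'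
        have i1 := ih _ hx'
        simp only [LinearMap.sub_apply, LinearMap.comp_apply, LinearMap.smul_apply]
        rw [wordBoundary_wordBoundary, map_zero, smul_zero, sub_zero] at i1
        rw [coneMap_cons]
        set x := word k (c :: l)
        set y := κ • coneMap h κ ω m₀ (wordBoundary k S x) + ω x with hy
        have hyM : y ∈ M' := add_mem (Submodule.smul_mem _ _ (coneMap_mem hM h0 _)) (hω' _)
        have i2 := hb c y hyM
        have i3 : b y ∈ D := by
          have := add_mem (Submodule.smul_mem _ κ i1) (hω x)
          convert this using 1
          rw [hy, map_add, map_smul]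
          module
        have i4 := sub_mem i2 (hD c _ i3)
        convert i4 using 1
        rw [hy]
        abel
  have hx : x ∈ wordSpan k (fun _ : List S => True) :=
    wordSpan_true (k := k) ▸ Submodule.mem_top
  exact wordSpan_map_le (f := b ∘ₗ coneMap h κ ω m₀ -
        κ • coneMap h κ ω m₀ ∘ₗ wordBoundary k S - ω) (fun l _ => key _ _ (word_mem_length l)) hx

theorem coneMap_mem_length {N : ℕ → Submodule k M} (e : ℕ) (hN : ∀ c n, ∀ y ∈ N n, h c y ∈ N (n + 1))
    (h0 : m₀ ∈ N e) (hω : ∀ n, ∀ x ∈ wordsOfLength k S (n + 1), ω x ∈ N (n + e)) {n : ℕ}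
    {x : Words k S} (hx : x ∈ wordsOfLength k S n) : coneMap h κ ω m₀ x ∈ N (n + e) := by
  induction n generalizing x with
  | zero =>
    refine wordSpan_map_le (fun l hl => ?_) hx
    obtain rfl := List.length_eq_zero_iff.1 hl
    simpa using h0
  | succ n ih =>
    refine wordSpan_map_le (fun l hl => ?_) hx
    cases l with
    | nil => simp at hl
    | cons c l =>
      have hx' := wordBoundary_word_mem (k := k) (c :: l)
      rw [hl, Nat.add_sub_cancel] at hx'
      rw [coneMap_cons, show n + 1 + e = n + e + 1 by ring]
      exact hN _ _ _ (add_mem (Submodule.smul_mem _ _ (ih hx')) (hω _ _ (word_mem hl)))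

/-- A refinement of stability of degenerate words under $b$ that keeps track of the length, as
induction along `coneMap_cons` requires. -/
theorem wordBoundary_word_degen (l : List S) (hl : Degenerate l) :
    wordBoundary k S (word k l) ∈
      wordSpan k fun m => Degenerate m ∧ m.length = l.length - 1 := by
  obtain ⟨u, c, v, rfl⟩ := hl.exists_eq
  have e : wordBoundary k S (word k (c :: c :: v)) =
      word k [c, c] * wordBoundary k S (word k v) := by
    rw [word_cons, word_cons c v, word_cons c [c], wordBoundary_letter_mul,
      wordBoundary_letter_mul, mul_sub, mul_assoc]
    abel
  rw [word_append, wordBoundary_word_mul, e]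
  refine add_mem ?_ (Submodule.smul_mem _ _ ?_)
  · rcases u with - | ⟨d, u⟩
    · simp
    · refine mul_mem_wordSpan (q := fun m => m = c :: c :: v) ?_ (wordBoundary_word_mem _)
        (word_mem rfl)
      rintro m _ h rfl
      refine ⟨degenerate_of_eq m c v, ?_⟩
      simp at h ⊢
      omega
  · rcases v with - | ⟨d, v⟩
    · simp
    · rw [← mul_assoc, ← word_append]
      refine mul_mem_wordSpan (p := fun m => m = u ++ [c, c]) ?_ (word_mem rfl)
        (wordBoundary_word_mem _)
      rintro _ m rfl h
      refine ⟨by simpa using degenerate_of_eq u c m, ?_⟩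
      simp at h ⊢
      omega

theorem coneMap_degenWords {D : Submodule k M} (hD : ∀ c, ∀ y ∈ D, h c y ∈ D)
    (hω : ∀ x ∈ degenWords k S, ω x ∈ D) {x : Words k S} (hx : x ∈ degenWords k S) :
    coneMap h κ ω m₀ x ∈ D := by
  have key : ∀ n, ∀ x ∈ wordSpan k (fun l : List S => Degenerate l ∧ l.length = n),
      coneMap h κ ω m₀ x ∈ D := by
    intro n
    induction n with
    | zero =>
      intro x hx
      refine wordSpan_map_le (fun l hl => ?_) hx
      obtain rfl := List.length_eq_zero_iff.1 hl.2
      simp [Degenerate] at hl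
    | succ n ih =>
      intro x hx
      refine wordSpan_map_le (fun l hl => ?_) hx
      cases l with
      | nil => simp at hl
      | cons c l =>
        have hx' := wordBoundary_word_degen (k := k) (c :: l) hl.1
        rw [hl.2, Nat.add_sub_cancel] at hx'
        rw [coneMap_cons]
        exact hD _ _ (add_mem (Submodule.smul_mem _ _ (ih _ hx')) (hω _ (word_mem hl.1)))
  exact wordSpan_map_le (fun l hl => key _ _ (word_mem ⟨hl, rfl⟩)) hx

/-- The contraction is indexed by the first letter, and a relabelling of the alphabet moves the
first letter and the contraction together. No averaging or choice of orbit representatives is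
involved. -/
theorem coneMap_equivariant {f : S → S} {ρ : Module.End k M} (hρ : ∀ c y, ρ (h c y) = h (f c) (ρ y))
    (h0 : ρ m₀ = m₀) (hω : ∀ x, ω (wordMap k f x) = ρ (ω x)) (x : Words k S) :
    coneMap h κ ω m₀ (wordMap k f x) = ρ (coneMap h κ ω m₀ x) := by
  have key : ∀ n, ∀ x ∈ wordsOfLength k S n,
      coneMap h κ ω m₀ (wordMap k f x) = ρ (coneMap h κ ω m₀ x) := by
    intro n
    induction n with
    | zero =>
      intro x hx
      refine wordSpan_eqOn (f := coneMap h κ ω m₀ ∘ₗ (wordMap k f).toLinearMap)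
        (g := ρ ∘ₗ coneMap h κ ω m₀) (fun l hl => ?_) hx
      obtain rfl := List.length_eq_zero_iff.1 hl
      simp [h0]
    | succ n ih =>
      intro x hx
      refine wordSpan_eqOn (f := coneMap h κ ω m₀ ∘ₗ (wordMap k f).toLinearMap)
        (g := ρ ∘ₗ coneMap h κ ω m₀) (fun l hl => ?_) hx
      cases l with
      | nil => simp at hl
      | cons c l =>
        have hx' := wordBoundary_word_mem (k := k) (c :: l)
        rw [hl, Nat.add_sub_cancel] at hx'
        have e := ih _ hx'
        have e' := hω (word k (c :: l))
        rw [← wordBoundary_wordMap] at e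
        simp only [LinearMap.comp_apply, AlgHom.toLinearMap_apply]
        rw [wordMap_word] at e e' ⊢
        rw [List.map_cons] at e e' ⊢
        rw [coneMap_cons, coneMap_cons, hρ, map_add ρ, map_smul ρ, e, e']
  exact LinearMap.congr_fun (f := coneMap h κ ω m₀ ∘ₗ (wordMap k f).toLinearMap)
    (g := ρ ∘ₗ coneMap h κ ω m₀) (words_hom_ext fun l => key _ _ (word_mem_length l)) x

end Cone

end HopfCyclic

end

noncomputable section

namespace HopfCyclic

/-! ## Sequences of maps and their total maps -/

theorem sum_antidiagonal_interchange {M : Type*} [AddCommMonoid M] (F : ℕ → ℕ → ℕ → ℕ → M) (n : ℕ) :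
    ∑ p ∈ Finset.HasAntidiagonal.antidiagonal n, ∑ q ∈ Finset.HasAntidiagonal.antidiagonal p.1, ∑ r ∈ Finset.HasAntidiagonal.antidiagonal p.2,
        F q.1 q.2 r.1 r.2 =
      ∑ p ∈ Finset.HasAntidiagonal.antidiagonal n, ∑ q ∈ Finset.HasAntidiagonal.antidiagonal p.1, ∑ r ∈ Finset.HasAntidiagonal.antidiagonal p.2,
        F q.1 r.1 q.2 r.2 := by
  simp_rw [← Finset.sum_product', Finset.sum_sigma']
  refine Finset.sum_nbij'
    (fun x => ⟨(x.2.1.1 + x.2.2.1, x.2.1.2 + x.2.2.2),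
      ((x.2.1.1, x.2.2.1), (x.2.1.2, x.2.2.2))⟩)
    (fun x => ⟨(x.2.1.1 + x.2.2.1, x.2.1.2 + x.2.2.2),
      ((x.2.1.1, x.2.2.1), (x.2.1.2, x.2.2.2))⟩) ?_ ?_ ?_ ?_ ?_
  · rintro ⟨⟨a, b⟩, ⟨c, d⟩, ⟨e, f⟩⟩ h
    simp at h ⊢
    omega
  · rintro ⟨⟨a, b⟩, ⟨c, d⟩, ⟨e, f⟩⟩ h
    simp at h ⊢
    omega
  · rintro ⟨⟨a, b⟩, ⟨c, d⟩, ⟨e, f⟩⟩ h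
    simp at h
    obtain ⟨h, rfl, rfl⟩ := h
    rfl
  · rintro ⟨⟨a, b⟩, ⟨c, d⟩, ⟨e, f⟩⟩ h
    simp at h
    obtain ⟨h, rfl, rfl⟩ := h
    rfl
  · rintro ⟨⟨a, b⟩, ⟨c, d⟩, ⟨e, f⟩⟩ h
    rfl

theorem sum_antidiagonal_assoc {M : Type*} [AddCommMonoid M] (F : ℕ → ℕ → ℕ → M) (n : ℕ) :
    ∑ p ∈ Finset.HasAntidiagonal.antidiagonal n, ∑ q ∈ Finset.HasAntidiagonal.antidiagonal p.1, F q.1 q.2 p.2 =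
      ∑ p ∈ Finset.HasAntidiagonal.antidiagonal n, ∑ q ∈ Finset.HasAntidiagonal.antidiagonal p.2, F p.1 q.1 q.2 := by
  simp_rw [Finset.sum_sigma']
  refine Finset.sum_nbij'
    (fun x => ⟨(x.2.1, x.2.2 + x.1.2), (x.2.2, x.1.2)⟩)
    (fun x => ⟨(x.1.1 + x.2.1, x.2.2), (x.1.1, x.2.1)⟩) ?_ ?_ ?_ ?_ ?_
  all_goals
    rintro ⟨⟨a, b⟩, ⟨c, d⟩⟩ h
    simp at h ⊢
    try omega

section Sequences

variable {k : Type*} [CommRing k] {L M N P P' Q Q' R R' : Type*}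
  [AddCommGroup L] [Module k L] [AddCommGroup M] [Module k M] [AddCommGroup N] [Module k N]
  [AddCommGroup P] [Module k P] [AddCommGroup P'] [Module k P']
  [AddCommGroup Q] [Module k Q] [AddCommGroup Q'] [Module k Q']
  [AddCommGroup R] [Module k R] [AddCommGroup R'] [Module k R']

/-- The composite of two sequences of maps, as power series. -/
def convolve (f : ℕ → N →ₗ[k] P) (g : ℕ → M →ₗ[k] N) : ℕ → M →ₗ[k] P := fun n =>
  ∑ p ∈ Finset.HasAntidiagonal.antidiagonal n, f p.1 ∘ₗ g p.2

theorem convolve_apply (f : ℕ → N →ₗ[k] P) (g : ℕ → M →ₗ[k] N) (n : ℕ) (x : M) :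
    convolve f g n x = ∑ p ∈ Finset.HasAntidiagonal.antidiagonal n, f p.1 (g p.2 x) := by
  simp [convolve]

theorem convolve_assoc (f : ℕ → N →ₗ[k] P) (g : ℕ → M →ₗ[k] N) (h : ℕ → L →ₗ[k] M) :
    convolve (convolve f g) h = convolve f (convolve g h) := by
  funext n
  ext x
  simp only [convolve_apply, map_sum]
  exact sum_antidiagonal_assoc (fun a b c => f a (g b (h c x))) n

theorem add_convolve (f f' : ℕ → N →ₗ[k] P) (g : ℕ → M →ₗ[k] N) :
    convolve (f + f') g = convolve f g + convolve f' g := by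
  funext n; ext x; simp [convolve_apply, Finset.sum_add_distrib]

theorem sub_convolve (f f' : ℕ → N →ₗ[k] P) (g : ℕ → M →ₗ[k] N) :
    convolve (f - f') g = convolve f g - convolve f' g := by
  funext n; ext x; simp [convolve_apply, Finset.sum_sub_distrib]

theorem convolve_add (f : ℕ → N →ₗ[k] P) (g g' : ℕ → M →ₗ[k] N) :
    convolve f (g + g') = convolve f g + convolve f g' := by
  funext n; ext x; simp [convolve_apply, Finset.sum_add_distrib]

theorem convolve_sub (f : ℕ → N →ₗ[k] P) (g g' : ℕ → M →ₗ[k] N) :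
    convolve f (g - g') = convolve f g - convolve f g' := by
  funext n; ext x; simp [convolve_apply, Finset.sum_sub_distrib]

/-- The constant sequence of maps. -/
def seqConst (f : M →ₗ[k] N) : ℕ → M →ₗ[k] N
  | 0 => f
  | _ + 1 => 0

/-- The sequence of maps with two entries. -/
def seqPair (f g : M →ₗ[k] N) : ℕ → M →ₗ[k] N
  | 0 => f
  | 1 => g
  | _ + 2 => 0

theorem seqConst_convolve (f : N →ₗ[k] P) (g : ℕ → M →ₗ[k] N) (n : ℕ) :
    convolve (seqConst f) g n = f ∘ₗ g n := by
  cases n with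
  | zero => simp [convolve, seqConst]
  | succ n => simp [convolve, seqConst, Finset.Nat.sum_antidiagonal_succ]

theorem convolve_seqConst (f : ℕ → N →ₗ[k] P) (g : M →ₗ[k] N) (n : ℕ) :
    convolve f (seqConst g) n = f n ∘ₗ g := by
  cases n with
  | zero => simp [convolve, seqConst]
  | succ n => simp [convolve, seqConst, Finset.Nat.sum_antidiagonal_succ']

@[simp] theorem id_convolve (g : ℕ → M →ₗ[k] N) : convolve (seqConst LinearMap.id) g = g := by
  funext n; simp [seqConst_convolve]

@[simp] theorem convolve_id (f : ℕ → M →ₗ[k] N) : convolve f (seqConst LinearMap.id) = f := by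
  funext n; simp [convolve_seqConst]

theorem seqPair_convolve_zero (f f' : N →ₗ[k] P) (g : ℕ → M →ₗ[k] N) :
    convolve (seqPair f f') g 0 = f ∘ₗ g 0 := by
  simp [convolve, seqPair]

theorem seqPair_convolve_succ (f f' : N →ₗ[k] P) (g : ℕ → M →ₗ[k] N) (n : ℕ) :
    convolve (seqPair f f') g (n + 1) = f ∘ₗ g (n + 1) + f' ∘ₗ g n := by
  cases n with
  | zero => simp [convolve, seqPair, Finset.Nat.sum_antidiagonal_succ]
  | succ n =>
    simp only [convolve, Finset.Nat.sum_antidiagonal_succ]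
    simp [seqPair]

theorem convolve_seqPair_zero (f : ℕ → N →ₗ[k] P) (g g' : M →ₗ[k] N) :
    convolve f (seqPair g g') 0 = f 0 ∘ₗ g := by
  simp [convolve, seqPair]

theorem convolve_seqPair_succ (f : ℕ → N →ₗ[k] P) (g g' : M →ₗ[k] N) (n : ℕ) :
    convolve f (seqPair g g') (n + 1) = f (n + 1) ∘ₗ g + f n ∘ₗ g' := by
  cases n with
  | zero => simp [convolve, seqPair, Finset.Nat.sum_antidiagonal_succ, add_comm]
  | succ n =>
    simp only [convolve, Finset.Nat.sum_antidiagonal_succ']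
    simp [seqPair, add_comm]

/-- The tensor product of two sequences of maps, as power series. -/
def boxProduct (f : ℕ → M →ₗ[k] N) (g : ℕ → P →ₗ[k] Q) : ℕ → M ⊗[k] P →ₗ[k] N ⊗[k] Q := fun n =>
  ∑ p ∈ Finset.HasAntidiagonal.antidiagonal n, TensorProduct.map (f p.1) (g p.2)

theorem boxProduct_tmul (f : ℕ → M →ₗ[k] N) (g : ℕ → P →ₗ[k] Q) (n : ℕ) (x : M) (y : P) :
    boxProduct f g n (x ⊗ₜ y) = ∑ p ∈ Finset.HasAntidiagonal.antidiagonal n, f p.1 x ⊗ₜ g p.2 y := by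
  simp [boxProduct]

theorem convolve_boxProduct (f : ℕ → N →ₗ[k] P) (f' : ℕ → M →ₗ[k] N) (g : ℕ → Q →ₗ[k] R)
    (g' : ℕ → L →ₗ[k] Q) : convolve (boxProduct f g) (boxProduct f' g') =
      boxProduct (convolve f f') (convolve g g') := by
  funext n
  refine TensorProduct.ext' fun x y => ?_
  simp only [convolve_apply, boxProduct_tmul, map_sum, TensorProduct.sum_tmul,
    TensorProduct.tmul_sum]
  have := sum_antidiagonal_interchange (fun a b c d => f a (f' c x) ⊗ₜ[k] g b (g' d y)) n
  refine (Eq.trans ?_ this).trans ?_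
  · exact Finset.sum_congr rfl fun _ _ => Finset.sum_comm
  · exact Finset.sum_congr rfl fun _ _ => Finset.sum_comm

theorem sub_boxProduct (f f' : ℕ → M →ₗ[k] N) (g : ℕ → P →ₗ[k] Q) :
    boxProduct (f - f') g = boxProduct f g - boxProduct f' g := by
  funext n
  refine TensorProduct.ext' fun x y => ?_
  simp [boxProduct_tmul, TensorProduct.sub_tmul]

theorem boxProduct_sub (f : ℕ → M →ₗ[k] N) (g g' : ℕ → P →ₗ[k] Q) :
    boxProduct f (g - g') = boxProduct f g - boxProduct f g' := by
  funext n
  refine TensorProduct.ext' fun x y => ?_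
  simp [boxProduct_tmul, TensorProduct.tmul_sub]

/-- The map `u^i ⊗ x ↦ ∑_{r+s=i} u^s ⊗ f_r x`. -/
def totalMap (f : ℕ → M →ₗ[k] N) : (ℕ →₀ M) →ₗ[k] (ℕ →₀ N) :=
  Finsupp.lsum k fun i => ∑ p ∈ Finset.HasAntidiagonal.antidiagonal i, Finsupp.lsingle p.2 ∘ₗ f p.1

theorem totalMap_single (f : ℕ → M →ₗ[k] N) (i : ℕ) (x : M) :
    totalMap f (Finsupp.single i x) =
      ∑ p ∈ Finset.HasAntidiagonal.antidiagonal i, Finsupp.single p.2 (f p.1 x) := by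
  simp [totalMap]

theorem finsupp_hom_ext {f g : (ℕ →₀ M) →ₗ[k] N}
    (h : ∀ i x, f (Finsupp.single i x) = g (Finsupp.single i x)) : f = g :=
  Finsupp.lhom_ext h

/-- Composition of $S$-maps is multiplication of power series in $u^{-1}$; powers of $u$ that would
become negative are dropped consistently on both sides. -/
theorem totalMap_convolve (f : ℕ → N →ₗ[k] P) (g : ℕ → M →ₗ[k] N) (x : ℕ →₀ M) :
    totalMap (convolve f g) x = totalMap f (totalMap g x) := by
  refine LinearMap.congr_fun (g := totalMap f ∘ₗ totalMap g) (finsupp_hom_ext fun i x => ?_) x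
  simp only [LinearMap.comp_apply, totalMap_single, map_sum, convolve_apply,
    Finsupp.single_finsetSum]
  rw [← sum_antidiagonal_assoc (fun r a c => Finsupp.single c (f a (g r x)))]
  refine Finset.sum_congr rfl fun p _ => ?_
  exact (Finset.Nat.sum_antidiagonal_swap (f := fun q : ℕ × ℕ => Finsupp.single p.2
    (f q.1 (g q.2 x)))).symm

@[simp] theorem totalMap_seqConst_id (x : ℕ →₀ M) :
    totalMap (seqConst (LinearMap.id : M →ₗ[k] M)) x = x := by
  refine LinearMap.congr_fun (g := LinearMap.id) (finsupp_hom_ext fun i x => ?_) x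
  cases i <;> simp [totalMap_single, seqConst, Finset.Nat.sum_antidiagonal_succ]

theorem totalMap_seqConst_single (f : M →ₗ[k] N) (i : ℕ) (x : M) :
    totalMap (seqConst f) (Finsupp.single i x) = Finsupp.single i (f x) := by
  cases i <;> simp [totalMap_single, seqConst, Finset.Nat.sum_antidiagonal_succ]

theorem totalMap_add (f g : ℕ → M →ₗ[k] N) : totalMap (f + g) = totalMap f + totalMap g :=
  finsupp_hom_ext fun i x => by simp [totalMap_single, Finset.sum_add_distrib]

theorem totalMap_sub (f g : ℕ → M →ₗ[k] N) : totalMap (f - g) = totalMap f - totalMap g :=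
  finsupp_hom_ext fun i x => by simp [totalMap_single, Finset.sum_sub_distrib]

theorem totalDiff_eq (b B : Module.End k M) : totalDiff b B = totalMap (seqPair b B) := by
  refine finsupp_hom_ext fun i x => ?_
  rcases i with - | i
  · simp [totalDiff, totalMap_single, seqPair]
  · cases i <;> simp [totalDiff, totalMap_single, seqPair, Finset.Nat.sum_antidiagonal_succ]

theorem mapRange_totalMap (p : N →ₗ[k] Q) (f : ℕ → M →ₗ[k] N) (g : ℕ → P →ₗ[k] Q)
    (s : M →ₗ[k] P) (h : ∀ r x, p (f r x) = g r (s x)) (x : ℕ →₀ M) :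
    Finsupp.mapRange.linearMap p (totalMap f x) =
      totalMap g (Finsupp.mapRange.linearMap s x) := by
  refine LinearMap.congr_fun (f := Finsupp.mapRange.linearMap p ∘ₗ totalMap f)
    (g := totalMap g ∘ₗ Finsupp.mapRange.linearMap s) (finsupp_hom_ext fun i x => ?_) x
  simp [totalMap_single, h]

/-- The elements of `k[u] ⊗ M` with coefficients in a submodule. -/
def totalSub (W : Submodule k M) : Submodule k (ℕ →₀ M) := ⨆ i, W.map (Finsupp.lsingle i)

theorem single_mem_totalSub {W : Submodule k M} (i : ℕ) {x : M} (hx : x ∈ W) :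
    Finsupp.single i x ∈ totalSub W :=
  Submodule.mem_iSup_of_mem i ⟨x, hx, rfl⟩

theorem totalSub_le {W : Submodule k M} {V : Submodule k (ℕ →₀ M)}
    (h : ∀ i, ∀ x ∈ W, Finsupp.single i x ∈ V) : totalSub W ≤ V :=
  iSup_le fun i => Submodule.map_le_iff_le_comap.2 fun x hx => h i x hx

theorem totalMap_mem {f : ℕ → M →ₗ[k] N} {W : Submodule k N} (h : ∀ r x, f r x ∈ W)
    (x : ℕ →₀ M) : totalMap f x ∈ totalSub W := by
  induction x using Finsupp.induction_linear with
  | zero => simp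
  | add x y hx hy => rw [map_add]; exact add_mem hx hy
  | single i x =>
    rw [totalMap_single]
    exact sum_mem fun p _ => single_mem_totalSub _ (h _ _)

theorem totalMap_mem_of_mem {f : ℕ → M →ₗ[k] N} {V : Submodule k M} {W : Submodule k N}
    (h : ∀ r, ∀ x ∈ V, f r x ∈ W) {x : ℕ →₀ M} (hx : x ∈ totalSub V) :
    totalMap f x ∈ totalSub W := by
  refine totalSub_le (V := (totalSub W).comap (totalMap f)) (fun i x hx => ?_) hx
  rw [Submodule.mem_comap, totalMap_single]
  exact sum_mem fun p _ => single_mem_totalSub _ (h _ _ hx)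

/-- The Künneth map on `k[u] ⊗ (M ⊗ M)`. -/
def totalKunneth : (ℕ →₀ M ⊗[k] M) →ₗ[k] (ℕ →₀ M) ⊗[k] (ℕ →₀ M) := Finsupp.lsum k kunnethTotal

theorem totalKunneth_single (s : ℕ) (x y : M) :
    totalKunneth (k := k) (Finsupp.single s (x ⊗ₜ y)) = ∑ p ∈ Finset.HasAntidiagonal.antidiagonal s,
      Finsupp.single p.1 x ⊗ₜ Finsupp.single p.2 y := by
  simp [totalKunneth, kunnethTotal]

/-- The Künneth map turns $u^{-1}$ on $k[u]\otimes(M\otimes M)$ into $u^{-1}$ acting on either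
factor; both ways of distributing the powers are the same fourfold sum. -/
theorem totalKunneth_totalMap (f g : ℕ → M →ₗ[k] N) (z : ℕ →₀ M ⊗[k] M) :
    totalKunneth (totalMap (boxProduct f g) z) =
      TensorProduct.map (totalMap f) (totalMap g) (totalKunneth z) := by
  refine LinearMap.congr_fun (f := totalKunneth ∘ₗ totalMap (boxProduct f g))
    (g := TensorProduct.map (totalMap f) (totalMap g) ∘ₗ totalKunneth) (finsupp_hom_ext ?_) z
  intro i z
  refine LinearMap.congr_fun
    (f := totalKunneth ∘ₗ totalMap (boxProduct f g) ∘ₗ Finsupp.lsingle i)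
    (g := TensorProduct.map (totalMap f) (totalMap g) ∘ₗ totalKunneth ∘ₗ Finsupp.lsingle i)
    (TensorProduct.ext' fun x y => ?_) z
  simp only [LinearMap.comp_apply, Finsupp.lsingle_apply, totalKunneth_single, map_sum,
    TensorProduct.map_tmul, totalMap_single, boxProduct_tmul, Finsupp.single_finsetSum,
    TensorProduct.sum_tmul, TensorProduct.tmul_sum]
  refine Eq.trans ?_ (sum_antidiagonal_interchange (fun a b c d =>
    Finsupp.single c (f a x) ⊗ₜ[k] Finsupp.single d (g b y)) i) |>.trans ?_
  · exact Finset.sum_congr rfl fun _ _ => rfl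
  · exact Finset.sum_congr rfl fun _ _ => Finset.sum_comm

end Sequences

end HopfCyclic

end

noncomputable section

namespace HopfCyclic

/-! ## Comparison of the mixed complexes `(E, b, 0)` and `(E, b, B)` -/

section Comparison

variable {k : Type*} [CommRing k] {S : Type*}

variable (k) in
/-- The contraction `x ↦ c x` of the augmented complex of words. -/
abbrev letterMul (c : S) : Module.End k (Words k S) := LinearMap.mulLeft k (word k [c])

variable (k S) in
/-- The sequence of differentials of the mixed complex of words. -/
abbrev mixedSeq : ℕ → Module.End k (Words k S) := seqPair (wordBoundary k S) (wordConnes k S)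

theorem letterMul_equivariant (f : S → S) (c : S) (y : Words k S) :
    wordMap k f (letterMul k c y) = letterMul k (f c) (wordMap k f y) := by simp

theorem coneMap_letterMul_boundary {D : Submodule k (Words k S)} {κ : k}
    {ω : Module.End k (Words k S)} {m₀ : Words k S} (hD : ∀ c, ∀ y ∈ D, letterMul k c y ∈ D)
    (hω : ∀ x, wordBoundary k S (ω x) + κ • ω (wordBoundary k S x) ∈ D)
    (h1 : wordBoundary k S m₀ - ω 1 ∈ D) (x : Words k S) :
    wordBoundary k S (coneMap (letterMul k) κ ω m₀ x) -
      κ • coneMap (letterMul k) κ ω m₀ (wordBoundary k S x) - ω x ∈ D :=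
  coneMap_boundary (M' := ⊤) (fun c y _ => by simp [wordBoundary_letter_mul]) hD
    (fun _ _ => trivial) trivial (fun _ => trivial) hω h1 x

theorem letterMul_mem_degenWords (c : S) (y : Words k S) (hy : y ∈ degenWords k S) :
    letterMul k c y ∈ degenWords k S := mul_mem_degenWords_left _ hy

variable {G : Type*}

/-- The entries of a `G`-equivariant `S`-map from `(E, b, 0)` to the normalization of
`(E, b, B)`, on the augmented complex of words. -/
structure IsWordComparison [Group G] (f : ℕ → Module.End k (Words k G)) : Prop where
  zero : f 0 = LinearMap.id
  one : ∀ r, f (r + 1) 1 = 0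
  length : ∀ r n, ∀ x ∈ wordsOfLength k G n, f r x ∈ wordsOfLength k G (n + 2 * r)
  equivariant : ∀ r (s : G) x, f r (wordMap k (s * ·) x) = wordMap k (s * ·) (f r x)
  comm : ∀ r x, (convolve (mixedSeq k G) f - convolve f (seqConst (wordBoundary k G))) r x ∈
    degenWords k G

/-! ### Construction of the comparison and of its retraction -/

section Existence

variable (k G)

/-- The standard comparison of `(E, b, 0)` with `(E, b, B)`. -/
def wordComparison : ℕ → Module.End k (Words k G)
  | 0 => LinearMap.id
  | r + 1 => coneMap (letterMul k) 1 (-(wordConnes k G ∘ₗ wordComparison r)) 0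

/-- The standard comparison of `(E, b, B)` with `(E, b, 0)`. -/
def wordRetract : ℕ → Module.End k (Words k G)
  | 0 => coneMap (letterMul k) 1 0 1
  | r + 1 => coneMap (letterMul k) 1 (wordRetract r ∘ₗ wordConnes k G) 0

variable {k G}

theorem wordComparison_one (r : ℕ) : wordComparison k G (r + 1) 1 = 0 := coneMap_one

theorem wordRetract_zero_one : wordRetract k G 0 1 = 1 := coneMap_one

theorem wordRetract_succ_one (r : ℕ) : wordRetract k G (r + 1) 1 = 0 := coneMap_one

/-- The obstruction to finding $f_{r+1}$ with $bf_{r+1}-f_{r+1}b=-Bf_r$ is that the right side must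
anticommute with $b$. This follows from the relation for $f_r$ and $B^2\equiv0$. -/
theorem wordComparison_comm (r : ℕ) (x : Words k G) :
    wordBoundary k G (wordComparison k G (r + 1) x) + wordConnes k G (wordComparison k G r x) -
      wordComparison k G (r + 1) (wordBoundary k G x) ∈ degenWords k G := by
  induction r generalizing x with
  | zero =>
    have := coneMap_letterMul_boundary (κ := 1) (ω := -(wordConnes k G ∘ₗ wordComparison k G 0))
      (m₀ := 0) letterMul_mem_degenWords
      (fun x => by simp [wordComparison, wordBoundary_wordConnes])
      (by simp [wordComparison]) x
    convert this using 1
    simp only [wordComparison, LinearMap.neg_apply, LinearMap.comp_apply]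
    module
  | succ r ih =>
    have := coneMap_letterMul_boundary (κ := 1)
      (ω := -(wordConnes k G ∘ₗ wordComparison k G (r + 1)))
      (m₀ := 0) letterMul_mem_degenWords
      (fun x => by
        have := sub_mem (wordConnes_degenWords (ih x))
          (wordConnes_wordConnes (wordComparison k G r x))
        convert this using 1
        simp only [LinearMap.neg_apply, LinearMap.comp_apply, map_neg, wordBoundary_wordConnes,
          map_sub, map_add]
        module)
      (by simp [wordComparison_one]) x
    convert this using 1
    simp only [wordComparison, LinearMap.neg_apply, LinearMap.comp_apply]
    module

theorem isWordComparison_wordComparison [Group G] : IsWordComparison (wordComparison k G) where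
  zero := rfl
  one := wordComparison_one
  length r := by
    induction r with
    | zero => exact fun n x hx => hx
    | succ r ih =>
      intro n x hx
      refine coneMap_mem_length (N := wordsOfLength k G) (2 * (r + 1))
        (fun c n y hy => letter_mul_mem_length c hy) (zero_mem _) (fun n x hx => neg_mem ?_) hx
      have := wordConnes_mem_length (ih _ x hx)
      rwa [show n + 1 + 2 * r + 1 = n + 2 * (r + 1) by ring] at this
  equivariant r := by
    induction r with
    | zero => exact fun s x => rfl
    | succ r ih =>
      intro s x
      refine coneMap_equivariant (f := (s * ·)) (ρ := (wordMap k (s * ·)).toLinearMap)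
        (fun c y => letterMul_equivariant _ c y) (map_zero _) (fun x => ?_) x
      simp [ih, wordConnes_wordMap]
  comm r x := by
    cases r with
    | zero => simp [seqPair_convolve_zero, convolve_seqConst, wordComparison]
    | succ r =>
      simpa [seqPair_convolve_succ, convolve_seqConst] using wordComparison_comm r x

/-- This is why the zeroth entry is built by `coneMap` with source term $0$ instead of being the
identity: the recursion vanishes on degenerate words exactly, so the retraction is defined on the
normalized complex. -/
theorem wordRetract_degenWords (r : ℕ) {x : Words k G} (hx : x ∈ degenWords k G) :
    wordRetract k G r x = 0 := by
  induction r generalizing x with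
  | zero => exact coneMap_degenWords (D := ⊥) (by simp) (by simp) hx
  | succ r ih =>
    exact coneMap_degenWords (D := ⊥) (ω := wordRetract k G r ∘ₗ wordConnes k G) (by simp)
      (fun x hx => ih (wordConnes_degenWords hx)) hx

theorem wordRetract_zero_comm (x : Words k G) :
    wordBoundary k G (wordRetract k G 0 x) = wordRetract k G 0 (wordBoundary k G x) := by
  have := coneMap_letterMul_boundary (κ := 1) (ω := (0 : Module.End k (Words k G))) (m₀ := 1)
    (D := ⊥) (by simp) (by simp) (by simp) x
  simpa [sub_eq_zero, wordRetract] using this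

/-- The relation is exact, not merely modulo degenerate words, because $B^2x$ is degenerate and the
retraction kills it. -/
theorem wordRetract_succ_comm (r : ℕ) (x : Words k G) :
    wordBoundary k G (wordRetract k G (r + 1) x) =
      wordRetract k G (r + 1) (wordBoundary k G x) + wordRetract k G r (wordConnes k G x) := by
  have key : ∀ r, (∀ x, wordBoundary k G (wordRetract k G r (wordConnes k G x)) =
      wordRetract k G r (wordBoundary k G (wordConnes k G x))) → ∀ x,
      wordBoundary k G (wordRetract k G (r + 1) x) =
      wordRetract k G (r + 1) (wordBoundary k G x) + wordRetract k G r (wordConnes k G x) := by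
    intro r h x
    have := coneMap_letterMul_boundary (κ := 1) (ω := wordRetract k G r ∘ₗ wordConnes k G) (m₀ := 0)
      (D := ⊥) (by simp) (fun x => by simp [h, wordBoundary_wordConnes]) (by simp) x
    rw [Submodule.mem_bot, one_smul, sub_sub, sub_eq_zero] at this
    exact this
  induction r generalizing x with
  | zero => exact key 0 (fun x => wordRetract_zero_comm _) x
  | succ r ih =>
    refine key (r + 1) (fun x => ?_) x
    rw [ih, wordRetract_degenWords r (wordConnes_wordConnes x), add_zero]

theorem convolve_wordRetract : convolve (seqConst (wordBoundary k G)) (wordRetract k G) =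
    convolve (wordRetract k G) (mixedSeq k G) := by
  funext r
  refine LinearMap.ext fun x => ?_
  cases r with
  | zero => simpa [seqConst_convolve, convolve_seqPair_zero] using wordRetract_zero_comm x
  | succ r => simpa [seqConst_convolve, convolve_seqPair_succ] using wordRetract_succ_comm r x

theorem wordRetract_length (r n : ℕ) (x : Words k G) (hx : x ∈ wordsOfLength k G n) :
    wordRetract k G r x ∈ wordsOfLength k G (n + 2 * r) := by
  induction r generalizing n x with
  | zero =>
    exact coneMap_mem_length (N := wordsOfLength k G) 0
        (fun c n y hy => letter_mul_mem_length c hy) (by rw [← word_nil]; exact word_mem_length [])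
        (fun n x hx => zero_mem _) hx
  | succ r ih =>
    refine coneMap_mem_length (N := wordsOfLength k G) (2 * (r + 1))
        (fun c n y hy => letter_mul_mem_length c hy) (zero_mem _) (fun n x hx => ?_) hx
    have := ih _ _ (wordConnes_mem_length hx)
    rwa [show n + 1 + 1 + 2 * r = n + 2 * (r + 1) by ring] at this

theorem wordRetract_equivariant [Group G] (r : ℕ) (s : G) (x : Words k G) :
    wordRetract k G r (wordMap k (s * ·) x) = wordMap k (s * ·) (wordRetract k G r x) := by
  induction r generalizing x with
  | zero =>
    exact coneMap_equivariant (f := (s * ·)) (ρ := (wordMap k (s * ·)).toLinearMap)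
      (fun c y => letterMul_equivariant _ c y) (map_one (wordMap k (s * ·))) (fun x => by simp) x
  | succ r ih =>
    exact coneMap_equivariant (f := (s * ·)) (ρ := (wordMap k (s * ·)).toLinearMap)
      (fun c y => letterMul_equivariant _ c y) (map_zero _)
      (fun x => by simp [ih, wordConnes_wordMap]) x

end Existence

/-! ### The comparison and the retraction are homotopy inverse -/

section Homotopies

theorem seqConst_id_length (r n : ℕ) (x : Words k G) (hx : x ∈ wordsOfLength k G n) :
    seqConst (LinearMap.id : Module.End k (Words k G)) r x ∈ wordsOfLength k G (n + 2 * r) := by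
  cases r with
  | zero => exact hx
  | succ r => exact zero_mem _

/-- The correction terms in the construction of a homotopy for `b + u⁻¹ B`. -/
def connesBracket (K : ℕ → Module.End k (Words k G)) : ℕ → Module.End k (Words k G)
  | 0 => 0
  | r + 1 => wordConnes k G ∘ₗ K r + K r ∘ₗ wordConnes k G

/-- A sequence of maps constructed with the contraction by letters, to satisfy
`[b + u⁻¹ B, K] = W`. -/
def mixedHomotopy (W : ℕ → Module.End k (Words k G)) : ℕ → Module.End k (Words k G)
  | 0 => coneMap (letterMul k) (-1) (W 0) 0
  | r + 1 => coneMap (letterMul k) (-1) (W (r + 1) -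
      (wordConnes k G ∘ₗ mixedHomotopy W r + mixedHomotopy W r ∘ₗ wordConnes k G)) 0

theorem mixedHomotopy_eq (W : ℕ → Module.End k (Words k G)) (r : ℕ) : mixedHomotopy W r =
    coneMap (letterMul k) (-1) (W r - connesBracket (mixedHomotopy W) r) 0 := by
  cases r with
  | zero => rw [connesBracket, sub_zero, mixedHomotopy]
  | succ r => rw [connesBracket, mixedHomotopy]

theorem mixedHomotopy_one (W : ℕ → Module.End k (Words k G)) (r : ℕ) :
    mixedHomotopy W r 1 = 0 := by
  rw [mixedHomotopy_eq, coneMap_one]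

theorem mixedHomotopy_degenWords {W : ℕ → Module.End k (Words k G)}
    (hW : ∀ r, ∀ x ∈ degenWords k G, W r x ∈ degenWords k G) (r : ℕ) {x : Words k G}
    (hx : x ∈ degenWords k G) : mixedHomotopy W r x ∈ degenWords k G := by
  induction r generalizing x with
  | zero => exact coneMap_degenWords letterMul_mem_degenWords (hW 0) hx
  | succ r ih =>
    exact coneMap_degenWords letterMul_mem_degenWords (fun x hx => sub_mem (hW _ x hx)
      (add_mem (wordConnes_degenWords (ih hx)) (ih (wordConnes_degenWords hx)))) hx

theorem mixedHomotopy_length {W : ℕ → Module.End k (Words k G)}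
    (hW : ∀ r n, ∀ x ∈ wordsOfLength k G n, W r x ∈ wordsOfLength k G (n + 2 * r)) (r n : ℕ)
    (x : Words k G) (hx : x ∈ wordsOfLength k G n) :
    mixedHomotopy W r x ∈ wordsOfLength k G (n + (2 * r + 1)) := by
  induction r generalizing n x with
  | zero =>
    refine coneMap_mem_length (N := wordsOfLength k G) 1
      (fun c n y hy => letter_mul_mem_length c hy) (zero_mem _) (fun n x hx => ?_) hx
    exact hW 0 _ _ hx
  | succ r ih =>
    refine coneMap_mem_length (N := wordsOfLength k G) (2 * (r + 1) + 1)
      (fun c n y hy => letter_mul_mem_length c hy) (zero_mem _) (fun n x hx => ?_) hx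
    have h1 := hW (r + 1) _ _ hx
    have h2 := wordConnes_mem_length (ih _ _ hx)
    have h3 := ih _ _ (wordConnes_mem_length hx)
    rw [show n + 1 + 2 * (r + 1) = n + (2 * (r + 1) + 1) by ring] at h1
    rw [show n + 1 + (2 * r + 1) + 1 = n + (2 * (r + 1) + 1) by ring] at h2
    rw [show n + 1 + 1 + (2 * r + 1) = n + (2 * (r + 1) + 1) by ring] at h3
    exact sub_mem h1 (add_mem h2 h3)

theorem mixedHomotopy_equivariant [Group G] {W : ℕ → Module.End k (Words k G)}
    (hW : ∀ r (s : G) x, W r (wordMap k (s * ·) x) = wordMap k (s * ·) (W r x)) (r : ℕ) (s : G)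
    (x : Words k G) :
    mixedHomotopy W r (wordMap k (s * ·) x) = wordMap k (s * ·) (mixedHomotopy W r x) := by
  induction r generalizing x with
  | zero =>
    exact coneMap_equivariant (f := (s * ·)) (ρ := (wordMap k (s * ·)).toLinearMap)
      (fun c y => letterMul_equivariant _ c y) (map_zero _) (hW 0 s) x
  | succ r ih =>
    exact coneMap_equivariant (f := (s * ·)) (ρ := (wordMap k (s * ·)).toLinearMap)
      (fun c y => letterMul_equivariant _ c y) (map_zero _)
      (fun x => by simp [ih, wordConnes_wordMap, hW]) x

/-- The entries are found one at a time. The source term of the $r$-th step is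
$W_r-(BK_{r-1}+K_{r-1}B)$. It commutes with $b$ because $W$ commutes with $b+u^{-1}B$, because of
the previous step, and because the commutator of $B$ with the bracket is $B^2K-KB^2$, which is
degenerate. -/
theorem mixedHomotopy_boundary {W : ℕ → Module.End k (Words k G)}
    (hD : ∀ r, ∀ x ∈ degenWords k G, W r x ∈ degenWords k G) (h1 : ∀ r, W r 1 = 0)
    (hW : ∀ r x, (convolve (mixedSeq k G) W - convolve W (mixedSeq k G)) r x ∈ degenWords k G)
    (r : ℕ) (x : Words k G) :
    wordBoundary k G (mixedHomotopy W r x) + mixedHomotopy W r (wordBoundary k G x) -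
      (W r x - connesBracket (mixedHomotopy W) r x) ∈ degenWords k G := by
  have key : ∀ r, (∀ x, wordBoundary k G ((W r - connesBracket (mixedHomotopy W) r) x) +
      (-1 : k) • (W r - connesBracket (mixedHomotopy W) r) (wordBoundary k G x) ∈
        degenWords k G) → ∀ x,
      wordBoundary k G (mixedHomotopy W r x) + mixedHomotopy W r (wordBoundary k G x) -
      (W r x - connesBracket (mixedHomotopy W) r x) ∈ degenWords k G := by
    intro r h x
    have h0 : (W r - connesBracket (mixedHomotopy W) r) 1 = 0 := by
      rw [LinearMap.sub_apply, h1]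
      cases r <;> simp [connesBracket, mixedHomotopy_one]
    have := coneMap_letterMul_boundary letterMul_mem_degenWords h (m₀ := 0) (by simp [h0]) x
    rw [← mixedHomotopy_eq] at this
    convert this using 1
    simp only [LinearMap.sub_apply]
    module
  induction r generalizing x with
  | zero =>
    refine key 0 (fun x => ?_) x
    have := hW 0 x
    simp only [Pi.sub_apply, LinearMap.sub_apply, seqPair_convolve_zero, convolve_seqPair_zero,
      LinearMap.comp_apply] at this
    convert this using 1
    simp only [connesBracket, sub_zero]
    module
  | succ r ih =>
    refine key (r + 1) (fun x => ?_) x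
    have e1 := hW (r + 1) x
    simp only [Pi.sub_apply, LinearMap.sub_apply, seqPair_convolve_succ, convolve_seqPair_succ,
      LinearMap.comp_apply, LinearMap.add_apply] at e1
    have e2 := wordConnes_degenWords (ih x)
    have e3 := ih (wordConnes k G x)
    have e4 : wordConnes k G (connesBracket (mixedHomotopy W) r x) -
        connesBracket (mixedHomotopy W) r (wordConnes k G x) ∈ degenWords k G := by
      cases r with
      | zero => simp [connesBracket]
      | succ r =>
        have := sub_mem (wordConnes_wordConnes (mixedHomotopy W r x))
          (mixedHomotopy_degenWords hD r (wordConnes_wordConnes x))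
        convert this using 1
        simp only [connesBracket, LinearMap.add_apply, LinearMap.comp_apply, map_add]
        abel
    have := add_mem (sub_mem (add_mem e1 e2) e3) (neg_mem e4)
    convert this using 1
    simp only [connesBracket, LinearMap.sub_apply, LinearMap.add_apply, LinearMap.comp_apply,
      map_sub, map_add, wordBoundary_wordConnes, map_neg]
    module

variable [Group G] {f : ℕ → Module.End k (Words k G)}

theorem IsWordComparison.convolve_one (hf : IsWordComparison f)
    (g : ℕ → Module.End k (Words k G)) (r : ℕ) :
    convolve g f r 1 = g r 1 := by
  cases r with
  | zero => simp [convolve_apply, hf.zero]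
  | succ r => simp [convolve_apply, hf.zero, hf.one, Finset.Nat.sum_antidiagonal_succ']

/-- The comparison commutes with the differentials only modulo degenerate words, but these are
killed by the retraction, so the composite is an honest chain map for $b$. -/
theorem IsWordComparison.convolve_wordRetract_boundary (hf : IsWordComparison f) (r : ℕ)
    (x : Words k G) :
    wordBoundary k G (convolve (wordRetract k G) f r x) =
      convolve (wordRetract k G) f r (wordBoundary k G x) := by
  have h : convolve (seqConst (wordBoundary k G)) (convolve (wordRetract k G) f) -
      convolve (convolve (wordRetract k G) f) (seqConst (wordBoundary k G)) =
      convolve (wordRetract k G) (convolve (mixedSeq k G) f -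
        convolve f (seqConst (wordBoundary k G))) := by
    rw [← convolve_assoc, convolve_wordRetract, convolve_sub, convolve_assoc, convolve_assoc]
  have h' := LinearMap.congr_fun (congrFun h r) x
  rw [convolve_apply, Finset.sum_eq_zero fun p _ => wordRetract_degenWords _ (hf.comm _ _)] at h'
  simpa [seqConst_convolve, convolve_seqConst, sub_eq_zero] using h'

theorem IsWordComparison.convolve_equivariant (hf : IsWordComparison f) {M : Type*} [AddCommGroup M] [Module k M]
    {g : ℕ → Words k G →ₗ[k] M} {s : G} {ρ : Module.End k M}
    (hg : ∀ r x, g r (wordMap k (s * ·) x) = ρ (g r x)) (r : ℕ) (x : Words k G) :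
    convolve g f r (wordMap k (s * ·) x) = ρ (convolve g f r x) := by
  simp [convolve_apply, hf.equivariant, hg]

/-- The composite `(E, b, 0) → (E, b, B) → (E, b, 0)` is homotopic to the identity. -/
theorem IsWordComparison.exists_homotopy_left (hf : IsWordComparison f) :
    ∃ H : ℕ → Module.End k (Words k G),
    (∀ r x, wordBoundary k G (H r x) + H r (wordBoundary k G x) =
      convolve (wordRetract k G) f r x - seqConst (LinearMap.id : Module.End k (Words k G)) r x) ∧
    (∀ r (s : G) x, H r (wordMap k (s * ·) x) = wordMap k (s * ·) (H r x)) ∧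
    ∀ r, H r 1 = 0 := by
  -- Both maps fix the empty word in the zeroth entry and kill it in the others, so the homotopy may
  -- start with $0$ on the empty word.
  have hω : ∀ r, (convolve (wordRetract k G) f r - seqConst LinearMap.id r : Module.End k (Words k G)) 1 = 0 := by
    intro r
    rw [LinearMap.sub_apply, hf.convolve_one]
    cases r <;> simp [wordRetract_zero_one, wordRetract_succ_one, seqConst]
  refine ⟨fun r => coneMap (letterMul k) (-1)
    (convolve (wordRetract k G) f r - seqConst LinearMap.id r) 0, fun r x => ?_, fun r s x => ?_,
    fun r => coneMap_one⟩
  · have := coneMap_letterMul_boundary (κ := -1) (D := ⊥) (m₀ := 0)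
      (ω := convolve (wordRetract k G) f r - seqConst LinearMap.id r) (by simp)
      (fun x => by
        rw [LinearMap.sub_apply, LinearMap.sub_apply, map_sub,
          hf.convolve_wordRetract_boundary]
        cases r <;> simp [seqConst]) (by rw [hω]; simp) x
    rw [Submodule.mem_bot, sub_eq_zero] at this
    rw [← LinearMap.sub_apply, ← this]
    rw [neg_one_smul, sub_neg_eq_add]
  · refine coneMap_equivariant (f := (s * ·)) (ρ := (wordMap k (s * ·)).toLinearMap)
      (fun c y => letterMul_equivariant _ c y) (map_zero _) (fun x => ?_) x
    rw [LinearMap.sub_apply, LinearMap.sub_apply, hf.convolve_equivariant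
      (ρ := (wordMap k (s * ·)).toLinearMap) (fun r x => wordRetract_equivariant r s x)]
    cases r <;> simp [seqConst]

theorem IsWordComparison.convolve_length (hf : IsWordComparison f)
    {g : ℕ → Module.End k (Words k G)}
    (hg : ∀ r n, ∀ x ∈ wordsOfLength k G n, g r x ∈ wordsOfLength k G (n + 2 * r)) (r n : ℕ)
    (x : Words k G) (hx : x ∈ wordsOfLength k G n) :
    convolve f g r x ∈ wordsOfLength k G (n + 2 * r) := by
  rw [convolve_apply]
  refine sum_mem fun p hp => ?_
  have := hf.length p.1 _ _ (hg p.2 _ _ hx)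
  rwa [add_assoc, ← mul_add, add_comm p.2, Finset.HasAntidiagonal.mem_antidiagonal.1 hp] at this

/-- The composite `(E, b, B) → (E, b, 0) → (E, b, B)` is homotopic to the identity. -/
theorem IsWordComparison.exists_homotopy_right (hf : IsWordComparison f) :
    ∃ K : ℕ → Module.End k (Words k G),
      (∀ r x, (convolve (mixedSeq k G) K + convolve K (mixedSeq k G) -
        (convolve f (wordRetract k G) - seqConst (LinearMap.id : Module.End k (Words k G)))) r x ∈ degenWords k G) ∧
      (∀ r (s : G) x, K r (wordMap k (s * ·) x) = wordMap k (s * ·) (K r x)) ∧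
      (∀ r, K r 1 = 0) ∧
      (∀ r n, ∀ x ∈ wordsOfLength k G n, K r x ∈ wordsOfLength k G (n + (2 * r + 1))) ∧
      ∀ r, ∀ x ∈ degenWords k G, K r x ∈ degenWords k G := by
  set W := convolve f (wordRetract k G) - seqConst (LinearMap.id : Module.End k (Words k G)) with hWdef
  have hD : ∀ r, ∀ x ∈ degenWords k G, W r x ∈ degenWords k G := by
    intro r x hx
    rw [hWdef, Pi.sub_apply, LinearMap.sub_apply, convolve_apply,
      Finset.sum_eq_zero fun p _ => by rw [wordRetract_degenWords _ hx, map_zero], zero_sub]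
    cases r with
    | zero => exact neg_mem hx
    | succ r => simp [seqConst]
  have h1 : ∀ r, W r 1 = 0 := by
    intro r
    rw [hWdef, Pi.sub_apply, LinearMap.sub_apply, convolve_apply]
    cases r with
    | zero => simp [wordRetract_zero_one, hf.zero, seqConst]
    | succ r => simp [Finset.Nat.sum_antidiagonal_succ', wordRetract_zero_one,
        wordRetract_succ_one, hf.one, seqConst]
  have hW : ∀ r x, (convolve (mixedSeq k G) W - convolve W (mixedSeq k G)) r x ∈
      degenWords k G := by
    intro r x
    -- The identity contributes nothing to the commutator, and the retraction commutes strictly.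
    -- What remains is the failure of $f$ to commute, evaluated on the retraction.
    have h : convolve (mixedSeq k G) W - convolve W (mixedSeq k G) =
        convolve (convolve (mixedSeq k G) f - convolve f (seqConst (wordBoundary k G)))
          (wordRetract k G) := by
      rw [hWdef, convolve_sub, sub_convolve, sub_convolve, convolve_assoc, convolve_assoc,
        convolve_assoc, convolve_wordRetract, convolve_id, id_convolve]
      abel
    rw [h, convolve_apply]
    exact sum_mem fun p _ => hf.comm _ _
  refine ⟨mixedHomotopy W, fun r x => ?_, mixedHomotopy_equivariant fun r s x => ?_,
    mixedHomotopy_one W, mixedHomotopy_length fun r n x hx =>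
      sub_mem (hf.convolve_length wordRetract_length r n x hx) (seqConst_id_length r n x hx),
    fun r x hx => mixedHomotopy_degenWords hD r hx⟩
  · have := mixedHomotopy_boundary hD h1 hW r x
    convert this using 1
    cases r with
    | zero =>
      simp only [Pi.sub_apply, Pi.add_apply, LinearMap.sub_apply, LinearMap.add_apply,
        seqPair_convolve_zero, convolve_seqPair_zero, LinearMap.comp_apply, connesBracket,
        LinearMap.zero_apply, sub_zero]
    | succ r =>
      simp only [Pi.sub_apply, Pi.add_apply, LinearMap.sub_apply, LinearMap.add_apply,
        seqPair_convolve_succ, convolve_seqPair_succ, LinearMap.comp_apply, connesBracket]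
      abel
  · rw [hWdef, Pi.sub_apply, LinearMap.sub_apply, LinearMap.sub_apply, map_sub]
    congr 1
    · simp [convolve_apply, wordRetract_equivariant, hf.equivariant]
    · cases r <;> simp [seqConst]

end Homotopies

end Comparison

end HopfCyclic

end

noncomputable section

namespace HopfCyclic

/-! ## The coproduct and the comparison -/

/-! ### A contraction of the tensor square of the resolution -/

section TensorContraction

variable {k : Type*} [CommRing k] {S : Type*}

variable (k) in
/-- Multiplication with the letter `c`, corrected on the empty word. -/
def reducedMul (c : S) : Module.End k (Words k S) :=
  letterMul k c - (emptyCoeff k S).smulRight (word k [c])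

variable (k) in
/-- The projection of words of length one to the multiples of `c`. -/
def letterProj (c : S) : Module.End k (Words k S) :=
  (emptyCoeff k S ∘ₗ wordBoundary k S).smulRight (word k [c])

theorem reducedMul_apply (c : S) (x : Words k S) :
    reducedMul k c x = word k [c] * x - emptyCoeff k S x • word k [c] := rfl

theorem letterProj_apply (c : S) (x : Words k S) :
    letterProj k c x = emptyCoeff k S (wordBoundary k S x) • word k [c] := rfl

variable (k) in
/-- The contraction of the tensor square of the complex of words in positive degrees. -/
def tensorContraction (c : S) : Module.End k (WordTensor k S S) :=
  TensorProduct.map (reducedMul k c) LinearMap.id +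
    TensorProduct.map (letterProj k c) (reducedMul k c)

theorem tensorContraction_tmul (c : S) (x y : Words k S) : tensorContraction k c (x ⊗ₜ y) =
    reducedMul k c x ⊗ₜ y + letterProj k c x ⊗ₜ reducedMul k c y := by
  simp [tensorContraction]

theorem emptyCoeff_wordSign (x : Words k S) :
    emptyCoeff k S (wordSign k S x) = -emptyCoeff k S x :=
  LinearMap.congr_fun (f := emptyCoeff k S ∘ₗ wordSign k S) (g := -emptyCoeff k S)
    (words_hom_ext fun l => by cases l <;> simp [emptyCoeff_word]) x

theorem emptyCoeff_wordConnes (x : Words k S) : emptyCoeff k S (wordConnes k S x) = 0 := by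
  refine LinearMap.congr_fun (f := emptyCoeff k S ∘ₗ wordConnes k S) (g := 0)
    (words_hom_ext fun l => ?_) x
  refine wordSpan_map_le (f := emptyCoeff k S) (W := ⊥) (fun m hm => ?_) (wordConnes_mem_length (word_mem_length l))
  simp [emptyCoeff_word, hm]

theorem emptyCoeff_wordBoundary_of_length {n : ℕ} {x : Words k S}
    (hx : x ∈ wordsOfLength k S (n + 2)) : emptyCoeff k S (wordBoundary k S x) = 0 :=
  wordSpan_map_le (f := emptyCoeff k S ∘ₗ wordBoundary k S) (W := ⊥) (fun m hm => by
    simp [emptyCoeff_word_eq, hm]) hx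

theorem emptyCoeff_of_mem_degenWords {x : Words k S} (hx : x ∈ degenWords k S) :
    emptyCoeff k S x = 0 :=
  wordSpan_map_le (W := ⊥) (fun m hm => by
    cases m with
    | nil => simp [Degenerate] at hm
    | cons => simp [emptyCoeff_word]) hx

/-- Connes' operator raises degrees and therefore has no component in bidegree $(0,0)$. -/
theorem letterCoeff_tensorConnes (z : WordTensor k S S) :
    letterCoeff k S S (tensorConnes k S S z) = 0 :=
  LinearMap.congr_fun (f := letterCoeff k S S ∘ₗ tensorConnes k S S) (g := 0)
    (TensorProduct.ext' fun x y => by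
      simp [tensorConnes_tmul, letterCoeff_tmul, wordBoundary_wordConnes, emptyCoeff_wordConnes]) z

theorem emptyCoeff_boundary_reducedMul (c : S) (x : Words k S) :
    emptyCoeff k S (wordBoundary k S (reducedMul k c x)) = 0 := by
  simp [reducedMul_apply, wordBoundary_letter_mul]

theorem letterCoeff_tensorContraction (c : S) (z : WordTensor k S S) :
    letterCoeff k S S (tensorContraction k c z) = 0 :=
  LinearMap.congr_fun (f := letterCoeff k S S ∘ₗ tensorContraction k c) (g := 0)
    (TensorProduct.ext' fun x y => by
      simp [tensorContraction_tmul, letterCoeff_tmul, emptyCoeff_boundary_reducedMul]) z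

theorem reducedMul_degenWordsOne (c : S) {x : Words k S} (hx : x ∈ degenWordsOne k S) :
    reducedMul k c x ∈ degenWordsOne k S := by
  refine degenWordsOne_map (fun x hx => ?_) ?_ hx
  · rw [reducedMul_apply, emptyCoeff_of_mem_degenWords hx, zero_smul, sub_zero]
    exact degenWords_le_one (mul_mem_degenWords_left _ hx)
  · simp [reducedMul_apply]

theorem letterProj_degenWordsOne (c : S) {x : Words k S} (hx : x ∈ degenWordsOne k S) :
    letterProj k c x = 0 :=
  degenWordsOne_map (W := ⊥) (fun x hx => by
    rw [letterProj_apply, emptyCoeff_of_mem_degenWords (wordBoundary_mem_degenWords hx), zero_smul]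
    exact zero_mem _) (by simp [letterProj_apply]) hx

theorem tensorContraction_degenTensorsOne (c : S) (z : WordTensor k S S)
    (hz : z ∈ degenTensorsOne k S S) : tensorContraction k c z ∈ degenTensorsOne k S S := by
  refine tensorIdeal_map (fun x hx y => ?_) (fun x y hy => ?_) hz <;>
    rw [tensorContraction_tmul]
  · rw [letterProj_degenWordsOne c hx, TensorProduct.zero_tmul, add_zero]
    exact tmul_mem_tensorIdeal_left (reducedMul_degenWordsOne c hx) _
  · exact add_mem (tmul_mem_tensorIdeal_right _ hy)
      (tmul_mem_tensorIdeal_right _ (reducedMul_degenWordsOne c hy))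

theorem wordBoundary_reducedMul (c : S) (x : Words k S) :
    wordBoundary k S (reducedMul k c x) =
      x - reducedMul k c (wordBoundary k S x) - emptyCoeff k S x • 1 - letterProj k c x := by
  simp only [reducedMul_apply, letterProj_apply, map_sub, wordBoundary_letter_mul, map_smul,
    wordBoundary_letter]
  abel

theorem wordSign_reducedMul (c : S) (x : Words k S) :
    wordSign k S (reducedMul k c x) = -reducedMul k c (wordSign k S x) := by
  have h : wordSign k S (word k [c]) = word k [c] := by simp
  simp only [reducedMul_apply, map_sub, map_smul, wordSign_letter_mul, emptyCoeff_wordSign, h]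
  module

theorem wordSign_letterProj (c : S) (x : Words k S) :
    wordSign k S (letterProj k c x) = letterProj k c x := by
  have h : wordSign k S (word k [c]) = word k [c] := by simp
  rw [letterProj_apply, map_smul, h]

theorem letterProj_wordSign (c : S) (x : Words k S) :
    letterProj k c (wordSign k S x) = letterProj k c x := by
  simp [letterProj_apply, wordBoundary_wordSign, emptyCoeff_wordSign]

/-- The standard contraction $h\otimes1+\epsilon\otimes h$ of a tensor product. `reducedMul` is
corrected so that it creates no letter from the empty word, since tensors with an empty factor count
as zero here. The price is the augmentation term, so it is a contraction on the kernel of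
`letterCoeff` only. -/
theorem tensorBoundary_tensorContraction (c : S) (z : WordTensor k S S) :
    tensorBoundary k S S (tensorContraction k c z) + tensorContraction k c (tensorBoundary k S S z)
      - z + letterCoeff k S S z • (word k [c] ⊗ₜ word k [c]) ∈ degenTensorsOne k S S := by
  induction z using TensorProduct.induction_on with
  | zero => simp
  | add z z' hz hz' =>
    convert add_mem hz hz' using 1
    simp only [map_add]
    module
  | tmul x y =>
    have h1 := tmul_mem_tensorIdeal_left (U := degenWordsOne k S) (U' := degenWordsOne k S)
      one_mem_degenWordsOne
      (emptyCoeff k S (wordBoundary k S x) • reducedMul k c y - emptyCoeff k S x • y)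
    have h2 := tmul_mem_tensorIdeal_right (U := degenWordsOne k S) (U' := degenWordsOne k S)
      (-(emptyCoeff k S y) • letterProj k c x) one_mem_degenWordsOne
    convert add_mem h1 h2 using 1
    rw [tensorContraction_tmul, map_add, tensorBoundary_tmul, tensorBoundary_tmul,
      tensorBoundary_tmul, map_add, tensorContraction_tmul, tensorContraction_tmul,
      wordSign_reducedMul, wordSign_letterProj, letterProj_wordSign, wordBoundary_reducedMul,
      wordBoundary_reducedMul, letterCoeff_tmul]
    simp only [letterProj_apply, map_smul, wordBoundary_letter, wordBoundary_wordBoundary, map_zero,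
      zero_smul, TensorProduct.zero_tmul, TensorProduct.sub_tmul, TensorProduct.tmul_sub,
      ← TensorProduct.smul_tmul', TensorProduct.tmul_smul, TensorProduct.neg_tmul]
    module

theorem tensorContraction_equivariant (f : S → S) (c : S) (z : WordTensor k S S) :
    tensorWordMap f f (tensorContraction k c z) =
      tensorContraction k (f c) (tensorWordMap f f z) :=
  LinearMap.congr_fun (f := tensorWordMap f f ∘ₗ tensorContraction k c)
    (g := tensorContraction k (f c) ∘ₗ tensorWordMap f f)
    (TensorProduct.ext' fun x y => by
      simp [tensorContraction_tmul, reducedMul_apply, letterProj_apply, wordBoundary_wordMap]) z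

end TensorContraction

/-! ### Compatibility of a comparison with the coproducts, up to homotopy -/

section Cup

variable {k : Type*} [CommRing k] {G : Type*}

variable (k G) in
/-- The entries of the cyclic Alexander–Whitney map on diagonal words. -/
def cupSeq (r : ℕ) : Words k G →ₗ[k] WordTensor k G G :=
  wordCyclicAW k G G r ∘ₗ (wordMap k fun g : G => (g, g)).toLinearMap

variable (k G) in
/-- The sequence of differentials of the tensor square of the mixed complex of words. -/
abbrev tensorSeq : ℕ → Module.End k (WordTensor k G G) :=
  seqPair (tensorBoundary k G G) (tensorConnes k G G)

theorem cupSeq_apply (r : ℕ) (x : Words k G) :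
    cupSeq k G r x = wordCyclicAW k G G r (wordMap k (fun g : G => (g, g)) x) := rfl

@[simp] theorem cupSeq_one (r : ℕ) : cupSeq k G r 1 = 0 := by simp [cupSeq_apply]

theorem cupSeq_degenWords (r : ℕ) {x : Words k G} (hx : x ∈ degenWords k G) :
    cupSeq k G r x ∈ degenTensors k G G :=
  wordCyclicAW_degenWords r (wordMap_mem_degenWords _ hx)

theorem cupSeq_equivariant (r : ℕ) (f : G → G) (x : Words k G) :
    cupSeq k G r (wordMap k f x) = tensorWordMap f f (cupSeq k G r x) := by
  rw [cupSeq_apply, cupSeq_apply, ← wordCyclicAW_wordMap, wordMap_wordMap, wordMap_wordMap]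
  rfl

theorem tensorBoundary_cupSeq_zero (x : Words k G) :
    tensorBoundary k G G (cupSeq k G 0 x) =
      cupSeq k G 0 (wordBoundary k G x) + 1 ⊗ₜ x + wordSign k G x ⊗ₜ 1 := by
  rw [cupSeq_apply, cupSeq_apply, ← wordBoundary_wordMap]
  refine (tensorBoundary_wordAW _).trans ?_
  rw [wordMap_wordMap, wordMap_wordMap]
  have : ∀ h : G → G, h = id → wordMap k h x = x := by rintro _ rfl; exact wordMap_id x
  rw [this _ (by rfl), this _ (by rfl)]
  rfl

theorem cupSeq_comm (r : ℕ) (x : Words k G) :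
    (convolve (tensorSeq k G) (cupSeq k G) - convolve (cupSeq k G) (mixedSeq k G)) r x ∈
      degenTensorsOne k G G := by
  cases r with
  | zero =>
    have := tensorBoundary_wordAW_mem (wordMap k (fun g : G => (g, g)) x)
    simpa [seqPair_convolve_zero, convolve_seqPair_zero, cupSeq_apply, wordBoundary_wordMap,
      wordCyclicAW] using this
  | succ r =>
    have := tensorBoundary_wordCyclicAW r (wordMap k (fun g : G => (g, g)) x)
    rw [wordBoundary_wordMap, wordConnes_wordMap] at this
    convert this using 1
    simp only [Pi.sub_apply, LinearMap.sub_apply, seqPair_convolve_succ, convolve_seqPair_succ,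
      cupSeq_apply, LinearMap.comp_apply, LinearMap.add_apply]
    abel

/-- Every higher entry has the form $AW\circ B$ after a map. In degree zero $AW$ is governed by the
coefficient of the empty word in $bB=-Bb$, which is $0$. -/
theorem letterCoeff_cupSeq_succ (r : ℕ) (x : Words k G) :
    letterCoeff k G G (cupSeq k G (r + 1) x) = 0 := by
  have key : ∀ r (y : Words k (G × G)), letterCoeff k G G (wordCyclicAW k G G (r + 1) y) = 0 := by
    intro r
    induction r with
    | zero =>
      intro y
      rw [wordCyclicAW_succ, map_neg]
      refine neg_eq_zero.2 ((letterCoeff_wordAW _).trans ?_)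
      rw [wordBoundary_wordConnes, map_neg, emptyCoeff_wordConnes, neg_zero]
    | succ r ih =>
      intro y
      rw [wordCyclicAW_succ, map_neg, ih, neg_zero]
  exact key r _

theorem letterCoeff_cupSeq_zero (x : Words k G) :
    letterCoeff k G G (cupSeq k G 0 x) = emptyCoeff k G (wordBoundary k G x) := by
  rw [cupSeq_apply]
  refine (letterCoeff_wordAW _).trans ?_
  rw [wordBoundary_wordMap, emptyCoeff_wordMap]

/-- Written with box products, the differential of the tensor square can be handled by
`convolve_boxProduct`, that is, factor by factor. -/
theorem tensorSeq_eq : tensorSeq k G =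
    boxProduct (mixedSeq k G) (seqConst LinearMap.id) +
      boxProduct (seqConst (wordSign k G)) (mixedSeq k G) := by
  funext r
  refine TensorProduct.ext' fun x y => ?_
  rcases r with - | - | r
  · simp [boxProduct_tmul, seqPair, seqConst, tensorBoundary_tmul]
  · simp [boxProduct_tmul, seqPair, seqConst, tensorConnes_tmul, Finset.Nat.sum_antidiagonal_succ]
  · simp only [Pi.add_apply, LinearMap.add_apply, boxProduct_tmul]
    rw [Finset.Nat.sum_antidiagonal_succ', Finset.Nat.sum_antidiagonal_succ
      (f := fun p : ℕ × ℕ => seqConst (wordSign k G) p.1 x ⊗ₜ[k] mixedSeq k G p.2 y)]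
    simp [seqPair, seqConst]

theorem seqConst_tensorBoundary_eq : seqConst (tensorBoundary k G G) =
    boxProduct (seqConst (wordBoundary k G)) (seqConst LinearMap.id) +
      boxProduct (seqConst (wordSign k G)) (seqConst (wordBoundary k G)) := by
  funext r
  refine TensorProduct.ext' fun x y => ?_
  rcases r with - | r
  · simp [boxProduct_tmul, seqConst, tensorBoundary_tmul]
  · simp [boxProduct_tmul, seqConst, Finset.Nat.sum_antidiagonal_succ]

theorem boxProduct_mem_left {f g : ℕ → Module.End k (Words k G)}
    (hf : ∀ r x, f r x ∈ degenWords k G) (r : ℕ) (z : WordTensor k G G) :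
    boxProduct f g r z ∈ degenTensorsOne k G G := by
  induction z using TensorProduct.induction_on with
  | zero => simp
  | add z z' hz hz' => rw [map_add]; exact add_mem hz hz'
  | tmul x y =>
    rw [boxProduct_tmul]
    exact sum_mem fun p _ => tmul_mem_tensorIdeal_left (degenWords_le_one (hf _ _)) _

theorem boxProduct_mem_right {f g : ℕ → Module.End k (Words k G)}
    (hg : ∀ r x, g r x ∈ degenWords k G) (r : ℕ) (z : WordTensor k G G) :
    boxProduct f g r z ∈ degenTensorsOne k G G := by
  induction z using TensorProduct.induction_on with
  | zero => simp
  | add z z' hz hz' => rw [map_add]; exact add_mem hz hz'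
  | tmul x y =>
    rw [boxProduct_tmul]
    exact sum_mem fun p _ => tmul_mem_tensorIdeal_right _ (degenWords_le_one (hg _ _))

variable {f : ℕ → Module.End k (Words k G)}

variable (f) in
/-- The deviation of a comparison from compatibility with the coproducts. -/
def cupDefect : ℕ → Words k G →ₗ[k] WordTensor k G G :=
  convolve (cupSeq k G) f - convolve (boxProduct f f) (seqConst (cupSeq k G 0))

variable (f) in
/-- The homotopy for the compatibility of a comparison with the coproducts. -/
def cupHomotopy : ℕ → Words k G →ₗ[k] WordTensor k G G
  | 0 => 0
  | r + 1 => coneMap (tensorContraction k) (-1)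
      (cupDefect f (r + 1) - tensorConnes k G G ∘ₗ cupHomotopy r) 0

theorem cupHomotopy_one (r : ℕ) : cupHomotopy f r 1 = 0 := by
  cases r with
  | zero => rfl
  | succ r => exact coneMap_one

theorem tensorBoundary_tensorConnes (z : WordTensor k G G) :
    tensorBoundary k G G (tensorConnes k G G z) = -tensorConnes k G G (tensorBoundary k G G z) :=
  LinearMap.congr_fun (f := tensorBoundary k G G ∘ₗ tensorConnes k G G)
    (g := -(tensorConnes k G G ∘ₗ tensorBoundary k G G)) (TensorProduct.ext' fun x y => by
      simp [tensorConnes_tmul, tensorBoundary_tmul, wordBoundary_wordConnes, wordBoundary_wordSign,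
        wordConnes_wordSign, TensorProduct.neg_tmul, TensorProduct.tmul_neg]
      abel) z

theorem tensorConnes_tensorConnes (z : WordTensor k G G) :
    tensorConnes k G G (tensorConnes k G G z) ∈ degenTensorsOne k G G := by
  induction z using TensorProduct.induction_on with
  | zero => simp
  | add z z' hz hz' => rw [map_add, map_add]; exact add_mem hz hz'
  | tmul x y =>
    have h1 := tmul_mem_tensorIdeal_left (U := degenWordsOne k G) (U' := degenWordsOne k G)
      (degenWords_le_one (wordConnes_wordConnes x)) y
    have h2 := tmul_mem_tensorIdeal_right (U := degenWordsOne k G) (U' := degenWordsOne k G)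
      (wordSign k G (wordSign k G x)) (degenWords_le_one (wordConnes_wordConnes y))
    convert add_mem h1 h2 using 1
    simp only [tensorConnes_tmul, map_add, wordConnes_wordSign, TensorProduct.neg_tmul]
    abel

variable [Group G]

theorem IsWordComparison.one_mem (hf : IsWordComparison f) (r : ℕ) :
    f r 1 ∈ degenWordsOne k G := by
  cases r with
  | zero => rw [hf.zero]; exact one_mem_degenWordsOne
  | succ r => rw [hf.one]; exact zero_mem _

theorem IsWordComparison.wordSign_comm (hf : IsWordComparison f) :
    convolve (seqConst (wordSign k G)) f = convolve f (seqConst (wordSign k G)) := by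
  funext r
  refine words_hom_ext fun l => ?_
  rw [seqConst_convolve, convolve_seqConst, LinearMap.comp_apply, LinearMap.comp_apply,
    wordSign_word, map_smul, wordSign_of_mem (hf.length r _ _ (word_mem_length l))]
  congr 1
  rw [add_right_comm, pow_add _ _ (2 * r), pow_mul]
  simp

/-- The commutator of the defect with the differentials is a sum of failures that are all
negligible: those of the cyclic Alexander–Whitney map, of $f$, of $f\otimes f$, and of $AW$ on
augmented complexes. The last produces only tensors with an empty factor. -/
theorem IsWordComparison.cupDefect_comm (hf : IsWordComparison f) (r : ℕ) (x : Words k G) :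
    (convolve (tensorSeq k G) (cupDefect f) -
      convolve (cupDefect f) (seqConst (wordBoundary k G))) r x ∈ degenTensorsOne k G G := by
  have h1 : convolve (tensorSeq k G) (boxProduct f f) -
      convolve (boxProduct f f) (seqConst (tensorBoundary k G G)) =
      boxProduct (convolve (mixedSeq k G) f - convolve f (seqConst (wordBoundary k G))) f +
      boxProduct (convolve (seqConst (wordSign k G)) f)
        (convolve (mixedSeq k G) f - convolve f (seqConst (wordBoundary k G))) := by
    rw [tensorSeq_eq, seqConst_tensorBoundary_eq, add_convolve, convolve_add, convolve_boxProduct,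
      convolve_boxProduct, convolve_boxProduct, convolve_boxProduct, sub_boxProduct,
      boxProduct_sub, hf.wordSign_comm, id_convolve, convolve_id]
    abel
  have h2 : convolve (tensorSeq k G) (cupDefect f) -
      convolve (cupDefect f) (seqConst (wordBoundary k G)) =
      convolve (convolve (tensorSeq k G) (cupSeq k G) - convolve (cupSeq k G) (mixedSeq k G)) f +
      convolve (cupSeq k G) (convolve (mixedSeq k G) f - convolve f (seqConst (wordBoundary k G))) -
      convolve (convolve (tensorSeq k G) (boxProduct f f) -
        convolve (boxProduct f f) (seqConst (tensorBoundary k G G))) (seqConst (cupSeq k G 0)) -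
      convolve (boxProduct f f) (convolve (seqConst (tensorBoundary k G G))
        (seqConst (cupSeq k G 0)) -
          convolve (seqConst (cupSeq k G 0)) (seqConst (wordBoundary k G))) := by
    simp only [cupDefect, convolve_sub, sub_convolve, convolve_assoc]
    abel
  rw [h2, h1]
  refine sub_mem (sub_mem (add_mem ?_ ?_) ?_) ?_
  · rw [convolve_apply]
    exact sum_mem fun p _ => cupSeq_comm _ _
  · rw [convolve_apply]
    exact sum_mem fun p _ => degenTensors_le_one (cupSeq_degenWords _ (hf.comm _ _))
  · rw [convolve_seqConst]
    exact add_mem (boxProduct_mem_left hf.comm _ _) (boxProduct_mem_right hf.comm _ _)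
  -- These are the augmentation terms $1\otimes x$ and $\pm x\otimes1$; $f$ maps the empty word to
  -- the empty word or to $0$, so they stay among the tensors with an empty factor.
  · have h3 : ∀ r x, (convolve (seqConst (tensorBoundary k G G)) (seqConst (cupSeq k G 0)) -
          convolve (seqConst (cupSeq k G 0)) (seqConst (wordBoundary k G))) r x =
          if r = 0 then 1 ⊗ₜ x + wordSign k G x ⊗ₜ 1 else 0 := by
      intro r x
      cases r with
      | zero =>
        simp only [Pi.sub_apply, LinearMap.sub_apply, seqConst_convolve, LinearMap.comp_apply,
          seqConst, tensorBoundary_cupSeq_zero, if_true]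
        abel
      | succ r => simp [seqConst_convolve, seqConst]
    rw [convolve_apply]
    refine sum_mem fun p _ => ?_
    rw [h3]
    split_ifs
    · rw [map_add, boxProduct_tmul, boxProduct_tmul]
      exact add_mem (sum_mem fun p _ => tmul_mem_tensorIdeal_left (hf.one_mem _) _)
        (sum_mem fun p _ => tmul_mem_tensorIdeal_right _ (hf.one_mem _))
    · rw [map_zero]; exact zero_mem _

theorem IsWordComparison.cupDefect_zero (hf : IsWordComparison f) : cupDefect f 0 = 0 := by
  have : boxProduct f f 0 = LinearMap.id := by
    simp [boxProduct, hf.zero]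
  rw [cupDefect, Pi.sub_apply, convolve_seqConst, this]
  refine LinearMap.ext fun x => ?_
  simp [convolve_apply, hf.zero]

theorem IsWordComparison.emptyCoeff_succ (hf : IsWordComparison f) (r : ℕ) (x : Words k G) :
    emptyCoeff k G (wordBoundary k G (f (r + 1) x)) = 0 :=
  LinearMap.congr_fun (f := emptyCoeff k G ∘ₗ wordBoundary k G ∘ₗ f (r + 1)) (g := 0)
    (words_hom_ext fun l => emptyCoeff_wordBoundary_of_length (n := l.length + 2 * r)
      (hf.length (r + 1) _ _ (word_mem_length l))) x

/-- An entry of index at least one raises the degree by at least two, so it cannot reach bidegree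
$(0,0)$. This places the defect in the part where the tensor square is contractible. -/
theorem IsWordComparison.letterCoeff_cupDefect (hf : IsWordComparison f) (r : ℕ) (x : Words k G) :
    letterCoeff k G G (cupDefect f r x) = 0 := by
  cases r with
  | zero => simp [hf.cupDefect_zero]
  | succ r =>
    have h : ∀ z, letterCoeff k G G (boxProduct f f (r + 1) z) = 0 := by
      intro z
      refine LinearMap.congr_fun (f := letterCoeff k G G ∘ₗ boxProduct f f (r + 1)) (g := 0)
        (TensorProduct.ext' fun x y => ?_) z
      rw [LinearMap.comp_apply, boxProduct_tmul, map_sum]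
      refine Finset.sum_eq_zero fun p hp => ?_
      rw [letterCoeff_tmul]
      obtain ⟨a, b⟩ := p
      rcases a with - | a
      · rcases b with - | b
        · simp at hp
        · rw [hf.emptyCoeff_succ, mul_zero]
      · rw [hf.emptyCoeff_succ, zero_mul]
    rw [cupDefect, Pi.sub_apply, LinearMap.sub_apply, map_sub, convolve_seqConst,
      LinearMap.comp_apply, h, sub_zero, convolve_apply, map_sum]
    refine Finset.sum_eq_zero fun p hp => ?_
    obtain ⟨a, b⟩ := p
    rcases a with - | a
    · rcases b with - | b
      · simp at hp
      · rw [letterCoeff_cupSeq_zero, hf.emptyCoeff_succ]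
    · exact letterCoeff_cupSeq_succ _ _

theorem IsWordComparison.cupDefect_one (hf : IsWordComparison f) (r : ℕ) :
    cupDefect f r 1 = 0 := by
  rw [cupDefect, Pi.sub_apply, LinearMap.sub_apply, convolve_seqConst, LinearMap.comp_apply,
    cupSeq_one, map_zero, sub_zero, convolve_apply]
  refine Finset.sum_eq_zero fun p _ => ?_
  obtain ⟨a, b⟩ := p
  cases b <;> simp [hf.zero, hf.one]

theorem IsWordComparison.cupDefect_equivariant (hf : IsWordComparison f) (r : ℕ) (s : G)
    (x : Words k G) :
    cupDefect f r (wordMap k (s * ·) x) = tensorWordMap (s * ·) (s * ·) (cupDefect f r x) := by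
  have h : ∀ z, boxProduct f f r (tensorWordMap (s * ·) (s * ·) z) =
      tensorWordMap (s * ·) (s * ·) (boxProduct f f r z) := by
    intro z
    refine LinearMap.congr_fun (f := boxProduct f f r ∘ₗ tensorWordMap (s * ·) (s * ·))
      (g := tensorWordMap (s * ·) (s * ·) ∘ₗ boxProduct f f r) (TensorProduct.ext' fun x y => ?_) z
    simp [boxProduct_tmul, hf.equivariant]
  rw [cupDefect, Pi.sub_apply, LinearMap.sub_apply, LinearMap.sub_apply, map_sub,
    hf.convolve_equivariant (fun r x => cupSeq_equivariant r _ x), convolve_seqConst,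
    LinearMap.comp_apply, LinearMap.comp_apply, cupSeq_equivariant, h]

/-- Since $f_0$ is the identity, the zeroth defect vanishes and the homotopy may start with $0$.
Each further entry is obtained from the contraction with `letterCoeff` zero; the condition on its
source term is the commutation of the defect, the previous step, and $B^2\equiv0$ on the tensor
square. -/
theorem IsWordComparison.cupHomotopy_boundary (hf : IsWordComparison f) (r : ℕ) (x : Words k G) :
    (convolve (tensorSeq k G) (cupHomotopy f) +
      convolve (cupHomotopy f) (seqConst (wordBoundary k G)) - cupDefect f) r x ∈
      degenTensorsOne k G G := by
  have key : ∀ r x, (∀ x, tensorBoundary k G G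
      ((cupDefect f (r + 1) - tensorConnes k G G ∘ₗ cupHomotopy f r) x) + (-1 : k) •
      (cupDefect f (r + 1) - tensorConnes k G G ∘ₗ cupHomotopy f r) (wordBoundary k G x) ∈
        degenTensorsOne k G G) → tensorBoundary k G G (cupHomotopy f (r + 1) x) +
      cupHomotopy f (r + 1) (wordBoundary k G x) + tensorConnes k G G (cupHomotopy f r x) -
        cupDefect f (r + 1) x ∈ degenTensorsOne k G G := by
    intro r x h
    have := coneMap_boundary (κ := -1) (m₀ := 0) (D := degenTensorsOne k G G)
      (M' := LinearMap.ker (letterCoeff k G G))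
      (ω := cupDefect f (r + 1) - tensorConnes k G G ∘ₗ cupHomotopy f r)
      (fun c y hy => by
        have := tensorBoundary_tensorContraction c y
        rwa [LinearMap.mem_ker.1 hy, zero_smul, add_zero] at this)
      tensorContraction_degenTensorsOne (fun c y => letterCoeff_tensorContraction c y)
      (zero_mem _)
      (fun x => by simp [hf.letterCoeff_cupDefect, letterCoeff_tensorConnes]) h
      (by simp [hf.cupDefect_one, cupHomotopy_one]) x
    convert this using 1
    simp only [cupHomotopy, LinearMap.sub_apply, LinearMap.comp_apply]
    module
  induction r generalizing x with
  | zero => simp [seqPair_convolve_zero, convolve_seqConst, cupHomotopy, hf.cupDefect_zero]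
  | succ r ih =>
    have := key r x fun x => ?_
    · convert this using 1
      simp only [Pi.sub_apply, Pi.add_apply, LinearMap.sub_apply, LinearMap.add_apply,
        seqPair_convolve_succ, convolve_seqConst, LinearMap.comp_apply]
      abel
    · have e1 := hf.cupDefect_comm (r + 1) x
      have e2 := tensorConnes_degenTensorsOne (ih x)
      have e3 : tensorConnes k G G (convolve (tensorSeq k G) (cupHomotopy f) r x) -
          tensorConnes k G G (tensorBoundary k G G (cupHomotopy f r x)) ∈
          degenTensorsOne k G G := by
        cases r with
        | zero => simp [seqPair_convolve_zero]
        | succ r =>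
          rw [seqPair_convolve_succ, ← map_sub]
          simpa using tensorConnes_tensorConnes (cupHomotopy f r x)
      have := sub_mem (add_mem e1 e2) e3
      convert this using 1
      simp only [Pi.sub_apply, Pi.add_apply, LinearMap.sub_apply, LinearMap.add_apply,
        seqPair_convolve_succ, convolve_seqConst, LinearMap.comp_apply, map_sub, map_add,
        tensorBoundary_tensorConnes]
      module

theorem IsWordComparison.cupHomotopy_equivariant (hf : IsWordComparison f) (r : ℕ) (s : G)
    (x : Words k G) :
    cupHomotopy f r (wordMap k (s * ·) x) = tensorWordMap (s * ·) (s * ·) (cupHomotopy f r x) := by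
  induction r generalizing x with
  | zero => simp [cupHomotopy]
  | succ r ih =>
    exact coneMap_equivariant (f := (s * ·)) (ρ := tensorWordMap (s * ·) (s * ·))
      (fun c y => tensorContraction_equivariant _ c y) (map_zero _)
      (fun x => by simp [ih, tensorConnes_wordMap, hf.cupDefect_equivariant]) x

end Cup

end HopfCyclic

end

noncomputable section

namespace HopfCyclic

/-! ## The structure maps of the cyclic module of words -/

section Operators

variable {k : Type*} [CommRing k] {S : Type*}

variable (k S) in
/-- The face deleting the letter in position `i`. -/
def wordFace (i : ℕ) : Module.End k (Words k S) :=
  wordLift fun l => if i < l.length ∧ 2 ≤ l.length then word k (l.eraseIdx i) else 0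

variable (k S) in
/-- The degeneracy repeating the letter in position `i`. -/
def wordDegen (i : ℕ) : Module.End k (Words k S) :=
  wordLift fun l => if i < l.length then word k (l.take (i + 1) ++ l.drop i) else 0

variable (k S) in
/-- The cyclic operator moving the last letter to the front. -/
def wordRot : Module.End k (Words k S) := wordLift fun l => word k (l.rotate (l.length - 1))

theorem wordFace_word {i : ℕ} {l : List S} (h : i < l.length) (h' : 2 ≤ l.length) :
    wordFace k S i (word k l) = word k (l.eraseIdx i) := by
  simp [wordFace, h, h']

theorem wordDegen_word {i : ℕ} {l : List S} (h : i < l.length) :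
    wordDegen k S i (word k l) = word k (l.take (i + 1) ++ l.drop i) := by
  simp [wordDegen, h]

theorem wordDegen_append_singleton (v : List S) (c : S) :
    wordDegen k S v.length (word k (v ++ [c])) = word k (v ++ [c, c]) := by
  rw [wordDegen_word (by simp)]
  simp [List.take_of_length_le]

theorem wordRot_append_singleton (v : List S) (c : S) :
    wordRot k S (word k (v ++ [c])) = word k (c :: v) := by
  simp [wordRot]

theorem wordRot_pow (v u : List S) :
    (wordRot k S ^ u.length) (word k (v ++ u)) = word k (u ++ v) := by
  induction u generalizing v with
  | nil => simp
  | cons c u ih =>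
    have := ih (v ++ [c])
    rw [List.append_assoc, List.singleton_append] at this
    rw [List.length_cons, pow_succ', Module.End.mul_apply, this, ← List.append_assoc,
      wordRot_append_singleton, List.cons_append]

theorem wordFace_range' {s j : ℕ} {l : List S} (hs : 1 ≤ s) (h : s + j ≤ l.length) :
    (((List.range' s j).map (wordFace k S)).prod) (word k l) =
      word k (l.take s ++ l.drop (s + j)) := by
  induction j generalizing l with
  | zero => simp
  | succ j ih =>
    have hl : (l.eraseIdx (s + j)).length = l.length - 1 := List.length_eraseIdx_of_lt (by omega)
    rw [List.range'_concat, List.map_append, List.prod_append, List.map_singleton,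
      List.prod_singleton, one_mul, Module.End.mul_apply, wordFace_word (by omega) (by omega),
      ih (by omega), List.eraseIdx_eq_take_drop_succ, List.take_append_of_le_length
        (by simp; omega), List.drop_append_of_le_length (by simp; omega)]
    simp [List.take_take, add_assoc]

theorem wordFace_zero_pow {i : ℕ} {l : List S} (h : i < l.length) :
    (wordFace k S 0 ^ i) (word k l) = word k (l.drop i) := by
  induction i with
  | zero => simp
  | succ i ih =>
    rw [pow_succ', Module.End.mul_apply, ih (by omega), wordFace_word (by simp; omega)
      (by simp; omega), List.eraseIdx_zero, List.tail_drop]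

variable (k S) in
/-- The map from words in pairs to pairs of words. -/
def wordUnzip : Words k (S × S) →ₗ[k] WordTensor k S S :=
  wordLift fun w => word k (w.map Prod.fst) ⊗ₜ word k (w.map Prod.snd)

@[simp] theorem wordUnzip_word (w : List (S × S)) :
    wordUnzip k S (word k w) = word k (w.map Prod.fst) ⊗ₜ word k (w.map Prod.snd) :=
  wordLift_word _ _

theorem wordUnzip_mul (x y : Words k (S × S)) :
    wordUnzip k S (x * y) = wordUnzip k S x * wordUnzip k S y := by
  refine LinearMap.congr_fun₂ (f := (LinearMap.mul k (Words k (S × S))).compr₂ (wordUnzip k S))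
    (g := (LinearMap.mul k (WordTensor k S S)).compl₁₂ (wordUnzip k S) (wordUnzip k S))
    (words_hom_ext fun l => words_hom_ext fun m => ?_) x y
  simp [← word_append]

/-- The splittings of a word. -/
theorem wordAW_word (w : List (S × S)) : wordAW k S S (word k w) =
    ∑ j ∈ Finset.range w.length,
      word k ((w.map Prod.fst).take (j + 1)) ⊗ₜ word k ((w.map Prod.snd).drop j) := by
  induction w with
  | nil => simp
  | cons c w ih =>
    rw [word_cons, wordAW_letter_mul, ih, List.length_cons, Finset.sum_range_succ', add_comm,
      Finset.mul_sum]
    simp [← word_append]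

/-- The front faces keep the first $i+1$ letters and the power of $\delta_0$ drops the first $i$
letters, which is the cut at position $i$. Length $n+1$ corresponds to degree $n$. -/
theorem alexanderWhitney_wordUnzip {n : ℕ} {x : Words k (S × S)}
    (hx : x ∈ wordsOfLength k (S × S) (n + 1)) :
    alexanderWhitney (wordFace k S) n (wordUnzip k S x) = wordAW k S S x := by
  refine wordSpan_eqOn (f := alexanderWhitney (wordFace k S) n ∘ₗ wordUnzip k S)
    (fun w hw => ?_) hx
  rw [LinearMap.comp_apply, wordUnzip_word, wordAW_word, hw, alexanderWhitney, LinearMap.sum_apply,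
    Finset.Nat.sum_antidiagonal_eq_sum_range_succ_mk]
  refine Finset.sum_congr rfl fun i hi => ?_
  have hi := Finset.mem_range.1 hi
  rw [TensorProduct.map_tmul, wordFace_range' (by omega) (by simp; omega),
    wordFace_zero_pow (by simp; omega), List.drop_of_length_le (by simp; omega), List.append_nil]

theorem wordRot_wordDegen_wordRot {n : ℕ} (v : List S) (c : S) (u : List S)
    (h : v.length + u.length = n) :
    (wordRot k S * wordDegen k S n * wordRot k S ^ u.length) (word k (v ++ c :: u)) =
      word k (c :: u ++ v ++ [c]) := by
  have h1 := wordRot_pow (k := k) (v ++ [c]) u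
  have h2 := wordDegen_append_singleton (k := k) (u ++ v) c
  have h3 := wordRot_append_singleton (k := k) (u ++ v ++ [c]) c
  rw [List.length_append, add_comm, h] at h2
  simp only [List.append_assoc, List.cons_append, List.nil_append] at h1 h2 h3 ⊢
  rw [Module.End.mul_apply, Module.End.mul_apply, h1, h2, h3]

theorem wordUnzip_listTurns {n : ℕ} (ζ : k) (u w : List (S × S)) (h : u.length + w.length = n + 1) :
    wordUnzip k S (listTurns ζ u w) = ∑ i ∈ Finset.range w.length, ζ ^ (w.length - 1 - i) •
      TensorProduct.map (wordRot k S * wordDegen k S n * wordRot k S ^ i)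
        (wordRot k S * wordDegen k S n * wordRot k S ^ i) (wordUnzip k S (word k (u ++ w))) := by
  induction w generalizing u with
  | nil => simp [listTurns]
  | cons c w ih =>
    have := ih (u ++ [c]) (by simp at h ⊢; omega)
    rw [listTurns, map_add, map_smul, this, List.length_cons, Finset.sum_range_succ, add_comm]
    congr 1
    · rw [Finset.smul_sum]
      refine Finset.sum_congr rfl fun i hi => ?_
      have hi := Finset.mem_range.1 hi
      rw [smul_smul, ← pow_succ', List.append_assoc, List.singleton_append]
      congr 2
      omega
    · have h1 := wordRot_wordDegen_wordRot (k := k) (n := n) (u.map Prod.fst) c.1 (w.map Prod.fst)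
        (by simp at h ⊢; omega)
      have h2 := wordRot_wordDegen_wordRot (k := k) (n := n) (u.map Prod.snd) c.2 (w.map Prod.snd)
        (by simp at h ⊢; omega)
      rw [List.length_map] at h1 h2
      simp only [wordUnzip_word, TensorProduct.map_tmul, List.map_append, List.map_cons, List.map_nil,
        h1, h2]
      simp

/-- The recursion `listTurns` meets the letters from left to right while the powers of the rotation
start from the right end; the signs agree after reversing the sum, by the parity of $n(n+1)$. -/
theorem diagConnes_wordUnzip {n : ℕ} {x : Words k (S × S)}
    (hx : x ∈ wordsOfLength k (S × S) (n + 1)) :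
    diagConnes (wordDegen k S) (wordRot k S) n (wordUnzip k S x) =
      wordUnzip k S (wordConnes k (S × S) x) := by
  refine wordSpan_eqOn (f := diagConnes (wordDegen k S) (wordRot k S) n ∘ₗ wordUnzip k S)
    (g := wordUnzip k S ∘ₗ wordConnes k (S × S)) (fun w hw => ?_) hx
  rw [LinearMap.comp_apply, LinearMap.comp_apply, wordConnes, wordLift_word, map_smul,
    wordUnzip_listTurns (n := n) _ _ _ (by simpa using hw), diagConnes, LinearMap.sum_apply, hw,
    Finset.smul_sum]
  refine Finset.sum_congr rfl fun i hi => ?_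
  have hi := Finset.mem_range.1 hi
  rw [LinearMap.smul_apply, smul_smul, List.nil_append]
  congr 1
  rw [← pow_mul, ← pow_add]
  obtain ⟨j, rfl⟩ : ∃ j, n = i + j := ⟨n - i, by omega⟩
  refine (neg_one_pow_congr (Nat.even_add.1 ?_)).symm
  have e := (Nat.even_mul_succ_self (i + j)).add (even_two_mul (1 + j))
  rw [show i + j + 1 - 1 - i = j by omega]
  have h : i + j + 1 + 1 + (i + j + 1 + 1) * j + (i + j) * i =
    (i + j) * (i + j + 1) + 2 * (1 + j) := by ring
  rwa [h]

end Operators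

end HopfCyclic

end

noncomputable section

namespace HopfCyclic

/-! ## The explicit Eilenberg–Mac Lane homotopy on words -/

section Shuffles

variable {k : Type*} [CommRing k] {S S' : Type*}

/-- The recursion on the last step of a lattice path. It is needed because the indices of iterated
degeneracies are naturally peeled off from the largest one, that is, from the end of the word. -/
theorem listShuffle_append_singleton (l : List S) (a : S) (m : List S') (b : S') :
    listShuffle k (l ++ [a]) (m ++ [b]) = ((if l.length + m.length = 0 then 1 else 0) +
      (-1 : k) ^ m.length • listShuffle k l (m ++ [b]) + listShuffle k (l ++ [a]) m) *
        word k [(a, b)] := by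
  suffices h : ∀ N, ∀ (l : List S) (m : List S'), l.length + m.length = N →
      listShuffle k (l ++ [a]) (m ++ [b]) = ((if l.length + m.length = 0 then 1 else 0) +
      (-1 : k) ^ m.length • listShuffle k l (m ++ [b]) + listShuffle k (l ++ [a]) m) *
        word k [(a, b)] from h _ l m rfl
  intro N
  induction N using Nat.strong_induction_on with
  | _ N ih =>
    intro l m hN
    rcases l with - | ⟨a', l⟩ <;> rcases m with - | ⟨b', m⟩
    · simp [listShuffle_cons_cons]
    · have := ih m.length (by simp at hN; omega) [] m (by simp)
      simp only [List.nil_append, listShuffle_nil_left, smul_zero, add_zero, List.length_nil,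
        zero_add] at this
      rw [List.nil_append, List.cons_append, listShuffle_cons_cons, this, listShuffle_cons_cons]
      simp [mul_assoc]
    · have := ih l.length (by simp at hN; omega) l [] (by simp)
      simp only [List.nil_append, listShuffle_nil_right, add_zero, List.length_nil, pow_zero,
        one_smul] at this
      rw [List.nil_append, List.cons_append, listShuffle_cons_cons, this, listShuffle_cons_cons]
      simp [mul_assoc]
    · have h1 := ih (l.length + m.length + 1) (by simp at hN; omega) l (b' :: m)
        (by simp; omega)
      have h2 := ih (l.length + m.length + 1) (by simp at hN; omega) (a' :: l) m
        (by simp; omega)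
      simp only [List.cons_append] at h1 h2 ⊢
      rw [listShuffle_cons_cons, h1, h2, listShuffle_cons_cons, listShuffle_cons_cons]
      simp only [List.length_append, List.length_cons, List.length_nil, zero_add, pow_succ,
        Nat.add_eq_zero_iff, one_ne_zero, and_false, false_and, if_false]
      simp only [mul_add, add_mul, mul_smul_comm, smul_mul_assoc, mul_assoc, smul_add]
      module

/-- The composite of the degeneracies in the positions `m + b` for `b` in a finite set. -/
def degenProd {P : Type*} [AddCommGroup P] [Module k P] (degen : ℕ → Module.End k P) (m : ℕ)
    (γ : Finset ℕ) : Module.End k P :=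
  ((γ.sort (· ≥ ·)).map fun b => degen (b + m)).prod

theorem degenProd_insert {P : Type*} [AddCommGroup P] [Module k P] (degen : ℕ → Module.End k P)
    (m : ℕ) {N : ℕ} {γ : Finset ℕ} (h : γ ⊆ Finset.range N) :
    degenProd degen m (insert N γ) = degen (N + m) * degenProd degen m γ := by
  rw [degenProd, Finset.sort_insert _ (fun b hb => (Finset.mem_range.1 (h hb)).le)
    fun hN => by simpa using h hN, List.map_cons, List.prod_cons]
  rfl

@[simp] theorem degenProd_empty {P : Type*} [AddCommGroup P] [Module k P]
    (degen : ℕ → Module.End k P) (m : ℕ) : degenProd degen m ∅ = 1 := by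
  simp [degenProd]

theorem subset_range_cases {N : ℕ} {γ : Finset ℕ} (h : γ ⊆ Finset.range (N + 1)) :
    γ ⊆ Finset.range N ∨ ∃ γ' ⊆ Finset.range N, N ∉ γ' ∧ γ = insert N γ' := by
  by_cases hN : N ∈ γ
  · refine Or.inr ⟨γ.erase N, fun x hx => ?_, Finset.notMem_erase _ _,
      (Finset.insert_erase hN).symm⟩
    have := Finset.mem_range.1 (h (Finset.mem_of_mem_erase hx))
    have := Finset.ne_of_mem_erase hx
    simp; omega
  · refine Or.inl fun x hx => ?_
    have := Finset.mem_range.1 (h hx)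
    have : x ≠ N := fun e => hN (e ▸ hx)
    simp; omega

theorem wordDegen_mul {n i : ℕ} {x : Words k S} (hx : x ∈ wordsOfLength k S n) (h : i < n)
    (y : Words k S) : wordDegen k S i (x * y) = wordDegen k S i x * y := by
  refine wordSpan_eqOn (f := wordDegen k S i ∘ₗ LinearMap.mulRight k y)
    (g := LinearMap.mulRight k y ∘ₗ wordDegen k S i) (fun l hl => ?_) hx
  refine LinearMap.congr_fun (f := wordDegen k S i ∘ₗ LinearMap.mulLeft k (word k l))
    (g := LinearMap.mulLeft k (wordDegen k S i (word k l))) (words_hom_ext fun m => ?_) y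
  subst hl
  simp only [LinearMap.comp_apply, LinearMap.mulLeft_apply]
  rw [← word_append, wordDegen_word (by simp; omega), wordDegen_word h, ← word_append,
    List.take_append_of_le_length (by omega), List.drop_append_of_le_length (by omega),
    List.append_assoc]

theorem wordDegen_mem_length {n i : ℕ} {x : Words k S} (hx : x ∈ wordsOfLength k S n) (h : i < n) :
    wordDegen k S i x ∈ wordsOfLength k S (n + 1) := by
  refine wordSpan_map_le (fun l hl => ?_) hx
  subst hl
  rw [wordDegen_word h]
  refine word_mem ?_
  simp; omega

theorem degenProd_mem_length {m n N : ℕ} {γ : Finset ℕ} (hγ : γ ⊆ Finset.range N)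
    (hN : N < n + γ.card) {x : Words k S} (hx : x ∈ wordsOfLength k S (m + n)) :
    degenProd (wordDegen k S) m γ x ∈ wordsOfLength k S (m + n + γ.card) := by
  induction N generalizing γ with
  | zero =>
    obtain rfl : γ = ∅ := by simpa using hγ
    simpa using hx
  | succ N ih =>
    rcases subset_range_cases hγ with h | ⟨γ', h, hN', rfl⟩
    · exact ih h (by omega)
    · rw [Finset.card_insert_of_notMem hN'] at hN ⊢
      rw [degenProd_insert _ _ h]
      exact wordDegen_mem_length (n := m + n + γ'.card) (ih h (by omega)) (by omega)

/-- The cardinality bound keeps each degeneracy inside the first factor: when the one with offset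
$N$ is applied, the word already has more than $N+m$ letters. -/
theorem degenProd_mul {m n N : ℕ} {γ : Finset ℕ} (hγ : γ ⊆ Finset.range N)
    (hN : N < n + γ.card) {x : Words k S} (hx : x ∈ wordsOfLength k S (m + n)) (y : Words k S) :
    degenProd (wordDegen k S) m γ (x * y) = degenProd (wordDegen k S) m γ x * y := by
  induction N generalizing γ with
  | zero =>
    obtain rfl : γ = ∅ := by simpa using hγ
    simp
  | succ N ih =>
    rcases subset_range_cases hγ with h | ⟨γ', h, hN', rfl⟩
    · exact ih h (by omega)
    · rw [Finset.card_insert_of_notMem hN'] at hN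
      rw [degenProd_insert _ _ h, Module.End.mul_apply, Module.End.mul_apply, ih h (by omega),
        wordDegen_mul (n := m + n + γ'.card) (degenProd_mem_length h (by omega) hx) (by omega)]

/-- The combinations of words of length `n` which end with `c`. -/
def wordsEndingWith (k : Type*) [CommRing k] {S : Type*} (c : S) (n : ℕ) :
    Submodule k (Words k S) := wordSpan k fun l => l.length = n ∧ ∃ v, l = v ++ [c]

theorem wordDegen_mem_ending {c : S} {n i : ℕ} {x : Words k S} (hx : x ∈ wordsEndingWith k c n)
    (h : i < n) : wordDegen k S i x ∈ wordsEndingWith k c (n + 1) := by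
  refine wordSpan_map_le (fun l hl => ?_) hx
  obtain ⟨rfl, v, rfl⟩ := hl
  rw [wordDegen_word h]
  simp only [List.length_append, List.length_singleton] at h
  refine word_mem ⟨by simp; omega, (v ++ [c]).take (i + 1) ++ v.drop i, ?_⟩
  rw [List.drop_append_of_le_length (by omega), List.append_assoc]

theorem degenProd_mem_ending {c : S} {m n N : ℕ} {γ : Finset ℕ} (hγ : γ ⊆ Finset.range N)
    (hN : N < n + γ.card) {x : Words k S} (hx : x ∈ wordsEndingWith k c (m + n)) :
    degenProd (wordDegen k S) m γ x ∈ wordsEndingWith k c (m + n + γ.card) := by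
  induction N generalizing γ with
  | zero =>
    obtain rfl : γ = ∅ := by simpa using hγ
    simpa using hx
  | succ N ih =>
    rcases subset_range_cases hγ with h | ⟨γ', h, hN', rfl⟩
    · exact ih h (by omega)
    · rw [Finset.card_insert_of_notMem hN'] at hN ⊢
      rw [degenProd_insert _ _ h]
      exact wordDegen_mem_ending (n := m + n + γ'.card) (ih h (by omega)) (by omega)

theorem wordDegen_of_mem_ending {c : S} {n : ℕ} {x : Words k S}
    (hx : x ∈ wordsEndingWith k c (n + 1)) : wordDegen k S n x = x * word k [c] := by
  refine wordSpan_eqOn (g := LinearMap.mulRight k (word k [c])) (fun l hl => ?_) hx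
  obtain ⟨hl, v, rfl⟩ := hl
  obtain rfl : v.length = n := by simpa using hl
  rw [wordDegen_append_singleton, LinearMap.mulRight_apply, ← word_append]
  simp

/-- Makes the truncated subtraction in the exponent of the explicit homotopy harmless. -/
theorem sum_range_card_le (N : ℕ) {γ : Finset ℕ} (h : γ ⊆ Finset.range N) :
    ∑ i ∈ Finset.range γ.card, i ≤ ∑ a ∈ γ, a := by
  induction N generalizing γ with
  | zero =>
    obtain rfl : γ = ∅ := by simpa using h
    simp
  | succ N ih =>
    rcases subset_range_cases h with h' | ⟨γ', h', hN', rfl⟩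
    · exact ih h'
    · rw [Finset.card_insert_of_notMem hN', Finset.sum_insert hN', Finset.sum_range_succ]
      have := Finset.card_le_card h'
      have := ih h'
      simp at *
      omega

/-- The sum over lattice paths in terms of degeneracies. -/
theorem sum_degenProd (N : ℕ) (u : List (S × S)) (l l' : List S) (a b : ℕ) (hl : l.length = a + 1)
    (hl' : l'.length = b + 1) (hN : a + b = N) :
    ∑ α ∈ Finset.powersetCard a (Finset.range N),
      (-1 : k) ^ ((∑ x ∈ α, x) + ∑ i ∈ Finset.range a, i) •
        TensorProduct.map (degenProd (wordDegen k S) u.length (Finset.range N \ α))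
          (degenProd (wordDegen k S) u.length α)
          (word k (u.map Prod.fst ++ l) ⊗ₜ word k (u.map Prod.snd ++ l')) =
      wordUnzip k S (word k u * listShuffle k l l') := by
  induction N generalizing l l' a b with
  | zero =>
    obtain ⟨rfl, rfl⟩ : a = 0 ∧ b = 0 := by omega
    obtain ⟨c, rfl⟩ := List.length_eq_one_iff.1 hl
    obtain ⟨c', rfl⟩ := List.length_eq_one_iff.1 hl'
    simp [listShuffle_cons_cons, ← word_append]
  | succ N ih =>
    obtain ⟨l, c, rfl⟩ : ∃ v c, l = v ++ [c] :=
      ⟨_, _, (List.dropLast_concat_getLast (l := l) (by rintro rfl; simp at hl)).symm⟩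
    obtain ⟨l', c', rfl⟩ : ∃ v c, l' = v ++ [c] :=
      ⟨_, _, (List.dropLast_concat_getLast (l := l') (by rintro rfl; simp at hl')).symm⟩
    have hla : l.length = a := by simpa using hl
    have hlb : l'.length = b := by simpa using hl'
    have hm : ∀ z z' : Words k S, ((z * word k [c]) ⊗ₜ[k] (z' * word k [c']) : WordTensor k S S) =
      (z ⊗ₜ[k] z') * wordUnzip k S (word k [(c, c')]) := by simp
    rw [listShuffle_append_singleton, if_neg (by omega), zero_add, ← mul_assoc, wordUnzip_mul,
      mul_add, map_add, add_mul, mul_smul_comm, map_smul]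
    have hend : ∀ (u v : List S) (c : S),
        word k (u ++ (v ++ [c])) ∈ wordsEndingWith k c (u.length + (v.length + 1)) :=
      fun u v c => word_mem ⟨by simp, u ++ v, by simp⟩
    -- If the largest index is not in $\alpha$, the last degeneracy repeats the final letter of the
    -- first factor, and the final letter of the second is passed by no degeneracy: the last step of
    -- the path is in the second direction. The case `key2` is symmetric.
    have key1 : ∀ α ∈ Finset.powersetCard a (Finset.range N), 0 < b →
        TensorProduct.map (degenProd (wordDegen k S) u.length (Finset.range (N + 1) \ α))
          (degenProd (wordDegen k S) u.length α)
          (word k (u.map Prod.fst ++ (l ++ [c])) ⊗ₜ word k (u.map Prod.snd ++ (l' ++ [c']))) =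
        TensorProduct.map (degenProd (wordDegen k S) u.length (Finset.range N \ α))
          (degenProd (wordDegen k S) u.length α)
          (word k (u.map Prod.fst ++ (l ++ [c])) ⊗ₜ word k (u.map Prod.snd ++ l')) *
          wordUnzip k S (word k [(c, c')]) := by
      intro α hα hb
      obtain ⟨hα, hc⟩ := Finset.mem_powersetCard.1 hα
      have e : Finset.range (N + 1) \ α = insert N (Finset.range N \ α) := by
        rw [Finset.range_add_one, Finset.insert_sdiff_of_notMem _ fun h => by simpa using hα h]
      have hcc : (Finset.range N \ α).card = N - a := by
        rw [Finset.card_sdiff_of_subset hα, hc, Finset.card_range]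
      have h1 := degenProd_mem_ending (m := u.length) (n := a + 1) (N := N)
        (γ := Finset.range N \ α) Finset.sdiff_subset (by omega)
        (by simpa [hla] using hend (u.map Prod.fst) l c)
      rw [hcc, show u.length + (a + 1) + (N - a) = N + u.length + 1 by omega] at h1
      rw [e, degenProd_insert _ _ Finset.sdiff_subset, TensorProduct.map_tmul,
        TensorProduct.map_tmul, Module.End.mul_apply, wordDegen_of_mem_ending h1,
        ← List.append_assoc (u.map Prod.snd), word_append (u.map Prod.snd ++ l'),
        degenProd_mul (m := u.length) (n := b) hα (by omega) (word_mem (by simp [hlb])), hm]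
    have key2 : ∀ α ∈ Finset.powersetCard (a - 1) (Finset.range N), 0 < a →
        TensorProduct.map (degenProd (wordDegen k S) u.length (Finset.range (N + 1) \ insert N α))
          (degenProd (wordDegen k S) u.length (insert N α))
          (word k (u.map Prod.fst ++ (l ++ [c])) ⊗ₜ word k (u.map Prod.snd ++ (l' ++ [c']))) =
        TensorProduct.map (degenProd (wordDegen k S) u.length (Finset.range N \ α))
          (degenProd (wordDegen k S) u.length α)
          (word k (u.map Prod.fst ++ l) ⊗ₜ word k (u.map Prod.snd ++ (l' ++ [c']))) *
          wordUnzip k S (word k [(c, c')]) := by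
      intro α hα ha
      obtain ⟨hα, hc⟩ := Finset.mem_powersetCard.1 hα
      have e : Finset.range (N + 1) \ insert N α = Finset.range N \ α := by
        ext x
        simp only [Finset.mem_sdiff, Finset.mem_range, Finset.mem_insert, not_or]
        exact ⟨fun h => ⟨by omega, h.2.2⟩, fun h => ⟨by omega, by omega, h.2⟩⟩
      have hcc : (Finset.range N \ α).card = N - (a - 1) := by
        rw [Finset.card_sdiff_of_subset hα, hc, Finset.card_range]
      have h1 := degenProd_mem_ending (m := u.length) (n := b + 1) (N := N)
        (γ := α) hα (by omega) (by simpa [hlb] using hend (u.map Prod.snd) l' c')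
      rw [hc, show u.length + (b + 1) + (a - 1) = N + u.length + 1 by omega] at h1
      rw [e, degenProd_insert _ _ hα, TensorProduct.map_tmul,
        TensorProduct.map_tmul, Module.End.mul_apply, wordDegen_of_mem_ending h1,
        ← List.append_assoc (u.map Prod.fst), word_append (u.map Prod.fst ++ l),
        degenProd_mul (m := u.length) (n := a) Finset.sdiff_subset (by omega)
          (word_mem (by simp [hla])), hm]
    have s1 : ∑ α ∈ Finset.powersetCard a (Finset.range N),
        (-1 : k) ^ ((∑ x ∈ α, x) + ∑ i ∈ Finset.range a, i) •
        TensorProduct.map (degenProd (wordDegen k S) u.length (Finset.range (N + 1) \ α))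
          (degenProd (wordDegen k S) u.length α)
          (word k (u.map Prod.fst ++ (l ++ [c])) ⊗ₜ word k (u.map Prod.snd ++ (l' ++ [c']))) =
        wordUnzip k S (word k u * listShuffle k (l ++ [c]) l') *
          wordUnzip k S (word k [(c, c')]) := by
      rcases Nat.eq_zero_or_pos b with rfl | hb
      · rw [Finset.powersetCard_eq_empty.2 (by simp; omega), List.length_eq_zero_iff.1 hlb]
        simp
      · rw [← ih (l ++ [c]) l' a (b - 1) hl (by omega) (by omega), Finset.sum_mul]
        refine Finset.sum_congr rfl fun α hα => ?_
        rw [key1 α hα hb, smul_mul_assoc]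
    rcases Nat.eq_zero_or_pos a with rfl | ha
    · rw [List.length_eq_zero_iff.1 hla] at s1 ⊢
      rw [listShuffle_nil_left, mul_zero, map_zero, smul_zero, zero_mul, zero_add, ← s1]
      simp
    obtain ⟨a, rfl⟩ : ∃ a', a = a' + 1 := ⟨a - 1, by omega⟩
    rw [Finset.range_add_one, Finset.powersetCard_succ_insert (by simp), Finset.sum_union, add_comm,
      ← Finset.range_add_one, s1]
    · congr 1
      rw [Finset.sum_image]
      · rw [← ih l (l' ++ [c']) a b hla hl' (by omega), Finset.smul_sum, Finset.sum_mul]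
        refine Finset.sum_congr rfl fun α hα => ?_
        rw [key2 α hα (by omega), smul_smul, smul_mul_assoc, ← pow_add]
        congr 1
        -- Adding the index $N$ to the set changes the exponent by $N+a$; as $N=a+b$ here, its
        -- parity is that of $b$, the sign of a last step in the first direction.
        refine neg_one_pow_congr (Nat.even_add.1 ?_)
        have hN' : N ∉ α := fun h => by simpa using (Finset.mem_powersetCard.1 hα).1 h
        rw [Finset.sum_insert hN', Finset.sum_range_succ, hlb]
        exact ⟨N + ∑ x ∈ α, x + ∑ i ∈ Finset.range a, i, by omega⟩
      · intro α hα β hβ h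
        have h1 : N ∉ α := fun h => by simpa using (Finset.mem_powersetCard.1 hα).1 h
        have h2 : N ∉ β := fun h => by simpa using (Finset.mem_powersetCard.1 hβ).1 h
        rw [← Finset.erase_insert h1, ← Finset.erase_insert h2, h]
    · rw [Finset.disjoint_left]
      intro α hα hα'
      obtain ⟨β, hβ, rfl⟩ := Finset.mem_image.1 hα'
      have := (Finset.mem_powersetCard.1 hα).1 (Finset.mem_insert_self N β)
      simp at this

end Shuffles

end HopfCyclic

end

noncomputable section

namespace HopfCyclic

/-! ### The explicit homotopy agrees with the recursive one -/

section Shih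

variable {k : Type*} [CommRing k] {S : Type*}

/-- The nondegenerate part of the homotopy `wordHomotopy`. -/
def listShih (k : Type*) [CommRing k] {S : Type*} (n : ℕ) (w : List (S × S)) : Words k (S × S) :=
  ∑ q ∈ Finset.range n, ∑ p ∈ Finset.range (n - q), (-1 : k) ^ (n - p - q) •
    (word k (w.take (n - p - q)) *
      listShuffle k (((w.map Prod.fst).drop (n - p - q - 1)).take (p + 2))
        ((w.map Prod.snd).drop (n - p - q + p)))

theorem shihHomotopy_word {n : ℕ} {w : List (S × S)} (hw : w.length = n + 1) :
    shihHomotopy (wordFace k S) (wordDegen k S) n (wordUnzip k S (word k w)) =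
      wordUnzip k S (listShih k n w) := by
  rw [shihHomotopy, listShih, LinearMap.sum_apply, map_sum]
  refine Finset.sum_congr rfl fun q hq => ?_
  rw [LinearMap.sum_apply, map_sum]
  refine Finset.sum_congr rfl fun p hp => ?_
  have hq := Finset.mem_range.1 hq
  have hp := Finset.mem_range.1 hp
  -- With $n=m+1+p+q$, the first $m+1$ letters are untouched. The degeneracy $s_m$ repeats letter
  -- $m$, so the shuffle in the first factor starts with that letter.
  obtain ⟨m, hm⟩ : ∃ m, n = m + 1 + p + q := ⟨n - p - q - 1, by omega⟩
  have hm' : n - p - q = m + 1 := by omega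
  have hX : ∀ X : List S, X.length = n + 1 →
      (wordDegen k S m * ((List.range' (n - q + 1) q).map (wordFace k S)).prod) (word k X) =
        word k (X.take (m + 1) ++ (X.drop m).take (p + 2)) := by
    intro X hX
    rw [Module.End.mul_apply, wordFace_range' (by omega) (by omega),
      List.drop_of_length_le (by omega), List.append_nil, wordDegen_word (by simp; omega),
      List.take_take, List.drop_take]
    congr 3 <;> omega
  have hY : ∀ X : List S, X.length = n + 1 →
      ((List.range' (m + 1) p).map (wordFace k S)).prod (word k X) =
        word k (X.take (m + 1) ++ X.drop (m + 1 + p)) :=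
    fun X hX => wordFace_range' (by omega) (by omega)
  rw [hm', Nat.add_sub_cancel, map_smul, ← sum_degenProd (p + 1 + q) (w.take (m + 1))
    (((w.map Prod.fst).drop m).take (p + 2)) ((w.map Prod.snd).drop (m + 1 + p)) (p + 1) q
    (by simp; omega) (by simp; omega) rfl, LinearMap.sum_apply, Finset.smul_sum,
    show p + q + 1 = p + 1 + q by ring]
  refine Finset.sum_congr rfl fun α hα => ?_
  obtain ⟨hα, hc⟩ := Finset.mem_powersetCard.1 hα
  have hle := sum_range_card_le _ hα
  rw [hc] at hle
  rw [LinearMap.smul_apply, smul_smul, ← pow_add, wordUnzip_word, TensorProduct.map_tmul,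
    mul_assoc, Module.End.mul_apply, hX _ (by simpa using hw), Module.End.mul_apply,
    hY _ (by simpa using hw), TensorProduct.map_tmul, List.length_take_of_le (by omega),
    List.map_take, List.map_take]
  congr 1
  refine neg_one_pow_congr (Nat.even_add.1 ?_)
  exact ⟨m + 1 + ∑ x ∈ α, x, by omega⟩

theorem listShih_mem_length {n : ℕ} {w : List (S × S)} (hw : w.length = n + 1) :
    listShih k n w ∈ wordsOfLength k (S × S) (n + 2) := by
  refine sum_mem fun q hq => sum_mem fun p hp => Submodule.smul_mem _ _ ?_
  have hq := Finset.mem_range.1 hq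
  have hp := Finset.mem_range.1 hp
  have h1 := word_mem_length (k := k) (w.take (n - p - q))
  have h2 := listShuffle_mem_length (k := k)
    (((w.map Prod.fst).drop (n - p - q - 1)).take (p + 2)) ((w.map Prod.snd).drop (n - p - q + p))
  have := mul_mem_length h1 h2
  rwa [show (w.take (n - p - q)).length + ((((w.map Prod.fst).drop (n - p - q - 1)).take
    (p + 2)).length + ((w.map Prod.snd).drop (n - p - q + p)).length - 1) = n + 2 by
      simp; omega] at this

theorem shuffleAW_word (w : List (S × S)) : shuffleAW k S S (word k w) =
    ∑ j ∈ Finset.range w.length,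
      listShuffle k ((w.map Prod.fst).take (j + 1)) ((w.map Prod.snd).drop j) := by
  simp [shuffleAW, wordAW_word]

/-- In each inner sum the largest $p$ belongs to a prefix of length one; these terms form the
shuffles after the first letter. In all other terms the first letter is a common left factor. -/
theorem listShih_cons {n : ℕ} (c : S × S) (w : List (S × S)) : listShih k (n + 1) (c :: w) =
    -(word k [c] * (listShih k n w + ∑ p ∈ Finset.range (n + 1),
      listShuffle k (((c :: w).map Prod.fst).take (p + 2))
        (((c :: w).map Prod.snd).drop (p + 1)))) := by
  have e : ∀ q ∈ Finset.range (n + 1), ∑ p ∈ Finset.range (n + 1 - q), (-1 : k) ^ (n + 1 - p - q) •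
      (word k ((c :: w).take (n + 1 - p - q)) *
      listShuffle k ((((c :: w).map Prod.fst).drop (n + 1 - p - q - 1)).take (p + 2))
        (((c :: w).map Prod.snd).drop (n + 1 - p - q + p))) =
      -(word k [c] * ((∑ p ∈ Finset.range (n - q), (-1 : k) ^ (n - p - q) •
      (word k (w.take (n - p - q)) *
      listShuffle k (((w.map Prod.fst).drop (n - p - q - 1)).take (p + 2))
        ((w.map Prod.snd).drop (n - p - q + p)))) +
        listShuffle k (((c :: w).map Prod.fst).take (n - q + 2))
        (((c :: w).map Prod.snd).drop (n - q + 1)))) := by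
    intro q hq
    have hq := Finset.mem_range.1 hq
    rw [show n + 1 - q = n - q + 1 by omega, Finset.sum_range_succ, mul_add, neg_add,
      Finset.mul_sum, ← Finset.sum_neg_distrib]
    congr 1
    · refine Finset.sum_congr rfl fun p hp => ?_
      have hp := Finset.mem_range.1 hp
      obtain ⟨m, hm⟩ : ∃ m, n - p - q = m + 1 := ⟨n - p - q - 1, by omega⟩
      rw [show n + 1 - p - q = m + 1 + 1 by omega, hm, pow_succ (-1 : k) (m + 1),
        Nat.add_sub_cancel, Nat.add_sub_cancel, List.take_succ_cons, word_cons, List.map_cons,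
        List.map_cons, List.drop_succ_cons, show m + 1 + 1 + p = m + 1 + p + 1 by ring,
        List.drop_succ_cons, mul_assoc, mul_smul_comm]
      module
    · rw [show n + 1 - (n - q) - q = 1 by omega, show 1 + (n - q) = n - q + 1 by ring]
      simp
  rw [listShih, Finset.sum_congr rfl e, Finset.sum_neg_distrib, ← Finset.mul_sum,
    Finset.sum_add_distrib, Finset.sum_range_succ, listShih]
  congr 3
  · simp
  · rw [← Finset.sum_range_reflect]
    refine Finset.sum_congr rfl fun p hp => ?_
    have hp := Finset.mem_range.1 hp
    rw [show n - (n + 1 - 1 - p) = p by omega]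

/-- The two recursions differ only by the cut at the first letter, which the explicit formula omits.
That shuffle starts at $c$, and multiplied by $c$ it is degenerate. -/
theorem listShih_sub_wordHomotopy {n : ℕ} {w : List (S × S)} (hw : w.length = n + 1) :
    listShih k n w - wordHomotopy k S S (word k w) ∈ degenWords k (S × S) := by
  have hs : ∀ (c : S × S) (w : List (S × S)),
      word k [c] * listShuffle k [c.1] ((c :: w).map Prod.snd) ∈ degenWords k (S × S) := by
    intro c w
    rw [List.map_cons, listShuffle_cons_cons, ← mul_assoc]
    exact mul_mem_degenWords_right (square_mem_degenWords c) _
  induction n generalizing w with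
  | zero =>
    obtain ⟨c, rfl⟩ := List.length_eq_one_iff.1 hw
    have := wordHomotopy_letter_mul (k := k) c 1
    rw [mul_one, wordHomotopy_one, zero_add, shuffleAW_word] at this
    rw [this]
    simpa [listShih] using hs c []
  | succ n ih =>
    cases w with
    | nil => simp at hw
    | cons c w =>
      have h1 := ih (w := w) (by simpa using hw)
      have h2 := shuffleAW_word (k := k) (c :: w)
      rw [hw, Finset.sum_range_succ'] at h2
      rw [listShih_cons, word_cons c w, wordHomotopy_letter_mul, ← word_cons c w, h2]
      have := sub_mem (hs c w) (mul_mem_degenWords_left (word k [c]) h1)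
      convert this using 1
      simp only [zero_add, List.drop_zero, List.map_cons, List.take_succ_cons, List.take_zero,
        mul_add, mul_sub]
      abel

/-- The explicit and the recursive $\varphi$ differ by degenerate words, which all later operators
preserve, so the discrepancy stays in the degenerate tensors for every $r$. -/
theorem cyclicAW_wordUnzip (r n : ℕ) {x : Words k (S × S)}
    (hx : x ∈ wordsOfLength k (S × S) (n + 1)) :
    cyclicAW (wordFace k S) (wordDegen k S) (wordRot k S) r n (wordUnzip k S x) -
      wordCyclicAW k S S r x ∈ degenTensors k S S := by
  induction r generalizing n x with
  | zero =>
    rw [cyclicAW, alexanderWhitney_wordUnzip hx, wordCyclicAW, sub_self]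
    exact zero_mem _
  | succ r ih =>
    refine wordSpan_map_le (f := cyclicAW (wordFace k S) (wordDegen k S) (wordRot k S) (r + 1) n ∘ₗ
      wordUnzip k S - wordCyclicAW k S S (r + 1)) (fun w hw => ?_) hx
    have hy := listShih_mem_length (k := k) hw
    have h1 := ih (n + 2) (wordConnes_mem_length hy)
    have h2 := wordCyclicAW_degenWords r (wordConnes_degenWords (listShih_sub_wordHomotopy (k := k) hw))
    have := neg_mem (add_mem h1 h2)
    convert this using 1
    rw [LinearMap.sub_apply, LinearMap.comp_apply, cyclicAW, LinearMap.neg_apply,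
      Module.End.mul_apply, Module.End.mul_apply, shihHomotopy_word hw,
      diagConnes_wordUnzip hy, wordCyclicAW_succ, map_sub, map_sub]
    abel

end Shih

end HopfCyclic

end

noncomputable section

namespace HopfCyclic

/-! ## Maps from words to cyclic modules -/

section Graded

variable {k : Type*} [CommRing k] {X : ℕ → Type*} [∀ n, AddCommGroup (X n)] [∀ n, Module k (X n)]

theorem gFace_lof (δ : ∀ n, Fin (n + 2) → X (n + 1) →ₗ[k] X n) {i n : ℕ} (h : i < n + 2)
    (x : X (n + 1)) : gFace δ i (DirectSum.lof k ℕ X (n + 1) x) =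
      DirectSum.lof k ℕ X n (δ n ⟨i, h⟩ x) := by
  rw [gFace, DirectSum.toModule_lof]
  simp [h]

theorem gFace_lof_of_le (δ : ∀ n, Fin (n + 2) → X (n + 1) →ₗ[k] X n) {i n : ℕ} (h : n < i ∨ n = 0)
    (x : X n) : gFace δ i (DirectSum.lof k ℕ X n x) = 0 := by
  rw [gFace, DirectSum.toModule_lof]
  cases n with
  | zero => rfl
  | succ n => simp [show ¬ i < n + 2 by omega]

theorem gDegen_lof (σ : ∀ n, Fin (n + 1) → X n →ₗ[k] X (n + 1)) {i n : ℕ} (h : i < n + 1)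
    (x : X n) : gDegen σ i (DirectSum.lof k ℕ X n x) =
      DirectSum.lof k ℕ X (n + 1) (σ n ⟨i, h⟩ x) := by
  rw [gDegen, DirectSum.toModule_lof]
  simp [h]

theorem gDegen_lof_of_le (σ : ∀ n, Fin (n + 1) → X n →ₗ[k] X (n + 1)) {i n : ℕ} (h : n < i)
    (x : X n) : gDegen σ i (DirectSum.lof k ℕ X n x) = 0 := by
  rw [gDegen, DirectSum.toModule_lof]
  simp [show ¬ i < n + 1 by omega]

theorem gRot_lof (τ : ∀ n, X n →ₗ[k] X n) (n : ℕ) (x : X n) :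
    gRot τ (DirectSum.lof k ℕ X n x) = DirectSum.lof k ℕ X n (τ n x) := by
  rw [gRot, DirectSum.toModule_lof]
  rfl

theorem gSign_lof (n : ℕ) (x : X n) :
    gSign k X (DirectSum.lof k ℕ X n x) = (-1 : k) ^ n • DirectSum.lof k ℕ X n x := by
  rw [gSign, DirectSum.toModule_lof]
  rfl

theorem hochschildDiff_lof (face : ℕ → Module.End k (⨁ n, X n)) (n : ℕ) (x : X n) :
    hochschildDiff face (DirectSum.lof k ℕ X n x) =
      ∑ i ∈ Finset.range (n + 1), (-1 : k) ^ i • face i (DirectSum.lof k ℕ X n x) := by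
  rw [hochschildDiff, DirectSum.toModule_lof]
  simp

theorem connesDiff_lof (degen : ℕ → Module.End k (⨁ n, X n)) (rot : Module.End k (⨁ n, X n))
    (n : ℕ) (x : X n) : connesDiff degen rot (DirectSum.lof k ℕ X n x) =
      ∑ i ∈ Finset.range (n + 1), (-1 : k) ^ (n * i) •
        (rot * degen n * rot ^ i) (DirectSum.lof k ℕ X n x) := by
  rw [connesDiff, DirectSum.toModule_lof]
  simp

variable {S : Type*}

theorem wordBoundary_word_eq_sum (l : List S) : wordBoundary k S (word k l) =
    ∑ i ∈ Finset.range l.length, (-1 : k) ^ i • word k (l.eraseIdx i) := by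
  induction l with
  | nil => simp
  | cons c l ih =>
    rw [word_cons, wordBoundary_letter_mul, ih, List.length_cons, Finset.sum_range_succ',
      Finset.mul_sum, sub_eq_add_neg, ← Finset.sum_neg_distrib, add_comm]
    simp [pow_succ, ← word_append]

theorem listTurns_eq_sum {n : ℕ} (ζ : k) (u w : List S) (h : u.length + w.length = n + 1) :
    listTurns ζ u w = ∑ i ∈ Finset.range w.length, ζ ^ (w.length - 1 - i) •
      (wordRot k S * wordDegen k S n * wordRot k S ^ i) (word k (u ++ w)) := by
  induction w generalizing u with
  | nil => simp [listTurns]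
  | cons c w ih =>
    have := ih (u ++ [c]) (by simp at h ⊢; omega)
    rw [listTurns, this, List.length_cons, Finset.sum_range_succ, add_comm]
    congr 1
    · rw [Finset.smul_sum]
      refine Finset.sum_congr rfl fun i hi => ?_
      have hi := Finset.mem_range.1 hi
      rw [smul_smul, ← pow_succ', List.append_assoc, List.singleton_append]
      congr 2
      omega
    · rw [wordRot_wordDegen_wordRot (k := k) (n := n) u c w (by simp at h ⊢; omega)]
      simp

theorem wordConnes_word_eq_sum {n : ℕ} {l : List S} (hl : l.length = n + 1) :
    wordConnes k S (word k l) = ∑ i ∈ Finset.range (n + 1), (-1 : k) ^ (n * i) •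
      (wordRot k S * wordDegen k S n * wordRot k S ^ i) (word k l) := by
  rw [wordConnes, wordLift_word, listTurns_eq_sum (n := n) _ _ _ (by simpa using hl), hl,
    Finset.smul_sum]
  refine Finset.sum_congr rfl fun i hi => ?_
  have hi := Finset.mem_range.1 hi
  rw [smul_smul, List.nil_append, ← pow_mul, ← pow_add]
  congr 1
  obtain ⟨j, rfl⟩ : ∃ j, n = i + j := ⟨n - i, by omega⟩
  refine neg_one_pow_congr (Nat.even_add.1 ?_)
  have e := (Nat.even_mul_succ_self (i + j)).add (even_two_mul (1 + j))
  rw [show i + j + 1 - 1 - i = j by omega]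
  have h : i + j + 1 + 1 + (i + j + 1 + 1) * j + (i + j) * i =
    (i + j) * (i + j + 1) + 2 * (1 + j) := by ring
  rwa [h]

/-- Maps from words to a cyclic module that are compatible with all structure maps. -/
structure IsCyclicMap (δ : ∀ n, Fin (n + 2) → X (n + 1) →ₗ[k] X n)
    (σ : ∀ n, Fin (n + 1) → X n →ₗ[k] X (n + 1)) (τ : ∀ n, X n →ₗ[k] X n)
    (F : Words k S →ₗ[k] ⨁ n, X n) : Prop where
  one : F 1 = 0
  degree : ∀ n, ∀ l : List S, l.length = n + 1 → ∃ x, F (word k l) = DirectSum.lof k ℕ X n x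
  face : ∀ i x, F (wordFace k S i x) = gFace δ i (F x)
  degen : ∀ i x, F (wordDegen k S i x) = gDegen σ i (F x)
  rot : ∀ x, F (wordRot k S x) = gRot τ (F x)

section IsCyclicMap

variable {δ : ∀ n, Fin (n + 2) → X (n + 1) →ₗ[k] X n}
  {σ : ∀ n, Fin (n + 1) → X n →ₗ[k] X (n + 1)} {τ : ∀ n, X n →ₗ[k] X n}
  {F : Words k S →ₗ[k] ⨁ n, X n}

/-- A single letter needs separate treatment: its word boundary is the empty word, while the
Hochschild differential is $0$ in degree zero. The two agree because the empty word is killed. -/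
theorem IsCyclicMap.boundary (hF : IsCyclicMap δ σ τ F) (x : Words k S) :
    F (wordBoundary k S x) = hochschildDiff (gFace δ) (F x) := by
  refine LinearMap.congr_fun (f := F ∘ₗ wordBoundary k S) (g := hochschildDiff (gFace δ) ∘ₗ F)
    (words_hom_ext fun l => ?_) x
  rw [LinearMap.comp_apply, LinearMap.comp_apply]
  obtain _ | ⟨c, l⟩ := l
  · simp [hF.one]
  obtain _ | ⟨d, l⟩ := l
  · obtain ⟨y, hy⟩ := hF.degree 0 [c] rfl
    rw [wordBoundary_letter, hF.one, hy, hochschildDiff_lof]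
    simp [gFace_lof_of_le]
  · obtain ⟨y, hy⟩ := hF.degree (l.length + 1) (c :: d :: l) rfl
    rw [wordBoundary_word_eq_sum, map_sum, hy, hochschildDiff_lof]
    refine Finset.sum_congr rfl fun i hi => ?_
    have hi := Finset.mem_range.1 hi
    rw [map_smul, ← hy, ← hF.face, wordFace_word hi (by simp)]

theorem IsCyclicMap.rot_degen_rot (hF : IsCyclicMap δ σ τ F) (n i : ℕ) (x : Words k S) :
    F ((wordRot k S * wordDegen k S n * wordRot k S ^ i) x) =
      (gRot τ * gDegen σ n * gRot τ ^ i) (F x) := by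
  have h : F ((wordRot k S ^ i) x) = (gRot τ ^ i) (F x) := by
    induction i with
    | zero => simp
    | succ i ih => rw [pow_succ', pow_succ', Module.End.mul_apply, Module.End.mul_apply, hF.rot, ih]
  simp only [Module.End.mul_apply, hF.rot, hF.degen, h]

theorem IsCyclicMap.connes (hF : IsCyclicMap δ σ τ F) (x : Words k S) :
    F (wordConnes k S x) = connesDiff (gDegen σ) (gRot τ) (F x) := by
  refine LinearMap.congr_fun (f := F ∘ₗ wordConnes k S)
    (g := connesDiff (gDegen σ) (gRot τ) ∘ₗ F) (words_hom_ext fun l => ?_) x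
  rw [LinearMap.comp_apply, LinearMap.comp_apply]
  obtain _ | ⟨c, l⟩ := l
  · simp [hF.one]
  · obtain ⟨y, hy⟩ := hF.degree l.length (c :: l) rfl
    rw [wordConnes_word_eq_sum (n := l.length) (by rfl), map_sum, hy, connesDiff_lof]
    refine Finset.sum_congr rfl fun i _ => ?_
    rw [map_smul, hF.rot_degen_rot, hy]

theorem IsCyclicMap.sign (hF : IsCyclicMap δ σ τ F) (x : Words k S) :
    F (wordSign k S x) = gSign k X (F x) := by
  refine LinearMap.congr_fun (f := F ∘ₗ wordSign k S) (g := gSign k X ∘ₗ F)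
    (words_hom_ext fun l => ?_) x
  rw [LinearMap.comp_apply, LinearMap.comp_apply]
  obtain _ | ⟨c, l⟩ := l
  · simp [hF.one]
  · obtain ⟨y, hy⟩ := hF.degree l.length (c :: l) rfl
    rw [wordSign_word, map_smul, hy, gSign_lof, List.length_cons, pow_succ, pow_succ]
    simp

end IsCyclicMap

end Graded

theorem wordFace_one {k : Type*} [CommRing k] {S : Type*} (i : ℕ) : wordFace k S i 1 = 0 := by
  rw [← word_nil]
  simp [wordFace, -word_nil]

theorem wordDegen_one {k : Type*} [CommRing k] {S : Type*} (i : ℕ) : wordDegen k S i 1 = 0 := by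
  rw [← word_nil]
  simp [wordDegen, -word_nil]

theorem wordRot_one {k : Type*} [CommRing k] {S : Type*} : wordRot k S 1 = 1 := by
  rw [← word_nil]
  simp [wordRot, -word_nil]

theorem wordDegen_mem_degenWords {k : Type*} [CommRing k] {S : Type*} (i : ℕ) (x : Words k S) :
    wordDegen k S i x ∈ degenWords k S := by
  refine wordSpan_map_le (p := fun _ => True) (fun l _ => ?_)
    (wordSpan_true (k := k) ▸ Submodule.mem_top)
  by_cases h : i < l.length
  · rw [wordDegen_word h, List.take_succ_eq_append_getElem h, List.drop_eq_getElem_cons h,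
      List.append_assoc]
    exact word_mem (degenerate_of_eq (l.take i) l[i] (l.drop (i + 1)))
  · simp [wordDegen, h]

/-- A word with equal neighbours is a degeneracy of the word with one of them removed; together with
the previous lemma, degenerate words are exactly the span of images of degeneracies. -/
theorem word_degenerate_eq {k : Type*} [CommRing k] {S : Type*} (u : List S) (c : S) (v : List S) :
    word k (u ++ c :: c :: v) = wordDegen k S u.length (word k (u ++ c :: v)) := by
  rw [wordDegen_word (by simp)]
  simp [List.take_append, List.take_of_length_le]

/-! ## The homogeneous bar resolution as a space of words -/

section Resolution

variable (k G : Type u) [CommRing k]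

/-- The map from words to the homogeneous bar resolution, killing the empty word. -/
def wordToE : Words k G →ₗ[k] GEG k G := wordLift fun l => match l with
  | [] => 0
  | c :: w => DirectSum.lof k ℕ (EG k G) w.length (Finsupp.single (c :: w).get 1)

/-- The inclusion of the homogeneous bar resolution into the space of words. -/
def wordOfE : GEG k G →ₗ[k] Words k G :=
  DirectSum.toModule k ℕ _ fun _ => Finsupp.lift _ k _ fun x => word k (List.ofFn x)

variable {k G}

@[simp] theorem wordToE_one : wordToE k G 1 = 0 := by
  rw [← word_nil, wordToE, wordLift_word]

theorem wordToE_word {n : ℕ} (l : List G) (h : l.length = n + 1) : wordToE k G (word k l) =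
    DirectSum.lof k ℕ (EG k G) n (Finsupp.single (fun j : Fin (n + 1) => l[j]) 1) := by
  obtain _ | ⟨c, w⟩ := l
  · simp at h
  obtain rfl : n = w.length := by simpa using h.symm
  rw [wordToE, wordLift_word]
  rfl

theorem wordOfE_lof (n : ℕ) (x : Fin (n + 1) → G) (a : k) :
    wordOfE k G (DirectSum.lof k ℕ (EG k G) n (Finsupp.single x a)) = a • word k (List.ofFn x) := by
  rw [wordOfE, DirectSum.toModule_lof]
  simp

theorem geg_hom_ext {M : Type*} [AddCommGroup M] [Module k M] {f g : GEG k G →ₗ[k] M}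
    (h : ∀ n x, f (DirectSum.lof k ℕ (EG k G) n (Finsupp.single x 1)) =
      g (DirectSum.lof k ℕ (EG k G) n (Finsupp.single x 1))) : f = g := by
  refine DirectSum.linearMap_ext k fun n => ?_
  ext x
  exact h n x

theorem wordToE_ofFn (n : ℕ) (x : Fin (n + 1) → G) : wordToE k G (word k (List.ofFn x)) =
    DirectSum.lof k ℕ (EG k G) n (Finsupp.single x 1) := by
  rw [wordToE_word (n := n) _ (by simp)]
  simp [-List.ofFn_succ]

theorem wordToE_wordOfE (z : GEG k G) : wordToE k G (wordOfE k G z) = z := by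
  refine LinearMap.congr_fun (f := wordToE k G ∘ₗ wordOfE k G) (g := LinearMap.id)
    (geg_hom_ext (M := GEG k G) fun n x => ?_) z
  simpa [wordOfE_lof, -List.ofFn_succ] using wordToE_ofFn n x

theorem wordOfE_wordToE (x : Words k G) :
    wordOfE k G (wordToE k G x) = x - emptyCoeff k G x • 1 := by
  refine LinearMap.congr_fun (f := wordOfE k G ∘ₗ wordToE k G)
    (g := LinearMap.id - (emptyCoeff k G).smulRight 1) (words_hom_ext fun l => ?_) x
  obtain _ | ⟨c, w⟩ := l
  · simp
  · rw [LinearMap.comp_apply, wordToE_word (n := w.length) _ (by rfl), wordOfE_lof]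
    have : (List.ofFn fun j : Fin (w.length + 1) => (c :: w)[j]) = c :: w :=
      List.ofFn_getElem (xs := c :: w)
    rw [this]
    simp [emptyCoeff_word]

theorem emptyCoeff_wordOfE (z : GEG k G) : emptyCoeff k G (wordOfE k G z) = 0 := by
  refine LinearMap.congr_fun (f := emptyCoeff k G ∘ₗ wordOfE k G) (g := 0)
    (geg_hom_ext fun n x => ?_) z
  simp [wordOfE_lof, emptyCoeff_word]

theorem wordOfE_wordToE_of_emptyCoeff {x : Words k G} (hx : emptyCoeff k G x = 0) :
    wordOfE k G (wordToE k G x) = x := by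
  rw [wordOfE_wordToE, hx, zero_smul, sub_zero]

theorem wordOfE_lof_mem (n : ℕ) (y : EG k G n) :
    wordOfE k G (DirectSum.lof k ℕ (EG k G) n y) ∈ wordsOfLength k G (n + 1) := by
  induction y using Finsupp.induction_linear with
  | zero => simp
  | add y z hy hz => simpa using add_mem hy hz
  | single x a => 
    rw [wordOfE_lof]
    exact Submodule.smul_mem _ _ (word_mem (by simp))

theorem wordToE_degree {n : ℕ} {x : Words k G} (hx : x ∈ wordsOfLength k G (n + 1)) :
    ∃ y, wordToE k G x = DirectSum.lof k ℕ (EG k G) n y := by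
  refine wordSpan_induction (p := fun x => ∃ y, wordToE k G x = DirectSum.lof k ℕ (EG k G) n y) hx
    (fun l hl => ⟨_, wordToE_word l hl⟩) ⟨0, by simp⟩ ?_ ?_
  · rintro x y ⟨u, hu⟩ ⟨v, hv⟩
    exact ⟨u + v, by rw [map_add, map_add, hu, hv]⟩
  · rintro a x ⟨u, hu⟩
    exact ⟨a • u, by rw [map_smul, map_smul, hu]⟩

theorem isCyclicMap_wordToE :
    IsCyclicMap (eFace k G) (eDegen k G) (eRot k G) (wordToE k G) where
  one := wordToE_one
  degree n l hl := ⟨_, wordToE_word l hl⟩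
  face i x := by
    refine LinearMap.congr_fun (f := wordToE k G ∘ₗ wordFace k G i)
      (g := gFace (eFace k G) i ∘ₗ wordToE k G) (words_hom_ext (M := GEG k G) fun l => ?_) x
    rw [LinearMap.comp_apply, LinearMap.comp_apply]
    obtain _ | ⟨c, w⟩ := l
    · simp [wordFace_one]
    by_cases h : i < (c :: w).length ∧ 2 ≤ (c :: w).length
    · rw [wordFace_word h.1 h.2]
      obtain ⟨n, hn⟩ : ∃ n, w.length = n + 1 := ⟨w.length - 1, by simp at h; omega⟩
      rw [wordToE_word (n := n + 1) (c :: w) (by simp [hn]), wordToE_word (n := n)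
        ((c :: w).eraseIdx i) (by rw [List.length_eraseIdx_of_lt h.1]; simp [hn]),
        gFace_lof _ (by simp at h; omega), eFace, Finsupp.lmapDomain_apply, Finsupp.mapDomain_single]
      congr 2
      funext j
      simp only [Fin.getElem_fin, List.getElem_eraseIdx, Fin.removeNth, Fin.succAbove, Fin.lt_def,
        Fin.val_castSucc]
      split_ifs <;> rfl
    · rw [wordToE_word (n := w.length) (c :: w) (by simp), gFace_lof_of_le]
      · rw [wordFace, wordLift_word, if_neg h, map_zero]
      · simp only [List.length_cons] at h
        omega
  degen i x := by
    refine LinearMap.congr_fun (f := wordToE k G ∘ₗ wordDegen k G i)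
      (g := gDegen (eDegen k G) i ∘ₗ wordToE k G) (words_hom_ext (M := GEG k G) fun l => ?_) x
    rw [LinearMap.comp_apply, LinearMap.comp_apply]
    obtain _ | ⟨c, w⟩ := l
    · simp [wordDegen_one]
    by_cases h : i < (c :: w).length
    · have h' : i < w.length + 1 := h
      rw [wordDegen_word h, wordToE_word (n := w.length) (c :: w) (by simp),
        wordToE_word (n := w.length + 1) _ (by
          simp only [List.length_append, List.length_take, List.length_drop, List.length_cons]
          omega),
        gDegen_lof _ h', eDegen, Finsupp.lmapDomain_apply, Finsupp.mapDomain_single]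
      congr 2
      funext j
      simp only [Fin.getElem_fin, List.getElem_append, List.length_take, List.getElem_take,
        List.getElem_drop, Function.comp_apply, Fin.predAbove, Fin.lt_def, Fin.val_castSucc,
        List.length_cons, lt_inf_iff]
      have hj := j.2
      split_ifs with h1 h2 h2
      · omega
      · simp
      · congr 1
        simp only [Fin.val_pred]
        omega
      · omega
    · rw [wordToE_word (n := w.length) (c :: w) (by simp), gDegen_lof_of_le]
      · rw [wordDegen, wordLift_word, if_neg h, map_zero]
      · simp only [List.length_cons] at h
        omega
  rot x := by
    refine LinearMap.congr_fun (f := wordToE k G ∘ₗ wordRot k G)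
      (g := gRot (eRot k G) ∘ₗ wordToE k G) (words_hom_ext (M := GEG k G) fun l => ?_) x
    rw [LinearMap.comp_apply, LinearMap.comp_apply]
    obtain rfl | ⟨v, c, rfl⟩ := l.eq_nil_or_concat'
    · simp [wordRot_one]
    · rw [wordRot_append_singleton, wordToE_word (n := v.length) (c :: v) (by simp),
        wordToE_word (n := v.length) (v ++ [c]) (by simp), gRot_lof, eRot,
        Finsupp.lmapDomain_apply, Finsupp.mapDomain_single]
      congr 2
      funext j
      obtain ⟨i, rfl⟩ := (finRotate (v.length + 1)).surjective j
      simp only [Function.comp_apply, Equiv.symm_apply_apply, Fin.getElem_fin]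
      induction i using Fin.lastCases with
      | last => simp
      | cast i => simp

theorem wordOfE_mem_degenWords {z : GEG k G} (hz : z ∈ eDegenerate k G) :
    wordOfE k G z ∈ degenWords k G := by
  have h : eDegenerate k G ≤ (degenWords k G).comap (wordOfE k G) := ?_
  · exact h hz
  refine iSup_le fun i => ?_
  rintro _ ⟨z, rfl⟩
  have h := wordDegen_mem_degenWords (k := k) i (wordOfE k G z)
  rw [Submodule.mem_comap, ← wordToE_wordOfE z, ← isCyclicMap_wordToE.degen,
    wordOfE_wordToE_of_emptyCoeff (emptyCoeff_of_mem_degenWords h)]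
  exact h

theorem wordToE_mem_eDegenerate {x : Words k G} (hx : x ∈ degenWords k G) :
    wordToE k G x ∈ eDegenerate k G := by
  refine wordSpan_induction (p := fun x => wordToE k G x ∈ eDegenerate k G) hx (fun l hl => ?_)
    (by rw [map_zero]; exact zero_mem _) (fun x y hx hy => by rw [map_add]; exact add_mem hx hy)
    (fun a x hx => by rw [map_smul]; exact Submodule.smul_mem _ _ hx)
  obtain ⟨u, c, v, rfl⟩ := hl.exists_eq
  rw [word_degenerate_eq, isCyclicMap_wordToE.degen]
  exact Submodule.mem_iSup_of_mem u.length ⟨_, rfl⟩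

variable [Group G]

theorem wordToE_wordMap (s : G) (x : Words k G) :
    wordToE k G (wordMap k (s * ·) x) = eAct k G s (wordToE k G x) := by
  refine LinearMap.congr_fun (f := wordToE k G ∘ₗ (wordMap k (s * ·)).toLinearMap)
    (g := eAct k G s ∘ₗ wordToE k G) (words_hom_ext (M := GEG k G) fun l => ?_) x
  obtain _ | ⟨c, w⟩ := l
  · simp
  · rw [LinearMap.comp_apply, LinearMap.comp_apply, AlgHom.toLinearMap_apply, wordMap_word,
      wordToE_word (n := w.length) _ (by simp), wordToE_word (n := w.length) (c :: w) (by simp),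
      eAct, DirectSum.toModule_lof, LinearMap.comp_apply, Finsupp.lmapDomain_apply,
      Finsupp.mapDomain_single]
    congr 2
    funext i
    simp only [Fin.getElem_fin, List.getElem_map]

theorem wordOfE_eAct (s : G) (z : GEG k G) :
    wordOfE k G (eAct k G s z) = wordMap k (s * ·) (wordOfE k G z) := by
  rw [← wordOfE_wordToE_of_emptyCoeff (x := wordMap k (s * ·) (wordOfE k G z))
    (by rw [emptyCoeff_wordMap, emptyCoeff_wordOfE]), wordToE_wordMap, wordToE_wordOfE]

/-- A comparison of the resolutions, on words. -/
def comparisonOnWords (f : ℕ → Module.End k (GEG k G)) : ℕ → Module.End k (Words k G)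
  | 0 => LinearMap.id
  | r + 1 => wordOfE k G ∘ₗ f (r + 1) ∘ₗ wordToE k G

theorem IsComparison.wordToE_comparisonOnWords {f : ℕ → Module.End k (GEG k G)}
    (hf : IsComparison k G f) (r : ℕ) (x : Words k G) :
    wordToE k G (comparisonOnWords f r x) = f r (wordToE k G x) := by
  cases r with
  | zero => simp [comparisonOnWords, hf.zero]
  | succ r => simp [comparisonOnWords, wordToE_wordOfE]

/-- The zeroth entry on words is the identity, not the conjugate of $f_0$: conjugation would kill
the empty word. In the higher entries conjugation is correct, and the relations transfer because
neither side involves the empty word. -/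
theorem IsComparison.isWordComparison {f : ℕ → Module.End k (GEG k G)}
    (hf : IsComparison k G f) : IsWordComparison (comparisonOnWords f) := by
  have hlen : ∀ r n, ∀ x ∈ wordsOfLength k G n,
      comparisonOnWords f r x ∈ wordsOfLength k G (n + 2 * r) := fun r n x hx => by
    cases r with
    | zero => exact hx
    | succ r =>
      refine wordSpan_map_le (fun l hl => ?_) hx
      rw [comparisonOnWords, LinearMap.comp_apply, LinearMap.comp_apply]
      obtain _ | n := n
      · obtain rfl := List.eq_nil_of_length_eq_zero hl
        simp
      · obtain ⟨y, hy⟩ := hf.degree (r + 1) n (Finsupp.single (fun j : Fin (n + 1) => l[j]) 1)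
        rw [wordToE_word l hl, hy, show n + 1 + 2 * (r + 1) = n + 2 * (r + 1) + 1 by ring]
        exact wordOfE_lof_mem _ y
  refine ⟨rfl, fun r => by simp [comparisonOnWords], hlen, fun r s x => ?_, fun r x => ?_⟩
  · cases r with
    | zero => rfl
    | succ r =>
      simp only [comparisonOnWords, LinearMap.comp_apply]
      rw [wordToE_wordMap, hf.equivariant, wordOfE_eAct]
  · cases r with
    | zero =>
      simp [seqPair_convolve_zero, convolve_seqConst, comparisonOnWords, mixedSeq]
    | succ r =>
      have h0 : emptyCoeff k G (wordBoundary k G (comparisonOnWords f (r + 1) x)) = 0 := by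
        refine LinearMap.congr_fun (f := emptyCoeff k G ∘ₗ wordBoundary k G ∘ₗ
          comparisonOnWords f (r + 1)) (g := 0) (words_hom_ext fun l => ?_) x
        have := hlen (r + 1) l.length _ (word_mem_length l)
        rw [show l.length + 2 * (r + 1) = l.length + 2 * r + 2 by ring] at this
        exact emptyCoeff_wordBoundary_of_length this
      have h1 : emptyCoeff k G (comparisonOnWords f (r + 1) (wordBoundary k G x)) = 0 :=
        emptyCoeff_wordOfE _
      simp only [Pi.sub_apply, LinearMap.sub_apply, mixedSeq, seqPair_convolve_succ,
        convolve_seqConst, LinearMap.add_apply, LinearMap.comp_apply]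
      have h := hf.comm r (wordToE k G x)
      rw [← hf.wordToE_comparisonOnWords, ← hf.wordToE_comparisonOnWords,
        ← isCyclicMap_wordToE.boundary, ← isCyclicMap_wordToE.boundary,
        ← hf.wordToE_comparisonOnWords, ← isCyclicMap_wordToE.connes] at h
      have h' := wordOfE_mem_degenWords h
      rw [map_sub, map_add, wordOfE_wordToE_of_emptyCoeff h0, wordOfE_wordToE_of_emptyCoeff h1,
        wordOfE_wordToE_of_emptyCoeff (emptyCoeff_wordConnes _)] at h'
      exact h'

theorem exists_isComparison : ∃ f, IsComparison k G f := by
  have hw := isWordComparison_wordComparison (k := k) (G := G)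
  refine ⟨fun r => wordToE k G ∘ₗ wordComparison k G r ∘ₗ wordOfE k G, ?_, fun r n x => ?_,
    fun r s x => ?_, fun r x => ?_⟩
  · refine LinearMap.ext fun z => ?_
    simp [wordComparison, wordToE_wordOfE]
  · have := hw.length r _ _ (wordOfE_lof_mem n x)
    rw [show n + 1 + 2 * r = n + 2 * r + 1 by ring] at this
    exact wordToE_degree this
  · simp only [LinearMap.comp_apply]
    rw [wordOfE_eAct, hw.equivariant, wordToE_wordMap]
  -- The boundary on words may contain the empty word, which `wordToE` drops; the discrepancy is
  -- invisible because $f_{r+1}$ kills the empty word.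
  · have e : wordOfE k G (eB k G x) =
        wordBoundary k G (wordOfE k G x) - emptyCoeff k G (wordBoundary k G (wordOfE k G x)) • 1 := by
      rw [← wordOfE_wordToE, isCyclicMap_wordToE.boundary, wordToE_wordOfE]
    simp only [LinearMap.comp_apply]
    rw [← isCyclicMap_wordToE.boundary, ← isCyclicMap_wordToE.connes, e, map_sub, map_smul,
      hw.one, smul_zero, sub_zero]
    have h := hw.comm (r + 1) (wordOfE k G x)
    simp only [Pi.sub_apply, LinearMap.sub_apply, mixedSeq, seqPair_convolve_succ,
      convolve_seqConst, LinearMap.add_apply, LinearMap.comp_apply] at h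
    have h' := wordToE_mem_eDegenerate h
    rw [map_sub, map_add] at h'
    exact h'

end Resolution

end HopfCyclic

end

noncomputable section

namespace HopfCyclic

/-! ## The quotient map from words to the cyclic module of a group algebra -/

section Hopf

variable (k : Type*) {G : Type*} [CommRing k] [Group G]

/-- The tensor product of group elements. -/
def groupTensor {n : ℕ} (h : Fin (n + 1) → G) : TPow k (MonoidAlgebra k G) n :=
  PiTensorProduct.tprod k fun i => MonoidAlgebra.of k G (h i)

/-- The cyclic quotients of a sequence in a group. -/
def cyclicQuotients {n : ℕ} (x : Fin (n + 1) → G) (i : Fin (n + 1)) : G :=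
  (x ((finRotate (n + 1)).symm i))⁻¹ * x i

theorem mulAdjacent_groupTensor {n : ℕ} (i : Fin (n + 1)) (h : Fin (n + 2) → G) :
    mulAdjacent k (MonoidAlgebra k G) n i (groupTensor k h) =
      groupTensor k (Fin.contractNth i.castSucc (· * ·) h) := by
  rw [mulAdjacent, groupTensor, PiTensorProduct.lift.tprod]
  change PiTensorProduct.tprod k _ = PiTensorProduct.tprod k _
  congr 1
  funext j
  simp only [Fin.contractNth]
  split_ifs
  · rfl
  · rw [map_mul]
  · rfl

theorem rotate_groupTensor {n : ℕ} (h : Fin (n + 1) → G) :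
    rotate k (MonoidAlgebra k G) n (groupTensor k h) =
      groupTensor k (h ∘ (finRotate (n + 1)).symm) :=
  PiTensorProduct.reindex_tprod _ _

theorem hopfDegen_groupTensor {n : ℕ} (i : Fin (n + 1)) (h : Fin (n + 1) → G) :
    hopfDegen k (MonoidAlgebra k G) n i (groupTensor k h) =
      groupTensor k (i.succ.insertNth (α := fun _ => G) 1 h) := by
  rw [hopfDegen, groupTensor, PiTensorProduct.lift.tprod]
  change PiTensorProduct.tprod k _ = PiTensorProduct.tprod k _
  congr 1
  funext j
  induction j using Fin.succAboveCases i.succ with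
  | x => simp [MonoidAlgebra.one_def]
  | p j => simp

theorem omegaDelta_groupTensor {n : ℕ} (h : Fin (n + 1) → G) :
    omegaDelta k (MonoidAlgebra k G) n (groupTensor k h) = groupTensor k h ⊗ₜ groupTensor k h := by
  rw [omegaDelta, LinearMap.comp_apply, groupTensor, PiTensorProduct.map_tprod]
  have : (fun i => (CoalgebraStruct.comul : MonoidAlgebra k G →ₗ[k] _) (MonoidAlgebra.of k G (h i)))
      = fun i => MonoidAlgebra.of k G (h i) ⊗ₜ[k] MonoidAlgebra.of k G (h i) := by
    funext i
    simp [MonoidAlgebra.of_apply]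
  rw [this, unshuffle_tprod]

theorem finRotate_symm_val {n : ℕ} (i : Fin (n + 1)) :
    ((finRotate (n + 1)).symm i : ℕ) = if (i : ℕ) = 0 then n else i - 1 := by
  obtain ⟨j, rfl⟩ := (finRotate (n + 1)).surjective i
  rw [Equiv.symm_apply_apply]
  induction j using Fin.lastCases with
  | last => simp
  | cast j => simp

theorem exists_eq_val {n : ℕ} (x : Fin (n + 1) → G) : ∃ y : ℕ → G, x = fun i : Fin (n + 1) => y i :=
  ⟨fun i => if h : i < n + 1 then x ⟨i, h⟩ else 1, by
    funext i
    dsimp only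
    rw [dif_pos i.2]⟩

/-- Deleting $x_i$ multiplies the adjacent quotients $x_{i-1}^{-1}x_i$ and $x_i^{-1}x_{i+1}$, which
telescope; indices are cyclic. -/
theorem cyclicQuotients_removeNth {n : ℕ} (i : Fin (n + 1)) (x : Fin (n + 2) → G) :
    cyclicQuotients (i.castSucc.removeNth x) =
      Fin.contractNth i.castSucc (· * ·) (cyclicQuotients x) := by
  obtain ⟨y, rfl⟩ := exists_eq_val x
  funext j
  simp only [cyclicQuotients, Fin.removeNth, Fin.contractNth, Fin.succAbove, Fin.lt_def,
    Fin.val_castSucc, apply_ite Fin.val, Fin.val_succ, finRotate_symm_val, Fin.val_castSucc]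
  have hj := j.2
  have hi := i.2
  obtain h | h | h := lt_trichotomy (j : ℕ) i
  · by_cases hj0 : (j : ℕ) = 0
    · have h0 : 0 < (i : ℕ) := by omega
      have hn : ¬ n < (i : ℕ) := by omega
      simp [h0, hj0, hn]
    · have : (j : ℕ) - 1 < i := by omega
      simp [h, hj0, this]
  · rw [h]
    by_cases hj0 : (i : ℕ) = 0
    · simp [hj0]
    · have : (i : ℕ) - 1 < i := by omega
      simp [hj0, this]
  · have h1 : ¬ (j : ℕ) < i := by omega
    have h2 : ¬ (j : ℕ) = i := by omega
    have h3 : ¬ (j : ℕ) = 0 := by omega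
    have h4 : ¬ (j : ℕ) - 1 < i := by omega
    have h5 : (j : ℕ) - 1 + 1 = j := by omega
    simp [h1, h2, h3, h4, h5]

theorem cyclicQuotients_rotate {n : ℕ} (x : Fin (n + 1) → G) :
    cyclicQuotients (x ∘ (finRotate (n + 1)).symm) =
      cyclicQuotients x ∘ (finRotate (n + 1)).symm := rfl

/-- Mirrors the definition of the last face of the Hopf cyclic module as $\delta_0$ after the cyclic
map. -/
theorem removeNth_last_eq {n : ℕ} (x : Fin (n + 2) → G) :
    (Fin.last (n + 1)).removeNth x = (0 : Fin (n + 2)).removeNth (x ∘ (finRotate (n + 2)).symm) := by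
  obtain ⟨y, rfl⟩ := exists_eq_val x
  funext j
  simp only [Fin.removeNth, Function.comp_apply, finRotate_symm_val]
  simp

theorem cyclicQuotients_predAbove {n : ℕ} (i : Fin (n + 1)) (x : Fin (n + 1) → G) :
    cyclicQuotients (x ∘ i.predAbove) = i.succ.insertNth (α := fun _ => G) 1 (cyclicQuotients x) := by
  obtain ⟨y, rfl⟩ := exists_eq_val x
  have e : ∀ l : Fin (n + 2), ((i.predAbove l : Fin (n + 1)) : ℕ) =
      if (i : ℕ) < l then (l : ℕ) - 1 else l := fun l => by
    simp only [Fin.predAbove, Fin.lt_def, Fin.val_castSucc]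
    split_ifs <;> simp
  have hi := i.2
  funext j
  induction j using Fin.succAboveCases i.succ with
  | x =>
    simp only [Fin.insertNth_apply_same, cyclicQuotients, Function.comp_apply, e,
      finRotate_symm_val]
    simp
  | p j =>
    have hj := j.2
    rw [Fin.insertNth_apply_succAbove]
    simp only [cyclicQuotients, Function.comp_apply, e,
      finRotate_symm_val, Fin.succAbove, Fin.lt_def, apply_ite Fin.val, Fin.val_castSucc,
      Fin.val_succ]
    by_cases h : (j : ℕ) < i + 1
    · have h1 : ¬ (i : ℕ) < j := by omega
      simp only [h, if_true, h1, if_false]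
      by_cases hj0 : (j : ℕ) = 0
      · have : (i : ℕ) < n + 1 := by omega
        simp [hj0, this]
      · have : ¬ (i : ℕ) < j - 1 := by omega
        simp [hj0, this]
    · have h1 : (i : ℕ) < j + 1 := by omega
      have h2 : ¬ (j : ℕ) + 1 = 0 := by omega
      have h3 : ¬ (j : ℕ) = 0 := by omega
      have h4 : (i : ℕ) < j := by omega
      simp [h, h1, h3, h4]

end Hopf

/-! ### The quotient of the resolution by $G$ respects the cyclic structure -/

section Quotient

variable {k G : Type u} [CommRing k] [Group G]

theorem eToHopf_lof (n : ℕ) (x : Fin (n + 1) → G) :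
    eToHopf k G (DirectSum.lof k ℕ (EG k G) n (Finsupp.single x 1)) =
      gι k (MonoidAlgebra k G) n (groupTensor k (cyclicQuotients x)) := by
  rw [eToHopf, DirectSum.toModule_lof]
  simp [groupTensor, cyclicQuotients]

theorem eToHopf_lof_mem (n : ℕ) (y : EG k G n) :
    ∃ z, eToHopf k G (DirectSum.lof k ℕ (EG k G) n y) = gι k (MonoidAlgebra k G) n z := by
  rw [eToHopf, DirectSum.toModule_lof]
  exact ⟨_, rfl⟩

theorem hFace_castSucc {n : ℕ} (i : Fin (n + 1)) (h : Fin (n + 2) → G) :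
    hFace k (MonoidAlgebra k G) i (gι k (MonoidAlgebra k G) (n + 1) (groupTensor k h)) =
      gι k (MonoidAlgebra k G) n (groupTensor k (Fin.contractNth i.castSucc (· * ·) h)) := by
  rw [hFace, gFace_lof _ (i := i) (by omega), hopfFace, dif_pos i.2, mulAdjacent_groupTensor]

theorem hFace_last {n : ℕ} (h : Fin (n + 2) → G) :
    hFace k (MonoidAlgebra k G) (n + 1) (gι k (MonoidAlgebra k G) (n + 1) (groupTensor k h)) =
      gι k (MonoidAlgebra k G) n (groupTensor k (Fin.contractNth 0 (· * ·) (h ∘ (finRotate (n + 2)).symm))) := by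
  rw [hFace, gFace_lof _ (i := n + 1) (by omega), hopfFace, dif_neg (by simp),
    LinearMap.comp_apply, rotate_groupTensor, mulAdjacent_groupTensor]
  rfl

theorem eToHopf_gFace (i : ℕ) (z : GEG k G) :
    eToHopf k G (gFace (eFace k G) i z) = hFace k (MonoidAlgebra k G) i (eToHopf k G z) := by
  refine LinearMap.congr_fun (f := eToHopf k G ∘ₗ gFace (eFace k G) i)
    (g := hFace k (MonoidAlgebra k G) i ∘ₗ eToHopf k G)
    (geg_hom_ext (M := GPow k (MonoidAlgebra k G)) fun n x => ?_) z
  rw [LinearMap.comp_apply, LinearMap.comp_apply, eToHopf_lof]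
  obtain h | h := lt_or_ge n i
  · rw [gFace_lof_of_le _ (Or.inl h), map_zero, hFace, gFace_lof_of_le _ (Or.inl h)]
  obtain _ | n := n
  · rw [gFace_lof_of_le _ (Or.inr rfl), map_zero, hFace, gFace_lof_of_le _ (Or.inr rfl)]
  rw [gFace_lof _ (i := i) (by omega), eFace, Finsupp.lmapDomain_apply, Finsupp.mapDomain_single,
    eToHopf_lof]
  obtain h | rfl := Nat.lt_or_eq_of_le h
  · exact (congrArg (gι k (MonoidAlgebra k G) _) (congrArg (groupTensor k) (cyclicQuotients_removeNth ⟨i, h⟩ x))).trans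
      (hFace_castSucc ⟨i, h⟩ _).symm
  · rw [hFace_last, ← cyclicQuotients_rotate]
    refine congrArg (gι k (MonoidAlgebra k G) _) (congrArg (groupTensor k) (Eq.trans ?_ (cyclicQuotients_removeNth 0 _)))
    exact congrArg _ (removeNth_last_eq x)

theorem eToHopf_gDegen (i : ℕ) (z : GEG k G) :
    eToHopf k G (gDegen (eDegen k G) i z) = hDegen k (MonoidAlgebra k G) i (eToHopf k G z) := by
  refine LinearMap.congr_fun (f := eToHopf k G ∘ₗ gDegen (eDegen k G) i)
    (g := hDegen k (MonoidAlgebra k G) i ∘ₗ eToHopf k G)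
    (geg_hom_ext (M := GPow k (MonoidAlgebra k G)) fun n x => ?_) z
  rw [LinearMap.comp_apply, LinearMap.comp_apply, eToHopf_lof]
  obtain h | h := lt_or_ge n i
  · rw [gDegen_lof_of_le _ h, map_zero, hDegen, gDegen_lof_of_le _ h]
  · rw [gDegen_lof _ (by omega), hDegen, gDegen_lof _ (by omega), hopfDegen_groupTensor, eDegen,
      Finsupp.lmapDomain_apply, Finsupp.mapDomain_single, eToHopf_lof, cyclicQuotients_predAbove]

theorem eToHopf_gRot (z : GEG k G) :
    eToHopf k G (gRot (eRot k G) z) = hRot k (MonoidAlgebra k G) (eToHopf k G z) := by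
  refine LinearMap.congr_fun (f := eToHopf k G ∘ₗ gRot (eRot k G))
    (g := hRot k (MonoidAlgebra k G) ∘ₗ eToHopf k G)
    (geg_hom_ext (M := GPow k (MonoidAlgebra k G)) fun n x => ?_) z
  rw [LinearMap.comp_apply, LinearMap.comp_apply, eToHopf_lof, gRot_lof, hRot, gRot_lof,
    rotate_groupTensor, eRot, Finsupp.lmapDomain_apply, Finsupp.mapDomain_single, eToHopf_lof,
    cyclicQuotients_rotate]

theorem eToHopf_eAct (s : G) (z : GEG k G) : eToHopf k G (eAct k G s z) = eToHopf k G z := by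
  refine LinearMap.congr_fun (f := eToHopf k G ∘ₗ eAct k G s) (g := eToHopf k G)
    (geg_hom_ext (M := GPow k (MonoidAlgebra k G)) fun n x => ?_) z
  rw [LinearMap.comp_apply, eAct, DirectSum.toModule_lof, LinearMap.comp_apply,
    Finsupp.lmapDomain_apply, Finsupp.mapDomain_single, eToHopf_lof, eToHopf_lof]
  congr 2
  funext i
  simp [cyclicQuotients, mul_assoc]

variable (k G) in
/-- The quotient map from words to the cyclic module of the group algebra. -/
def wordToHopf : Words k G →ₗ[k] GPow k (MonoidAlgebra k G) := eToHopf k G ∘ₗ wordToE k G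

theorem isCyclicMap_wordToHopf :
    IsCyclicMap (hopfFace k (MonoidAlgebra k G)) (hopfDegen k (MonoidAlgebra k G))
      (rotate k (MonoidAlgebra k G)) (wordToHopf k G) where
  one := by rw [wordToHopf, LinearMap.comp_apply, wordToE_one, map_zero]
  degree n l hl := by
    rw [wordToHopf, LinearMap.comp_apply, wordToE_word l hl]
    exact eToHopf_lof_mem n _
  face i x := by
    rw [wordToHopf, LinearMap.comp_apply, isCyclicMap_wordToE.face, eToHopf_gFace,
      LinearMap.comp_apply]
  degen i x := by
    rw [wordToHopf, LinearMap.comp_apply, isCyclicMap_wordToE.degen, eToHopf_gDegen,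
      LinearMap.comp_apply]
  rot x := by
    rw [wordToHopf, LinearMap.comp_apply, isCyclicMap_wordToE.rot, eToHopf_gRot,
      LinearMap.comp_apply]

theorem wordToHopf_wordMap (s : G) (x : Words k G) :
    wordToHopf k G (wordMap k (s * ·) x) = wordToHopf k G x := by
  rw [wordToHopf, LinearMap.comp_apply, wordToE_wordMap, eToHopf_eAct, LinearMap.comp_apply]

/-- Group elements are group-like, so the coproduct of the Hopf algebra is the diagonal on words. -/
theorem gOmegaDelta_wordToHopf (x : Words k G) :
    gOmegaDelta k (MonoidAlgebra k G) (wordToHopf k G x) =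
      TensorProduct.map (wordToHopf k G) (wordToHopf k G)
        (wordUnzip k G (wordMap k (fun g : G => (g, g)) x)) := by
  refine LinearMap.congr_fun (f := gOmegaDelta k (MonoidAlgebra k G) ∘ₗ wordToHopf k G)
    (g := TensorProduct.map (wordToHopf k G) (wordToHopf k G) ∘ₗ wordUnzip k G ∘ₗ
      (wordMap k (fun g : G => (g, g))).toLinearMap) 
      (words_hom_ext (M := GPow k (MonoidAlgebra k G) ⊗[k] GPow k (MonoidAlgebra k G))
        fun l => ?_) x
  simp only [LinearMap.comp_apply, AlgHom.toLinearMap_apply, wordMap_word, wordUnzip_word,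
    List.map_map, TensorProduct.map_tmul]
  have : (Prod.fst ∘ fun g : G => (g, g)) = id := rfl
  have e : (Prod.snd ∘ fun g : G => (g, g)) = id := rfl
  rw [this, e, List.map_id]
  obtain _ | ⟨c, w⟩ := l
  · simp [isCyclicMap_wordToHopf.one]
  · rw [wordToHopf, LinearMap.comp_apply, wordToE_word (n := w.length) _ (by simp), eToHopf_lof,
      gOmegaDelta, DirectSum.toModule_lof, LinearMap.comp_apply, omegaDelta_groupTensor,
      TensorProduct.map_tmul]

end Quotient

end HopfCyclic

end

noncomputable section

namespace HopfCyclic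

/-! ## The quotient map from words to the bar complex -/

section Bar

variable {k G : Type u} [CommRing k]

theorem bar_hom_ext {M : Type*} [AddCommGroup M] [Module k M] {f g : (⨁ n, GChains k G n) →ₗ[k] M}
    (h : ∀ n x, f (DirectSum.lof k ℕ (GChains k G) n (Finsupp.single x 1)) =
      g (DirectSum.lof k ℕ (GChains k G) n (Finsupp.single x 1))) : f = g := by
  refine DirectSum.linearMap_ext k fun n => ?_
  ext x
  exact h n x

theorem groupCup_lof (n : ℕ) (g : Fin n → G) :
    groupCup k G (DirectSum.lof k ℕ (GChains k G) n (Finsupp.single g 1)) =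
      ∑ i : Fin (n + 1), DirectSum.lof k ℕ (GChains k G) i
          (Finsupp.single (fun t : Fin i => g ⟨t, by omega⟩) 1) ⊗ₜ[k]
        DirectSum.lof k ℕ (GChains k G) (n - i)
          (Finsupp.single (fun t : Fin (n - i) => g ⟨i + t, by omega⟩) 1) := by
  rw [groupCup, DirectSum.toModule_lof, Finsupp.lift_apply, Finsupp.sum_single_index, one_smul]
  exact zero_smul _ _

variable [Group G]

/-- The successive quotients of a sequence in a group. -/
def successiveQuotients {n : ℕ} (x : Fin (n + 1) → G) (i : Fin n) : G :=
  (x i.castSucc)⁻¹ * x i.succ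

theorem successiveQuotients_partialProd {n : ℕ} (g : Fin n → G) :
    successiveQuotients (Fin.partialProd g) = g :=
  funext fun i => Fin.partialProd_right_inv g i

theorem partialProd_successiveQuotients {n : ℕ} (x : Fin (n + 1) → G) (i : Fin (n + 1)) :
    x 0 * Fin.partialProd (successiveQuotients x) i = x i :=
  congrFun (Fin.partialProd_left_inv x) i

theorem cyclicQuotients_succ {n : ℕ} (x : Fin (n + 1) → G) (i : Fin n) :
    cyclicQuotients x i.succ = successiveQuotients x i := by
  have : (finRotate (n + 1)).symm i.succ = i.castSucc :=
    Fin.ext (by simp only [finRotate_symm_val]; simp)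
  rw [cyclicQuotients, this, successiveQuotients]

theorem successiveQuotients_removeNth_zero {n : ℕ} (x : Fin (n + 2) → G) :
    successiveQuotients ((0 : Fin (n + 2)).removeNth x) = fun i => successiveQuotients x i.succ := by
  funext i
  simp [successiveQuotients, Fin.removeNth]

theorem successiveQuotients_removeNth_succ {n : ℕ} (j : Fin (n + 1)) (x : Fin (n + 2) → G) :
    successiveQuotients (j.succ.removeNth x) =
      Fin.contractNth j (· * ·) (successiveQuotients x) := by
  obtain ⟨y, rfl⟩ := exists_eq_val x
  funext i
  simp only [successiveQuotients, Fin.removeNth, Fin.contractNth, Fin.succAbove, Fin.lt_def,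
    Fin.val_castSucc, Fin.val_succ]
  obtain h | h | h := lt_trichotomy (i : ℕ) j
  · have h1 : (i : ℕ) < j + 1 := by omega
    simp [h, h1]
  · simp [h]
  · have h1 : ¬ (i : ℕ) < j + 1 := by omega
    have h2 : ¬ (i : ℕ) < j := by omega
    have h3 : ¬ (i : ℕ) = j := by omega
    simp [h1, h2, h3]

variable (k G) in
/-- The quotient map from the homogeneous bar resolution to the bar complex. -/
def eToBar : GEG k G →ₗ[k] ⨁ n, GChains k G n :=
  DirectSum.toModule k ℕ _ fun n =>
    DirectSum.lof k ℕ (GChains k G) n ∘ₗ Finsupp.lmapDomain k k successiveQuotients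

theorem eToBar_lof (n : ℕ) (x : Fin (n + 1) → G) (a : k) :
    eToBar k G (DirectSum.lof k ℕ (EG k G) n (Finsupp.single x a)) =
      DirectSum.lof k ℕ (GChains k G) n (Finsupp.single (successiveQuotients x) a) := by
  rw [eToBar, DirectSum.toModule_lof, LinearMap.comp_apply, Finsupp.lmapDomain_apply,
    Finsupp.mapDomain_single]

variable (k G) in
/-- The quotient map from words to the bar complex. -/
def wordToBar : Words k G →ₗ[k] ⨁ n, GChains k G n := eToBar k G ∘ₗ wordToE k G

variable (k G) in
/-- The section of the quotient map from words to the bar complex. -/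
def barToWord : (⨁ n, GChains k G n) →ₗ[k] Words k G :=
  wordOfE k G ∘ₗ DirectSum.toModule k ℕ _ (barToE k G)

theorem barToWord_lof (n : ℕ) (g : Fin n → G) (a : k) :
    barToWord k G (DirectSum.lof k ℕ (GChains k G) n (Finsupp.single g a)) =
      a • word k (List.ofFn (Fin.partialProd g)) := by
  rw [barToWord, LinearMap.comp_apply, DirectSum.toModule_lof, barToE, LinearMap.comp_apply,
    Finsupp.lmapDomain_apply, Finsupp.mapDomain_single, wordOfE_lof]

theorem wordToBar_word {n : ℕ} (l : List G) (h : l.length = n + 1) : wordToBar k G (word k l) =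
    DirectSum.lof k ℕ (GChains k G) n
      (Finsupp.single (successiveQuotients fun j : Fin (n + 1) => l[j]) 1) := by
  rw [wordToBar, LinearMap.comp_apply, wordToE_word l h, eToBar_lof]

@[simp] theorem wordToBar_one : wordToBar k G 1 = 0 := by
  rw [wordToBar, LinearMap.comp_apply, wordToE_one, map_zero]

theorem barToWord_lof_mem (n : ℕ) (c : GChains k G n) :
    barToWord k G (DirectSum.lof k ℕ (GChains k G) n c) ∈ wordsOfLength k G (n + 1) := by
  rw [barToWord, LinearMap.comp_apply, DirectSum.toModule_lof]
  exact wordOfE_lof_mem n _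

theorem wordToBar_degree {n : ℕ} {x : Words k G} (hx : x ∈ wordsOfLength k G (n + 1)) :
    ∃ y, wordToBar k G x = DirectSum.lof k ℕ (GChains k G) n y := by
  obtain ⟨y, hy⟩ := wordToE_degree hx
  rw [wordToBar, LinearMap.comp_apply, hy, eToBar, DirectSum.toModule_lof]
  exact ⟨_, rfl⟩

theorem wordToBar_barToWord (c : ⨁ n, GChains k G n) : wordToBar k G (barToWord k G c) = c := by
  refine LinearMap.congr_fun (f := wordToBar k G ∘ₗ barToWord k G) (g := LinearMap.id)
    (bar_hom_ext (M := ⨁ n, GChains k G n) fun n g => ?_) c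
  rw [LinearMap.comp_apply, barToWord_lof, one_smul, wordToBar, LinearMap.comp_apply,
    wordToE_ofFn, eToBar_lof, successiveQuotients_partialProd, LinearMap.id_apply]

theorem exists_wordMap_barToWord (c : G) (w : List G) : ∃ s : G,
    wordMap k (s * ·) (barToWord k G (wordToBar k G (word k (c :: w)))) = word k (c :: w) := by
  refine ⟨c, ?_⟩
  rw [wordToBar_word (n := w.length) _ (by rfl), barToWord_lof, one_smul, wordMap_word,
    List.map_ofFn]
  congr 1
  conv_rhs => rw [← List.ofFn_getElem (xs := c :: w)]
  congr 1
  funext i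
  exact partialProd_successiveQuotients (fun j : Fin (w.length + 1) => (c :: w)[j]) i

/-- The section picks the translate whose first entry is $1$, which an invariant map cannot
distinguish from the original word. -/
theorem barToWord_wordToBar_of_invariant {N : Type*} [AddCommGroup N] [Module k N]
    {ψ : Words k G →ₗ[k] N} (hψ : ∀ (s : G) x, ψ (wordMap k (s * ·) x) = ψ x) (h1 : ψ 1 = 0)
    (x : Words k G) : ψ (barToWord k G (wordToBar k G x)) = ψ x := by
  induction x using words_induction with
  | ha x y hx hy => simp only [map_add, hx, hy]
  | hs a x hx => simp only [map_smul, hx]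
  | h l =>
    obtain _ | ⟨c, w⟩ := l
    · simp [h1]
    · obtain ⟨s, hs⟩ := exists_wordMap_barToWord (k := k) c w
      rw [← hψ s, hs]

theorem wordToHopf_barToWord (c : ⨁ n, GChains k G n) :
    wordToHopf k G (barToWord k G c) = gBarToHopf k G c := by
  rw [wordToHopf, barToWord, LinearMap.comp_apply, LinearMap.comp_apply, wordToE_wordOfE]
  refine LinearMap.congr_fun (f := eToHopf k G ∘ₗ DirectSum.toModule k ℕ _ (barToE k G))
    (g := gBarToHopf k G) (bar_hom_ext (M := GPow k (MonoidAlgebra k G)) fun n g => ?_) c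
  rw [LinearMap.comp_apply, gBarToHopf, DirectSum.toModule_lof, DirectSum.toModule_lof, barToHopf,
    LinearMap.comp_apply]

theorem gBarToHopf_wordToBar (x : Words k G) :
    gBarToHopf k G (wordToBar k G x) = wordToHopf k G x := by
  rw [← wordToHopf_barToWord]
  exact barToWord_wordToBar_of_invariant (N := GPow k (MonoidAlgebra k G)) (ψ := wordToHopf k G)
    wordToHopf_wordMap isCyclicMap_wordToHopf.one x

theorem wordToBar_wordMap (s : G) (x : Words k G) :
    wordToBar k G (wordMap k (s * ·) x) = wordToBar k G x := by
  refine LinearMap.congr_fun (f := wordToBar k G ∘ₗ (wordMap k (s * ·)).toLinearMap)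
    (g := wordToBar k G) (words_hom_ext (M := ⨁ n, GChains k G n) fun l => ?_) x
  rw [LinearMap.comp_apply, AlgHom.toLinearMap_apply, wordMap_word]
  obtain _ | ⟨c, w⟩ := l
  · simp
  · rw [wordToBar_word (n := w.length) _ (by simp), wordToBar_word (n := w.length) (c :: w) (by rfl)]
    congr 2
    funext i
    simp only [successiveQuotients, Fin.getElem_fin, List.getElem_map]
    group

theorem gSign_wordToBar (x : Words k G) :
    gSign k (GChains k G) (wordToBar k G x) = wordToBar k G (wordSign k G x) := by
  refine LinearMap.congr_fun (f := gSign k (GChains k G) ∘ₗ wordToBar k G)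
    (g := wordToBar k G ∘ₗ wordSign k G) (words_hom_ext (M := ⨁ n, GChains k G n) fun l => ?_) x
  rw [LinearMap.comp_apply, LinearMap.comp_apply]
  obtain _ | ⟨c, w⟩ := l
  · simp
  · rw [wordSign_word, List.length_cons, map_smul, wordToBar_word (n := w.length) (c :: w) (by rfl),
      gSign_lof, pow_succ, pow_succ]
    simp

theorem gBarDiff_lof (n : ℕ) (g : Fin (n + 1) → G) :
    gBarDiff k G (DirectSum.lof k ℕ (GChains k G) (n + 1) (Finsupp.single g 1)) =
      DirectSum.lof k ℕ (GChains k G) n (Finsupp.single (fun i => g i.succ) 1) +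
      ∑ j : Fin (n + 1), (-1 : k) ^ ((j : ℕ) + 1) •
        DirectSum.lof k ℕ (GChains k G) n (Finsupp.single (Fin.contractNth j (· * ·) g) 1) := by
  have h := groupHomology.inhomogeneousChains.d_single (A := Rep.trivial k G k) n g (1 : k)
  have h1 : (Rep.trivial k G k).ρ (g 0)⁻¹ (1 : k) = (1 : k) := rfl
  rw [h1] at h
  rw [gBarDiff, DirectSum.toModule_lof, LinearMap.comp_apply]
  refine (congrArg (DirectSum.lof k ℕ (GChains k G) n) h).trans ?_
  rw [map_add, map_sum]
  simp only [map_smul]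

theorem gBarDiff_zero (c : GChains k G 0) :
    gBarDiff k G (DirectSum.lof k ℕ (GChains k G) 0 c) = 0 := by
  rw [gBarDiff, DirectSum.toModule_lof]
  rfl

theorem gBarDiff_wordToBar (x : Words k G) :
    gBarDiff k G (wordToBar k G x) = wordToBar k G (wordBoundary k G x) := by
  refine LinearMap.congr_fun (f := gBarDiff k G ∘ₗ wordToBar k G)
    (g := wordToBar k G ∘ₗ wordBoundary k G) (words_hom_ext (M := ⨁ n, GChains k G n) fun l => ?_) x
  rw [LinearMap.comp_apply, LinearMap.comp_apply]
  obtain _ | ⟨c, l⟩ := l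
  · simp
  obtain _ | ⟨d, l⟩ := l
  · rw [wordBoundary_letter, wordToBar_one, wordToBar_word (n := 0) [c] rfl, gBarDiff_zero]
  · have e : ∀ i : Fin (l.length + 2), wordToBar k G (word k ((c :: d :: l).eraseIdx i)) =
        DirectSum.lof k ℕ (GChains k G) l.length (Finsupp.single (successiveQuotients
          (i.removeNth fun j : Fin (l.length + 2) => (c :: d :: l)[j])) 1) := fun i => by
      rw [wordToBar_word (n := l.length) _ (by
        rw [List.length_eraseIdx_of_lt (by simp; omega)]; simp)]
      congr 3
      funext j
      simp only [Fin.getElem_fin, List.getElem_eraseIdx, Fin.removeNth, Fin.succAbove, Fin.lt_def,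
        Fin.val_castSucc]
      split_ifs <;> rfl
    rw [wordBoundary_word_eq_sum, List.length_cons, List.length_cons, map_sum, wordToBar_word (n := l.length + 1) (c :: d :: l) (by rfl),
      gBarDiff_lof]
    simp only [map_smul]
    rw [← Fin.sum_univ_eq_sum_range (fun i => (-1 : k) ^ i •
      wordToBar k G (word k ((c :: d :: l).eraseIdx i)))]
    refine Eq.trans ?_ (Fin.sum_univ_succ _).symm
    congr 1
    · rw [e 0, successiveQuotients_removeNth_zero]
      simp
    · refine Finset.sum_congr rfl fun j _ => ?_
      rw [e j.succ, successiveQuotients_removeNth_succ]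
      rfl

/-- The front part $(x_0,\dots,x_i)$ and the back part $(x_i,\dots,x_n)$ share a letter, so their
successive quotients cut $(g_1,\dots,g_n)$ after $g_i$ without overlap. -/
theorem groupCup_wordToBar (x : Words k G) :
    groupCup k G (wordToBar k G x) =
      TensorProduct.map (wordToBar k G) (wordToBar k G) (cupSeq k G 0 x) := by
  induction x using words_induction with
  | ha x y hx hy => rw [map_add, map_add, map_add, map_add, hx, hy]
  | hs a x hx => rw [map_smul, map_smul, map_smul, map_smul, hx]
  | h l =>
    obtain _ | ⟨c, w⟩ := l
    · rw [word_nil, wordToBar_one, cupSeq_one, map_zero, map_zero]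
    have h1 : (Prod.fst ∘ fun g : G => (g, g)) = id := rfl
    have h2 : (Prod.snd ∘ fun g : G => (g, g)) = id := rfl
    rw [cupSeq_apply, wordMap_word, wordCyclicAW, wordAW_word, List.length_map, List.length_cons,
      List.map_map, List.map_map, h1, h2,
      List.map_id, map_sum, wordToBar_word (n := w.length) (c :: w) (by rfl), groupCup_lof,
      ← Fin.sum_univ_eq_sum_range (fun i =>
        TensorProduct.map (wordToBar k G) (wordToBar k G)
          (word k ((c :: w).take (i + 1)) ⊗ₜ word k ((c :: w).drop i)))]
    refine Finset.sum_congr rfl fun i _ => ?_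
    have hi := i.2
    rw [TensorProduct.map_tmul, wordToBar_word (n := i) _ (by simp; omega),
      wordToBar_word (n := w.length - i) _ (by simp; omega)]
    congr 3
    · funext t
      simp only [successiveQuotients, Fin.getElem_fin, List.getElem_take, Fin.val_castSucc,
        Fin.val_succ]
    · funext t
      simp [successiveQuotients, add_assoc]

/-! ### The bar complex as a quotient of tensor powers of the group algebra -/

variable (k G) in
/-- The basis of the tensor powers of a group algebra given by the tensors of group elements. -/
def groupTensorBasis (n : ℕ) : Module.Basis (Fin (n + 1) → G) k (TPow k (MonoidAlgebra k G) n) :=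
  Basis.piTensorProduct fun _ => MonoidAlgebra.basis G k

theorem groupTensorBasis_apply {n : ℕ} (h : Fin (n + 1) → G) :
    groupTensorBasis k G n h = groupTensor k h := by
  rw [groupTensorBasis, Basis.piTensorProduct_apply, groupTensor]
  congr 1

variable (k G) in
/-- The left inverse of the embedding of the bar complex, forgetting the first factor. -/
def hopfToBar : GPow k (MonoidAlgebra k G) →ₗ[k] ⨁ n, GChains k G n :=
  DirectSum.toModule k ℕ _ fun n => DirectSum.lof k ℕ (GChains k G) n ∘ₗ
    (groupTensorBasis k G n).constr k fun h => Finsupp.single (Fin.tail h) 1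

theorem hopfToBar_groupTensor {n : ℕ} (h : Fin (n + 1) → G) :
    hopfToBar k G (gι k (MonoidAlgebra k G) n (groupTensor k h)) =
      DirectSum.lof k ℕ (GChains k G) n (Finsupp.single (Fin.tail h) 1) := by
  rw [hopfToBar, DirectSum.toModule_lof, LinearMap.comp_apply, ← groupTensorBasis_apply,
    Module.Basis.constr_basis]

theorem hopfToBar_wordToHopf (x : Words k G) :
    hopfToBar k G (wordToHopf k G x) = wordToBar k G x := by
  rw [wordToHopf, wordToBar, LinearMap.comp_apply, LinearMap.comp_apply]
  generalize wordToE k G x = z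
  refine LinearMap.congr_fun (f := hopfToBar k G ∘ₗ eToHopf k G) (g := eToBar k G)
    (geg_hom_ext (M := ⨁ n, GChains k G n) fun n x => ?_) z
  rw [LinearMap.comp_apply, eToHopf_lof, hopfToBar_groupTensor, eToBar_lof]
  congr 2
  funext i
  exact cyclicQuotients_succ x i

theorem hopfToBar_gBarToHopf (c : ⨁ n, GChains k G n) :
    hopfToBar k G (gBarToHopf k G c) = c := by
  rw [← wordToHopf_barToWord, hopfToBar_wordToHopf, wordToBar_barToWord]

theorem tpow_hom_ext {M : Type*} [AddCommGroup M] [Module k M] {n : ℕ}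
    {f g : TPow k (MonoidAlgebra k G) n →ₗ[k] M}
    (h : ∀ x : Fin (n + 1) → G, f (groupTensor k x) = g (groupTensor k x)) : f = g :=
  (groupTensorBasis k G n).ext fun x => by rw [groupTensorBasis_apply, h]

/-- The coinvariants of the codiagonal coaction are the image of the bar complex. -/
theorem hopfChains_eq (n : ℕ) : (hopfChains k (MonoidAlgebra k G) n).map (gι k _ n) =
    LinearMap.range (barToHopf k G n) := by
  have hco : ∀ h : Fin (n + 1) → G, codiagonalCoaction k (MonoidAlgebra k G) n (groupTensor k h) =
      groupTensor k h ⊗ₜ MonoidAlgebra.of k G (List.ofFn h).prod := fun h => by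
    rw [codiagonalCoaction, LinearMap.comp_apply, omegaDelta_groupTensor, LinearMap.lTensor_tmul]
    congr 1
    rw [groupTensor, PiTensorProduct.lift.tprod, MultilinearMap.mkPiAlgebraFin_apply,
      map_list_prod, List.map_ofFn]
    rfl
  have hg : ∀ h : Fin (n + 1) → G, (List.ofFn h).prod = 1 →
      gι k (MonoidAlgebra k G) n (groupTensor k h) =
        barToHopf k G n (Finsupp.single (Fin.tail h) 1) := fun h hh => by
    rw [barToHopf, LinearMap.comp_apply, barToE, LinearMap.comp_apply, Finsupp.lmapDomain_apply,
      Finsupp.mapDomain_single, eToHopf_lof]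
    congr 2
    funext i
    induction i using Fin.cases with
    | zero =>
      have e : (finRotate (n + 1)).symm 0 = Fin.last n :=
        Fin.ext (by simp only [finRotate_symm_val]; simp)
      rw [cyclicQuotients, e, Fin.partialProd_zero, mul_one]
      have : Fin.partialProd (Fin.tail h) (Fin.last n) = (List.ofFn (Fin.tail h)).prod := by
        simp [Fin.partialProd, List.take_of_length_le]
      rw [this]
      rw [List.ofFn_succ, List.prod_cons] at hh
      exact eq_inv_of_mul_eq_one_left hh
    | succ i => rw [cyclicQuotients_succ, successiveQuotients_partialProd]; rfl
  refine le_antisymm ?_ ?_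
  · rintro _ ⟨z, hz, rfl⟩
    -- The coefficient of the unit, applied to the group factor of the coaction, projects onto the
    -- span of tensors of group elements with product $1$. Coinvariants are fixed by this
    -- projection, hence lie in that span.
    let ε : MonoidAlgebra k G →ₗ[k] k :=
      Finsupp.lapply 1 ∘ₗ (MonoidAlgebra.coeffLinearEquiv k).toLinearMap
    let R : Module.End k (TPow k (MonoidAlgebra k G) n) :=
      (TensorProduct.rid k _).toLinearMap ∘ₗ LinearMap.lTensor _ ε ∘ₗ
        codiagonalCoaction k (MonoidAlgebra k G) n
    have hε : ∀ g : G, g ≠ 1 → ε (MonoidAlgebra.of k G g) = 0 := fun g hg => by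
      simp [ε, MonoidAlgebra.of_apply, hg]
    have hε1 : ε 1 = 1 := by simp [ε, MonoidAlgebra.one_def]
    have hR : R z = z := by
      have : codiagonalCoaction k (MonoidAlgebra k G) n z = z ⊗ₜ 1 := hz
      simp [R, this, hε1]
    have h0 : ∀ z, gι k (MonoidAlgebra k G) n (R z) ∈ LinearMap.range (barToHopf k G n) := by
      intro z
      have : (LinearMap.range (barToHopf k G n)).mkQ ∘ₗ gι k (MonoidAlgebra k G) n ∘ₗ R = 0 := by
        refine tpow_hom_ext fun h => ?_
        simp only [LinearMap.comp_apply, LinearMap.zero_apply, Submodule.mkQ_apply,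
          Submodule.Quotient.mk_eq_zero, R, hco, LinearMap.lTensor_tmul]
        by_cases hh : (List.ofFn h).prod = 1
        · rw [hh, map_one, hε1]
          exact ⟨Finsupp.single (Fin.tail h) 1, by simp [hg h hh]⟩
        · rw [hε _ hh]
          simp
      simpa using LinearMap.congr_fun this z
    rw [← hR]
    exact h0 z
  · rintro _ ⟨c, rfl⟩
    induction c using Finsupp.induction_linear with
    | zero => simp
    | add x y hx hy => rw [map_add]; exact add_mem hx hy
    | single g a =>
      rw [← mul_one a, ← smul_eq_mul, ← Finsupp.smul_single, map_smul]
      refine Submodule.smul_mem _ _ ?_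
      have hp : (List.ofFn (Fin.cons (List.ofFn g).prod⁻¹ g : Fin (n + 1) → G)).prod = 1 := by
        simp [List.ofFn_succ]
      have ht : Fin.tail (Fin.cons (List.ofFn g).prod⁻¹ g : Fin (n + 1) → G) = g := Fin.tail_cons _ _
      have hgt := hg _ hp
      rw [ht] at hgt
      rw [← hgt]
      refine Submodule.mem_map_of_mem ?_
      change codiagonalCoaction k (MonoidAlgebra k G) n _ = _
      rw [hco, hp, map_one]
      rfl

end Bar

end HopfCyclic

end

noncomputable section

namespace HopfCyclic

/-! ## Naturality of the Alexander–Whitney maps -/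

section Naturality

variable {k : Type*} [CommRing k] {P Q : Type*} [AddCommGroup P] [Module k P] [AddCommGroup Q]
  [Module k Q] {F : P →ₗ[k] Q}

theorem map_list_prod_of_intertwine {a : ℕ → Module.End k P} {a' : ℕ → Module.End k Q}
    (h : ∀ i x, F (a i x) = a' i (F x)) (L : List ℕ) (x : P) :
    F ((L.map a).prod x) = (L.map a').prod (F x) := by
  induction L with
  | nil => rfl
  | cons i L ih =>
    rw [List.map_cons, List.map_cons, List.prod_cons, List.prod_cons, Module.End.mul_apply,
      Module.End.mul_apply, h, ih]

theorem map_pow_of_intertwine {a : Module.End k P} {a' : Module.End k Q}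
    (h : ∀ x, F (a x) = a' (F x)) (i : ℕ) (x : P) : F ((a ^ i) x) = (a' ^ i) (F x) := by
  induction i with
  | zero => rfl
  | succ i ih => rw [pow_succ', pow_succ', Module.End.mul_apply, Module.End.mul_apply, h, ih]

theorem map_map_of_intertwine {a b : Module.End k P} {a' b' : Module.End k Q}
    (ha : ∀ x, F (a x) = a' (F x)) (hb : ∀ x, F (b x) = b' (F x)) (z : P ⊗[k] P) :
    TensorProduct.map F F (TensorProduct.map a b z) =
      TensorProduct.map a' b' (TensorProduct.map F F z) := by
  refine LinearMap.congr_fun (f := TensorProduct.map F F ∘ₗ TensorProduct.map a b)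
    (g := TensorProduct.map a' b' ∘ₗ TensorProduct.map F F) (TensorProduct.ext' fun x y => ?_) z
  simp [ha, hb]

variable {face degen : ℕ → Module.End k P} {rot : Module.End k P}
  {face' degen' : ℕ → Module.End k Q} {rot' : Module.End k Q}

theorem alexanderWhitney_natural (hf : ∀ i x, F (face i x) = face' i (F x)) (n : ℕ)
    (z : P ⊗[k] P) : TensorProduct.map F F (alexanderWhitney face n z) =
      alexanderWhitney face' n (TensorProduct.map F F z) := by
  simp only [alexanderWhitney, LinearMap.sum_apply, map_sum]
  exact Finset.sum_congr rfl fun p _ =>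
    map_map_of_intertwine (map_list_prod_of_intertwine hf _) (map_pow_of_intertwine (hf 0) _) z

theorem diagConnes_natural (hd : ∀ i x, F (degen i x) = degen' i (F x))
    (hr : ∀ x, F (rot x) = rot' (F x)) (n : ℕ) (z : P ⊗[k] P) :
    TensorProduct.map F F (diagConnes degen rot n z) =
      diagConnes degen' rot' n (TensorProduct.map F F z) := by
  have h : ∀ i x, F ((rot * degen n * rot ^ i) x) = (rot' * degen' n * rot' ^ i) (F x) := fun i x => by
    simp only [Module.End.mul_apply, hr, hd, map_pow_of_intertwine hr]
  simp only [diagConnes, LinearMap.sum_apply, LinearMap.smul_apply, map_sum, map_smul]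
  exact Finset.sum_congr rfl fun i _ => congrArg _ (map_map_of_intertwine (h i) (h i) z)

theorem shihHomotopy_natural (hf : ∀ i x, F (face i x) = face' i (F x))
    (hd : ∀ i x, F (degen i x) = degen' i (F x)) (n : ℕ) (z : P ⊗[k] P) :
    TensorProduct.map F F (shihHomotopy face degen n z) =
      shihHomotopy face' degen' n (TensorProduct.map F F z) := by
  simp only [shihHomotopy, LinearMap.sum_apply, LinearMap.smul_apply, map_sum, map_smul]
  refine Finset.sum_congr rfl fun q _ => Finset.sum_congr rfl fun p _ =>
    Finset.sum_congr rfl fun α _ => congrArg _ (map_map_of_intertwine (fun x => ?_) (fun x => ?_) z)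
  · rw [Module.End.mul_apply, Module.End.mul_apply, Module.End.mul_apply, Module.End.mul_apply,
      map_list_prod_of_intertwine (a := fun b => degen (b + (n - p - q)))
        (a' := fun b => degen' (b + (n - p - q))) (fun i x => hd _ x), hd,
      map_list_prod_of_intertwine hf]
  · rw [Module.End.mul_apply, Module.End.mul_apply,
      map_list_prod_of_intertwine (a := fun b => degen (b + (n - p - q)))
        (a' := fun b => degen' (b + (n - p - q))) (fun i x => hd _ x),
      map_list_prod_of_intertwine hf]

theorem cyclicAW_natural (hf : ∀ i x, F (face i x) = face' i (F x))
    (hd : ∀ i x, F (degen i x) = degen' i (F x)) (hr : ∀ x, F (rot x) = rot' (F x)) (r n : ℕ)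
    (z : P ⊗[k] P) : TensorProduct.map F F (cyclicAW face degen rot r n z) =
      cyclicAW face' degen' rot' r n (TensorProduct.map F F z) := by
  induction r generalizing n z with
  | zero => exact alexanderWhitney_natural hf n z
  | succ r ih =>
    simp only [cyclicAW, LinearMap.neg_apply, map_neg, Module.End.mul_apply]
    rw [ih, diagConnes_natural hd hr, shihHomotopy_natural hf hd]

theorem mapRange_seqConst (p : P →ₗ[k] Q) (x : ℕ →₀ P) :
    totalMap (seqConst p) x = Finsupp.mapRange.linearMap p x := by
  refine LinearMap.congr_fun (f := totalMap (seqConst p)) (g := Finsupp.mapRange.linearMap p)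
    (finsupp_hom_ext fun i x => ?_) x
  rw [totalMap_seqConst_single]
  simp

theorem kunnethTotal_natural (p : P →ₗ[k] Q) (s : ℕ) (z : P ⊗[k] P) :
    kunnethTotal s (TensorProduct.map p p z) = TensorProduct.map (Finsupp.mapRange.linearMap p)
      (Finsupp.mapRange.linearMap p) (kunnethTotal s z) := by
  refine LinearMap.congr_fun (f := kunnethTotal s ∘ₗ TensorProduct.map p p)
    (g := TensorProduct.map (Finsupp.mapRange.linearMap p)
      (Finsupp.mapRange.linearMap p) ∘ₗ kunnethTotal s) (TensorProduct.ext' fun x y => ?_) z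
  simp [kunnethTotal]

theorem totalKunneth_mapRange (p : P →ₗ[k] Q) (z : ℕ →₀ P ⊗[k] P) :
    totalKunneth (Finsupp.mapRange.linearMap (TensorProduct.map p p) z) =
      TensorProduct.map (Finsupp.mapRange.linearMap p) (Finsupp.mapRange.linearMap p)
        (totalKunneth z) := by
  refine LinearMap.congr_fun
    (f := totalKunneth ∘ₗ Finsupp.mapRange.linearMap (TensorProduct.map p p))
    (g := TensorProduct.map (Finsupp.mapRange.linearMap p) (Finsupp.mapRange.linearMap p) ∘ₗ
      totalKunneth) (finsupp_hom_ext fun i x => ?_) z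
  simp [totalKunneth, kunnethTotal_natural]

end Naturality

/-! ## Complexes presented by words -/

section Presentation

variable {k : Type*} [CommRing k] {S : Type*}

variable (k S) in
/-- The part of degree `n` of `k[u] ⊗ words`. -/
def totalWords (n : ℕ) : Submodule k (ℕ →₀ Words k S) :=
  ⨆ i : Fin (n / 2 + 1), (wordsOfLength k S (n - 2 * i + 1)).map (Finsupp.lsingle (i : ℕ))

theorem single_mem_totalWords (i m : ℕ) {x : Words k S} (hx : x ∈ wordsOfLength k S (m + 1)) :
    Finsupp.single i x ∈ totalWords k S (m + 2 * i) := by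
  refine Submodule.mem_iSup_of_mem ⟨i, by omega⟩ ⟨x, ?_, rfl⟩
  simpa using hx

theorem totalWords_le {n : ℕ} {W : Submodule k (ℕ →₀ Words k S)}
    (h : ∀ i m, m + 2 * i = n → ∀ x ∈ wordsOfLength k S (m + 1), Finsupp.single i x ∈ W) :
    totalWords k S n ≤ W := by
  refine iSup_le fun i => ?_
  rintro _ ⟨x, hx, rfl⟩
  exact h i (n - 2 * i) (by have := i.2; omega) x hx

theorem total_induction {p : (ℕ →₀ Words k S) → Prop}
    (X : ℕ →₀ Words k S) (h : ∀ i l, p (Finsupp.single i (word k l)))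
    (ha : ∀ x y, p x → p y → p (x + y)) (hs : ∀ (a : k) x, p x → p (a • x)) : p X := by
  induction X using Finsupp.induction_linear with
  | zero => simpa using hs 0 _ (h 0 [])
  | add x y hx hy => exact ha x y hx hy
  | single i x =>
    induction x using words_induction with
    | ha x y hx hy => rw [Finsupp.single_add]; exact ha _ _ hx hy
    | hs a x hx => rw [← Finsupp.smul_single]; exact hs a _ hx
    | h l => exact h i l

variable {Q : Type*} [AddCommGroup Q] [Module k Q]

/-- A presentation of a complex as a quotient of the total mixed complex of words. -/
structure IsWordPresentation (C : SubquotientComplex k (ℕ →₀ Q)) (ϖ : Words k S →ₗ[k] Q) : Prop where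
  one : ϖ 1 = 0
  chains : ∀ n, C.chains n = (totalWords k S n).map (Finsupp.mapRange.linearMap ϖ)
  degen : C.degen = (totalSub (degenWords k S)).map (Finsupp.mapRange.linearMap ϖ)
  d : ∀ X, C.d (Finsupp.mapRange.linearMap ϖ X) =
    Finsupp.mapRange.linearMap ϖ (totalMap (mixedSeq k S) X)
  sgn : ∀ X, C.sgn (Finsupp.mapRange.linearMap ϖ X) =
    Finsupp.mapRange.linearMap ϖ (Finsupp.mapRange.linearMap (wordSign k S) X)

section SubquotientComplex

variable {V : Type*} [AddCommGroup V] [Module k V] (C : SubquotientComplex k V)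

theorem SubquotientComplex.tmul_mem_tensorBoundaries_left {x y : V} (hx : x ∈ C.degen)
    (hy : y ∈ ⨆ n, C.chains n) : x ⊗ₜ[k] y ∈ C.tensorBoundaries := by
  have h : x ⊗ₜ[k] y ∈ SubquotientComplex.tensorSub C.degen (⨆ n, C.chains n) :=
    ⟨⟨x, hx⟩ ⊗ₜ ⟨y, hy⟩, rfl⟩
  exact Submodule.mem_sup_left (Submodule.mem_sup_right h)

theorem SubquotientComplex.tmul_mem_tensorBoundaries_right {x y : V} (hx : x ∈ ⨆ n, C.chains n)
    (hy : y ∈ C.degen) : x ⊗ₜ[k] y ∈ C.tensorBoundaries := by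
  have h : x ⊗ₜ[k] y ∈ SubquotientComplex.tensorSub (⨆ n, C.chains n) C.degen :=
    ⟨⟨x, hx⟩ ⊗ₜ ⟨y, hy⟩, rfl⟩
  exact Submodule.mem_sup_right h

theorem SubquotientComplex.tensorDiff_mem_tensorBoundaries {x y : V} (hx : x ∈ ⨆ n, C.chains n)
    (hy : y ∈ ⨆ n, C.chains n) :
    C.d x ⊗ₜ[k] y + C.sgn x ⊗ₜ[k] C.d y ∈ C.tensorBoundaries := by
  refine Submodule.mem_sup_left (Submodule.mem_sup_left ⟨x ⊗ₜ y, ⟨⟨x, hx⟩ ⊗ₜ ⟨y, hy⟩, rfl⟩, ?_⟩)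
  simp

theorem SubquotientComplex.map_tensorBoundaries_le {N : Type*} [AddCommGroup N] [Module k N]
    {f : V ⊗[k] V →ₗ[k] N} {W : Submodule k N}
    (h : ∀ x ∈ ⨆ n, C.chains n, ∀ y ∈ ⨆ n, C.chains n,
      f (C.d x ⊗ₜ[k] y + C.sgn x ⊗ₜ[k] C.d y) ∈ W)
    (hl : ∀ x ∈ C.degen, ∀ y ∈ ⨆ n, C.chains n, f (x ⊗ₜ y) ∈ W)
    (hr : ∀ x ∈ ⨆ n, C.chains n, ∀ y ∈ C.degen, f (x ⊗ₜ y) ∈ W)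
    {z : V ⊗[k] V} (hz : z ∈ C.tensorBoundaries) : f z ∈ W := by
  have hsub : ∀ (A B : Submodule k V) (g : V ⊗[k] V →ₗ[k] N),
      (∀ x ∈ A, ∀ y ∈ B, g (x ⊗ₜ y) ∈ W) → SubquotientComplex.tensorSub A B ≤ W.comap g := by
    rintro A B g hg _ ⟨t, rfl⟩
    induction t using TensorProduct.induction_on with
    | zero => rw [map_zero]; exact zero_mem _
    | add x y hx hy => rw [map_add]; exact add_mem hx hy
    | tmul x y => exact hg x x.2 y y.2
  have : C.tensorBoundaries ≤ W.comap f := by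
    refine sup_le (sup_le ?_ (hsub _ _ f hl)) (hsub _ _ f hr)
    rw [Submodule.map_le_iff_le_comap]
    exact hsub _ _ (f ∘ₗ (TensorProduct.map C.d LinearMap.id + TensorProduct.map C.sgn C.d))
      fun x hx y hy => by simpa using h x hx y hy
  exact this hz

end SubquotientComplex

namespace IsWordPresentation

variable {C : SubquotientComplex k (ℕ →₀ Q)} {ϖ : Words k S →ₗ[k] Q}

theorem mem_chains (h : IsWordPresentation C ϖ) (X : ℕ →₀ Words k S) :
    Finsupp.mapRange.linearMap ϖ X ∈ ⨆ n, C.chains n := by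
  induction X using total_induction with
  | ha x y hx hy => rw [map_add]; exact add_mem hx hy
  | hs a x hx => rw [map_smul]; exact Submodule.smul_mem _ _ hx
  | h i l =>
    obtain _ | ⟨c, l⟩ := l
    · simp [h.one]
    · refine Submodule.mem_iSup_of_mem (l.length + 2 * i) ?_
      rw [h.chains]
      exact Submodule.mem_map_of_mem (single_mem_totalWords i l.length (word_mem rfl))

theorem exists_of_mem_chains (h : IsWordPresentation C ϖ) {y : ℕ →₀ Q} (hy : y ∈ ⨆ n, C.chains n) :
    ∃ X, y = Finsupp.mapRange.linearMap ϖ X := by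
  have : (⨆ n, C.chains n) ≤ LinearMap.range (Finsupp.mapRange.linearMap ϖ) := iSup_le fun n => by
    rw [h.chains]
    exact LinearMap.map_le_range
  obtain ⟨X, hX⟩ := this hy
  exact ⟨X, hX.symm⟩

theorem mem_degen (h : IsWordPresentation C ϖ) {X : ℕ →₀ Words k S}
    (hX : X ∈ totalSub (degenWords k S)) : Finsupp.mapRange.linearMap ϖ X ∈ C.degen := by
  rw [h.degen]
  exact Submodule.mem_map_of_mem hX

variable (ϖ) in
/-- The map from the tensor square of words, composed with the Künneth map. -/
def tensorMap : (ℕ →₀ WordTensor k S S) →ₗ[k] (ℕ →₀ Q) ⊗[k] (ℕ →₀ Q) :=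
  TensorProduct.map (Finsupp.mapRange.linearMap ϖ) (Finsupp.mapRange.linearMap ϖ) ∘ₗ totalKunneth

/-- A factor that is degenerate or empty becomes zero in the complex, so after the Künneth map every
summand has a factor regarded as zero. -/
theorem tensorMap_degen (h : IsWordPresentation C ϖ) {Z : ℕ →₀ WordTensor k S S}
    (hZ : Z ∈ totalSub (degenTensorsOne k S S)) : tensorMap ϖ Z ∈ C.tensorBoundaries := by
  have hd : ∀ i : ℕ, ∀ x ∈ degenWordsOne k S,
      Finsupp.mapRange.linearMap ϖ (Finsupp.single i x) ∈ C.degen := fun i x hx => by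
    refine degenWordsOne_map (f := Finsupp.mapRange.linearMap ϖ ∘ₗ Finsupp.lsingle i)
      (fun x hx => h.mem_degen (single_mem_totalSub i hx)) ?_ hx
    simp [h.one]
  have hle : totalSub (degenTensorsOne k S S) ≤ C.tensorBoundaries.comap (tensorMap ϖ) := by
    refine totalSub_le fun i z hz => ?_
    refine tensorIdeal_map (f := tensorMap ϖ ∘ₗ Finsupp.lsingle i) (W := C.tensorBoundaries)
      (fun x hx y => ?_) (fun x y hy => ?_) hz
    · rw [LinearMap.comp_apply, tensorMap, LinearMap.comp_apply, Finsupp.lsingle_apply,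
        totalKunneth_single, map_sum]
      refine sum_mem fun p _ => ?_
      rw [TensorProduct.map_tmul]
      exact C.tmul_mem_tensorBoundaries_left (hd p.1 x hx) (h.mem_chains _)
    · rw [LinearMap.comp_apply, tensorMap, LinearMap.comp_apply, Finsupp.lsingle_apply,
        totalKunneth_single, map_sum]
      refine sum_mem fun p _ => ?_
      rw [TensorProduct.map_tmul]
      exact C.tmul_mem_tensorBoundaries_right (h.mem_chains _) (hd p.2 y hy)
  exact hle hZ

theorem tensorMap_tensorSeq (h : IsWordPresentation C ϖ) (Z : ℕ →₀ WordTensor k S S) :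
    tensorMap ϖ (totalMap (tensorSeq k S) Z) ∈ C.tensorBoundaries := by
  have h1 : totalMap (seqConst (LinearMap.id : Module.End k (Words k S))) = LinearMap.id :=
    LinearMap.ext totalMap_seqConst_id
  have h2 : totalMap (seqConst (wordSign k S)) = Finsupp.mapRange.linearMap (wordSign k S) :=
    LinearMap.ext (mapRange_seqConst _)
  rw [tensorMap, LinearMap.comp_apply, tensorSeq_eq, totalMap_add, LinearMap.add_apply, map_add,
    totalKunneth_totalMap, totalKunneth_totalMap, h1, h2]
  induction totalKunneth Z using TensorProduct.induction_on with
  | zero => simp only [map_zero, add_zero]; exact zero_mem _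
  | add x y hx hy => 
    simp only [map_add] at hx hy ⊢
    rw [add_add_add_comm]
    exact add_mem hx hy
  | tmul x y =>
    have := C.tensorDiff_mem_tensorBoundaries (h.mem_chains x) (h.mem_chains y)
    rw [h.d, h.d, h.sgn] at this
    simpa only [map_add, TensorProduct.map_tmul, LinearMap.id_apply] using this

end IsWordPresentation

end Presentation

/-! ## The complexes of the group algebra in terms of words -/

section Complexes

variable {k G : Type u} [CommRing k] [Group G]

/-- Words of length `m + 1` span, after passing to the quotient, the chains of degree `m`. -/
theorem wordToHopf_wordsOfLength (m : ℕ) : (wordsOfLength k G (m + 1)).map (wordToHopf k G) =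
    (hopfChains k (MonoidAlgebra k G) m).map (gι k (MonoidAlgebra k G) m) := by
  rw [hopfChains_eq]
  refine le_antisymm ?_ ?_
  · rintro _ ⟨x, hx, rfl⟩
    obtain ⟨y, hy⟩ := wordToBar_degree hx
    rw [← gBarToHopf_wordToBar, hy, gBarToHopf, DirectSum.toModule_lof]
    exact ⟨y, rfl⟩
  · rintro _ ⟨c, rfl⟩
    refine ⟨_, barToWord_lof_mem m c, ?_⟩
    rw [wordToHopf_barToWord, gBarToHopf, DirectSum.toModule_lof]

/-- Degeneracies commute with the quotient map, and the chains in each degree are images of words,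
so degenerate chains and degenerate words have the same image. -/
theorem hopfDegenerate_eq : (⨆ m, (hopfDegenerate k (MonoidAlgebra k G) m).map
    (gι k (MonoidAlgebra k G) m)) = (degenWords k G).map (wordToHopf k G) := by
  refine le_antisymm (iSup_le fun m => ?_) ?_
  · obtain _ | m := m
    · simp [hopfDegenerate]
    · rw [hopfDegenerate, Submodule.map_iSup]
      refine iSup_le fun i => ?_
      rintro _ ⟨_, ⟨z, hz, rfl⟩, rfl⟩
      have h := wordToHopf_wordsOfLength (k := k) (G := G) m
      obtain ⟨x, -, hx⟩ := h.ge (Submodule.mem_map_of_mem hz)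
      refine ⟨_, wordDegen_mem_degenWords i x, ?_⟩
      rw [isCyclicMap_wordToHopf.degen, hx, gDegen_lof _ i.2]
  · rw [Submodule.map_le_iff_le_comap]
    refine wordSpan_le.2 fun l hl => ?_
    obtain ⟨u, c, v, rfl⟩ := hl.exists_eq
    have h := wordToHopf_wordsOfLength (k := k) (G := G) (u.length + v.length)
    obtain ⟨z, hz, e⟩ := h.le (Submodule.mem_map_of_mem (word_mem (k := k)
      (p := fun l => l.length = u.length + v.length + 1) (l := u ++ c :: v) (by simp; omega)))
    rw [Submodule.mem_comap, word_degenerate_eq, isCyclicMap_wordToHopf.degen, ← e,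
      gDegen_lof _ (by omega)]
    refine Submodule.mem_iSup_of_mem (u.length + v.length + 1) (Submodule.mem_map_of_mem ?_)
    exact Submodule.mem_iSup_of_mem (⟨u.length, by omega⟩ : Fin (u.length + v.length + 1))
      (Submodule.mem_map_of_mem hz)

variable (k G) in
/-- The map from `k[u] ⊗ words` to the total complex. -/
abbrev totalToHopf : (ℕ →₀ Words k G) →ₗ[k] (ℕ →₀ GPow k (MonoidAlgebra k G)) :=
  Finsupp.mapRange.linearMap (wordToHopf k G)

theorem cyclicComplex_chains (n : ℕ) : (cyclicComplex k (MonoidAlgebra k G)).chains n =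
    (totalWords k G n).map (totalToHopf k G) := by
  rw [totalWords, Submodule.map_iSup, cyclicComplex]
  refine iSup_congr fun i => ?_
  rw [Submodule.map_comp, ← wordToHopf_wordsOfLength, ← Submodule.map_comp, ← Submodule.map_comp]
  congr 1
  exact LinearMap.ext fun x => by simp

theorem cyclicComplex_degen : (cyclicComplex k (MonoidAlgebra k G)).degen =
    (totalSub (degenWords k G)).map (totalToHopf k G) := by
  rw [totalSub, Submodule.map_iSup, cyclicComplex]
  refine iSup_congr fun i => ?_
  simp only [Submodule.map_comp]
  rw [← Submodule.map_iSup, hopfDegenerate_eq, ← Submodule.map_comp, ← Submodule.map_comp]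
  congr 1
  exact LinearMap.ext fun x => by simp

theorem cyclicComplex_d (X : ℕ →₀ Words k G) :
    (cyclicComplex k (MonoidAlgebra k G)).d (totalToHopf k G X) =
      totalToHopf k G (totalMap (mixedSeq k G) X) := by
  rw [cyclicComplex, totalDiff_eq]
  refine (mapRange_totalMap (wordToHopf k G) (mixedSeq k G) _ (wordToHopf k G) (fun r x => ?_) X).symm
  match r with
  | 0 => exact isCyclicMap_wordToHopf.boundary x
  | 1 => exact isCyclicMap_wordToHopf.connes x
  | r + 2 => exact map_zero _

theorem cyclicComplex_sgn (X : ℕ →₀ Words k G) :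
    (cyclicComplex k (MonoidAlgebra k G)).sgn (totalToHopf k G X) =
      totalToHopf k G (Finsupp.mapRange.linearMap (wordSign k G) X) := by
  refine LinearMap.congr_fun
    (f := (cyclicComplex k (MonoidAlgebra k G)).sgn ∘ₗ totalToHopf k G)
    (g := totalToHopf k G ∘ₗ Finsupp.mapRange.linearMap (wordSign k G))
    (finsupp_hom_ext fun i x => ?_) X
  simp [cyclicComplex, isCyclicMap_wordToHopf.sign]

theorem isWordPresentation_cyclicComplex :
    IsWordPresentation (cyclicComplex k (MonoidAlgebra k G)) (wordToHopf k G) where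
  one := isCyclicMap_wordToHopf.one
  chains := cyclicComplex_chains
  degen := cyclicComplex_degen
  d := cyclicComplex_d
  sgn := cyclicComplex_sgn

theorem cyclicCup_single (j n : ℕ) (z : TPow k (MonoidAlgebra k G) n) :
    cyclicCup k (MonoidAlgebra k G) (Finsupp.single j (gι k (MonoidAlgebra k G) n z)) =
      ∑ sr ∈ Finset.HasAntidiagonal.antidiagonal j, kunnethTotal sr.1
        (cyclicAW (hFace k (MonoidAlgebra k G)) (hDegen k (MonoidAlgebra k G))
          (hRot k (MonoidAlgebra k G)) sr.2 n
          (gOmegaDelta k (MonoidAlgebra k G) (gι k (MonoidAlgebra k G) n z))) := by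
  rw [cyclicCup, Finsupp.lsum_single, DirectSum.toModule_lof, LinearMap.sum_apply]
  rfl

/-- The element `Z` collects the differences between the explicit and the recursive entries. -/
theorem cyclicCup_word (j : ℕ) (l : List G) : ∃ Z ∈ totalSub (degenTensors k G G),
    cyclicCup k (MonoidAlgebra k G) (Finsupp.single j (wordToHopf k G (word k l))) =
      IsWordPresentation.tensorMap (wordToHopf k G)
        (totalMap (cupSeq k G) (Finsupp.single j (word k l)) + Z) := by
  obtain _ | ⟨c, w⟩ := l
  · refine ⟨0, zero_mem _, ?_⟩
    rw [word_nil, isCyclicMap_wordToHopf.one, Finsupp.single_zero, map_zero, add_zero,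
      totalMap_single, Finset.sum_eq_zero fun p _ => by rw [cupSeq_one, Finsupp.single_zero],
      map_zero]
  obtain ⟨z, hz⟩ := isCyclicMap_wordToHopf.degree (k := k) w.length (c :: w) rfl
  have hmem : wordMap k (fun g : G => (g, g)) (word k (c :: w)) ∈
      wordsOfLength k (G × G) (w.length + 1) := wordMap_mem_length _ (word_mem rfl)
  have e2 : totalMap (cupSeq k G) (Finsupp.single j (word k (c :: w))) =
      ∑ sr ∈ Finset.HasAntidiagonal.antidiagonal j, Finsupp.single sr.1
        (wordCyclicAW k G G sr.2 (wordMap k (fun g : G => (g, g)) (word k (c :: w)))) := by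
    rw [totalMap_single, ← Finset.Nat.sum_antidiagonal_swap]
    rfl
  refine ⟨∑ sr ∈ Finset.HasAntidiagonal.antidiagonal j, Finsupp.single sr.1
    (cyclicAW (wordFace k G) (wordDegen k G) (wordRot k G) sr.2 w.length
      (wordUnzip k G (wordMap k (fun g : G => (g, g)) (word k (c :: w)))) -
      wordCyclicAW k G G sr.2 (wordMap k (fun g : G => (g, g)) (word k (c :: w)))),
    sum_mem fun sr _ => single_mem_totalSub _ (cyclicAW_wordUnzip _ _ hmem), ?_⟩
  rw [e2, ← Finset.sum_add_distrib, hz, cyclicCup_single, ← hz, gOmegaDelta_wordToHopf, map_sum]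
  refine Finset.sum_congr rfl fun sr _ => ?_
  rw [← cyclicAW_natural (F := wordToHopf k G) isCyclicMap_wordToHopf.face isCyclicMap_wordToHopf.degen
    isCyclicMap_wordToHopf.rot, kunnethTotal_natural, ← Finsupp.single_add, add_sub_cancel,
    IsWordPresentation.tensorMap, LinearMap.comp_apply, totalKunneth, Finsupp.lsum_single]

theorem cyclicCup_totalToHopf (X : ℕ →₀ Words k G) : ∃ Z ∈ totalSub (degenTensors k G G),
    cyclicCup k (MonoidAlgebra k G) (totalToHopf k G X) =
      IsWordPresentation.tensorMap (wordToHopf k G) (totalMap (cupSeq k G) X + Z) := by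
  induction X using total_induction with
  | ha x y hx hy =>
    obtain ⟨Z, hZ, e⟩ := hx
    obtain ⟨Z', hZ', e'⟩ := hy
    exact ⟨Z + Z', add_mem hZ hZ', by
      rw [map_add, map_add, e, e', ← map_add, (totalMap (cupSeq k G)).map_add,
        add_add_add_comm]⟩
  | hs a x hx =>
    obtain ⟨Z, hZ, e⟩ := hx
    exact ⟨a • Z, Submodule.smul_mem _ _ hZ, by
      rw [map_smul, map_smul, e, ← map_smul, (totalMap (cupSeq k G)).map_smul, smul_add]⟩
  | h j l =>
    rw [Finsupp.mapRange.linearMap_apply, Finsupp.mapRange_single]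
    exact cyclicCup_word j l

theorem hochschildCup_lof (n : ℕ) (z : TPow k (MonoidAlgebra k G) n) :
    hochschildCup k (MonoidAlgebra k G) (gι k (MonoidAlgebra k G) n z) =
      alexanderWhitney (hFace k (MonoidAlgebra k G)) n
        (gOmegaDelta k (MonoidAlgebra k G) (gι k (MonoidAlgebra k G) n z)) := by
  rw [hochschildCup, DirectSum.toModule_lof]
  rfl

theorem hochschildCup_wordToHopf (x : Words k G) :
    hochschildCup k (MonoidAlgebra k G) (wordToHopf k G x) =
      TensorProduct.map (wordToHopf k G) (wordToHopf k G) (cupSeq k G 0 x) := by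
  induction x using words_induction with
  | ha x y hx hy => simp only [map_add, hx, hy]
  | hs a x hx => simp only [map_smul, hx]
  | h l =>
    obtain _ | ⟨c, w⟩ := l
    · rw [word_nil, isCyclicMap_wordToHopf.one, cupSeq_one, map_zero, map_zero]
    obtain ⟨z, hz⟩ := isCyclicMap_wordToHopf.degree (k := k) w.length (c :: w) rfl
    have hmem : wordMap k (fun g : G => (g, g)) (word k (c :: w)) ∈
        wordsOfLength k (G × G) (w.length + 1) := wordMap_mem_length _ (word_mem rfl)
    rw [hz, hochschildCup_lof, ← hz, gOmegaDelta_wordToHopf,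
      ← alexanderWhitney_natural (F := wordToHopf k G) isCyclicMap_wordToHopf.face, alexanderWhitney_wordUnzip hmem,
      cupSeq_apply, wordCyclicAW]

theorem hochschildCup_gBarToHopf (c : ⨁ n, GChains k G n) :
    hochschildCup k (MonoidAlgebra k G) (gBarToHopf k G c) =
      TensorProduct.map (gBarToHopf k G) (gBarToHopf k G) (groupCup k G c) := by
  have h := groupCup_wordToBar (barToWord k G c)
  rw [wordToBar_barToWord] at h
  have e : gBarToHopf k G ∘ₗ wordToBar k G = wordToHopf k G := LinearMap.ext gBarToHopf_wordToBar
  rw [← wordToHopf_barToWord, hochschildCup_wordToHopf, h, ← e, TensorProduct.map_comp,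
    LinearMap.comp_apply]

end Complexes

end HopfCyclic

end

noncomputable section

namespace HopfCyclic

/-! ## Uniqueness and transfer of induced coproducts -/

section Transfer

variable {k : Type*} [CommRing k] {V : Type*} [AddCommGroup V] [Module k V]
  {Z H : ℕ → Type*} [∀ n, AddCommGroup (Z n)] [∀ n, Module k (Z n)]
  [∀ n, AddCommGroup (H n)] [∀ n, Module k (H n)]
  {ι : ∀ n, Z n →ₗ[k] V} {π : ∀ n, Z n →ₗ[k] H n} {bd : Submodule k (V ⊗[k] V)}
  {c : V →ₗ[k] V ⊗[k] V} {D : Coproduct k H} {p : ∀ n, V →ₗ[k] H n}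

theorem sum_antidiagonal_map_eq (hp : ∀ n z, p n (ι n z) = π n z)
    (hp' : ∀ m n z, m ≠ n → p m (ι n z) = 0) {n : ℕ}
    (t : (pq : Finset.HasAntidiagonal.antidiagonal n) → Z pq.1.1 ⊗[k] Z pq.1.2)
    (pq : Finset.HasAntidiagonal.antidiagonal n) :
    TensorProduct.map (p pq.1.1) (p pq.1.2) (∑ rs, TensorProduct.map (ι _) (ι _) (t rs)) =
      TensorProduct.map (π _) (π _) (t pq) := by
  rw [map_sum, Finset.sum_eq_single pq]
  · rw [← LinearMap.comp_apply, ← TensorProduct.map_comp]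
    congr 2 <;> exact LinearMap.ext fun z => hp _ z
  · intro rs _ hne
    rw [← LinearMap.comp_apply, ← TensorProduct.map_comp]
    have : p pq.1.1 ∘ₗ ι rs.1.1 = 0 := LinearMap.ext fun z => hp' _ _ z fun e => hne <| by
      have h1 := Finset.HasAntidiagonal.mem_antidiagonal.1 pq.2
      have h2 := Finset.HasAntidiagonal.mem_antidiagonal.1 rs.2
      exact Subtype.ext (Prod.ext e.symm (by omega))
    rw [this, TensorProduct.map_zero_left, LinearMap.zero_apply]
  · exact fun h => absurd (Finset.mem_univ _) h

/-- Projections that extend the class maps, vanish on cycles of other degrees and kill tensor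
boundaries invert the Künneth map. They recover each component of the coproduct from the chain-level
formula, which makes it unique. -/
theorem IsInducedCoproduct.apply_eq (hD : IsInducedCoproduct ι π bd c D)
    (hp : ∀ n z, p n (ι n z) = π n z) (hp' : ∀ m n z, m ≠ n → p m (ι n z) = 0)
    (hbd : ∀ a b, ∀ w ∈ bd, TensorProduct.map (p a) (p b) w = 0) (n : ℕ) (x : Z n)
    (pq : Finset.HasAntidiagonal.antidiagonal n) :
    D n (π n x) pq = TensorProduct.map (p _) (p _) (c (ι n x)) := by
  obtain ⟨t, ht, hc⟩ := hD n x
  have := hbd pq.1.1 pq.1.2 _ hc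
  rw [map_sub, sum_antidiagonal_map_eq hp hp', sub_eq_zero] at this
  rw [ht, this]

theorem IsInducedCoproduct.unique {D' : Coproduct k H} (hD : IsInducedCoproduct ι π bd c D)
    (hD' : IsInducedCoproduct ι π bd c D')
    (hπ : ∀ n, Function.Surjective (π n))
    (hp : ∀ n z, p n (ι n z) = π n z) (hp' : ∀ m n z, m ≠ n → p m (ι n z) = 0)
    (hbd : ∀ a b, ∀ w ∈ bd, TensorProduct.map (p a) (p b) w = 0) : D = D' := by
  refine funext fun n => LinearMap.ext fun y => funext fun pq => ?_
  obtain ⟨x, rfl⟩ := hπ n y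
  rw [hD.apply_eq hp hp' hbd, hD'.apply_eq hp hp' hbd]

variable (ι π p) in
/-- The complex given by cycles `ι` and homology `π` in `V`, with projections `p` onto homology,
computes the homology of `C` by means of the maps `Φ` and `Ψ`. -/
structure IsHomologyModel {W : Type*} [AddCommGroup W] [Module k W]
    (C : SubquotientComplex k W) (Φ : V →ₗ[k] W) (Ψ : W →ₗ[k] V) : Prop where
  surjective : ∀ n, Function.Surjective (π n)
  proj : ∀ n z, p n (ι n z) = π n z
  proj_ne : ∀ m n z, m ≠ n → p m (ι n z) = 0
  mem_cycles : ∀ n z, Φ (ι n z) ∈ C.cycles n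
  mem_boundaries : ∀ n z, π n z = 0 → Φ (ι n z) ∈ C.boundaries n
  exists_cycle : ∀ n, ∀ w ∈ C.cycles n, ∃ z, w - Φ (ι n z) ∈ C.boundaries n ∧
    ∀ m, p m (Ψ w) = p m (ι n z)
  proj_boundaries : ∀ n, ∀ w ∈ C.boundaries n, p n (Ψ w) = 0
  proj_Φ : ∀ n z, p n (Ψ (Φ (ι n z))) = π n z
  proj_tensorBoundaries : ∀ a b, ∀ w ∈ C.tensorBoundaries,
    TensorProduct.map (p a ∘ₗ Ψ) (p b ∘ₗ Ψ) w = 0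

namespace IsHomologyModel

variable {W : Type*} [AddCommGroup W] [Module k W] {C : SubquotientComplex k W} {Φ : V →ₗ[k] W}
  {Ψ : W →ₗ[k] V}

/-- The isomorphism is built from $\Psi$ alone; $\Phi$ only serves to prove bijectivity. This is
what later makes $\theta$ independent of the chosen comparison. -/
theorem exists_equiv (h : IsHomologyModel ι π p C Φ Ψ) : ∃ θ : ∀ n, C.Homology n ≃ₗ[k] H n,
    ∀ n (w : C.cycles n), θ n (C.classOf n w) = p n (Ψ w) := by
  have hle : ∀ n, (C.boundaries n).comap (C.cycles n).subtype ≤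
      LinearMap.ker (p n ∘ₗ Ψ ∘ₗ (C.cycles n).subtype) := fun n w hw =>
    h.proj_boundaries n w hw
  let L : ∀ n, C.Homology n →ₗ[k] H n := fun n => Submodule.liftQ _ _ (hle n)
  have hL : ∀ n (w : C.cycles n), L n (C.classOf n w) = p n (Ψ w) := fun n w =>
    Submodule.liftQ_apply _ _ _
  have hbij : ∀ n, Function.Bijective (L n) := by
    refine fun n => ⟨(injective_iff_map_eq_zero _).2 fun x hx => ?_, fun y => ?_⟩
    · obtain ⟨w, rfl⟩ := Submodule.mkQ_surjective _ x
      obtain ⟨z, hz, e⟩ := h.exists_cycle n w w.2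
      have h0 : L n (C.classOf n w) = 0 := hx
      rw [hL, e, h.proj] at h0
      refine (Submodule.Quotient.mk_eq_zero _).2 ?_
      have := add_mem hz (h.mem_boundaries n z h0)
      rwa [sub_add_cancel] at this
    · obtain ⟨z, rfl⟩ := h.surjective n y
      exact ⟨C.classOf n ⟨_, h.mem_cycles n z⟩, by rw [hL, h.proj_Φ]⟩
  exact ⟨fun n => LinearEquiv.ofBijective (L n) (hbij n), hL⟩

theorem exists_coproduct (h : IsHomologyModel ι π p C Φ Ψ) (hD : IsInducedCoproduct ι π bd c D)
    {c' : W →ₗ[k] W ⊗[k] W}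
    (hΦ : ∀ n z, c' (Φ (ι n z)) - TensorProduct.map Φ Φ (c (ι n z)) ∈ C.tensorBoundaries)
    (hc : ∀ n, ∀ w ∈ C.boundaries n, c' w ∈ C.tensorBoundaries)
    (hbd : ∀ w ∈ bd, TensorProduct.map Φ Φ w ∈ C.tensorBoundaries)
    {θ : ∀ n, C.Homology n ≃ₗ[k] H n}
    (hθ : ∀ n (w : C.cycles n), θ n (C.classOf n w) = p n (Ψ w)) :
    ∃ D' : Coproduct k C.Homology, IsInducedCoproduct (fun n => (C.cycles n).subtype) C.classOf
      C.tensorBoundaries c' D' ∧ CarriesCoproduct θ D' D ∧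
      ∀ D'' : Coproduct k C.Homology, IsInducedCoproduct (fun n => (C.cycles n).subtype) C.classOf
        C.tensorBoundaries c' D'' → D'' = D' := by
  let D' : Coproduct k C.Homology := fun n => LinearMap.pi fun pq =>
    TensorProduct.map (θ pq.1.1).symm.toLinearMap (θ pq.1.2).symm.toLinearMap ∘ₗ
      LinearMap.proj pq ∘ₗ D n ∘ₗ (θ n).toLinearMap
  have hD' : ∀ n x pq, D' n x pq = TensorProduct.map (θ pq.1.1).symm.toLinearMap
    (θ pq.1.2).symm.toLinearMap (D n (θ n x) pq) := fun _ _ _ => rfl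
  have hind : IsInducedCoproduct (fun n => (C.cycles n).subtype) C.classOf C.tensorBoundaries c'
      D' := by
    intro n w
    -- Every cycle is replaced by a homologous one in the image of $\Phi$, where the coproduct is
    -- known from $V$.
    obtain ⟨z, hz, e⟩ := h.exists_cycle n w w.2
    obtain ⟨t, ht, hb⟩ := hD n z
    let φ : ∀ n, Z n →ₗ[k] C.cycles n := fun n => (Φ ∘ₗ ι n).codRestrict _ (h.mem_cycles n)
    have hφ : ∀ n, (θ n).symm.toLinearMap ∘ₗ π n = C.classOf n ∘ₗ φ n := fun n =>
      LinearMap.ext fun z => by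
        rw [LinearMap.comp_apply, LinearEquiv.coe_coe, LinearEquiv.symm_apply_eq,
          LinearMap.comp_apply, hθ]
        exact (h.proj_Φ n z).symm
    refine ⟨fun pq => TensorProduct.map (φ _) (φ _) (t pq), fun pq => ?_, ?_⟩
    · rw [hD', hθ, e, h.proj, ht, ← LinearMap.comp_apply, ← TensorProduct.map_comp, hφ, hφ,
        TensorProduct.map_comp, LinearMap.comp_apply]
    · have e1 : ∑ pq : Finset.HasAntidiagonal.antidiagonal n,
          TensorProduct.map ((C.cycles pq.1.1).subtype) ((C.cycles pq.1.2).subtype)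
            (TensorProduct.map (φ _) (φ _) (t pq)) =
          TensorProduct.map Φ Φ (∑ pq, TensorProduct.map (ι _) (ι _) (t pq)) := by
        rw [map_sum]
        refine Finset.sum_congr rfl fun pq _ => ?_
        rw [← LinearMap.comp_apply, ← LinearMap.comp_apply, ← TensorProduct.map_comp,
          ← TensorProduct.map_comp]
        rfl
      have h1 := hc n _ hz
      have h3 := hbd _ hb
      rw [map_sub] at h1 h3
      have := add_mem (add_mem h1 (hΦ n z)) h3
      rw [sub_add_sub_cancel, sub_add_sub_cancel] at this
      exact e1 ▸ this
  refine ⟨D', hind, fun n x pq => ?_, fun D'' hD'' => ?_⟩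
  · rw [hD', ← LinearMap.comp_apply, ← TensorProduct.map_comp, LinearEquiv.comp_symm,
      LinearEquiv.comp_symm, TensorProduct.map_id, LinearMap.id_apply]
  · refine hD''.unique hind (fun n => Submodule.mkQ_surjective _)
      (p := fun n => (θ n).symm.toLinearMap ∘ₗ p n ∘ₗ Ψ) (fun n w => ?_) (fun m n w hne => ?_)
      (fun a b w hw => ?_)
    · rw [LinearMap.comp_apply, LinearEquiv.coe_coe, LinearEquiv.symm_apply_eq, hθ]
      rfl
    · obtain ⟨z, -, e⟩ := h.exists_cycle n w w.2
      rw [LinearMap.comp_apply, LinearMap.comp_apply, Submodule.subtype_apply, e,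
        h.proj_ne _ _ _ hne, map_zero]
    · rw [TensorProduct.map_comp, LinearMap.comp_apply, h.proj_tensorBoundaries a b w hw, map_zero]

end IsHomologyModel

end Transfer

end HopfCyclic

end

noncomputable section

namespace HopfCyclic

/-! ## Contractions of complexes over a field onto their homology, and the Künneth theorem -/

section SplitHomology

variable {k : Type*} [CommRing k] {V : Type*} [AddCommGroup V] [Module k V]
  {Z H : ℕ → Type*} [∀ n, AddCommGroup (Z n)] [∀ n, Module k (Z n)]
  [∀ n, AddCommGroup (H n)] [∀ n, Module k (H n)]

/-- The differential of the tensor square of the complex `(V, D)` with sign operator `sgn`. -/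
def squareDiff (D sgn : Module.End k V) : Module.End k (V ⊗[k] V) :=
  TensorProduct.map D LinearMap.id + TensorProduct.map sgn D

/-- The elements of total degree `n` in a tensor square. -/
def squareDegree (deg : ℕ → Submodule k V) (n : ℕ) : Submodule k (V ⊗[k] V) :=
  ⨆ pq ∈ Finset.HasAntidiagonal.antidiagonal n,
    SubquotientComplex.tensorSub (deg pq.1) (deg pq.2)

theorem tmul_mem_squareDegree {deg : ℕ → Submodule k V} {a b n : ℕ} (h : a + b = n) {x y : V}
    (hx : x ∈ deg a) (hy : y ∈ deg b) : x ⊗ₜ[k] y ∈ squareDegree deg n :=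
  Submodule.mem_iSup_of_mem (a, b) (Submodule.mem_iSup_of_mem
    (Finset.HasAntidiagonal.mem_antidiagonal.2 h) ⟨⟨x, hx⟩ ⊗ₜ ⟨y, hy⟩, rfl⟩)

theorem squareDegree_le {deg : ℕ → Submodule k V} {n : ℕ} {W : Submodule k (V ⊗[k] V)}
    (h : ∀ a b, a + b = n → ∀ x ∈ deg a, ∀ y ∈ deg b, x ⊗ₜ[k] y ∈ W) :
    squareDegree deg n ≤ W := by
  refine iSup₂_le fun pq hpq => ?_
  rintro _ ⟨t, rfl⟩
  induction t using TensorProduct.induction_on with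
  | zero => rw [map_zero]; exact zero_mem _
  | add x y hx hy => rw [map_add]; exact add_mem hx hy
  | tmul x y => exact h _ _ (Finset.HasAntidiagonal.mem_antidiagonal.1 hpq) x x.2 y y.2

/-- A contraction `h` of the complex `(V, D)` onto its homology, presented by cycles `ι n` and
classes `π n`, by means of cycle representatives `s n` and extensions `p n` of `π n` to `V`. -/
structure IsSplitHomology (ι : ∀ n, Z n →ₗ[k] V) (π : ∀ n, Z n →ₗ[k] H n) (D sgn : Module.End k V)
    (deg : ℕ → Submodule k V) (s : ∀ n, H n →ₗ[k] Z n) (p : ∀ n, V →ₗ[k] H n)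
    (h e : Module.End k V) : Prop where
  section_eq : ∀ n x, π n (s n x) = x
  proj : ∀ n z, p n (ι n z) = π n z
  proj_ne : ∀ m n, m ≠ n → ∀ x ∈ deg n, p m x = 0
  proj_D : ∀ n x, p n (D x) = 0
  mem_deg : ∀ n z, ι n z ∈ deg n
  D_ι : ∀ n z, D (ι n z) = 0
  e_apply : ∀ n, ∀ x ∈ deg n, e x = ι n (s n (p n x))
  homotopy : ∀ x, x = e x + D (h x) + h (D x)
  D_e : ∀ x, D (e x) = 0
  e_D : ∀ x, e (D x) = 0
  sgn_e : ∀ x, sgn (e x) = e (sgn x)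
  h_sgn : ∀ x, h (sgn x) = -sgn (h x)
  D_sgn : ∀ x, D (sgn x) = -sgn (D x)
  sgn_sgn : ∀ x, sgn (sgn x) = x
  h_deg : ∀ n, ∀ x ∈ deg n, h x ∈ deg (n + 1)
  D_h : ∀ n, ∀ x ∈ deg n, D (h x) ∈ LinearMap.range (ι n)

namespace IsSplitHomology

variable {ι : ∀ n, Z n →ₗ[k] V} {π : ∀ n, Z n →ₗ[k] H n} {D sgn : Module.End k V}
  {deg : ℕ → Submodule k V} {s : ∀ n, H n →ₗ[k] Z n} {p : ∀ n, V →ₗ[k] H n}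
  {h e : Module.End k V}

theorem surjective (hS : IsSplitHomology ι π D sgn deg s p h e) (n : ℕ) :
    Function.Surjective (π n) := fun x => ⟨s n x, hS.section_eq n x⟩

theorem exists_cycle (hS : IsSplitHomology ι π D sgn deg s p h e) {n : ℕ} {x : V}
    (hx : x ∈ deg n) (hD : D x = 0) : ∃ z, ι n z = x := by
  obtain ⟨z, hz⟩ := hS.D_h n x hx
  refine ⟨s n (p n x) + z, ?_⟩
  conv_rhs => rw [hS.homotopy x, hD, map_zero, add_zero, hS.e_apply n x hx]
  rw [map_add, hz]

theorem eq_D_of_class_eq_zero (hS : IsSplitHomology ι π D sgn deg s p h e) {n : ℕ} {z : Z n}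
    (hz : π n z = 0) : ι n z = D (h (ι n z)) := by
  have := hS.homotopy (ι n z)
  rwa [hS.e_apply n _ (hS.mem_deg n z), hS.proj, hz, map_zero, map_zero, zero_add, hS.D_ι,
    map_zero, add_zero] at this

theorem proj_squareDiff (hS : IsSplitHomology ι π D sgn deg s p h e) (a b : ℕ) (y : V ⊗[k] V) :
    TensorProduct.map (p a) (p b) (squareDiff D sgn y) = 0 := by
  induction y using TensorProduct.induction_on with
  | zero => simp
  | add x y hx hy => rw [map_add, map_add, hx, hy, add_zero]
  | tmul x y => simp [squareDiff, hS.proj_D]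

/-- The Künneth theorem in explicit form: $h\otimes1+\mathrm{sgn}\,e\otimes h$ contracts the tensor
square onto the image of $e\otimes e$, first contracting the left factor and then, on its homology,
the right one. -/
theorem sub_mem_range_squareDiff (hS : IsSplitHomology ι π D sgn deg s p h e) {y : V ⊗[k] V}
    (hy : squareDiff D sgn y = 0) :
    y - TensorProduct.map e e y ∈ LinearMap.range (squareDiff D sgn) := by
  refine ⟨TensorProduct.map h LinearMap.id y + TensorProduct.map (sgn ∘ₗ e) h y, ?_⟩
  have key : ∀ y : V ⊗[k] V, squareDiff D sgn (TensorProduct.map h LinearMap.id y +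
      TensorProduct.map (sgn ∘ₗ e) h y) + (TensorProduct.map h LinearMap.id (squareDiff D sgn y) +
        TensorProduct.map (sgn ∘ₗ e) h (squareDiff D sgn y)) = y - TensorProduct.map e e y := by
    intro y
    induction y using TensorProduct.induction_on with
    | zero => simp
    | add x y hx hy =>
      rw [map_add (TensorProduct.map e e), add_sub_add_comm, ← hx, ← hy]
      simp only [map_add]
      abel
    | tmul x y =>
      have h2 : sgn (e (sgn x)) = e x := by rw [hS.sgn_e, hS.sgn_sgn]
      have h3 : x ⊗ₜ[k] y - e x ⊗ₜ[k] e y =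
          (D (h x) + h (D x)) ⊗ₜ[k] y + e x ⊗ₜ[k] (D (h y) + h (D y)) := by
        conv_lhs => rw [hS.homotopy x, hS.homotopy y]
        have h4 : e (e x + D (h x) + h (D x)) = e x := by rw [← hS.homotopy]
        have h5 : e (e y + D (h y) + h (D y)) = e y := by rw [← hS.homotopy]
        rw [h4, h5]
        conv_rhs => rw [hS.homotopy y]
        have h6 : D (h (e y + D (h y) + h (D y))) = D (h y) := by rw [← hS.homotopy]
        have h7 : h (D (e y + D (h y) + h (D y))) = h (D y) := by rw [← hS.homotopy]
        rw [h6, h7]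
        simp only [TensorProduct.add_tmul, TensorProduct.tmul_add]
        abel
      rw [TensorProduct.map_tmul e e, h3]
      simp only [squareDiff, LinearMap.add_apply, TensorProduct.map_tmul, LinearMap.id_apply,
        LinearMap.comp_apply, map_add, h2, hS.e_D, hS.D_e, hS.h_sgn, hS.sgn_e, map_zero,
        TensorProduct.zero_tmul, TensorProduct.add_tmul, TensorProduct.tmul_add,
        TensorProduct.neg_tmul]
      abel
  rw [← key, hy]
  simp

/-- In total degree $n$, $e\otimes e$ factors through the sum of the tensor products of homologies
of bidegree $(p,q)$, $p+q=n$; all other projections vanish. -/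
theorem map_e_apply (hS : IsSplitHomology ι π D sgn deg s p h e) {n : ℕ} {y : V ⊗[k] V}
    (hy : y ∈ squareDegree deg n) : TensorProduct.map e e y =
      ∑ pq : Finset.HasAntidiagonal.antidiagonal n, TensorProduct.map (ι _) (ι _)
        (TensorProduct.map (s _) (s _) (TensorProduct.map (p pq.1.1) (p pq.1.2) y)) := by
  have hle : squareDegree deg n ≤ LinearMap.eqLocus (TensorProduct.map e e)
      (∑ pq : Finset.HasAntidiagonal.antidiagonal n, TensorProduct.map (ι pq.1.1) (ι pq.1.2) ∘ₗ
        TensorProduct.map (s _) (s _) ∘ₗ TensorProduct.map (p pq.1.1) (p pq.1.2)) := by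
    refine squareDegree_le fun a b hab x hx y hy => ?_
    rw [LinearMap.mem_eqLocus, LinearMap.sum_apply, Finset.sum_eq_single
      ⟨(a, b), Finset.HasAntidiagonal.mem_antidiagonal.2 hab⟩]
    · simp [hS.e_apply a x hx, hS.e_apply b y hy]
    · intro pq _ hne
      have : p pq.1.1 x = 0 := hS.proj_ne _ a (fun e => hne (Subtype.ext (Prod.ext e (by
        have := Finset.HasAntidiagonal.mem_antidiagonal.1 pq.2
        change pq.1.2 = b
        omega)))) x hx
      simp [this]
    · exact fun h => absurd (Finset.mem_univ _) h
  have := hle hy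
  rwa [LinearMap.mem_eqLocus, LinearMap.sum_apply] at this

variable {c : V →ₗ[k] V ⊗[k] V}

/-- A cycle with zero class is a boundary, its coproduct is a tensor boundary, and the projections
kill it. Thus evaluating on the chosen representatives agrees with evaluating on any cycle. -/
theorem exists_coproduct (hS : IsSplitHomology ι π D sgn deg s p h e)
    (hc : ∀ x, squareDiff D sgn (c x) = c (D x)) : ∃ cup : Coproduct k H,
      ∀ n x pq, cup n (π n x) pq = TensorProduct.map (p pq.1.1) (p pq.1.2) (c (ι n x)) := by
  refine ⟨fun n => LinearMap.pi fun pq => TensorProduct.map (p pq.1.1) (p pq.1.2) ∘ₗ c ∘ₗ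
    ι n ∘ₗ s n, fun n x pq => ?_⟩
  change TensorProduct.map _ _ (c (ι n (s n (π n x)))) = _
  have hz : π n (s n (π n x) - x) = 0 := by rw [map_sub, hS.section_eq, sub_self]
  have := hS.eq_D_of_class_eq_zero hz
  rw [← sub_eq_zero, ← map_sub, ← map_sub, ← map_sub, this, ← hc, hS.proj_squareDiff]

theorem isInducedCoproduct (hS : IsSplitHomology ι π D sgn deg s p h e)
    (hc : ∀ x, squareDiff D sgn (c x) = c (D x))
    (hdeg : ∀ n, ∀ x ∈ deg n, c x ∈ squareDegree deg n) {cup : Coproduct k H}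
    (hcup : ∀ n x pq, cup n (π n x) pq = TensorProduct.map (p pq.1.1) (p pq.1.2) (c (ι n x))) :
    IsInducedCoproduct ι π (LinearMap.range (squareDiff D sgn)) c cup := by
  intro n x
  refine ⟨fun pq => TensorProduct.map (s _) (s _) (TensorProduct.map (p pq.1.1) (p pq.1.2)
    (c (ι n x))), fun pq => ?_, ?_⟩
  · have : ∀ n, π n ∘ₗ s n = LinearMap.id := fun n => LinearMap.ext (hS.section_eq n)
    rw [hcup]
    conv_rhs => rw [← LinearMap.comp_apply, ← TensorProduct.map_comp, this, this,
      TensorProduct.map_id, LinearMap.id_apply]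
  · rw [← hS.map_e_apply (hdeg n _ (hS.mem_deg n x))]
    exact hS.sub_mem_range_squareDiff (by rw [hc, hS.D_ι, map_zero])

theorem unique_coproduct (hS : IsSplitHomology ι π D sgn deg s p h e) {cup cup' : Coproduct k H}
    (h1 : IsInducedCoproduct ι π (LinearMap.range (squareDiff D sgn)) c cup)
    (h2 : IsInducedCoproduct ι π (LinearMap.range (squareDiff D sgn)) c cup') : cup = cup' :=
  h1.unique h2 hS.surjective hS.proj (fun m n z hne => hS.proj_ne m n hne _ (hS.mem_deg n z))
    fun a b => by rintro _ ⟨y, rfl⟩; exact hS.proj_squareDiff a b y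

end IsSplitHomology

end SplitHomology

/-! ### The total complex -/

section TotalSplit

variable {k : Type*} [CommRing k] {V : Type*} [AddCommGroup V] [Module k V]
  {Z H : ℕ → Type*} [∀ n, AddCommGroup (Z n)] [∀ n, Module k (Z n)]
  [∀ n, AddCommGroup (H n)] [∀ n, Module k (H n)]

/-- The cycles of `k[u] ⊗ V`. -/
def evenCycles (ι : ∀ n, Z n →ₗ[k] V) (n : ℕ) : EvenSum Z n →ₗ[k] (ℕ →₀ V) :=
  ∑ i : Fin (n / 2 + 1), Finsupp.lsingle (i : ℕ) ∘ₗ ι (n - 2 * i) ∘ₗ LinearMap.proj i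

/-- A family of maps, applied to even sums. -/
def evenMap (π : ∀ n, Z n →ₗ[k] H n) (n : ℕ) : EvenSum Z n →ₗ[k] EvenSum H n :=
  LinearMap.pi fun i => π (n - 2 * i) ∘ₗ LinearMap.proj i

/-- The projections of `k[u] ⊗ V` to even sums. -/
def evenProj (p : ∀ n, V →ₗ[k] H n) (n : ℕ) : (ℕ →₀ V) →ₗ[k] EvenSum H n :=
  LinearMap.pi fun i => p (n - 2 * i) ∘ₗ Finsupp.lapply (i : ℕ)

/-- The degrees of `k[u] ⊗ V`. -/
def evenDegree (deg : ℕ → Submodule k V) (n : ℕ) : Submodule k (ℕ →₀ V) :=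
  ⨆ i : Fin (n / 2 + 1), (deg (n - 2 * i)).map (Finsupp.lsingle (i : ℕ))

theorem evenCycles_apply (ι : ∀ n, Z n →ₗ[k] V) (n : ℕ) (x : EvenSum Z n) :
    evenCycles ι n x = ∑ i : Fin (n / 2 + 1), Finsupp.single (i : ℕ) (ι (n - 2 * i) (x i)) := by
  simp [evenCycles]

theorem evenCycles_single (ι : ∀ n, Z n →ₗ[k] V) (n : ℕ) (i : Fin (n / 2 + 1)) (z : Z (n - 2 * i)) :
    evenCycles ι n (Pi.single i z) = Finsupp.single (i : ℕ) (ι (n - 2 * i) z) := by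
  rw [evenCycles_apply, Finset.sum_eq_single i]
  · rw [Pi.single_eq_same]
  · intro j _ hj
    rw [Pi.single_eq_of_ne hj, map_zero, Finsupp.single_zero]
  · exact fun h => absurd (Finset.mem_univ _) h

theorem evenProj_apply (p : ∀ n, V →ₗ[k] H n) (n : ℕ) (x : ℕ →₀ V) (i : Fin (n / 2 + 1)) :
    evenProj p n x i = p (n - 2 * i) (x i) := rfl

theorem single_mem_evenDegree {deg : ℕ → Submodule k V} {m n i : ℕ} (h : m + 2 * i = n) {x : V}
    (hx : x ∈ deg m) : Finsupp.single i x ∈ evenDegree deg n := by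
  refine Submodule.mem_iSup_of_mem ⟨i, by omega⟩ ⟨x, ?_, rfl⟩
  obtain rfl : m = n - 2 * i := by omega
  exact hx

theorem evenDegree_le {deg : ℕ → Submodule k V} {n : ℕ} {W : Submodule k (ℕ →₀ V)}
    (h : ∀ m i, m + 2 * i = n → ∀ x ∈ deg m, Finsupp.single i x ∈ W) : evenDegree deg n ≤ W := by
  refine iSup_le fun i => ?_
  rintro _ ⟨x, hx, rfl⟩
  exact h (n - 2 * i) i (by have := i.2; omega) x hx

theorem evenProj_single_of_le (p : ∀ n, V →ₗ[k] H n) {n i : ℕ} (h : i < n / 2 + 1) (x : V) :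
    evenProj p n (Finsupp.single i x) =
      LinearMap.single k (fun j : Fin (n / 2 + 1) => H (n - 2 * j)) ⟨i, h⟩ (p (n - 2 * i) x) := by
  funext j
  rw [evenProj_apply, LinearMap.single_apply]
  by_cases hj : j = ⟨i, h⟩
  · subst hj
    simp
  · rw [Pi.single_eq_of_ne hj, Finsupp.single_eq_of_ne (fun e => hj (Fin.ext e)), map_zero]

theorem evenProj_single_of_gt (p : ∀ n, V →ₗ[k] H n) {n i : ℕ} (h : ¬ i < n / 2 + 1) (x : V) :
    evenProj p n (Finsupp.single i x) = 0 := by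
  funext j
  rw [evenProj_apply, Finsupp.single_eq_of_ne (fun e : (j : ℕ) = i => h (e ▸ j.2)), map_zero]
  rfl

variable {ι : ∀ n, Z n →ₗ[k] V} {π : ∀ n, Z n →ₗ[k] H n} {D sgn : Module.End k V}
  {deg : ℕ → Submodule k V} {s : ∀ n, H n →ₗ[k] Z n} {p : ∀ n, V →ₗ[k] H n}
  {h e : Module.End k V}

/-- The total complex here carries $b$ alone, so everything acts coefficientwise in $u$. -/
theorem IsSplitHomology.total (hS : IsSplitHomology ι π D sgn deg s p h e) :
    IsSplitHomology (evenCycles ι) (evenMap π) (Finsupp.mapRange.linearMap D)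
      (Finsupp.mapRange.linearMap sgn) (evenDegree deg) (evenMap s) (evenProj p)
      (Finsupp.mapRange.linearMap h) (Finsupp.mapRange.linearMap e) where
  section_eq n x := funext fun i => hS.section_eq _ (x i)
  proj n z := by
    funext j
    rw [evenCycles_apply, map_sum, Finset.sum_apply, Finset.sum_eq_single j]
    · rw [evenProj_apply, Finsupp.single_eq_same]
      exact hS.proj _ _
    · intro i _ hne
      rw [evenProj_apply, Finsupp.single_eq_of_ne (fun e => hne (Fin.ext e.symm)), map_zero]
    · exact fun h => absurd (Finset.mem_univ _) h
  proj_ne m n hne x hx := by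
    have hle : evenDegree deg n ≤ LinearMap.ker (evenProj p m) := by
      refine evenDegree_le fun a i hi x hx => ?_
      rw [LinearMap.mem_ker]
      by_cases h : i < m / 2 + 1
      · rw [evenProj_single_of_le p h, hS.proj_ne _ a (by omega) x hx, map_zero]
      · exact evenProj_single_of_gt p h x
    exact hle hx
  proj_D n x := funext fun i => by
    rw [evenProj_apply, Finsupp.mapRange.linearMap_apply, Finsupp.mapRange_apply, hS.proj_D]
    rfl
  mem_deg n z := by
    rw [evenCycles_apply]
    exact sum_mem fun i _ => single_mem_evenDegree (by have := i.2; omega) (hS.mem_deg _ _)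
  D_ι n z := by
    rw [evenCycles_apply, map_sum]
    refine Finset.sum_eq_zero fun i _ => ?_
    rw [Finsupp.mapRange.linearMap_apply, Finsupp.mapRange_single, hS.D_ι, Finsupp.single_zero]
  e_apply n x hx := by
    have hle : evenDegree deg n ≤ LinearMap.eqLocus (Finsupp.mapRange.linearMap e)
        (evenCycles ι n ∘ₗ evenMap s n ∘ₗ evenProj p n) := by
      refine evenDegree_le fun m i hi x hx => ?_
      have h : i < n / 2 + 1 := by omega
      obtain rfl : m = n - 2 * i := by omega
      rw [LinearMap.mem_eqLocus, LinearMap.comp_apply, LinearMap.comp_apply,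
        Finsupp.mapRange.linearMap_apply, Finsupp.mapRange_single, hS.e_apply _ x hx,
        evenCycles_apply, Finset.sum_eq_single ⟨i, h⟩]
      · rw [evenMap, LinearMap.pi_apply, LinearMap.comp_apply, LinearMap.proj_apply,
          evenProj_apply, Finsupp.single_eq_same]
      · intro j _ hne
        rw [evenMap, LinearMap.pi_apply, LinearMap.comp_apply, LinearMap.proj_apply,
          evenProj_apply, Finsupp.single_eq_of_ne (fun e => hne (Fin.ext e)), map_zero, map_zero,
          map_zero, Finsupp.single_zero]
      · exact fun h => absurd (Finset.mem_univ _) h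
    exact hle hx
  homotopy x := Finsupp.ext fun i => by simpa using hS.homotopy (x i)
  D_e x := Finsupp.ext fun i => by simpa using hS.D_e (x i)
  e_D x := Finsupp.ext fun i => by simpa using hS.e_D (x i)
  sgn_e x := Finsupp.ext fun i => by simpa using hS.sgn_e (x i)
  h_sgn x := Finsupp.ext fun i => by simpa using hS.h_sgn (x i)
  D_sgn x := Finsupp.ext fun i => by simpa using hS.D_sgn (x i)
  sgn_sgn x := Finsupp.ext fun i => by simpa using hS.sgn_sgn (x i)
  h_deg n x hx := by
    refine evenDegree_le (W := (evenDegree deg (n + 1)).comap (Finsupp.mapRange.linearMap h))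
      (fun m i hi x hx => ?_) hx
    rw [Submodule.mem_comap, Finsupp.mapRange.linearMap_apply, Finsupp.mapRange_single]
    exact single_mem_evenDegree (by omega) (hS.h_deg m x hx)
  D_h n x hx := by
    refine evenDegree_le (W := (LinearMap.range (evenCycles ι n)).comap
      (Finsupp.mapRange.linearMap D ∘ₗ Finsupp.mapRange.linearMap h)) (fun m i hi x hx => ?_) hx
    obtain rfl : m = n - 2 * i := by omega
    obtain ⟨z, hz⟩ := hS.D_h _ x hx
    refine ⟨Pi.single (⟨i, by omega⟩ : Fin (n / 2 + 1)) z, ?_⟩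
    rw [evenCycles_single, hz]
    simp

variable {c : V →ₗ[k] V ⊗[k] V}

/-- The coproduct of `k[u] ⊗ V` given by `u^i ↦ ∑ u^a ⊗ u^b` and a coproduct of `V`. -/
def totalCoproduct (c : V →ₗ[k] V ⊗[k] V) : (ℕ →₀ V) →ₗ[k] (ℕ →₀ V) ⊗[k] (ℕ →₀ V) :=
  totalKunneth ∘ₗ Finsupp.mapRange.linearMap c

theorem totalCoproduct_single (i : ℕ) (x : V) :
    totalCoproduct c (Finsupp.single i x) = kunnethTotal i (c x) := by
  simp [totalCoproduct, totalKunneth]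

theorem squareDiff_totalCoproduct (hc : ∀ x, squareDiff D sgn (c x) = c (D x)) (X : ℕ →₀ V) :
    squareDiff (Finsupp.mapRange.linearMap D) (Finsupp.mapRange.linearMap sgn)
      (totalCoproduct c X) = totalCoproduct c (Finsupp.mapRange.linearMap D X) := by
  refine LinearMap.congr_fun (f := squareDiff (Finsupp.mapRange.linearMap D)
    (Finsupp.mapRange.linearMap sgn) ∘ₗ totalCoproduct c)
    (g := totalCoproduct c ∘ₗ Finsupp.mapRange.linearMap D) (finsupp_hom_ext fun i x => ?_) X
  have key : ∀ y : V ⊗[k] V, squareDiff (Finsupp.mapRange.linearMap D)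
      (Finsupp.mapRange.linearMap sgn) (kunnethTotal i y) = kunnethTotal i (squareDiff D sgn y) := by
    intro y
    induction y using TensorProduct.induction_on with
    | zero => simp
    | add x y hx hy => simp only [map_add, hx, hy]
    | tmul x y => simp [squareDiff, kunnethTotal, Finset.sum_add_distrib]
  rw [LinearMap.comp_apply, LinearMap.comp_apply, Finsupp.mapRange.linearMap_apply,
    Finsupp.mapRange_single, totalCoproduct_single, totalCoproduct_single, key, hc]

theorem totalCoproduct_mem (hdeg : ∀ n, ∀ x ∈ deg n, c x ∈ squareDegree deg n) (n : ℕ)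
    (X : ℕ →₀ V) (hX : X ∈ evenDegree deg n) :
    totalCoproduct c X ∈ squareDegree (evenDegree deg) n := by
  have hle : evenDegree deg n ≤ (squareDegree (evenDegree deg) n).comap (totalCoproduct c) := by
    refine evenDegree_le fun m i hi x hx => ?_
    rw [Submodule.mem_comap, totalCoproduct_single]
    have hle' : squareDegree deg m ≤ (squareDegree (evenDegree deg) n).comap (kunnethTotal i) := by
      refine squareDegree_le fun a b hab x hx y hy => ?_
      rw [Submodule.mem_comap, kunnethTotal, LinearMap.sum_apply]
      refine sum_mem fun jl hjl => ?_
      have := Finset.HasAntidiagonal.mem_antidiagonal.1 hjl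
      exact tmul_mem_squareDegree (a := a + 2 * jl.1) (b := b + 2 * jl.2) (by omega)
        (single_mem_evenDegree rfl hx) (single_mem_evenDegree rfl hy)
    exact hle' (hdeg m x hx)
  exact hle hX

/-- Both sides sum the same terms `F j l`: the extended coproduct over a rectangle of exponents, the
Künneth map over the triangle $j+l\le n/2$. The rectangle lies in the triangle, and outside it `F`
vanishes because an exponent exceeds what the degree of its factor allows. -/
theorem extendCoproduct_apply_eq {cup : Coproduct k H}
    (hcup : ∀ n x pq, cup n (π n x) pq = TensorProduct.map (p pq.1.1) (p pq.1.2) (c (ι n x)))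
    (n : ℕ) (x : EvenSum Z n) (pq : Finset.HasAntidiagonal.antidiagonal n) :
    extendCoproduct cup n (evenMap π n x) pq = TensorProduct.map (evenProj p pq.1.1)
      (evenProj p pq.1.2) (totalCoproduct c (evenCycles ι n x)) := by
  obtain ⟨⟨a, b⟩, hab⟩ := pq
  have hn := Finset.HasAntidiagonal.mem_antidiagonal.1 hab
  dsimp only at hn ⊢
  let Y : ℕ → V := fun i => if h : i < n / 2 + 1 then ι (n - 2 * i) (x ⟨i, h⟩) else 0
  let F : ℕ → ℕ → EvenSum H a ⊗[k] EvenSum H b := fun j l =>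
    TensorProduct.map (evenProj p a ∘ₗ Finsupp.lsingle j) (evenProj p b ∘ₗ Finsupp.lsingle l)
      (c (Y (j + l)))
  have hF : ∀ j l, ¬ (j < a / 2 + 1 ∧ l < b / 2 + 1) → F j l = 0 := fun j l hjl => by
    rcases not_and_or.1 hjl with h | h
    · have : evenProj p a ∘ₗ Finsupp.lsingle j = 0 :=
        LinearMap.ext fun x => evenProj_single_of_gt p h x
      simp only [F, this, TensorProduct.map_zero_left, LinearMap.zero_apply]
    · have : evenProj p b ∘ₗ Finsupp.lsingle l = 0 :=
        LinearMap.ext fun x => evenProj_single_of_gt p h x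
      simp only [F, this, TensorProduct.map_zero_right, LinearMap.zero_apply]
  have hR : TensorProduct.map (evenProj p a) (evenProj p b)
      (totalCoproduct c (evenCycles ι n x)) = ∑ i ∈ Finset.range (n / 2 + 1),
        ∑ jl ∈ Finset.HasAntidiagonal.antidiagonal i, F jl.1 jl.2 := by
    rw [evenCycles_apply, map_sum, map_sum, ← Fin.sum_univ_eq_sum_range (fun i =>
      ∑ jl ∈ Finset.HasAntidiagonal.antidiagonal i, F jl.1 jl.2)]
    refine Finset.sum_congr rfl fun i _ => ?_
    rw [totalCoproduct_single, kunnethTotal, LinearMap.sum_apply, map_sum]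
    refine Finset.sum_congr rfl fun jl hjl => ?_
    rw [← LinearMap.comp_apply, ← TensorProduct.map_comp]
    obtain ⟨i, hi⟩ := i
    obtain rfl : jl.1 + jl.2 = i := Finset.HasAntidiagonal.mem_antidiagonal.1 hjl
    simp only [F, Y, hi, dif_pos]
  have hL : extendCoproduct cup n (evenMap π n x) ⟨(a, b), hab⟩ =
      ∑ j ∈ Finset.range (a / 2 + 1), ∑ l ∈ Finset.range (b / 2 + 1), F j l := by
    rw [← Fin.sum_univ_eq_sum_range (fun j => ∑ l ∈ Finset.range (b / 2 + 1), F j l)]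
    simp only [← Fin.sum_univ_eq_sum_range (fun l => F _ l)]
    rw [extendCoproduct, LinearMap.pi_apply, LinearMap.sum_apply]
    refine Finset.sum_congr rfl fun j _ => ?_
    rw [LinearMap.sum_apply]
    refine Finset.sum_congr rfl fun l _ => ?_
    have hjl : (j + l : ℕ) < n / 2 + 1 := by have := j.2; have := l.2; dsimp only at *; omega
    have e1 : evenProj p a ∘ₗ Finsupp.lsingle (j : ℕ) = LinearMap.single k
        (fun i : Fin (a / 2 + 1) => H (a - 2 * i)) j ∘ₗ p (a - 2 * j) :=
      LinearMap.ext fun x => evenProj_single_of_le p j.2 x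
    have e2 : evenProj p b ∘ₗ Finsupp.lsingle (l : ℕ) = LinearMap.single k
        (fun i : Fin (b / 2 + 1) => H (b - 2 * i)) l ∘ₗ p (b - 2 * l) :=
      LinearMap.ext fun x => evenProj_single_of_le p l.2 x
    simp only [F, Y, hjl, dif_pos, e1, e2]
    rw [TensorProduct.map_comp, LinearMap.comp_apply, LinearMap.comp_apply]
    exact congrArg _ (hcup (n - 2 * (j + l)) (x ⟨j + l, hjl⟩) ⟨(a - 2 * j, b - 2 * l), _⟩)
  rw [hR, hL, ← Finset.sum_product', Finset.sum_sigma']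
  refine Finset.sum_of_injOn (fun jl => ⟨jl.1 + jl.2, jl⟩) ?_ ?_ ?_ ?_
  · rintro ⟨j, l⟩ _ ⟨j', l'⟩ _ h
    simpa using (Sigma.mk.inj_iff.1 h).2
  · rintro ⟨j, l⟩ h
    simp only [Finset.coe_product, Set.mem_prod, Finset.mem_coe, Finset.mem_range] at h
    simp only [Finset.coe_sigma, Set.mem_sigma_iff, Finset.mem_coe, Finset.mem_range,
      Finset.HasAntidiagonal.mem_antidiagonal, and_true]
    omega
  · rintro ⟨i, j, l⟩ h h'
    refine hF j l fun hjl => h' ⟨(j, l), ?_, ?_⟩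
    · simpa [Finset.mem_product] using hjl
    · obtain ⟨-, h⟩ := Finset.mem_sigma.1 h
      obtain rfl : j + l = i := Finset.HasAntidiagonal.mem_antidiagonal.1 h
      rfl
  · exact fun _ _ => rfl

end TotalSplit

end HopfCyclic

end

noncomputable section

namespace HopfCyclic

/-! ## Contraction of the bar complex onto group homology -/

section Contraction

variable {k : Type*} [Field k]

theorem exists_lift_of_mem_range {A B M : Type*} [AddCommGroup A] [Module k A] [AddCommGroup B]
    [Module k B] [AddCommGroup M] [Module k M] (d : A →ₗ[k] B) (f : M →ₗ[k] B)
    (h : ∀ x, ∃ a, d a = f x) : ∃ g : M →ₗ[k] A, ∀ x, d (g x) = f x := by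
  obtain ⟨g, hg⟩ := Module.projective_lifting_property d.rangeRestrict
    (f.codRestrict (LinearMap.range d) h) d.surjective_rangeRestrict
  exact ⟨g, fun x => congrArg Subtype.val (LinearMap.congr_fun hg x)⟩

variable {C Z H : ℕ → Type*} [∀ n, AddCommGroup (C n)] [∀ n, Module k (C n)]
  [∀ n, AddCommGroup (Z n)] [∀ n, Module k (Z n)] [∀ n, AddCommGroup (H n)] [∀ n, Module k (H n)]

/-- Over a field, choose a retraction onto the cycles, a section of the class map, and a lift $g$ of
the boundary part of the cycle projection. Subtracting from $g$ its own cycle part makes $h(dc)$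
equal to $c$ minus the cycle part of $c$, which is the homotopy identity. -/
theorem exists_contraction (d : ∀ n, C (n + 1) →ₗ[k] C n) (ι : ∀ n, Z n →ₗ[k] C n)
    (π : ∀ n, Z n →ₗ[k] H n) (hι : ∀ n, Function.Injective (ι n))
    (hπ : ∀ n, Function.Surjective (π n)) (h0 : ∀ c, ∃ z, ι 0 z = c)
    (hker : ∀ n c, d n c = 0 ↔ ∃ z, ι (n + 1) z = c)
    (hbd : ∀ n z, π n z = 0 ↔ ∃ c, d n c = ι n z) (hdd : ∀ n c, d n (d (n + 1) c) = 0) :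
    ∃ (p : ∀ n, C n →ₗ[k] H n) (s : ∀ n, H n →ₗ[k] Z n) (h : ∀ n, C n →ₗ[k] C (n + 1)),
      (∀ n x, π n (s n x) = x) ∧ (∀ n z, p n (ι n z) = π n z) ∧ (∀ n c, p n (d n c) = 0) ∧
      (∀ c, c = ι 0 (s 0 (p 0 c)) + d 0 (h 0 c)) ∧
      ∀ n c, c = ι (n + 1) (s (n + 1) (p (n + 1) c)) + d (n + 1) (h (n + 1) c) + h n (d n c) := by
  choose r hr using fun n => LinearMap.exists_leftInverse_of_injective (ι n)
    (LinearMap.ker_eq_bot.2 (hι n))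
  choose s hs using fun n => LinearMap.exists_rightInverse_of_surjective (π n)
    (LinearMap.range_eq_top.2 (hπ n))
  have hr : ∀ n z, r n (ι n z) = z := fun n => LinearMap.congr_fun (hr n)
  have hs : ∀ n x, π n (s n x) = x := fun n => LinearMap.congr_fun (hs n)
  have hdι : ∀ n z, d n (ι (n + 1) z) = 0 := fun n z => (hker n _).2 ⟨z, rfl⟩
  have hd : ∀ n c, ∃ z, ι n z = d n c := by
    rintro (_ | n) c
    · exact h0 _
    · exact (hker n _).1 (hdd n c)
  choose g hg using fun n => exists_lift_of_mem_range (d n)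
    (ι n ∘ₗ (r n - s n ∘ₗ π n ∘ₗ r n)) fun c => (hbd n _).1 (by simp [hs])
  have key : ∀ n c, ι n (r n c) = ι n (s n (π n (r n c))) + d n (g n c - ι (n + 1) (r (n + 1) (g n c))) :=
    fun n c => by rw [map_sub, hdι, sub_zero, hg]; simp
  refine ⟨fun n => π n ∘ₗ r n, s, fun n => g n - ι (n + 1) ∘ₗ r (n + 1) ∘ₗ g n, hs,
    fun n z => by simp [hr], fun n c => ?_, fun c => ?_, fun n c => ?_⟩
  · obtain ⟨z, hz⟩ := hd n c
    rw [← hz, LinearMap.comp_apply, hr, hbd]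
    exact ⟨c, hz.symm⟩
  · have e : c = ι 0 (r 0 c) := by
      obtain ⟨z, rfl⟩ := h0 c
      rw [hr]
    conv_lhs => rw [e, key 0 c]
    rfl
  · have e : c = ι (n + 1) (r (n + 1) c) +
        (g n (d n c) - ι (n + 1) (r (n + 1) (g n (d n c)))) := by
      obtain ⟨z, hz⟩ := hd n c
      have hz' : π n z = 0 := (hbd n z).2 ⟨c, hz.symm⟩
      have hgd : d n (g n (d n c)) = d n c := by
        -- The chain $dc$ is a cycle with zero class, so $d\,g$ returns it unchanged.
        rw [hg, ← hz]
        simp [hr, hz']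
      have h1 : d n (c - g n (d n c)) = 0 := by rw [map_sub, hgd, sub_self]
      obtain ⟨y, hy⟩ := (hker n _).1 h1
      have h2 : ι (n + 1) (r (n + 1) (c - g n (d n c))) = c - g n (d n c) := by rw [← hy, hr]
      rw [map_sub, map_sub, sub_eq_iff_eq_add] at h2
      rw [h2]
      abel
    conv_lhs => rw [e, key (n + 1) c]
    rfl

theorem lof_hom_ext {N : Type*} [AddCommGroup N] [Module k N] {f g : (⨁ n, C n) →ₗ[k] N}
    (h : ∀ n c, f (DirectSum.lof k ℕ C n c) = g (DirectSum.lof k ℕ C n c)) (x : ⨁ n, C n) :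
    f x = g x :=
  LinearMap.congr_fun (DirectSum.linearMap_ext k fun n => LinearMap.ext (h n)) x

theorem exists_isSplitHomology (d : ∀ n, C (n + 1) →ₗ[k] C n) (ι : ∀ n, Z n →ₗ[k] C n)
    (π : ∀ n, Z n →ₗ[k] H n) (hι : ∀ n, Function.Injective (ι n))
    (hπ : ∀ n, Function.Surjective (π n)) (h0 : ∀ c, ∃ z, ι 0 z = c)
    (hker : ∀ n c, d n c = 0 ↔ ∃ z, ι (n + 1) z = c)
    (hbd : ∀ n z, π n z = 0 ↔ ∃ c, d n c = ι n z) (hdd : ∀ n c, d n (d (n + 1) c) = 0)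
    {D : Module.End k (⨁ n, C n)} (hD0 : ∀ c, D (DirectSum.lof k ℕ C 0 c) = 0)
    (hD : ∀ n c, D (DirectSum.lof k ℕ C (n + 1) c) = DirectSum.lof k ℕ C n (d n c)) :
    ∃ s p h e, IsSplitHomology (fun n => DirectSum.lof k ℕ C n ∘ₗ ι n) π D (gSign k C)
      (fun n => LinearMap.range (DirectSum.lof k ℕ C n)) s p h e := by
  obtain ⟨p, s, h, hs, hp, hpd, hh0, hh⟩ := exists_contraction d ι π hι hπ h0 hker hbd hdd
  have hdι : ∀ n z, d n (ι (n + 1) z) = 0 := fun n z => (hker n _).2 ⟨z, rfl⟩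
  let e : Module.End k (⨁ n, C n) := DirectSum.toModule k ℕ _ fun n =>
    DirectSum.lof k ℕ C n ∘ₗ ι n ∘ₗ s n ∘ₗ p n
  let hT : Module.End k (⨁ n, C n) := DirectSum.toModule k ℕ _ fun n =>
    DirectSum.lof k ℕ C (n + 1) ∘ₗ h n
  have he : ∀ n c, e (DirectSum.lof k ℕ C n c) = DirectSum.lof k ℕ C n (ι n (s n (p n c))) :=
    fun n c => DirectSum.toModule_lof _ _ _
  have hh' : ∀ n c, hT (DirectSum.lof k ℕ C n c) = DirectSum.lof k ℕ C (n + 1) (h n c) :=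
    fun n c => DirectSum.toModule_lof _ _ _
  have hDι : ∀ n z, D (DirectSum.lof k ℕ C n (ι n z)) = 0 := by
    rintro (_ | n) z
    · exact hD0 _
    · rw [hD, hdι, map_zero]
  have hpT : ∀ n c, (p n ∘ₗ DirectSum.component k ℕ C n) (DirectSum.lof k ℕ C n c) = p n c :=
    fun n c => by rw [LinearMap.comp_apply, DirectSum.component.lof_self]
  have hpT' : ∀ m n c, m ≠ n →
      (p m ∘ₗ DirectSum.component k ℕ C m) (DirectSum.lof k ℕ C n c) = 0 := fun m n c hne => by
    rw [LinearMap.comp_apply, DirectSum.component.of, dif_neg (Ne.symm hne), map_zero]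
  refine ⟨s, fun n => p n ∘ₗ DirectSum.component k ℕ C n, hT, e, hs, fun n z => ?_, ?_, ?_,
    fun n z => ⟨_, rfl⟩, hDι, ?_, ?_, ?_, ?_, ?_, ?_, ?_, ?_, ?_, ?_⟩
  · rw [LinearMap.comp_apply (DirectSum.lof k ℕ C n), hpT, hp]
  · rintro m n hne _ ⟨c, rfl⟩
    exact hpT' m n c hne
  · intro n
    refine lof_hom_ext (f := (p n ∘ₗ DirectSum.component k ℕ C n) ∘ₗ D) (g := 0) ?_
    rintro (_ | m) c
    · rw [LinearMap.comp_apply, hD0, map_zero, LinearMap.zero_apply]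
    · rw [LinearMap.comp_apply, hD, LinearMap.zero_apply]
      by_cases hne : n = m
      · subst hne; rw [hpT, hpd]
      · exact hpT' n m _ hne
  · rintro n _ ⟨c, rfl⟩
    rw [he, hpT]
    rfl
  · refine lof_hom_ext (f := LinearMap.id) (g := e + D ∘ₗ hT + hT ∘ₗ D) ?_
    rintro (_ | n) c
    · simp only [LinearMap.id_apply, LinearMap.add_apply, LinearMap.comp_apply, he, hh', hD0, hD,
        map_zero, add_zero, ← map_add]
      exact congrArg _ (hh0 c)
    · simp only [LinearMap.id_apply, LinearMap.add_apply, LinearMap.comp_apply, he, hh', hD,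
        ← map_add]
      exact congrArg _ (hh n c)
  · refine lof_hom_ext (f := D ∘ₗ e) (g := 0) fun n c => ?_
    rw [LinearMap.comp_apply, he, hDι, LinearMap.zero_apply]
  · refine lof_hom_ext (f := e ∘ₗ D) (g := 0) ?_
    rintro (_ | n) c
    · rw [LinearMap.comp_apply, hD0, map_zero, LinearMap.zero_apply]
    · rw [LinearMap.comp_apply, hD, he, hpd, map_zero, map_zero, map_zero, LinearMap.zero_apply]
  · refine lof_hom_ext (f := gSign k C ∘ₗ e) (g := e ∘ₗ gSign k C) fun n c => ?_
    simp only [LinearMap.comp_apply, he, gSign_lof, map_smul]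
  · refine lof_hom_ext (f := hT ∘ₗ gSign k C) (g := -(gSign k C ∘ₗ hT)) fun n c => ?_
    simp only [LinearMap.comp_apply, LinearMap.neg_apply, hh', gSign_lof, map_smul, pow_succ]
    simp
  · refine lof_hom_ext (f := D ∘ₗ gSign k C) (g := -(gSign k C ∘ₗ D)) ?_
    rintro (_ | n) c
    · simp only [LinearMap.comp_apply, LinearMap.neg_apply, hD0, gSign_lof, map_smul, map_zero,
        smul_zero, neg_zero]
    · simp only [LinearMap.comp_apply, LinearMap.neg_apply, hD, gSign_lof, map_smul, pow_succ]
      simp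
  · refine lof_hom_ext (f := gSign k C ∘ₗ gSign k C) (g := LinearMap.id) fun n c => ?_
    simp only [LinearMap.comp_apply, gSign_lof, map_smul, smul_smul, ← mul_pow, LinearMap.id_apply]
    simp
  · rintro n _ ⟨c, rfl⟩
    exact ⟨_, (hh' n c).symm⟩
  · rintro n _ ⟨c, rfl⟩
    rw [hh', hD]
    rcases n with _ | n
    · obtain ⟨z, hz⟩ := h0 (d 0 (h 0 c))
      exact ⟨z, congrArg (DirectSum.lof k ℕ C _) hz⟩
    · obtain ⟨z, hz⟩ := (hker n _).1 (hdd n (h (n + 1) c))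
      exact ⟨z, congrArg (DirectSum.lof k ℕ C _) hz⟩

end Contraction

/-! ### Cycles and classes of the bar complex in elementary terms -/

section GroupHomology

open CategoryTheory

variable {k : Type u} [CommRing k]

theorem chainComplex_homologyπ_eq_zero_iff (K : ChainComplex (ModuleCat.{u} k) ℕ) (n : ℕ)
    (z : K.cycles n) : (K.homologyπ n).hom z = 0 ↔
      ∃ c : K.X (n + 1), (K.d (n + 1) n).hom c = (K.iCycles n).hom z := by
  have hinj : Function.Injective (K.iCycles n).hom :=
    (ModuleCat.mono_iff_injective (K.iCycles n)).1 inferInstance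
  have hd : ∀ c, (K.d (n + 1) n).hom c = (K.iCycles n).hom ((K.toCycles (n + 1) n).hom c) :=
    fun c => by
      have := K.toCycles_i (n + 1) n
      rw [← this]
      rfl
  constructor
  · intro hz
    have hex : (ShortComplex.mk (K.toCycles (n + 1) n) (K.homologyπ n) (by simp)).Exact :=
      ShortComplex.exact_of_g_is_cokernel _ (K.homologyIsCokernel (n + 1) n (by simp))
    obtain ⟨c, hc⟩ := (ShortComplex.moduleCat_exact_iff _).1 hex z hz
    exact ⟨c, by rw [hd]; exact congrArg _ hc⟩
  · rintro ⟨c, hc⟩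
    rw [hd] at hc
    rw [← hinj hc]
    have := K.toCycles_comp_homologyπ (n + 1) n
    exact LinearMap.congr_fun (congrArg ModuleCat.Hom.hom this) c

variable {G : Type u} [Group G]

variable (k G) in
/-- The differential of bar chains, as a linear map. -/
abbrev barDiff (n : ℕ) : GChains k G (n + 1) →ₗ[k] GChains k G n :=
  (groupHomology.inhomogeneousChains.d (Rep.trivial k G k) n).hom

theorem gCyclesι_injective (n : ℕ) : Function.Injective (gCyclesι k G n) :=
  (ModuleCat.mono_iff_injective (groupHomology.iCycles (Rep.trivial k G k) n)).1 inferInstance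

theorem gClass_surjective (n : ℕ) : Function.Surjective (gClass k G n) :=
  fun x => groupHomology_induction_on x fun z => ⟨z, rfl⟩

theorem gCyclesι_zero_surjective (c : GChains k G 0) : ∃ z, gCyclesι k G 0 z = c :=
  ⟨groupHomology.cyclesMk (A := Rep.trivial k G k) 0 0 (by simp) c (by
    rw [HomologicalComplex.shape _ _ _ (by simp)]; rfl), groupHomology.iCycles_mk _ _ _⟩

theorem barDiff_eq_zero_iff (n : ℕ) (c : GChains k G (n + 1)) :
    barDiff k G n c = 0 ↔ ∃ z, gCyclesι k G (n + 1) z = c := by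
  constructor
  · intro h
    refine ⟨groupHomology.cyclesMk (A := Rep.trivial k G k) (n + 1) n (by simp) c ?_,
      groupHomology.iCycles_mk _ _ _⟩
    rw [groupHomology.inhomogeneousChains.d_def]
    exact h
  · rintro ⟨z, rfl⟩
    have := (groupHomology.inhomogeneousChains (Rep.trivial k G k)).iCycles_d (n + 1) n
    rw [groupHomology.inhomogeneousChains.d_def] at this
    exact LinearMap.congr_fun (congrArg ModuleCat.Hom.hom this) z

theorem gClass_eq_zero_iff (n : ℕ) (z : GCycles k G n) :
    gClass k G n z = 0 ↔ ∃ c, barDiff k G n c = gCyclesι k G n z := by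
  have := chainComplex_homologyπ_eq_zero_iff
    (groupHomology.inhomogeneousChains (Rep.trivial k G k)) n z
  rw [groupHomology.inhomogeneousChains.d_def] at this
  exact this

theorem barDiff_barDiff (n : ℕ) (c : GChains k G (n + 2)) :
    barDiff k G n (barDiff k G (n + 1) c) = 0 := by
  have := groupHomology.inhomogeneousChains.d_comp_d (A := Rep.trivial k G k) n
  exact LinearMap.congr_fun (congrArg ModuleCat.Hom.hom this) c

end GroupHomology

section GroupSplit

variable {k G : Type u} [Field k] [Group G]

variable (k G) in
theorem exists_isSplitHomology_group : ∃ s p h e, IsSplitHomology (V := ⨁ n, GChains k G n)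
    (fun n => DirectSum.lof k ℕ (GChains k G) n ∘ₗ gCyclesι k G n) (gClass k G) (gBarDiff k G)
    (gSign k (GChains k G)) (fun n => LinearMap.range (DirectSum.lof k ℕ (GChains k G) n))
    s p h e :=
  exists_isSplitHomology (barDiff k G) (gCyclesι k G) (gClass k G) gCyclesι_injective
    gClass_surjective gCyclesι_zero_surjective barDiff_eq_zero_iff gClass_eq_zero_iff
    barDiff_barDiff (fun c => by rw [gBarDiff, DirectSum.toModule_lof]; rfl)
    (fun n c => by rw [gBarDiff, DirectSum.toModule_lof]; rfl)

end GroupSplit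

end HopfCyclic

end

noncomputable section

namespace HopfCyclic

/-! ## The coproduct of group homology and the Hochschild case -/

section GroupCoproduct

variable {k G : Type u} [CommRing k]

theorem groupCup_degree (n : ℕ) (c : ⨁ n, GChains k G n)
    (hc : c ∈ LinearMap.range (DirectSum.lof k ℕ (GChains k G) n)) : groupCup k G c ∈
      squareDegree (V := ⨁ n, GChains k G n)
        (fun n => LinearMap.range (DirectSum.lof k ℕ (GChains k G) n)) n := by
  obtain ⟨c, rfl⟩ := hc
  induction c using Finsupp.induction_linear with
  | zero => rw [map_zero, map_zero]; exact zero_mem _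
  | add x y hx hy => rw [map_add, map_add]; exact add_mem hx hy
  | single g a =>
    rw [← mul_one a, ← smul_eq_mul, ← Finsupp.smul_single, map_smul, map_smul, groupCup_lof]
    exact Submodule.smul_mem _ _ (sum_mem fun i _ => tmul_mem_squareDegree (a := i) (b := n - i)
      (by omega) ⟨_, rfl⟩ ⟨_, rfl⟩)

variable [Group G]

theorem squareDiff_map_wordToBar (z : WordTensor k G G) :
    squareDiff (V := ⨁ n, GChains k G n) (gBarDiff k G) (gSign k (GChains k G))
      (TensorProduct.map (wordToBar k G) (wordToBar k G) z) =
        TensorProduct.map (wordToBar k G) (wordToBar k G) (tensorBoundary k G G z) := by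
  induction z using TensorProduct.induction_on with
  | zero => simp only [map_zero]
  | add x y hx hy => simp only [map_add, hx, hy]
  | tmul x y =>
    rw [tensorBoundary_tmul, map_add, TensorProduct.map_tmul, TensorProduct.map_tmul,
      TensorProduct.map_tmul, ← gBarDiff_wordToBar, ← gBarDiff_wordToBar, ← gSign_wordToBar]
    rfl

/-- The augmentation terms in the boundary of $AW$ have an empty factor, which the bar complex
kills; there the coproduct is an exact chain map. -/
theorem squareDiff_groupCup (c : ⨁ n, GChains k G n) :
    squareDiff (V := ⨁ n, GChains k G n) (gBarDiff k G) (gSign k (GChains k G))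
      (groupCup k G c) = groupCup k G (gBarDiff k G c) := by
  rw [← wordToBar_barToWord c, groupCup_wordToBar, squareDiff_map_wordToBar,
    tensorBoundary_cupSeq_zero, gBarDiff_wordToBar, groupCup_wordToBar, map_add, map_add,
    TensorProduct.map_tmul, TensorProduct.map_tmul, wordToBar_one, TensorProduct.zero_tmul,
    TensorProduct.tmul_zero, add_zero, add_zero]

end GroupCoproduct

/-! ### Transport of the coproduct to the Hochschild complex -/

section Hochschild

variable {k : Type*} [CommRing k] {V W : Type*} [AddCommGroup V] [Module k V] [AddCommGroup W]
  [Module k W] {Z H : ℕ → Type*} [∀ n, AddCommGroup (Z n)] [∀ n, Module k (Z n)]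
  [∀ n, AddCommGroup (H n)] [∀ n, Module k (H n)]
  {ι : ∀ n, Z n →ₗ[k] V} {π : ∀ n, Z n →ₗ[k] H n} {D sgn : Module.End k V}
  {deg : ℕ → Submodule k V} {s : ∀ n, H n →ₗ[k] Z n} {p : ∀ n, V →ₗ[k] H n}
  {h e : Module.End k V}

/-- $\Phi$ commutes with the differentials only up to elements regarded as zero; on a tensor this
costs one correction in each factor, both of which are tensor boundaries by definition. -/
theorem SubquotientComplex.map_squareDiff_mem {C : SubquotientComplex k W} {Φ : V →ₗ[k] W}
    {D sgn : Module.End k V} (hmem : ∀ x, Φ x ∈ ⨆ n, C.chains n)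
    (hd : ∀ x, C.d (Φ x) - Φ (D x) ∈ C.degen) (hs : ∀ x, C.sgn (Φ x) = Φ (sgn x))
    {w : V ⊗[k] V} (hw : w ∈ LinearMap.range (squareDiff D sgn)) :
    TensorProduct.map Φ Φ w ∈ C.tensorBoundaries := by
  obtain ⟨y, rfl⟩ := hw
  induction y using TensorProduct.induction_on with
  | zero => rw [map_zero, map_zero]; exact zero_mem _
  | add x y hx hy => rw [map_add, map_add]; exact add_mem hx hy
  | tmul x y =>
    have h1 := C.tensorDiff_mem_tensorBoundaries (hmem x) (hmem y)
    have h2 := C.tmul_mem_tensorBoundaries_left (hd x) (hmem y)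
    have h3 := C.tmul_mem_tensorBoundaries_right (hmem (sgn x)) (hd y)
    have := sub_mem (sub_mem h1 h2) h3
    rw [hs, TensorProduct.sub_tmul, TensorProduct.tmul_sub] at this
    convert this using 1
    simp only [squareDiff, LinearMap.add_apply, map_add, TensorProduct.map_tmul,
      LinearMap.id_apply]
    abel

/-- If the elements regarded as zero are killed by `Ψ`, and `Ψ` commutes with the differentials,
then `p ∘ Ψ` kills tensor boundaries. -/
theorem IsSplitHomology.proj_tensorBoundaries (hS : IsSplitHomology ι π D sgn deg s p h e)
    {C : SubquotientComplex k W} {Ψ : W →ₗ[k] V}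
    (hd : ∀ x ∈ ⨆ n, C.chains n, Ψ (C.d x) = D (Ψ x)) (hΨ : ∀ x ∈ C.degen, Ψ x = 0) (a b : ℕ)
    (w : W ⊗[k] W) (hw : w ∈ C.tensorBoundaries) :
    TensorProduct.map (p a ∘ₗ Ψ) (p b ∘ₗ Ψ) w = 0 := by
  rw [← Submodule.mem_bot k]
  refine C.map_tensorBoundaries_le (fun x hx y hy => ?_) (fun x hx y hy => ?_)
    (fun x hx y hy => ?_) hw
  · simp [hd x hx, hd y hy, hS.proj_D]
  · simp [hΨ x hx]
  · simp [hΨ y hy]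

/-- With nothing degenerate and $\Phi$ injective onto the chains, cycles and boundaries correspond
literally. -/
theorem IsSplitHomology.isHomologyModel_of_leftInverse
    (hS : IsSplitHomology ι π D sgn deg s p h e) {C : SubquotientComplex k W} {Φ : V →ₗ[k] W}
    {Ψ : W →ₗ[k] V} (hΨΦ : ∀ x, Ψ (Φ x) = x) (hdegen : C.degen = ⊥)
    (hd : ∀ x, C.d (Φ x) = Φ (D x)) (hchains : ∀ n, C.chains n = (deg n).map Φ) :
    IsHomologyModel ι π p C Φ Ψ := by
  have hmem : ∀ n, ∀ x ∈ deg n, Φ x ∈ C.chains n := fun n x hx =>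
    hchains n ▸ Submodule.mem_map_of_mem hx
  have hΨd : ∀ n, ∀ x ∈ C.chains n, Ψ (C.d x) = D (Ψ x) := fun n x hx => by
    rw [hchains] at hx
    obtain ⟨x, -, rfl⟩ := hx
    rw [hd, hΨΦ, hΨΦ]
  have hΨ0 : ∀ x ∈ C.degen, Ψ x = 0 := fun x hx => by
    rw [hdegen, Submodule.mem_bot] at hx
    rw [hx, map_zero]
  refine ⟨hS.surjective, hS.proj, fun m n z hne => hS.proj_ne m n hne _ (hS.mem_deg n z),
    fun n z => ⟨hmem n _ (hS.mem_deg n z), ?_⟩, fun n z hz => ?_, fun n w hw => ?_,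
    fun n w hw => ?_, fun n z => by rw [hΨΦ, hS.proj], hS.proj_tensorBoundaries ?_ hΨ0⟩
  · rw [SetLike.mem_coe, Submodule.mem_comap, hd, hS.D_ι, map_zero]
    exact zero_mem _
  · rw [hS.eq_D_of_class_eq_zero hz, ← hd]
    exact Submodule.mem_sup_left (Submodule.mem_map_of_mem
      (hmem _ _ (hS.h_deg n _ (hS.mem_deg n z))))
  · obtain ⟨hw, hw'⟩ := hw
    rw [hchains] at hw
    obtain ⟨x, hx, rfl⟩ := hw
    rw [SetLike.mem_coe, Submodule.mem_comap, hdegen, Submodule.mem_bot] at hw'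
    obtain ⟨z, rfl⟩ := hS.exists_cycle hx (by rw [← hΨΦ (D x), ← hd, hw', map_zero])
    exact ⟨z, by rw [sub_self]; exact zero_mem _, fun m => by rw [hΨΦ]⟩
  · obtain ⟨_, ⟨x, hx, rfl⟩, y, hy, rfl⟩ := Submodule.mem_sup.1 hw
    rw [map_add, hΨ0 y hy, add_zero, hΨd _ x hx, hS.proj_D]
  · intro x hx
    have hle : (⨆ n, C.chains n) ≤ LinearMap.eqLocus (Ψ ∘ₗ C.d) (D ∘ₗ Ψ) := iSup_le hΨd
    exact hle hx

theorem IsSplitHomology.exists_coproduct_of_leftInverse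
    (hS : IsSplitHomology ι π D sgn deg s p h e) {C : SubquotientComplex k W} {Φ : V →ₗ[k] W}
    {Ψ : W →ₗ[k] V} (hΨΦ : ∀ x, Ψ (Φ x) = x) (hdegen : C.degen = ⊥)
    (hd : ∀ x, C.d (Φ x) = Φ (D x)) (hs : ∀ x, C.sgn (Φ x) = Φ (sgn x))
    (hchains : ∀ n, C.chains n = (deg n).map Φ) (hmem : ∀ x, Φ x ∈ ⨆ n, C.chains n)
    {c : V →ₗ[k] V ⊗[k] V} {c' : W →ₗ[k] W ⊗[k] W}
    (hc : ∀ x, squareDiff D sgn (c x) = c (D x))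
    (hΦ : ∀ x, c' (Φ x) = TensorProduct.map Φ Φ (c x)) {cup : Coproduct k H}
    (hcup : IsInducedCoproduct ι π (LinearMap.range (squareDiff D sgn)) c cup) :
    ∃ (θ : ∀ n, C.Homology n ≃ₗ[k] H n) (cup' : Coproduct k C.Homology),
      (∀ n z, ∃ w : C.cycles n, (w : W) = Φ (ι n z) ∧ θ n (C.classOf n w) = π n z) ∧
      IsInducedCoproduct (fun n => (C.cycles n).subtype) C.classOf C.tensorBoundaries c' cup' ∧
      CarriesCoproduct θ cup' cup ∧ ∀ cup'' : Coproduct k C.Homology,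
        IsInducedCoproduct (fun n => (C.cycles n).subtype) C.classOf C.tensorBoundaries c' cup'' →
        cup'' = cup' := by
  have hM := hS.isHomologyModel_of_leftInverse hΨΦ hdegen hd hchains
  have hbd : ∀ w ∈ LinearMap.range (squareDiff D sgn),
      TensorProduct.map Φ Φ w ∈ C.tensorBoundaries := fun w hw =>
    C.map_squareDiff_mem hmem (fun x => by rw [hd, sub_self]; exact zero_mem _) hs hw
  have hb : ∀ n, ∀ w ∈ C.boundaries n, c' w ∈ C.tensorBoundaries := by
    intro n w hw
    obtain ⟨_, ⟨x, hx, rfl⟩, y, hy, rfl⟩ := Submodule.mem_sup.1 hw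
    rw [hdegen, Submodule.mem_bot] at hy
    rw [SetLike.mem_coe, hchains] at hx
    obtain ⟨v, -, rfl⟩ := hx
    rw [hy, add_zero, hd, hΦ, ← hc]
    exact hbd _ ⟨_, rfl⟩
  obtain ⟨θ, hθ⟩ := hM.exists_equiv
  obtain ⟨cup', h1, h2, h3⟩ := hM.exists_coproduct hcup (c' := c')
    (fun n z => by rw [hΦ, sub_self]; exact zero_mem _) hb hbd hθ
  exact ⟨θ, cup', fun n z => ⟨⟨_, hM.mem_cycles n z⟩, rfl, by rw [hθ, hM.proj_Φ]⟩, h1, h2, h3⟩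

end Hochschild

section GroupAlgebra

variable {k G : Type u} [CommRing k] [Group G]

theorem hochschildComplex_d_gBarToHopf (c : ⨁ n, GChains k G n) :
    (hochschildComplex k (MonoidAlgebra k G)).d (gBarToHopf k G c) =
      gBarToHopf k G (gBarDiff k G c) := by
  rw [← wordToBar_barToWord c, gBarDiff_wordToBar, gBarToHopf_wordToBar, gBarToHopf_wordToBar]
  exact (isCyclicMap_wordToHopf.boundary _).symm

theorem hochschildComplex_sgn_gBarToHopf (c : ⨁ n, GChains k G n) :
    (hochschildComplex k (MonoidAlgebra k G)).sgn (gBarToHopf k G c) =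
      gBarToHopf k G (gSign k (GChains k G) c) := by
  rw [← wordToBar_barToWord c, gSign_wordToBar, gBarToHopf_wordToBar, gBarToHopf_wordToBar]
  exact (isCyclicMap_wordToHopf.sign _).symm

theorem hochschildComplex_chains (n : ℕ) : (hochschildComplex k (MonoidAlgebra k G)).chains n =
    (LinearMap.range (DirectSum.lof k ℕ (GChains k G) n)).map (gBarToHopf k G) := by
  refine (hopfChains_eq n).trans ?_
  rw [← LinearMap.range_comp]
  congr 1
  exact LinearMap.ext fun c => by rw [LinearMap.comp_apply, gBarToHopf, DirectSum.toModule_lof]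

theorem gBarToHopf_mem (c : ⨁ n, GChains k G n) :
    gBarToHopf k G c ∈ ⨆ n, (hochschildComplex k (MonoidAlgebra k G)).chains n := by
  induction c using DirectSum.induction_on with
  | zero => rw [map_zero]; exact zero_mem _
  | add x y hx hy => rw [map_add]; exact add_mem hx hy
  | of n c =>
    refine Submodule.mem_iSup_of_mem n ?_
    rw [hochschildComplex_chains]
    exact Submodule.mem_map_of_mem ⟨c, rfl⟩

end GroupAlgebra

end HopfCyclic

end

noncomputable section

namespace HopfCyclic

/-! ## Equivariant comparisons of mixed complexes, after passing to coinvariants -/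

section Total

variable {k : Type*} [CommRing k] {S : Type*} {M N P : Type*} [AddCommGroup M] [Module k M]
  [AddCommGroup N] [Module k N] [AddCommGroup P] [Module k P]

theorem mapRange_totalMap_comp (p : N →ₗ[k] P) (f : ℕ → M →ₗ[k] N) (X : ℕ →₀ M) :
    Finsupp.mapRange.linearMap p (totalMap f X) = totalMap (fun r => p ∘ₗ f r) X := by
  rw [← mapRange_seqConst, ← totalMap_convolve]
  congr 2
  exact funext fun n => seqConst_convolve p f n

theorem totalMap_mapRange (f : ℕ → N →ₗ[k] P) (p : M →ₗ[k] N) (X : ℕ →₀ M) :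
    totalMap f (Finsupp.mapRange.linearMap p X) = totalMap (fun r => f r ∘ₗ p) X := by
  rw [← mapRange_seqConst, ← totalMap_convolve]
  congr 2
  exact funext fun n => convolve_seqConst f p n

theorem totalMap_mem_totalWords {F : ℕ → Module.End k (Words k S)} {e : ℕ}
    (hF : ∀ r n, ∀ x ∈ wordsOfLength k S n, F r x ∈ wordsOfLength k S (n + (2 * r + e))) {n : ℕ}
    {X : ℕ →₀ Words k S} (hX : X ∈ totalWords k S n) : totalMap F X ∈ totalWords k S (n + e) := by
  refine totalWords_le (W := (totalWords k S (n + e)).comap (totalMap F)) (fun i m hi x hx => ?_) hX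
  rw [Submodule.mem_comap, totalMap_single]
  refine sum_mem fun p hp => ?_
  have := Finset.HasAntidiagonal.mem_antidiagonal.1 hp
  have h := single_mem_totalWords p.2 (m + (2 * p.1 + e))
    (by simpa only [add_right_comm m 1] using hF p.1 (m + 1) x hx)
  rwa [show m + (2 * p.1 + e) + 2 * p.2 = n + e by omega] at h

end Total

/-! ### Comparison and retraction on coinvariants -/

section Model

variable {k G : Type*} [CommRing k] [Group G] {V : Type*} [AddCommGroup V] [Module k V]

/-- A complex `(V, D)` with a coproduct `c`, presented as the coinvariants of the complex of words
under the quotient map `q` with section `σ`. -/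
structure IsCoinvariants (q : Words k G →ₗ[k] V) (σ : V →ₗ[k] Words k G) (D sgn : Module.End k V)
    (deg : ℕ → Submodule k V) (c : V →ₗ[k] V ⊗[k] V) : Prop where
  one : q 1 = 0
  invariant : ∀ (s : G) x, q (wordMap k (s * ·) x) = q x
  right_inv : ∀ v, q (σ v) = v
  translate : ∀ a w, ∃ s : G, wordMap k (s * ·) (σ (q (word k (a :: w)))) = word k (a :: w)
  boundary : ∀ x, D (q x) = q (wordBoundary k G x)
  sign : ∀ x, sgn (q x) = q (wordSign k G x)
  cup : ∀ x, c (q x) = TensorProduct.map q q (cupSeq k G 0 x)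
  degree : ∀ n, ∀ x ∈ wordsOfLength k G (n + 1), q x ∈ deg n
  section_degree : ∀ n, ∀ v ∈ deg n, σ v ∈ wordsOfLength k G (n + 1)

namespace IsCoinvariants

variable {q : Words k G →ₗ[k] V} {σ : V →ₗ[k] Words k G} {D sgn : Module.End k V}
  {deg : ℕ → Submodule k V} {c : V →ₗ[k] V ⊗[k] V}

local notation "mr" => Finsupp.mapRange.linearMap

/-- An invariant operator does not see the translation by which a word differs from the chosen
representative of its orbit. This turns equivariant identities on words into identities on
coinvariants. -/
theorem descend (hq : IsCoinvariants q σ D sgn deg c) {N : Type*} [AddCommGroup N] [Module k N]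
    {ψ : ℕ → Words k G →ₗ[k] N} (hψ : ∀ r (s : G) x, ψ r (wordMap k (s * ·) x) = ψ r x)
    (h1 : ∀ r, ψ r 1 = 0) (X : ℕ →₀ Words k G) :
    totalMap ψ (mr σ (mr q X)) = totalMap ψ X := by
  rw [totalMap_mapRange, totalMap_mapRange]
  congr 2
  refine funext fun r => words_hom_ext fun l => ?_
  obtain _ | ⟨a, w⟩ := l
  · rw [word_nil, LinearMap.comp_apply, hq.one, map_zero, h1]
  · obtain ⟨s, hs⟩ := hq.translate a w
    rw [LinearMap.comp_apply, LinearMap.comp_apply, ← hψ r s, hs]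

theorem mapRange_right_inv (hq : IsCoinvariants q σ D sgn deg c) (v : ℕ →₀ V) :
    mr q (mr σ v) = v := Finsupp.ext fun i => by simp [hq.right_inv]

theorem mapRange_boundary (hq : IsCoinvariants q σ D sgn deg c) (X : ℕ →₀ Words k G) :
    mr D (mr q X) = mr q (totalMap (seqConst (wordBoundary k G)) X) := by
  rw [mapRange_seqConst]
  exact Finsupp.ext fun i => by simp [hq.boundary]

theorem mapRange_degree (hq : IsCoinvariants q σ D sgn deg c) {n : ℕ} {X : ℕ →₀ Words k G}
    (hX : X ∈ totalWords k G n) : mr q X ∈ evenDegree deg n := by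
  refine totalWords_le (W := (evenDegree deg n).comap (mr q)) (fun i m hi x hx => ?_) hX
  rw [Submodule.mem_comap, Finsupp.mapRange.linearMap_apply, Finsupp.mapRange_single]
  exact single_mem_evenDegree hi (hq.degree m x hx)

theorem mapRange_section_degree (hq : IsCoinvariants q σ D sgn deg c) {n : ℕ} {v : ℕ →₀ V}
    (hv : v ∈ evenDegree deg n) : mr σ v ∈ totalWords k G n := by
  refine evenDegree_le (W := (totalWords k G n).comap (mr σ)) (fun m i hi x hx => ?_) hv
  rw [Submodule.mem_comap, Finsupp.mapRange.linearMap_apply, Finsupp.mapRange_single, ← hi]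
  exact single_mem_totalWords i m (hq.section_degree m x hx)

variable {Q : Type*} [AddCommGroup Q] [Module k Q] {C : SubquotientComplex k (ℕ →₀ Q)}
  {ϖ : Words k G →ₗ[k] Q} {κ : Q →ₗ[k] V} {f : ℕ → Module.End k (Words k G)}

variable (σ ϖ f) in
/-- The map of coinvariants induced by an equivariant comparison. -/
def totalComparison : (ℕ →₀ V) →ₗ[k] (ℕ →₀ Q) := mr ϖ ∘ₗ totalMap f ∘ₗ mr σ

variable (q σ κ) in
/-- The map of coinvariants induced by the retraction of words. -/
def totalRetract : (ℕ →₀ Q) →ₗ[k] (ℕ →₀ V) :=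
  mr q ∘ₗ totalMap (wordRetract k G) ∘ₗ mr σ ∘ₗ mr κ

theorem totalComparison_mapRange (hq : IsCoinvariants q σ D sgn deg c) (hϖ1 : ϖ 1 = 0)
    (hϖ : ∀ (s : G) x, ϖ (wordMap k (s * ·) x) = ϖ x) (hf : IsWordComparison f)
    (X : ℕ →₀ Words k G) : totalComparison σ ϖ f (mr q X) = mr ϖ (totalMap f X) := by
  rw [totalComparison, LinearMap.comp_apply, LinearMap.comp_apply, mapRange_totalMap_comp,
    mapRange_totalMap_comp]
  refine hq.descend (fun r s x => ?_) (fun r => ?_) X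
  · rw [LinearMap.comp_apply, hf.equivariant, hϖ, LinearMap.comp_apply]
  · cases r with
    | zero => rw [hf.zero, LinearMap.comp_apply, LinearMap.id_apply, hϖ1]
    | succ r => rw [LinearMap.comp_apply, hf.one, map_zero]

theorem totalRetract_mapRange (hq : IsCoinvariants q σ D sgn deg c) (hκ : ∀ x, κ (ϖ x) = q x)
    (X : ℕ →₀ Words k G) :
    totalRetract q σ κ (mr ϖ X) = mr q (totalMap (wordRetract k G) X) := by
  have : mr κ (mr ϖ X) = mr q X := Finsupp.ext fun i => by simp [hκ]
  rw [totalRetract, LinearMap.comp_apply, LinearMap.comp_apply, LinearMap.comp_apply, this,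
    mapRange_totalMap_comp, mapRange_totalMap_comp]
  refine hq.descend (fun r s x => ?_) (fun r => ?_) X
  · rw [LinearMap.comp_apply, wordRetract_equivariant, hq.invariant, LinearMap.comp_apply]
  · cases r with
    | zero => rw [LinearMap.comp_apply, wordRetract_zero_one, hq.one]
    | succ r => rw [LinearMap.comp_apply, wordRetract_succ_one, map_zero]

theorem totalRetract_degen (hq : IsCoinvariants q σ D sgn deg c) (hκ : ∀ x, κ (ϖ x) = q x)
    (hC : IsWordPresentation C ϖ) {w : ℕ →₀ Q} (hw : w ∈ C.degen) :
    totalRetract q σ κ w = 0 := by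
  rw [hC.degen] at hw
  obtain ⟨X, hX, rfl⟩ := hw
  have h0 := totalMap_mem_of_mem (W := (⊥ : Submodule k (Words k G)))
    (fun r x hx => wordRetract_degenWords r hx) hX
  have hle : totalSub (⊥ : Submodule k (Words k G)) ≤ ⊥ := totalSub_le fun i x hx => by
    rw [(Submodule.mem_bot k).1 hx, Finsupp.single_zero]
    exact zero_mem _
  rw [hq.totalRetract_mapRange hκ, (Submodule.mem_bot k).1 (hle h0), map_zero]

theorem totalRetract_d (hq : IsCoinvariants q σ D sgn deg c) (hκ : ∀ x, κ (ϖ x) = q x)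
    (hC : IsWordPresentation C ϖ) (X : ℕ →₀ Words k G) :
    totalRetract q σ κ (C.d (mr ϖ X)) = mr D (totalRetract q σ κ (mr ϖ X)) := by
  rw [hC.d, hq.totalRetract_mapRange hκ, hq.totalRetract_mapRange hκ, hq.mapRange_boundary,
    ← totalMap_convolve, ← totalMap_convolve, convolve_wordRetract]

theorem totalComparison_d (hq : IsCoinvariants q σ D sgn deg c)
    (hϖ : ∀ (s : G) x, ϖ (wordMap k (s * ·) x) = ϖ x) (hC : IsWordPresentation C ϖ)
    (hf : IsWordComparison f) (v : ℕ →₀ V) :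
    C.d (totalComparison σ ϖ f v) - totalComparison σ ϖ f (mr D v) ∈ C.degen := by
  rw [← hq.mapRange_right_inv v, hq.mapRange_boundary, hq.totalComparison_mapRange hC.one hϖ hf,
    hq.totalComparison_mapRange hC.one hϖ hf, hC.d, ← map_sub, ← totalMap_convolve,
    ← totalMap_convolve, ← LinearMap.sub_apply, ← totalMap_sub]
  exact hC.mem_degen (totalMap_mem hf.comm _)

theorem totalComparison_sgn (hq : IsCoinvariants q σ D sgn deg c)
    (hϖ : ∀ (s : G) x, ϖ (wordMap k (s * ·) x) = ϖ x) (hC : IsWordPresentation C ϖ)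
    (hf : IsWordComparison f) (v : ℕ →₀ V) :
    C.sgn (totalComparison σ ϖ f v) = totalComparison σ ϖ f (mr sgn v) := by
  have : mr sgn (mr q (mr σ v)) = mr q (mr (wordSign k G) (mr σ v)) :=
    Finsupp.ext fun i => by simp [hq.sign]
  have h : mr (wordSign k G) (totalMap f (mr σ v)) = totalMap f (mr (wordSign k G) (mr σ v)) := by
    rw [← mapRange_seqConst (wordSign k G), ← mapRange_seqConst (wordSign k G),
      ← totalMap_convolve, ← totalMap_convolve, hf.wordSign_comm]
  rw [← hq.mapRange_right_inv v, this, hq.totalComparison_mapRange hC.one hϖ hf,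
    hq.totalComparison_mapRange hC.one hϖ hf, hC.sgn, h]

theorem totalComparison_mem (hq : IsCoinvariants q σ D sgn deg c) (hC : IsWordPresentation C ϖ)
    (hf : IsWordComparison f) {n : ℕ} {v : ℕ →₀ V} (hv : v ∈ evenDegree deg n) :
    totalComparison σ ϖ f v ∈ C.chains n := by
  rw [hC.chains]
  exact Submodule.mem_map_of_mem
    (totalMap_mem_totalWords (e := 0) hf.length (hq.mapRange_section_degree hv))

/-- The homotopy on words gives $gf=1+bH+Hb$. The representative $\sigma v$ of a cycle need not be a
cycle on words, but $H$ is equivariant, so the term $Hb\,\sigma v$ depends only on $Dv=0$ after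
passing to coinvariants. -/
theorem totalRetract_totalComparison (hq : IsCoinvariants q σ D sgn deg c)
    (hκ : ∀ x, κ (ϖ x) = q x) (hf : IsWordComparison f) {v : ℕ →₀ V} (hv : mr D v = 0) :
    ∃ v', totalRetract q σ κ (totalComparison σ ϖ f v) = v + mr D v' := by
  obtain ⟨H, hH, hHe, hH1⟩ := hf.exists_homotopy_left
  have hs : convolve (wordRetract k G) f = seqConst LinearMap.id +
      (convolve (seqConst (wordBoundary k G)) H + convolve H (seqConst (wordBoundary k G))) := by
    refine funext fun r => LinearMap.ext fun x => ?_
    rw [Pi.add_apply, Pi.add_apply, LinearMap.add_apply, LinearMap.add_apply, seqConst_convolve,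
      convolve_seqConst, LinearMap.comp_apply, LinearMap.comp_apply, hH, add_sub_cancel]
  refine ⟨mr q (totalMap H (mr σ v)), ?_⟩
  have h0 : mr q (totalMap H (totalMap (seqConst (wordBoundary k G)) (mr σ v))) = 0 := by
    rw [mapRange_totalMap_comp, ← hq.descend (fun r s x => ?_) (fun r => ?_),
      ← hq.mapRange_boundary, hq.mapRange_right_inv, hv, map_zero, map_zero]
    · rw [LinearMap.comp_apply, hHe, hq.invariant, LinearMap.comp_apply]
    · rw [LinearMap.comp_apply, hH1, map_zero]
  rw [totalComparison, LinearMap.comp_apply, LinearMap.comp_apply, hq.totalRetract_mapRange hκ,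
    ← totalMap_convolve, hs, totalMap_add, totalMap_add, LinearMap.add_apply, LinearMap.add_apply,
    map_add, map_add, totalMap_convolve, totalMap_convolve, h0, add_zero, totalMap_seqConst_id,
    hq.mapRange_right_inv, ← hq.mapRange_boundary]

theorem totalComparison_totalRetract (hq : IsCoinvariants q σ D sgn deg c) (hκ : ∀ x, κ (ϖ x) = q x)
    (hϖ : ∀ (s : G) x, ϖ (wordMap k (s * ·) x) = ϖ x) (hC : IsWordPresentation C ϖ)
    (hf : IsWordComparison f) {n : ℕ} {w : ℕ →₀ Q} (hw : w ∈ C.cycles n) :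
    w - totalComparison σ ϖ f (totalRetract q σ κ w) ∈ C.boundaries n := by
  obtain ⟨hwn, hd⟩ := hw
  rw [SetLike.mem_coe, hC.chains] at hwn
  obtain ⟨X, hX, rfl⟩ := hwn
  rw [SetLike.mem_coe, Submodule.mem_comap, hC.d, hC.degen] at hd
  obtain ⟨Z, hZ, hZX⟩ := hd
  obtain ⟨K, hK, hKe, hK1, hKl, hKd⟩ := hf.exists_homotopy_right
  have h1 := hC.mem_degen (totalMap_mem hK X)
  -- The differential of $X$ is degenerate only after passing to the quotient. By equivariance $K$
  -- may be evaluated on the degenerate lift `Z` instead.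
  have h2 : mr ϖ (totalMap K (totalMap (mixedSeq k G) X)) ∈ C.degen := by
    have hκϖ : ∀ Y : ℕ →₀ Words k G, mr κ (mr ϖ Y) = mr q Y := fun Y =>
      Finsupp.ext fun i => by simp [hκ]
    have hdesc : ∀ Y : ℕ →₀ Words k G, mr ϖ (totalMap K Y) =
        totalMap (fun r => ϖ ∘ₗ K r) (mr σ (mr κ (mr ϖ Y))) := fun Y => by
      rw [hκϖ, mapRange_totalMap_comp, hq.descend (fun r s x => ?_) (fun r => ?_)]
      · rw [LinearMap.comp_apply, hKe, hϖ, LinearMap.comp_apply]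
      · rw [LinearMap.comp_apply, hK1, map_zero]
    rw [hdesc, ← hZX, ← hdesc]
    exact hC.mem_degen (totalMap_mem_of_mem hKd hZ)
  have h3 : C.d (mr ϖ (totalMap K X)) ∈ C.boundaries n := by
    refine Submodule.mem_sup_left (Submodule.mem_map_of_mem ?_)
    rw [hC.chains]
    exact Submodule.mem_map_of_mem (totalMap_mem_totalWords hKl hX)
  have h4 := sub_mem (Submodule.mem_sup_right (add_mem (neg_mem h2) h1)) h3
  rw [hq.totalRetract_mapRange hκ, hq.totalComparison_mapRange hC.one hϖ hf]
  refine (congrArg (· ∈ C.boundaries n) ?_).mpr h4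
  rw [hC.d]
  simp only [totalMap_sub, totalMap_add, LinearMap.sub_apply, LinearMap.add_apply, map_sub, map_add,
    totalMap_convolve, totalMap_seqConst_id]
  abel

theorem isHomologyModel (hq : IsCoinvariants q σ D sgn deg c) (hκ : ∀ x, κ (ϖ x) = q x)
    (hϖ : ∀ (s : G) x, ϖ (wordMap k (s * ·) x) = ϖ x) (hC : IsWordPresentation C ϖ)
    (hf : IsWordComparison f) {Z H : ℕ → Type*} [∀ n, AddCommGroup (Z n)] [∀ n, Module k (Z n)]
    [∀ n, AddCommGroup (H n)] [∀ n, Module k (H n)]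
    {ι : ∀ n, Z n →ₗ[k] V} {π : ∀ n, Z n →ₗ[k] H n}
    {s : ∀ n, H n →ₗ[k] Z n} {p : ∀ n, V →ₗ[k] H n} {h e : Module.End k V}
    (hS : IsSplitHomology ι π D sgn deg s p h e) :
    IsHomologyModel (evenCycles ι) (evenMap π) (evenProj p) C (totalComparison σ ϖ f)
      (totalRetract q σ κ) := by
  have hT := hS.total
  have hΨd : ∀ x ∈ ⨆ n, C.chains n,
      totalRetract q σ κ (C.d x) = mr D (totalRetract q σ κ x) := fun x hx => by
    obtain ⟨X, rfl⟩ := hC.exists_of_mem_chains hx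
    exact hq.totalRetract_d hκ hC X
  have hΨ0 : ∀ x ∈ C.degen, totalRetract q σ κ x = 0 := fun x hx => hq.totalRetract_degen hκ hC hx
  have hd := hq.totalComparison_d hϖ hC hf
  refine ⟨hT.surjective, hT.proj, fun m n z hne => hT.proj_ne m n hne _ (hT.mem_deg n z),
    fun n z => ⟨hq.totalComparison_mem hC hf (hT.mem_deg n z), ?_⟩, fun n z hz => ?_,
    fun n w hw => ?_, fun n w hw => ?_, fun n z => ?_, hT.proj_tensorBoundaries hΨd hΨ0⟩
  · have := hd (evenCycles ι n z)
    rwa [hT.D_ι, map_zero, sub_zero] at this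
  · rw [hT.eq_D_of_class_eq_zero hz]
    have h1 := hd (mr h (evenCycles ι n z))
    have h2 : C.d (totalComparison σ ϖ f (mr h (evenCycles ι n z))) ∈
        (C.chains (n + 1)).map C.d := Submodule.mem_map_of_mem
      (hq.totalComparison_mem hC hf (hT.h_deg n _ (hT.mem_deg n z)))
    have := sub_mem (Submodule.mem_sup_left h2) (Submodule.mem_sup_right h1)
    rwa [sub_sub_cancel] at this
  · have hw1 := hw.1
    rw [SetLike.mem_coe, hC.chains] at hw1
    obtain ⟨X, hX, rfl⟩ := hw1
    have h0 : mr D (totalRetract q σ κ (mr ϖ X)) = 0 := by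
      rw [← hq.totalRetract_d hκ hC, hΨ0 _ hw.2]
    have hmem : totalRetract q σ κ (mr ϖ X) ∈ evenDegree deg n := by
      rw [hq.totalRetract_mapRange hκ]
      exact hq.mapRange_degree (totalMap_mem_totalWords (e := 0) wordRetract_length hX)
    obtain ⟨z, hz⟩ := hT.exists_cycle hmem h0
    exact ⟨z, hz ▸ hq.totalComparison_totalRetract hκ hϖ hC hf hw, fun m => by rw [hz]⟩
  · obtain ⟨_, ⟨x, hx, rfl⟩, y, hy, rfl⟩ := Submodule.mem_sup.1 hw
    rw [map_add, hΨ0 y hy, add_zero, hΨd x (Submodule.mem_iSup_of_mem _ hx), hT.proj_D]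
  · obtain ⟨v', hv'⟩ := hq.totalRetract_totalComparison (ϖ := ϖ) hκ hf (hT.D_ι n z)
    rw [hv', map_add, hT.proj, hT.proj_D, add_zero]

end IsCoinvariants

end Model

end HopfCyclic

end

noncomputable section

namespace HopfCyclic

/-! ## Cup products on coinvariants, and the cyclic homology of group algebras -/

section Cup

variable {k G : Type*} [CommRing k] {V : Type*} [AddCommGroup V] [Module k V]
  {Q : Type*} [AddCommGroup Q] [Module k Q] {C : SubquotientComplex k (ℕ →₀ Q)}
  {ϖ : Words k G →ₗ[k] Q} {f : ℕ → Module.End k (Words k G)}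
  {q : Words k G →ₗ[k] V} {σ : V →ₗ[k] Words k G} {D sgn : Module.End k V}
  {deg : ℕ → Submodule k V} {c : V →ₗ[k] V ⊗[k] V} {c' : (ℕ →₀ Q) →ₗ[k] (ℕ →₀ Q) ⊗[k] (ℕ →₀ Q)}

local notation "mr" => Finsupp.mapRange.linearMap

theorem totalSub_mono {M : Type*} [AddCommGroup M] [Module k M] {A B : Submodule k M}
    (h : A ≤ B) : totalSub A ≤ totalSub B :=
  totalSub_le fun i _ hx => single_mem_totalSub i (h hx)

theorem IsWordPresentation.tensorMap_eq (Z : ℕ →₀ WordTensor k G G) :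
    IsWordPresentation.tensorMap ϖ Z = totalKunneth (mr (TensorProduct.map ϖ ϖ) Z) :=
  (totalKunneth_mapRange ϖ Z).symm

theorem IsWordPresentation.cup_boundaries (hC : IsWordPresentation C ϖ)
    (hc' : ∀ X, ∃ Z ∈ totalSub (degenTensors k G G),
      c' (mr ϖ X) = IsWordPresentation.tensorMap ϖ (totalMap (cupSeq k G) X + Z))
    {n : ℕ} {w : ℕ →₀ Q} (hw : w ∈ C.boundaries n) : c' w ∈ C.tensorBoundaries := by
  have hdegen : ∀ Z ∈ totalSub (degenTensors k G G),
      IsWordPresentation.tensorMap ϖ Z ∈ C.tensorBoundaries := fun Z hZ =>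
    hC.tensorMap_degen (totalSub_mono degenTensors_le_one hZ)
  obtain ⟨_, ⟨x, hx, rfl⟩, y, hy, rfl⟩ := Submodule.mem_sup.1 hw
  rw [map_add]
  refine add_mem ?_ ?_
  · obtain ⟨X, rfl⟩ := hC.exists_of_mem_chains (Submodule.mem_iSup_of_mem _ hx)
    rw [hC.d]
    obtain ⟨Z, hZ, e⟩ := hc' (totalMap (mixedSeq k G) X)
    have h1 := hC.tensorMap_degen (totalMap_mem cupSeq_comm X)
    have h2 := hC.tensorMap_tensorSeq (totalMap (cupSeq k G) X)
    rw [totalMap_sub, LinearMap.sub_apply, totalMap_convolve, totalMap_convolve, map_sub] at h1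
    have h3 := sub_mem h2 h1
    rw [sub_sub_cancel] at h3
    rw [e, map_add]
    exact add_mem h3 (hdegen Z hZ)
  · rw [hC.degen] at hy
    obtain ⟨X, hX, rfl⟩ := hy
    obtain ⟨Z, hZ, e⟩ := hc' X
    rw [e]
    exact hdegen _ (add_mem (totalMap_mem_of_mem (fun r x hx => cupSeq_degenWords r hx) hX) hZ)

namespace IsCoinvariants

theorem totalComparison_single (i : ℕ) (v : V) :
    totalComparison σ ϖ f (Finsupp.single i v) =
      ∑ r ∈ Finset.range (i + 1), Finsupp.single (i - r) (ϖ (f r (σ v))) := by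
  have h : mr σ (Finsupp.single i v) = Finsupp.single i (σ v) := by simp
  rw [totalComparison, LinearMap.comp_apply, LinearMap.comp_apply, h, totalMap_single, map_sum]
  refine (Finset.Nat.sum_antidiagonal_eq_sum_range_succ
    (fun r j => mr ϖ (Finsupp.single j (f r (σ v)))) i).trans (Finset.sum_congr rfl fun r _ => ?_)
  rw [Finsupp.mapRange.linearMap_apply, Finsupp.mapRange_single]

variable [Group G]

theorem map_totalCoproduct (hq : IsCoinvariants q σ D sgn deg c) (hϖ1 : ϖ 1 = 0)
    (hϖ : ∀ (s : G) x, ϖ (wordMap k (s * ·) x) = ϖ x) (hf : IsWordComparison f) (v : ℕ →₀ V) :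
    TensorProduct.map (totalComparison σ ϖ f) (totalComparison σ ϖ f) (totalCoproduct c v) =
      IsWordPresentation.tensorMap ϖ (totalMap (boxProduct f f)
        (totalMap (seqConst (cupSeq k G 0)) (mr σ v))) := by
  have h1 : mr c v = mr (TensorProduct.map q q) (mr (cupSeq k G 0) (mr σ v)) := by
    refine Finsupp.ext fun i => ?_
    simp [← hq.cup, hq.right_inv]
  have h2 : totalComparison σ ϖ f ∘ₗ mr q = mr ϖ ∘ₗ totalMap f :=
    LinearMap.ext (hq.totalComparison_mapRange hϖ1 hϖ hf)
  rw [totalCoproduct, LinearMap.comp_apply, h1, totalKunneth_mapRange, ← LinearMap.comp_apply,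
    ← TensorProduct.map_comp, h2, TensorProduct.map_comp, LinearMap.comp_apply,
    ← totalKunneth_totalMap, mapRange_seqConst, IsWordPresentation.tensorMap, LinearMap.comp_apply]

theorem totalMap_cupHomotopy_boundary (hq : IsCoinvariants q σ D sgn deg c)
    (hϖ : ∀ (s : G) x, ϖ (wordMap k (s * ·) x) = ϖ x) (hf : IsWordComparison f) {v : ℕ →₀ V}
    (hv : mr D v = 0) : IsWordPresentation.tensorMap ϖ (totalMap (cupHomotopy f)
      (totalMap (seqConst (wordBoundary k G)) (mr σ v))) = 0 := by
  have hϖ2 : ∀ (s : G) (z : WordTensor k G G), TensorProduct.map ϖ ϖ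
      (tensorWordMap (s * ·) (s * ·) z) = TensorProduct.map ϖ ϖ z := fun s z =>
    LinearMap.congr_fun (f := TensorProduct.map ϖ ϖ ∘ₗ tensorWordMap (s * ·) (s * ·))
      (g := TensorProduct.map ϖ ϖ) (TensorProduct.ext' fun x y => by simp [hϖ]) z
  rw [IsWordPresentation.tensorMap_eq, mapRange_totalMap_comp,
    ← hq.descend (fun r s x => ?_) (fun r => ?_), ← hq.mapRange_boundary, hq.mapRange_right_inv,
    hv, map_zero, map_zero, map_zero]
  · rw [LinearMap.comp_apply, hf.cupHomotopy_equivariant, hϖ2, LinearMap.comp_apply]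
  · rw [LinearMap.comp_apply, cupHomotopy_one, map_zero]

/-- The total map of `cupHomotopy` bounds the difference of the two composites; its other term
vanishes on cycles by descent to coinvariants. -/
theorem cup_totalComparison (hq : IsCoinvariants q σ D sgn deg c)
    (hϖ : ∀ (s : G) x, ϖ (wordMap k (s * ·) x) = ϖ x) (hC : IsWordPresentation C ϖ)
    (hf : IsWordComparison f)
    (hc' : ∀ X, ∃ Z ∈ totalSub (degenTensors k G G),
      c' (mr ϖ X) = IsWordPresentation.tensorMap ϖ (totalMap (cupSeq k G) X + Z))
    {v : ℕ →₀ V} (hv : mr D v = 0) : c' (totalComparison σ ϖ f v) -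
      TensorProduct.map (totalComparison σ ϖ f) (totalComparison σ ϖ f) (totalCoproduct c v) ∈
        C.tensorBoundaries := by
  obtain ⟨Z, hZ, e⟩ := hc' (totalMap f (mr σ v))
  have h1 := hC.tensorMap_degen (totalMap_mem hf.cupHomotopy_boundary (mr σ v))
  have h2 := hC.tensorMap_tensorSeq (totalMap (cupHomotopy f) (mr σ v))
  have h3 := hC.tensorMap_degen (totalSub_mono degenTensors_le_one hZ)
  rw [totalMap_sub, totalMap_add, LinearMap.sub_apply, LinearMap.add_apply, totalMap_convolve,
    totalMap_convolve, map_sub, map_add, hq.totalMap_cupHomotopy_boundary hϖ hf hv, add_zero] at h1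
  have h4 := add_mem (sub_mem h2 h1) h3
  rw [sub_sub_cancel, cupDefect, totalMap_sub, LinearMap.sub_apply, totalMap_convolve,
    totalMap_convolve, map_sub] at h4
  rw [totalComparison, LinearMap.comp_apply, LinearMap.comp_apply, e, ← totalComparison,
    hq.map_totalCoproduct hC.one hϖ hf, map_add, add_sub_right_comm]
  exact h4

theorem map_squareDiff_mem (hq : IsCoinvariants q σ D sgn deg c)
    (hϖ : ∀ (s : G) x, ϖ (wordMap k (s * ·) x) = ϖ x) (hC : IsWordPresentation C ϖ)
    (hf : IsWordComparison f) {w : (ℕ →₀ V) ⊗[k] (ℕ →₀ V)}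
    (hw : w ∈ LinearMap.range (squareDiff (mr D) (mr sgn))) :
    TensorProduct.map (totalComparison σ ϖ f) (totalComparison σ ϖ f) w ∈ C.tensorBoundaries :=
  C.map_squareDiff_mem (Φ := totalComparison σ ϖ f) (fun _ => hC.mem_chains _) (hq.totalComparison_d hϖ hC hf)
    (hq.totalComparison_sgn hϖ hC hf) hw

theorem exists_coproduct (hq : IsCoinvariants q σ D sgn deg c) {κ : Q →ₗ[k] V}
    (hκ : ∀ x, κ (ϖ x) = q x) (hϖ : ∀ (s : G) x, ϖ (wordMap k (s * ·) x) = ϖ x)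
    (hC : IsWordPresentation C ϖ) (hf : IsWordComparison f)
    (hc' : ∀ X, ∃ Z ∈ totalSub (degenTensors k G G),
      c' (mr ϖ X) = IsWordPresentation.tensorMap ϖ (totalMap (cupSeq k G) X + Z))
    {Z H : ℕ → Type*} [∀ n, AddCommGroup (Z n)] [∀ n, Module k (Z n)]
    [∀ n, AddCommGroup (H n)] [∀ n, Module k (H n)]
    {ι : ∀ n, Z n →ₗ[k] V} {π : ∀ n, Z n →ₗ[k] H n}
    {s : ∀ n, H n →ₗ[k] Z n} {p : ∀ n, V →ₗ[k] H n} {h e : Module.End k V}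
    (hS : IsSplitHomology ι π D sgn deg s p h e) (hc : ∀ x, squareDiff D sgn (c x) = c (D x))
    (hdeg : ∀ n, ∀ x ∈ deg n, c x ∈ squareDegree deg n) {cup : Coproduct k H}
    (hcup : ∀ n x pq, cup n (π n x) pq = TensorProduct.map (p pq.1.1) (p pq.1.2) (c (ι n x))) :
    ∃ (θ : ∀ n, C.Homology n ≃ₗ[k] EvenSum H n) (cup' : Coproduct k C.Homology),
      (∀ f : ℕ → Module.End k (Words k G), IsWordComparison f →
        ∀ (n : ℕ) (i : Fin (n / 2 + 1)) (z : Z (n - 2 * i)), ∃ w : C.cycles n,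
          (w : ℕ →₀ Q) = totalComparison σ ϖ f (Finsupp.single i (ι (n - 2 * i) z)) ∧
            θ n (C.classOf n w) = Pi.single i (π (n - 2 * i) z)) ∧
      IsInducedCoproduct (fun n => (C.cycles n).subtype) C.classOf C.tensorBoundaries c' cup' ∧
      CarriesCoproduct θ cup' (extendCoproduct cup) ∧ ∀ cup'' : Coproduct k C.Homology,
        IsInducedCoproduct (fun n => (C.cycles n).subtype) C.classOf C.tensorBoundaries c' cup'' →
        cup'' = cup' := by
  have hM := hq.isHomologyModel hκ hϖ hC hf hS
  have hT := hS.total.isInducedCoproduct (squareDiff_totalCoproduct hc) (totalCoproduct_mem hdeg)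
    (extendCoproduct_apply_eq hcup)
  obtain ⟨θ, hθ⟩ := hM.exists_equiv
  obtain ⟨cup', h1, h2, h3⟩ := hM.exists_coproduct hT (c' := c')
    (fun n z => hq.cup_totalComparison hϖ hC hf hc' (hS.total.D_ι n z))
    (fun n w hw => hC.cup_boundaries hc' hw) (fun w hw => hq.map_squareDiff_mem hϖ hC hf hw) hθ
  refine ⟨θ, cup', fun f hf n i z => ?_, h1, h2, h3⟩
  -- A second model, for an arbitrary comparison. It has the same retraction as the one that defined
  -- $\theta$, so $\theta$ inverts the map induced by this comparison as well.
  have hM := hq.isHomologyModel hκ hϖ hC hf hS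
  refine ⟨⟨_, hM.mem_cycles n (Pi.single i z)⟩,
    congrArg (totalComparison σ ϖ f) (evenCycles_single ι n i z), ?_⟩
  · rw [hθ, hM.proj_Φ]
    funext j
    obtain rfl | hj := eq_or_ne j i
    · simp [evenMap]
    · simp [evenMap, hj]

end IsCoinvariants

end Cup

/-! ### The group algebra as an instance -/

section GroupAlgebra

variable {k G : Type u} [CommRing k] [Group G]

theorem isCoinvariants_group : IsCoinvariants (V := ⨁ n, GChains k G n) (wordToBar k G)
    (barToWord k G) (gBarDiff k G) (gSign k (GChains k G))
    (fun n => LinearMap.range (DirectSum.lof k ℕ (GChains k G) n)) (groupCup k G) where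
  one := wordToBar_one
  invariant := wordToBar_wordMap
  right_inv := wordToBar_barToWord
  translate := exists_wordMap_barToWord
  boundary := gBarDiff_wordToBar
  sign := gSign_wordToBar
  cup := groupCup_wordToBar
  degree _ _ hx := by
    obtain ⟨y, hy⟩ := wordToBar_degree hx
    exact ⟨y, hy.symm⟩
  section_degree := by
    rintro n _ ⟨y, rfl⟩
    exact barToWord_lof_mem n y

/-- Identifies the chain-level map in the definition of $\theta$ with the one handled on words; the
section of the bar complex is the same on both sides. -/
theorem IsComparison.comparisonChain_eq {f : ℕ → Module.End k (GEG k G)}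
    (hf : IsComparison k G f) (i m : ℕ) (c : GChains k G m) :
    comparisonChain f i m c = IsCoinvariants.totalComparison (V := ⨁ n, GChains k G n)
      (barToWord k G) (wordToHopf k G) (comparisonOnWords f)
      (Finsupp.single i (DirectSum.lof k ℕ (GChains k G) m c)) := by
  have h : ∀ r, wordToHopf k G (comparisonOnWords f r
      (barToWord k G (DirectSum.lof k ℕ (GChains k G) m c))) = eToHopf k G (f r (barToE k G m c)) := by
    intro r
    rw [wordToHopf, LinearMap.comp_apply, hf.wordToE_comparisonOnWords, barToWord,
      LinearMap.comp_apply, wordToE_wordOfE, DirectSum.toModule_lof]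
  rw [comparisonChain, LinearMap.sum_apply]
  refine Eq.trans (Finset.sum_congr rfl fun r _ => ?_)
    (IsCoinvariants.totalComparison_single (V := ⨁ n, GChains k G n) i _).symm
  rw [h]
  rfl

end GroupAlgebra

end HopfCyclic

end

theorem mainTheorem5 {k G : Type u} [Field k] [CharZero k] [Group G] :
    ∃ (cupGr : HopfCyclic.Coproduct k (HopfCyclic.GH k G))
      (cupHH : HopfCyclic.Coproduct k (HopfCyclic.HopfHH k (MonoidAlgebra k G)))
      (cupHC : HopfCyclic.Coproduct k (HopfCyclic.HopfHC k (MonoidAlgebra k G)))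
      (θHH : ∀ n, HopfCyclic.HopfHH k (MonoidAlgebra k G) n ≃ₗ[k] HopfCyclic.GH k G n)
      (θ : ∀ n, HopfCyclic.HopfHC k (MonoidAlgebra k G) n ≃ₗ[k] HopfCyclic.GHSum k G n),
      -- the three coproducts exist and are determined by their defining formulas
      (HopfCyclic.IsGroupCoproduct k G cupGr ∧
        ∀ D, HopfCyclic.IsGroupCoproduct k G D → D = cupGr) ∧
      (HopfCyclic.IsHochschildCoproduct k (MonoidAlgebra k G) cupHH ∧
        ∀ D, HopfCyclic.IsHochschildCoproduct k (MonoidAlgebra k G) D → D = cupHH) ∧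
      (HopfCyclic.IsCyclicCoproduct k (MonoidAlgebra k G) cupHC ∧
        ∀ D, HopfCyclic.IsCyclicCoproduct k (MonoidAlgebra k G) D → D = cupHC) ∧
      -- `θHH` and `θ` are the canonical isomorphisms
      HopfCyclic.IsHochschildComparison k G θHH ∧
      (∃ f, HopfCyclic.IsComparison k G f) ∧ HopfCyclic.IsCyclicComparison k G θ ∧
      -- the Hochschild case, on chains and in homology
      (∀ z, HopfCyclic.hochschildCup k (MonoidAlgebra k G) (HopfCyclic.gBarToHopf k G z) =
        TensorProduct.map (HopfCyclic.gBarToHopf k G) (HopfCyclic.gBarToHopf k G)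
          (HopfCyclic.groupCup k G z)) ∧
      HopfCyclic.CarriesCoproduct θHH cupHH cupGr ∧
      -- the cyclic case
      HopfCyclic.CarriesCoproduct θ cupHC (HopfCyclic.extendCoproduct cupGr) := by
  obtain ⟨s, p, h, e, hS⟩ := HopfCyclic.exists_isSplitHomology_group k G
  obtain ⟨cupGr, hcup⟩ := hS.exists_coproduct HopfCyclic.squareDiff_groupCup
  have hGr := hS.isInducedCoproduct HopfCyclic.squareDiff_groupCup HopfCyclic.groupCup_degree hcup
  obtain ⟨θHH, cupHH, hθHH, hH1, hH2, hH3⟩ := hS.exists_coproduct_of_leftInverse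
    HopfCyclic.hopfToBar_gBarToHopf rfl HopfCyclic.hochschildComplex_d_gBarToHopf
    HopfCyclic.hochschildComplex_sgn_gBarToHopf HopfCyclic.hochschildComplex_chains
    HopfCyclic.gBarToHopf_mem HopfCyclic.squareDiff_groupCup HopfCyclic.hochschildCup_gBarToHopf hGr
  obtain ⟨f, hf⟩ := HopfCyclic.exists_isComparison (k := k) (G := G)
  obtain ⟨θ, cupHC, hθ, hC1, hC2, hC3⟩ :=
    -- Forgetting the first tensor factor recovers the bar chain from its image in $\widetilde
    -- C_*(kG)$, which lets the retraction start from the cyclic complex.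
    HopfCyclic.isCoinvariants_group.exists_coproduct (κ := HopfCyclic.hopfToBar k G)
      HopfCyclic.hopfToBar_wordToHopf HopfCyclic.wordToHopf_wordMap
      HopfCyclic.isWordPresentation_cyclicComplex hf.isWordComparison
      HopfCyclic.cyclicCup_totalToHopf hS HopfCyclic.squareDiff_groupCup
      HopfCyclic.groupCup_degree hcup
  refine ⟨cupGr, cupHH, cupHC, θHH, θ, ⟨hGr, fun D hD => hS.unique_coproduct hD hGr⟩, ⟨hH1, hH3⟩,
    ⟨hC1, hC3⟩, fun n z => ?_, ⟨f, hf⟩, fun f hf n i z => ?_,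
    HopfCyclic.hochschildCup_gBarToHopf, hH2, hC2⟩
  · obtain ⟨w, hw, e⟩ := hθHH n z
    refine ⟨w, hw.trans ?_, e⟩
    rw [LinearMap.comp_apply, HopfCyclic.gBarToHopf, DirectSum.toModule_lof]
  · obtain ⟨w, hw, e⟩ := hθ _ hf.isWordComparison n i z
    exact ⟨w, hw.trans (hf.comparisonChain_eq i _ _).symm, e⟩
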